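/- Let $G$ be a finite group. **Categories.** Let $\mathrm{Mod}$ be the category of pairs $(R;M)$ of a commutative ring $R$ and an $R$-module $M$; a morphism $(R;M)\to(R';M')$ is a ring homomorphism $\alpha:R\to R'$ together with an additive map $f:M\to M'$ such that $f(rm)=\alpha(r)f(m)$. It is symmetric monoidal with $(R;M)\otimes(R';M')=(R\otimes_{\mathbb Z}R';M\otimes_{\mathbb Z}M')$ and unit $(\mathbb Z;\mathbb Z)$. Let $\mathrm{Mack}_G(\mathrm{Ab})$ be the category of $G$-Mackey functors, symmetric monoidal under the box product $\square$, with unit the Burnside Mackey functor $\underline\Omega$. **Ghost components.** For $H\le G$ let $\mathrm{gh}_H(R;M)=\big(\prod_{U\le H}M^{\otimes_R G/U}\big)^H$, where $h\in H$ acts through the isomorphisms $M^{\otimes_R G/U}\to M^{\otimes_R G/hUh^{-1}}$ induced by $aU\mapsto ah^{-1}(hUh^{-1})$. These groups form a Mackey functor $\underline{\mathrm{gh}}(R;M)$, with restrictions given by forgetting components, conjugations by the action of $G$, and transfers $V_K^H(a)_U=\sum_{hK\in(H/K)^U}h\cdot a_{h^{-1}Uh}$. For $V\le H$ and $m\in M^{\otimes_R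 G/V}$ let $\tau_V(m)\in\mathrm{gh}_V(R;M)$ be the element with component $f_{G/V}(m^{\otimes V/U})$ at $U\le V$, where $f_{G/V}:M^{\otimes_R (G/V\times V/U)}\cong M^{\otimes_R G/U}$ is induced by $(gV,vU)\mapsto gvU$ for a chosen representative $g$ of each coset in $G/V$. **Witt vectors.** For free coefficients $(T;Q)$ (a free module over a polynomial ring over $\mathbb Z$) let $\underline W_G(T;Q)\subseteq\underline{\mathrm{gh}}(T;Q)$ be the image of the ghost map, that is, the Mackey subfunctor whose value at $H$ is the subgroup generated by all $V_V^H\tau_V(m)$, $V\le H$, $m\in Q^{\otimes_T G/V}$. In general let $\underline W_G(R;M)$ be the coequaliser of $\underline W_G(FUFU(R;M))\rightrightarrows\underline W_G(FU(R;M))$, where $FU(R;M)=(\mathbb Z[R];\mathbb Z[R](M))$ is the free pair on the underlying pair of sets. This is the functor $\underline W_G:\mathrm{Mod}\to\mathrm{Mack}_G(\mathrm{Ab})$ of untruncated $G$-typical Witt vectors with coefficients; it comes with a natural ghost map $w:\underline W_G(R;M)\to\underline{\mathrm{gh}}(R;M)$. **Theorem.** 1. The functor $\underline W_G:\mathrm{Mod}\to\mathrm{Mack}_G(\mathrm{Ab})$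 is strong symmetric monoidal: there are natural isomorphisms $$\mu:\underline W_G(R;M)\,\square\,\underline W_G(R';M')\xrightarrow{\ \cong\ }\underline W_G(R\otimes_{\mathbb Z}R';M\otimes_{\mathbb Z}M')$$ and an isomorphism $\varepsilon:\underline\Omega\xrightarrow{\cong}\underline W_G(\mathbb Z;\mathbb Z)$, compatible with the associativity, unit and symmetry isomorphisms. Here $\mu$ is induced by the external product of Witt vectors: for $H\le G$, $a\in\underline W_G(R;M)(H)$, $b\in\underline W_G(R';M')(H)$ and $U\le H$ one has $w(\mu(a\,\square\,b))_U=s\big(w(a)_U\otimes w(b)_U\big)$, where $s$ is the shuffle map $M^{\otimes_R G/U}\otimes M'^{\otimes_{R'}G/U}\to(M\otimes M')^{\otimes_{R\otimes R'}G/U}$; and $\varepsilon$ sends $[H/H]\in\Omega(H)$ to an element whose ghost components are all $1\otimes\dots\otimes1$. 2. Consequently, for every commutative ring $R$, the commutative monoid $(\mathbb Z;R)$ in $\mathrm{Mod}$ and its modules $(R;R)$ and $(\mathbb Z;M)$, for $M$ an $R$-module, make $\underline W_G(\mathbb Z;R)$ a commutative Green functor and $\underline W_G(R;R)$, $\underline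 W_G(\mathbb Z;M)$ modules over it, and there is an isomorphism of Mackey functors $$\underline W_G(R;M)\;\cong\;\underline W_G(R;R)\;\square_{\underline W_G(\mathbb Z;R)}\;\underline W_G(\mathbb Z;M).$$ More precisely, the map $\underline W_G(R;R)\,\square\,\underline W_G(\mathbb Z;M)\xrightarrow{\mu}\underline W_G\big((R;R)\otimes(\mathbb Z;M)\big)\to\underline W_G(R;M)$ induced by $R\otimes M\to M$ is the coequaliser of the two maps from $\underline W_G(R;R)\,\square\,\underline W_G(\mathbb Z;R)\,\square\,\underline W_G(\mathbb Z;M)$ given by the two module actions. -/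

import Mathlib

open CategoryTheory MonoidalCategory
open scoped Pointwise TensorProduct

universe u

set_option linter.unusedSectionVars false

namespace WittMackey

/-! ### Sums over cosets and double cosets -/

section Sums

variable {G : Type u} [Group G] [Finite G]

/-- The classes of the equivalence relation `s` on `G` whose chosen representative lies in `H`. (We
only use relations for which `H` is a union of classes.) -/
abbrev Reps (s : Setoid G) (H : Subgroup G) : Type u := {q : Quotient s // q.out ∈ H}

noncomputable instance (s : Setoid G) (H : Subgroup G) : Fintype (Reps s H) :=
  Fintype.ofFinite _

/-- The sum of `f` over representatives in `H` of the classes of `s` contained in `H`. -/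
noncomputable def sumOver (s : Setoid G) (H : Subgroup G) {A : Type*} [AddCommMonoid A]
    (f : G → A) : A := ∑ q : Reps s H, f q.1.out

/-- The equivalence relation whose classes are the double cosets `J x K`. -/
abbrev dc (J K : Subgroup G) : Setoid G := DoubleCoset.setoid (J : Set G) (K : Set G)

/-- The equivalence relation whose classes are the left cosets `x K`. -/
abbrev lc (K : Subgroup G) : Setoid G := QuotientGroup.leftRel K

theorem dc_iff {J K : Subgroup G} {x y : G} :
    dc J K x y ↔ ∃ a ∈ J, ∃ b ∈ K, y = a * x * b := DoubleCoset.rel_iff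

theorem lc_eq (K : Subgroup G) : lc K = dc ⊥ K := by
  ext x y
  exact (iff_of_eq (congrFun (congrFun (DoubleCoset.bot_rel_eq_leftRel K) x) y)).symm

theorem sumOver_eq {s : Setoid G} {H : Subgroup G} {A : Type*} [AddCommMonoid A] {f : G → A}
    {ι : Type*} [Fintype ι] (r : ι → G) (hr : ∀ i, r i ∈ H)
    (hex : ∀ x ∈ H, ∃ i, s x (r i)) (hinj : ∀ i j, s (r i) (r j) → i = j)
    (hs : ∀ x y, s x y → x ∈ H → y ∈ H)
    (hf : ∀ x ∈ H, ∀ y ∈ H, s x y → f x = f y) :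
    sumOver s H f = ∑ i, f (r i) := by
  symm
  have key : ∀ i, s (r i) (Quotient.mk s (r i)).out := fun i =>
    s.symm (Quotient.mk_out (s := s) (r i))
  refine Fintype.sum_bijective (fun i => (⟨Quotient.mk s (r i), hs _ _ (key i) (hr i)⟩ : Reps s H))
    ⟨?_, ?_⟩ _ _ ?_
  · intro i j h
    exact hinj i j (Quotient.exact (congrArg Subtype.val h))
  · rintro ⟨q, hq⟩
    obtain ⟨i, hi⟩ := hex _ hq
    exact ⟨i, Subtype.ext ((Quotient.sound (s.symm hi)).trans (Quotient.out_eq q))⟩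
  · intro i
    exact hf _ (hr i) _ (hs _ _ (key i) (hr i)) (key i)

theorem sumOver_congr {s : Setoid G} {H : Subgroup G} {A : Type*} [AddCommMonoid A] {f g : G → A}
    (h : ∀ x ∈ H, f x = g x) : sumOver s H f = sumOver s H g :=
  Finset.sum_congr rfl fun q _ => h _ q.2

theorem map_sumOver {s : Setoid G} {H : Subgroup G} {A B F : Type*} [AddCommMonoid A]
    [AddCommMonoid B] [FunLike F A B] [AddMonoidHomClass F A B] (φ : F) (f : G → A) :
    φ (sumOver s H f) = sumOver s H fun x => φ (f x) := map_sum _ _ _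

theorem coe_sumOver {s : Setoid G} {H : Subgroup G} {A : Type*} [AddCommGroup A]
    (S : AddSubgroup A) (f : G → S) : ((sumOver s H f : S) : A) = sumOver s H fun x => (f x : A) :=
  map_sum S.subtype _ _

theorem sumOver_add {s : Setoid G} {H : Subgroup G} {A : Type*} [AddCommMonoid A] (f g : G → A) :
    (sumOver s H fun x => f x + g x) = sumOver s H f + sumOver s H g := Finset.sum_add_distrib

theorem sumOver_mem {s : Setoid G} {H : Subgroup G} {A : Type*} [AddCommGroup A] {f : G → A}
    (S : AddSubgroup A) (h : ∀ x ∈ H, f x ∈ S) : sumOver s H f ∈ S :=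
  AddSubgroup.sum_mem _ fun q _ => h _ q.2

theorem dc_mem {H J K : Subgroup G} (hJ : J ≤ H) (hK : K ≤ H) :
    ∀ x y, dc J K x y → x ∈ H → y ∈ H := by
  intro x y h hx
  obtain ⟨a, ha, b, hb, rfl⟩ := dc_iff.1 h
  exact H.mul_mem (H.mul_mem (hJ ha) hx) (hK hb)

theorem out_rel {J K : Subgroup G} (x : G) : dc J K x (Quotient.mk (dc J K) x).out :=
  (dc J K).symm (Quotient.mk_out (s := dc J K) x)

theorem out_spec {J K : Subgroup G} (x : G) :
    ∃ a ∈ J, ∃ b ∈ K, x = a * (Quotient.mk (dc J K) x).out * b :=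
  dc_iff.1 (Quotient.mk_out (s := dc J K) x)

theorem dc_out_eq {J K : Subgroup G} {p q : Quotient (dc J K)} (h : dc J K p.out q.out) :
    p = q := by
  rw [← Quotient.out_eq p, ← Quotient.out_eq q]
  exact Quotient.sound h

theorem mem_conj_inv {x a : G} {J : Subgroup G} :
    a ∈ MulAut.conj x⁻¹ • J ↔ x * a * x⁻¹ ∈ J := by
  rw [Subgroup.mem_pointwise_smul_iff_inv_smul_mem]
  simp

theorem mem_conj {x a : G} {J : Subgroup G} :
    a ∈ MulAut.conj x • J ↔ x⁻¹ * a * x ∈ J := by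
  rw [Subgroup.mem_pointwise_smul_iff_inv_smul_mem, ← map_inv]
  simp

theorem sumOver_nested_right {H J K L : Subgroup G} (hJ : J ≤ H) (hK : K ≤ H) (hL : L ≤ K)
    {A : Type*} [AddCommMonoid A] {f : G → A}
    (hf : ∀ x ∈ H, ∀ a ∈ J, ∀ b ∈ L, f (a * x * b) = f x) :
    sumOver (dc J L) H f = sumOver (dc J K) H fun x =>
      sumOver (dc (MulAut.conj x⁻¹ • J ⊓ K) L) K fun y => f (x * y) := by
  rw [sumOver_eq (ι := Σ q : Reps (dc J K) H,
    Reps (dc (MulAut.conj (q.1.out)⁻¹ • J ⊓ K) L) K) (fun p => p.1.1.out * p.2.1.out)]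
  · exact Fintype.sum_sigma _
  · rintro ⟨p, q⟩
    exact H.mul_mem p.2 (hK q.2)
  · intro x hx
    obtain ⟨a, ha, b, hb, hab⟩ := out_spec (J := J) (K := K) x
    set q := Quotient.mk (dc J K) x with hq
    have hqH : q.out ∈ H := dc_mem hJ hK x _ (dc_iff.2 ⟨a⁻¹, J.inv_mem ha, b⁻¹, K.inv_mem hb,
      by rw [hab]; group⟩) hx
    obtain ⟨c, hc, d, hd, hcd⟩ := out_spec (J := MulAut.conj (q.out)⁻¹ • J ⊓ K) (K := L) b
    have hr : (Quotient.mk (dc (MulAut.conj (q.out)⁻¹ • J ⊓ K) L) b).out ∈ K :=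
      dc_mem inf_le_right hL b _ (out_rel _) hb
    refine ⟨⟨⟨q, hqH⟩, ⟨_, hr⟩⟩, Setoid.symm' _ (dc_iff.2 ⟨a * (q.out * c * q.out⁻¹),
      J.mul_mem ha (mem_conj_inv.1 hc.1), d, hd, ?_⟩)⟩
    conv_lhs => rw [hab, hcd]
    simp only []
    group
  · rintro ⟨p, p'⟩ ⟨q, q'⟩ h
    obtain ⟨a, ha, b, hb, hab⟩ := dc_iff.1 h
    have h1 : p = q := Subtype.ext (dc_out_eq (dc_iff.2 ⟨a, ha,
      p'.1.out * b * q'.1.out⁻¹, K.mul_mem (K.mul_mem p'.2 (hL hb)) (K.inv_mem q'.2), by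
        simp only [] at hab
        rw [eq_comm, ← mul_assoc, mul_inv_eq_iff_eq_mul, hab]
        group⟩))
    subst h1
    have h2 : p' = q' := by
      refine Subtype.ext (dc_out_eq (dc_iff.2 ⟨p.1.out⁻¹ * a * p.1.out, ⟨?_, ?_⟩, b, hb, ?_⟩))
      · exact mem_conj_inv.2 (by simpa [mul_assoc] using ha)
      · have : p.1.out⁻¹ * a * p.1.out = q'.1.out * b⁻¹ * p'.1.out⁻¹ := by
          simp only [] at hab
          rw [eq_mul_inv_iff_mul_eq, eq_mul_inv_iff_mul_eq, mul_assoc, mul_assoc, mul_assoc,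
            inv_mul_eq_iff_eq_mul, hab]
          group
        rw [this]
        exact K.mul_mem (K.mul_mem q'.2 (K.inv_mem (hL hb))) (K.inv_mem p'.2)
      · simp only [] at hab
        rw [← mul_right_inj p.1.out, hab]
        group
    subst h2
    rfl
  · exact dc_mem hJ (hL.trans hK)
  · intro x hx y _ h
    obtain ⟨a, ha, b, hb, rfl⟩ := dc_iff.1 h
    exact (hf x hx a ha b hb).symm

/-- Reversing double cosets. -/
theorem sumOver_inv {H J K : Subgroup G} (hJ : J ≤ H) (hK : K ≤ H)
    {A : Type*} [AddCommMonoid A] {f : G → A}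
    (hf : ∀ x ∈ H, ∀ a ∈ J, ∀ b ∈ K, f (a * x * b) = f x) :
    sumOver (dc J K) H f = sumOver (dc K J) H fun x => f x⁻¹ := by
  rw [sumOver_eq (ι := Reps (dc K J) H) (fun p => p.1.out⁻¹)]
  · rfl
  · exact fun p => H.inv_mem p.2
  · intro x hx
    obtain ⟨a, ha, b, hb, hab⟩ := out_spec (J := K) (K := J) x⁻¹
    refine ⟨⟨Quotient.mk (dc K J) x⁻¹, dc_mem hK hJ x⁻¹ _
      (out_rel _) (H.inv_mem hx)⟩, dc_iff.2 ⟨b, hb, a, ha, ?_⟩⟩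
    generalize (Quotient.mk (dc K J) x⁻¹).out = y at hab ⊢
    rw [← inv_inv x, hab]; group
  · intro p q h
    obtain ⟨a, ha, b, hb, hab⟩ := dc_iff.1 h
    refine Subtype.ext (dc_out_eq (dc_iff.2 ⟨b⁻¹, K.inv_mem hb, a⁻¹, J.inv_mem ha, ?_⟩))
    rw [← inv_inj, hab]; group
  · exact dc_mem hJ hK
  · intro x hx y _ h
    obtain ⟨a, ha, b, hb, rfl⟩ := dc_iff.1 h
    exact (hf x hx a ha b hb).symm

theorem sumOver_nested_left {H I J K : Subgroup G} (hI : I ≤ J) (hJ : J ≤ H) (hK : K ≤ H)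
    {A : Type*} [AddCommMonoid A] {f : G → A}
    (hf : ∀ x ∈ H, ∀ a ∈ I, ∀ b ∈ K, f (a * x * b) = f x) :
    sumOver (dc I K) H f = sumOver (dc J K) H fun x =>
      sumOver (dc I (J ⊓ MulAut.conj x • K)) J fun y => f (y * x) := by
  rw [sumOver_eq (ι := Σ q : Reps (dc J K) H,
    Reps (dc I (J ⊓ MulAut.conj (q.1.out) • K)) J) (fun p => p.2.1.out * p.1.1.out)]
  · exact Fintype.sum_sigma _
  · rintro ⟨p, q⟩
    exact H.mul_mem (hJ q.2) p.2
  · intro x hx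
    obtain ⟨a, ha, b, hb, hab⟩ := out_spec (J := J) (K := K) x
    set q := Quotient.mk (dc J K) x with hq
    have hqH : q.out ∈ H := dc_mem hJ hK x _ (dc_iff.2 ⟨a⁻¹, J.inv_mem ha, b⁻¹, K.inv_mem hb,
      by rw [hab]; group⟩) hx
    obtain ⟨c, hc, d, hd, hcd⟩ := out_spec (J := I) (K := J ⊓ MulAut.conj (q.out) • K) a
    have hr : (Quotient.mk (dc I (J ⊓ MulAut.conj (q.out) • K)) a).out ∈ J :=
      dc_mem hI inf_le_left a _ (out_rel _) ha
    refine ⟨⟨⟨q, hqH⟩, ⟨_, hr⟩⟩, Setoid.symm' _ (dc_iff.2 ⟨c, hc, q.out⁻¹ * d * q.out * b,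
      K.mul_mem (mem_conj.1 hd.2) hb, ?_⟩)⟩
    conv_lhs => rw [hab, hcd]
    simp only []
    group
  · rintro ⟨p, p'⟩ ⟨q, q'⟩ h
    obtain ⟨a, ha, b, hb, hab⟩ := dc_iff.1 h
    simp only [] at hab
    have h1 : p = q := Subtype.ext (dc_out_eq (dc_iff.2 ⟨q'.1.out⁻¹ * a * p'.1.out,
      J.mul_mem (J.mul_mem (J.inv_mem q'.2) (hI ha)) p'.2, b, hb, by
        rw [mul_assoc, mul_assoc, mul_assoc, eq_inv_mul_iff_mul_eq, hab]
        group⟩))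
    subst h1
    have h2 : p' = q' := by
      have e : q'.1.out = a * p'.1.out * (p.1.out * b * p.1.out⁻¹) := by
        rw [← mul_left_inj p.1.out, hab]; group
      refine Subtype.ext (dc_out_eq (dc_iff.2 ⟨a, ha, p.1.out * b * p.1.out⁻¹, ⟨?_, ?_⟩, e⟩))
      · have : p.1.out * b * p.1.out⁻¹ = p'.1.out⁻¹ * a⁻¹ * q'.1.out := by
          rw [e]; group
        rw [this]
        exact J.mul_mem (J.mul_mem (J.inv_mem p'.2) (J.inv_mem (hI ha))) q'.2
      · exact mem_conj.2 (by simpa [mul_assoc] using hb)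
    subst h2
    rfl
  · exact dc_mem (hI.trans hJ) hK
  · intro x hx y _ h
    obtain ⟨a, ha, b, hb, rfl⟩ := dc_iff.1 h
    exact (hf x hx a ha b hb).symm

/-- If there is just one class, the sum has one term. -/
theorem sumOver_single {s : Setoid G} {H : Subgroup G} {A : Type*} [AddCommMonoid A] {f : G → A}
    (hs : ∀ x, s x 1 ↔ x ∈ H) (hf : ∀ x ∈ H, f x = f 1) : sumOver s H f = f 1 := by
  rw [sumOver_eq (ι := Unit) (fun _ => 1)]
  · simp
  · exact fun _ => H.one_mem
  · exact fun x hx => ⟨(), (hs x).2 hx⟩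
  · exact fun _ _ _ => rfl
  · exact fun x y h hx => (hs y).1 (s.trans (s.symm h) ((hs x).2 hx))
  · exact fun x hx y hy _ => (hf x hx).trans (hf y hy).symm

/-- Translating double cosets by an element of `G`. -/
theorem sumOver_conj {H J K H' J' K' : Subgroup G} (hJ : J ≤ H) (hK : K ≤ H) (g h : G)
    (hH' : H' = MulAut.conj g • H) (hJ' : J' = MulAut.conj g • J)
    (hh : g⁻¹ * h ∈ H) (hK' : K' = MulAut.conj h • K)
    {A : Type*} [AddCommMonoid A] {f : G → A}
    (hf : ∀ x ∈ H', ∀ a ∈ J', ∀ b ∈ K', f (a * x * b) = f x) :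
    sumOver (dc J' K') H' f = sumOver (dc J K) H fun x => f (g * x * h⁻¹) := by
  subst hH' hJ' hK'
  have hhg : h⁻¹ * g ∈ H := by simpa using H.inv_mem hh
  rw [sumOver_eq (ι := Reps (dc J K) H) (fun p => g * p.1.out * h⁻¹)]
  · rfl
  · intro p
    rw [mem_conj]
    simpa [mul_assoc] using H.mul_mem p.2 hhg
  · intro x hx
    rw [mem_conj] at hx
    have hx' : g⁻¹ * x * h ∈ H := by simpa [mul_assoc] using H.mul_mem hx hh
    obtain ⟨a, ha, b, hb, hab⟩ := out_spec (J := J) (K := K) (g⁻¹ * x * h)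
    refine ⟨⟨Quotient.mk (dc J K) (g⁻¹ * x * h), dc_mem hJ hK _ _
      (out_rel _) hx'⟩, Setoid.symm' _ (dc_iff.2 ⟨g * a * g⁻¹, ?_,
      h * b * h⁻¹, ?_, ?_⟩)⟩
    · rw [mem_conj]; simpa [mul_assoc] using ha
    · rw [mem_conj]; simpa [mul_assoc] using hb
    · have : x = g * (g⁻¹ * x * h) * h⁻¹ := by group
      conv_lhs => rw [this, hab]
      group
  · intro p q hpq
    obtain ⟨a, ha, b, hb, hab⟩ := dc_iff.1 hpq
    rw [mem_conj] at ha hb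
    refine Subtype.ext (dc_out_eq (dc_iff.2 ⟨_, ha, _, hb, ?_⟩))
    have : q.1.out = g⁻¹ * (g * q.1.out * h⁻¹) * h := by group
    rw [this, hab]; group
  · refine dc_mem (Subgroup.pointwise_smul_le_pointwise_smul_iff.2 hJ) fun b hb => ?_
    rw [mem_conj] at hb ⊢
    have := H.mul_mem (H.mul_mem hh (hK hb)) hhg
    simpa [mul_assoc] using this
  · intro x hx y _ hxy
    obtain ⟨a, ha, b, hb, rfl⟩ := dc_iff.1 hxy
    exact (hf x hx a ha b hb).symm

end Sums

/-! ### Mackey functors -/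

section Mackey

theorem conj_inf {G : Type u} [Group G] (J K : Subgroup G) (x : G) :
    J ⊓ MulAut.conj x • K = MulAut.conj x • (MulAut.conj x⁻¹ • J ⊓ K) := by
  rw [Subgroup.smul_inf, smul_smul, ← map_mul]; simp

theorem conj_mono {G : Type u} [Group G] {H K H' K' : Subgroup G} {g : G} (h : K ≤ H)
    (hH : H' = MulAut.conj g • H) (hK : K' = MulAut.conj g • K) : K' ≤ H' := by
  subst hH hK
  exact Subgroup.pointwise_smul_le_pointwise_smul_iff.2 h

theorem conj_eq_self {G : Type u} [Group G] {H : Subgroup G} {g : G} (hg : g ∈ H) :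
    H = MulAut.conj g • H := (Subgroup.conj_smul_eq_self_of_mem hg).symm

theorem conj_mul {G : Type u} [Group G] {H H' H'' : Subgroup G} {g g' : G}
    (h : H' = MulAut.conj g • H) (h' : H'' = MulAut.conj g' • H') :
    H'' = MulAut.conj (g' * g) • H := by
  rw [h', h, smul_smul, map_mul]

/-- A Mackey functor for the finite group `G` with values in abelian groups: groups `M(H)` for
`H ≤ G`, with transfers, restrictions and conjugations `c_g : M(H) → M(gHg⁻¹)`. (The target of
`conj g` is written as any subgroup `H'` with a proof of `H' = gHg⁻¹`.) The last axiom is the double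
coset formula, where `J ⊓ ᵍK = J ⊓ gKg⁻¹` is the conjugate of `Jᵍ ⊓ K = g⁻¹Jg ⊓ K`. -/
structure MackeyFunctor (G : Type u) [Group G] [Finite G] where
  /-- the value at `H`, or at the transitive `G`-set `G/H` -/
  obj : Subgroup G → Type u
  [grp : ∀ H, AddCommGroup (obj H)]
  tr : ∀ {K H : Subgroup G}, K ≤ H → obj K →+ obj H
  res : ∀ {K H : Subgroup G}, K ≤ H → obj H →+ obj K
  conj : ∀ (g : G) {H H' : Subgroup G}, H' = MulAut.conj g • H → obj H →+ obj H'
  tr_self : ∀ {H : Subgroup G} (h : H ≤ H) (x : obj H), tr h x = x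
  res_self : ∀ {H : Subgroup G} (h : H ≤ H) (x : obj H), res h x = x
  conj_self : ∀ {H : Subgroup G} {g : G} (_ : g ∈ H) (h : H = MulAut.conj g • H) (x : obj H),
    conj g h x = x
  tr_tr : ∀ {J K H : Subgroup G} (h : J ≤ K) (h' : K ≤ H) (h'' : J ≤ H) (x : obj J),
    tr h' (tr h x) = tr h'' x
  res_res : ∀ {J K H : Subgroup G} (h : J ≤ K) (h' : K ≤ H) (h'' : J ≤ H) (x : obj H),
    res h (res h' x) = res h'' x
  conj_conj : ∀ {g g' : G} {H H' H'' : Subgroup G} (h : H' = MulAut.conj g • H)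
    (h' : H'' = MulAut.conj g' • H') (h'' : H'' = MulAut.conj (g' * g) • H) (x : obj H),
    conj g' h' (conj g h x) = conj (g' * g) h'' x
  conj_tr : ∀ {g : G} {H K H' K' : Subgroup G} (h : K ≤ H) (h' : K' ≤ H')
    (hK : K' = MulAut.conj g • K) (hH : H' = MulAut.conj g • H) (x : obj K),
    conj g hH (tr h x) = tr h' (conj g hK x)
  conj_res : ∀ {g : G} {H K H' K' : Subgroup G} (h : K ≤ H) (h' : K' ≤ H')
    (hK : K' = MulAut.conj g • K) (hH : H' = MulAut.conj g • H) (x : obj H),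
    conj g hK (res h x) = res h' (conj g hH x)
  res_tr : ∀ {J K H : Subgroup G} (hJ : J ≤ H) (hK : K ≤ H) (x : obj K),
    res hJ (tr hK x) = sumOver (dc J K) H fun g =>
      tr (inf_le_left : J ⊓ MulAut.conj g • K ≤ J) (conj g (conj_inf J K g)
        (res (inf_le_right : MulAut.conj g⁻¹ • J ⊓ K ≤ K) x))

attribute [instance] MackeyFunctor.grp

namespace MackeyFunctor

variable {G : Type u} [Group G] [Finite G]

/-- A morphism of Mackey functors. -/
@[ext]
structure Hom (M N : MackeyFunctor G) where
  app : ∀ H : Subgroup G, M.obj H →+ N.obj H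
  app_tr : ∀ {K H : Subgroup G} (h : K ≤ H) (x : M.obj K), app H (M.tr h x) = N.tr h (app K x)
  app_res : ∀ {K H : Subgroup G} (h : K ≤ H) (x : M.obj H), app K (M.res h x) = N.res h (app H x)
  app_conj : ∀ {g : G} {H H' : Subgroup G} (h : H' = MulAut.conj g • H) (x : M.obj H),
    app H' (M.conj g h x) = N.conj g h (app H x)

/-- The category `Mack_G(Ab)` of Mackey functors. -/
instance : Category (MackeyFunctor G) where
  Hom := Hom
  id M := ⟨fun H => AddMonoidHom.id _, fun _ _ => rfl, fun _ _ => rfl, fun _ _ => rfl⟩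
  comp f g := ⟨fun H => (g.app H).comp (f.app H),
    fun h x => by simp [f.app_tr, g.app_tr], fun h x => by simp [f.app_res, g.app_res],
    fun h x => by simp [f.app_conj, g.app_conj]⟩

@[simp] theorem id_app (M : MackeyFunctor G) (H : Subgroup G) (x : M.obj H) :
    Hom.app (𝟙 M) H x = x := rfl

@[simp] theorem comp_app {M N P : MackeyFunctor G} (f : M ⟶ N) (g : N ⟶ P) (H : Subgroup G)
    (x : M.obj H) : Hom.app (f ≫ g) H x = Hom.app g H (Hom.app f H x) := rfl

theorem hom_ext {M N : MackeyFunctor G} {f g : M ⟶ N}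
    (h : ∀ H x, Hom.app f H x = Hom.app g H x) : f = g :=
  Hom.ext (funext fun H => AddMonoidHom.ext (h H))

/-- A family of subgroups that is stable under all operations. -/
structure IsStable (M : MackeyFunctor G) (S : ∀ H, AddSubgroup (M.obj H)) : Prop where
  tr : ∀ {K H : Subgroup G} (h : K ≤ H), ∀ x ∈ S K, M.tr h x ∈ S H
  res : ∀ {K H : Subgroup G} (h : K ≤ H), ∀ x ∈ S H, M.res h x ∈ S K
  conj : ∀ {g : G} {H H' : Subgroup G} (h : H' = MulAut.conj g • H), ∀ x ∈ S H, M.conj g h x ∈ S H'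

/-- The Mackey subfunctor given by a stable family. -/
def sub (M : MackeyFunctor G) {S : ∀ H, AddSubgroup (M.obj H)} (hS : M.IsStable S) :
    MackeyFunctor G where
  obj H := S H
  tr h := ((M.tr h).comp (S _).subtype).codRestrict _ fun x => hS.tr h _ x.2
  res h := ((M.res h).comp (S _).subtype).codRestrict _ fun x => hS.res h _ x.2
  conj g _ _ h := ((M.conj g h).comp (S _).subtype).codRestrict _ fun x => hS.conj h _ x.2
  tr_self h x := Subtype.ext (M.tr_self h _)
  res_self h x := Subtype.ext (M.res_self h _)
  conj_self hg h x := Subtype.ext (M.conj_self hg h _)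
  tr_tr h h' h'' x := Subtype.ext (M.tr_tr h h' h'' _)
  res_res h h' h'' x := Subtype.ext (M.res_res h h' h'' _)
  conj_conj h h' h'' x := Subtype.ext (M.conj_conj h h' h'' _)
  conj_tr h h' hK hH x := Subtype.ext (M.conj_tr h h' hK hH _)
  conj_res h h' hK hH x := Subtype.ext (M.conj_res h h' hK hH _)
  res_tr {J K H} hJ hK x := by
    refine Subtype.ext ((M.res_tr hJ hK x.1).trans ?_)
    exact (coe_sumOver (s := dc J K) (H := H) (S J) fun g =>
      ⟨M.tr inf_le_left (M.conj g (conj_inf J K g) (M.res inf_le_right x.1)),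
        hS.tr _ _ (hS.conj _ _ (hS.res _ _ x.2))⟩).symm

/-- The quotient of a Mackey functor by a stable family. -/
def quot (M : MackeyFunctor G) {S : ∀ H, AddSubgroup (M.obj H)} (hS : M.IsStable S) :
    MackeyFunctor G where
  obj H := M.obj H ⧸ S H
  tr h := QuotientAddGroup.map _ _ (M.tr h) fun x hx => hS.tr h x hx
  res h := QuotientAddGroup.map _ _ (M.res h) fun x hx => hS.res h x hx
  conj g _ _ h := QuotientAddGroup.map _ _ (M.conj g h) fun x hx => hS.conj h x hx
  tr_self h x := by
    obtain ⟨x, rfl⟩ := QuotientAddGroup.mk_surjective x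
    exact congrArg QuotientAddGroup.mk (M.tr_self h x)
  res_self h x := by
    obtain ⟨x, rfl⟩ := QuotientAddGroup.mk_surjective x
    exact congrArg QuotientAddGroup.mk (M.res_self h x)
  conj_self hg h x := by
    obtain ⟨x, rfl⟩ := QuotientAddGroup.mk_surjective x
    exact congrArg QuotientAddGroup.mk (M.conj_self hg h x)
  tr_tr h h' h'' x := by
    obtain ⟨x, rfl⟩ := QuotientAddGroup.mk_surjective x
    exact congrArg QuotientAddGroup.mk (M.tr_tr h h' h'' x)
  res_res h h' h'' x := by
    obtain ⟨x, rfl⟩ := QuotientAddGroup.mk_surjective x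
    exact congrArg QuotientAddGroup.mk (M.res_res h h' h'' x)
  conj_conj h h' h'' x := by
    obtain ⟨x, rfl⟩ := QuotientAddGroup.mk_surjective x
    exact congrArg QuotientAddGroup.mk (M.conj_conj h h' h'' x)
  conj_tr h h' hK hH x := by
    obtain ⟨x, rfl⟩ := QuotientAddGroup.mk_surjective x
    exact congrArg QuotientAddGroup.mk (M.conj_tr h h' hK hH x)
  conj_res h h' hK hH x := by
    obtain ⟨x, rfl⟩ := QuotientAddGroup.mk_surjective x
    exact congrArg QuotientAddGroup.mk (M.conj_res h h' hK hH x)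
  res_tr hJ hK x := by
    obtain ⟨x, rfl⟩ := QuotientAddGroup.mk_surjective x
    exact (congrArg QuotientAddGroup.mk (M.res_tr hJ hK x)).trans
      (map_sumOver (QuotientAddGroup.mk' _) _)

/-- The projection to the quotient. -/
def quotMk (M : MackeyFunctor G) {S : ∀ H, AddSubgroup (M.obj H)} (hS : M.IsStable S) :
    M ⟶ M.quot hS where
  app _ := QuotientAddGroup.mk' _
  app_tr _ _ := rfl
  app_res _ _ := rfl
  app_conj _ _ := rfl

theorem quotMk_surj (M : MackeyFunctor G) {S : ∀ H, AddSubgroup (M.obj H)} (hS : M.IsStable S)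
    (H : Subgroup G) : Function.Surjective (Hom.app (M.quotMk hS) H) :=
  QuotientAddGroup.mk'_surjective _

/-- Morphisms out of a quotient. -/
def quotLift {M N : MackeyFunctor G} {S : ∀ H, AddSubgroup (M.obj H)} (hS : M.IsStable S)
    (f : M ⟶ N) (hf : ∀ H, ∀ x ∈ S H, Hom.app f H x = 0) : M.quot hS ⟶ N where
  app H := QuotientAddGroup.lift _ (Hom.app f H) (hf H)
  app_tr h x := by
    obtain ⟨x, rfl⟩ := M.quotMk_surj hS _ x; exact f.app_tr h x
  app_res h x := by
    obtain ⟨x, rfl⟩ := M.quotMk_surj hS _ x; exact f.app_res h x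
  app_conj h x := by
    obtain ⟨x, rfl⟩ := M.quotMk_surj hS _ x; exact f.app_conj h x

end MackeyFunctor

/-- A system of sets with restrictions and conjugations. -/
structure ResSystem (G : Type u) [Group G] where
  obj : Subgroup G → Type u
  res : ∀ {K H : Subgroup G}, K ≤ H → obj H → obj K
  conj : ∀ (g : G) {H H' : Subgroup G}, H' = MulAut.conj g • H → obj H → obj H'
  res_self : ∀ {H : Subgroup G} (h : H ≤ H) (x : obj H), res h x = x
  conj_self : ∀ {H : Subgroup G} {g : G} (_ : g ∈ H) (h : H = MulAut.conj g • H) (x : obj H),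
    conj g h x = x
  res_res : ∀ {J K H : Subgroup G} (h : J ≤ K) (h' : K ≤ H) (h'' : J ≤ H) (x : obj H),
    res h (res h' x) = res h'' x
  conj_conj : ∀ {g g' : G} {H H' H'' : Subgroup G} (h : H' = MulAut.conj g • H)
    (h' : H'' = MulAut.conj g' • H') (h'' : H'' = MulAut.conj (g' * g) • H) (x : obj H),
    conj g' h' (conj g h x) = conj (g' * g) h'' x
  conj_res : ∀ {g : G} {H K H' K' : Subgroup G} (h : K ≤ H) (h' : K' ≤ H')
    (hK : K' = MulAut.conj g • K) (hH : H' = MulAut.conj g • H) (x : obj H),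
    conj g hK (res h x) = res h' (conj g hH x)

namespace ResSystem

variable {G : Type u} [Group G] [Finite G] (D : ResSystem G)

/-- The pairs `(K, d)` with `K ≤ H` and `d ∈ D(K)`. -/
abbrev Gen (H : Subgroup G) : Type u := Σ K : {K : Subgroup G // K ≤ H}, D.obj K.1

/-- The relations `(ʰK, c_h d) = (K, d)` for `h ∈ H`. -/
def conjRel (H : Subgroup G) : AddSubgroup (FreeAbelianGroup (D.Gen H)) :=
  AddSubgroup.closure {z | ∃ (K K' : Subgroup G) (hK : K ≤ H) (hK' : K' ≤ H) (h : G) (_ : h ∈ H)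
    (e : K' = MulAut.conj h • K) (d : D.obj K),
    z = FreeAbelianGroup.of ⟨⟨K', hK'⟩, D.conj h e d⟩ - FreeAbelianGroup.of ⟨⟨K, hK⟩, d⟩}

/-- The group generated by symbols `tr_K^H [d]`, with `K ≤ H` and `d ∈ D(K)`, modulo
`tr_{hK}^H [c_h d] = tr_K^H [d]` for `h ∈ H`. -/
abbrev FreeObj (H : Subgroup G) : Type u := FreeAbelianGroup (D.Gen H) ⧸ D.conjRel H

variable {D}

/-- The generator `tr_K^H [d]`. -/
def gen {K H : Subgroup G} (h : K ≤ H) (d : D.obj K) : D.FreeObj H :=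
  QuotientAddGroup.mk (FreeAbelianGroup.of ⟨⟨K, h⟩, d⟩)

theorem mk_conj {K K' H : Subgroup G} (hK : K ≤ H) (hK' : K' ≤ H) {h : G} (hh : h ∈ H)
    (e : K' = MulAut.conj h • K) (d : D.obj K) : gen hK' (D.conj h e d) = gen hK d := by
  rw [← sub_eq_zero]
  exact (QuotientAddGroup.eq_zero_iff _).2 (AddSubgroup.subset_closure
    ⟨K, K', hK, hK', h, hh, e, d, rfl⟩)

/-- Maps out of `FreeObj`. -/
def lift {H : Subgroup G} {A : Type*} [AddCommGroup A]
    (φ : ∀ K : Subgroup G, K ≤ H → D.obj K → A)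
    (hφ : ∀ (K K' : Subgroup G) (hK : K ≤ H) (hK' : K' ≤ H) (h : G), h ∈ H →
      ∀ (e : K' = MulAut.conj h • K) (d : D.obj K), φ K' hK' (D.conj h e d) = φ K hK d) :
    D.FreeObj H →+ A :=
  QuotientAddGroup.lift _ (FreeAbelianGroup.lift fun p : D.Gen H => φ p.1.1 p.1.2 p.2) (by
    intro x hx
    refine (AddSubgroup.closure_le _).2 ?_ hx
    rintro _ ⟨K, K', hK, hK', h, hh, e, d, rfl⟩
    simp [hφ K K' hK hK' h hh e d])

@[simp] theorem lift_mk {H : Subgroup G} {A : Type*} [AddCommGroup A]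
    (φ : ∀ K : Subgroup G, K ≤ H → D.obj K → A) (hφ) {K : Subgroup G} (hK : K ≤ H)
    (d : D.obj K) : lift φ hφ (gen hK d) = φ K hK d := by
  simp [lift, gen]

theorem ext {H : Subgroup G} {A : Type*} [AddCommGroup A] {f g : D.FreeObj H →+ A}
    (h : ∀ (K : Subgroup G) (hK : K ≤ H) (d : D.obj K), f (gen hK d) = g (gen hK d)) : f = g := by
  refine QuotientAddGroup.addMonoidHom_ext _ (FreeAbelianGroup.lift_ext _ _ ?_)
  rintro ⟨⟨K, hK⟩, d⟩
  exact h K hK d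

theorem ext' {H : Subgroup G} {A : Type*} [AddCommGroup A] {f g : D.FreeObj H →+ A}
    (h : ∀ (K : Subgroup G) (hK : K ≤ H) (d : D.obj K), f (gen hK d) = g (gen hK d))
    (x : D.FreeObj H) : f x = g x := DFunLike.congr_fun (ext h) x

theorem conj_res_eq {K L L' T T' : Subgroup G} {x x' k a : G} (e : T = MulAut.conj x • L)
    (e' : T' = MulAut.conj x' • L') (eT : T' = MulAut.conj a • T) (h : L ≤ K) (h' : L' ≤ K)
    (hk : k ∈ K) (hx : x' = a * x * k) (d : D.obj K) :
    D.conj x' e' (D.res h' d) = D.conj a eT (D.conj x e (D.res h d)) := by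
  have eL : L = MulAut.conj k • L' := by
    have : MulAut.conj (a * x) • L = MulAut.conj (a * x * k) • L' := by
      rw [← hx, ← e', eT, e, smul_smul, map_mul]
    rw [map_mul (MulAut.conj) (a * x) k, mul_smul] at this
    exact smul_left_cancel _ this
  subst hx
  conv_rhs => rw [← D.conj_self hk (conj_eq_self hk) d, ← D.conj_res h' h eL]
  rw [D.conj_conj _ _ (conj_mul eL e), D.conj_conj _ _ (by rw [e', mul_assoc])]
  congr 1
  rw [mul_assoc]

/-- The comparison used for all identities between double coset sums. -/
theorem mk_eq {J K K' L L' T T' : Subgroup G} {x x' k a b : G} (hT : T ≤ J) (hT' : T' ≤ J)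
    (e : T = MulAut.conj x • L) (e' : T' = MulAut.conj x' • L') (eT : T' = MulAut.conj a • T)
    (ha : a ∈ J) (h : L ≤ K) (h' : L' ≤ K') (hb : K' = MulAut.conj b • K) (hk : k ∈ K)
    (hx : x' * b = a * x * k) (d : D.obj K) :
    gen hT' (D.conj x' e' (D.res h' (D.conj b hb d))) = gen hT (D.conj x e (D.res h d)) := by
  have hb' : L' = MulAut.conj b • (MulAut.conj b⁻¹ • L') := by
    rw [smul_smul, ← map_mul]; simp
  have h0 : MulAut.conj b⁻¹ • L' ≤ K := by
    exact (Subgroup.pointwise_smul_le_pointwise_smul_iff (a := MulAut.conj b)).1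
      (by rw [← hb, ← hb']; exact h')
  rw [← D.conj_res h0 h' hb' hb, D.conj_conj _ _ (conj_mul hb' e'),
    conj_res_eq e (conj_mul hb' e') eT h h0 hk hx, mk_conj]
  exact ha

theorem mk_eq' {J K L L' T T' : Subgroup G} {x x' k a : G} (hT : T ≤ J) (hT' : T' ≤ J)
    (e : T = MulAut.conj x • L) (e' : T' = MulAut.conj x' • L') (eT : T' = MulAut.conj a • T)
    (ha : a ∈ J) (h : L ≤ K) (h' : L' ≤ K) (hk : k ∈ K)
    (hx : x' = a * x * k) (d : D.obj K) :
    gen hT' (D.conj x' e' (D.res h' d)) = gen hT (D.conj x e (D.res h d)) := by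
  rw [conj_res_eq e e' eT h h' hk hx, mk_conj]
  exact ha

/-- The term of the double coset formula at `x`. -/
def term (J : Subgroup G) {K : Subgroup G} (d : D.obj K) (x : G) : D.FreeObj J :=
  gen (inf_le_left : J ⊓ MulAut.conj x • K ≤ J) (D.conj x (conj_inf J K x)
    (D.res (inf_le_right : MulAut.conj x⁻¹ • J ⊓ K ≤ K) d))

theorem term_inv {J K : Subgroup G} (d : D.obj K) (x : G) (a : G) (ha : a ∈ J) (b : G)
    (hb : b ∈ K) : term J d (a * x * b) = term J d x := by
  refine mk_eq' _ _ _ _ ?_ ha _ _ hb rfl d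
  rw [map_mul, map_mul, mul_smul, mul_smul, Subgroup.smul_inf,
    Subgroup.conj_smul_eq_self_of_mem hb, Subgroup.conj_smul_eq_self_of_mem ha]

/-- Restriction, by the double coset formula. -/
noncomputable def freeRes {J H : Subgroup G} (hJ : J ≤ H) : D.FreeObj H →+ D.FreeObj J :=
  lift (fun K _ d => sumOver (dc J K) H (term J d)) (by
    intro K K' hK hK' h hh e d
    rw [sumOver_conj (H := H) (J := J) hJ hK 1 h (by simp) (by simp) (by simpa using hh) e
      (fun x _ a ha b hb => term_inv _ x a ha b hb)]
    refine sumOver_congr fun x hx => ?_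
    refine mk_eq (a := 1) (k := 1) _ _ _ _ ?_ J.one_mem _ _ _ K.one_mem (by group) d
    rw [e, smul_smul, ← map_mul]
    simp)

theorem freeRes_mk {J H K : Subgroup G} (hJ : J ≤ H) (hK : K ≤ H) (d : D.obj K) :
    freeRes hJ (gen hK d) = sumOver (dc J K) H (term J d) := lift_mk _ _ _ _

/-- Conjugation. -/
def freeConj (g : G) {H H' : Subgroup G} (h : H' = MulAut.conj g • H) :
    D.FreeObj H →+ D.FreeObj H' :=
  lift (fun _ hK d => gen (conj_mono hK h rfl) (D.conj g rfl d)) (by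
    intro K K' hK hK' k hk e d
    have e0 : MulAut.conj g • K' = MulAut.conj (g * k) • K := by
      rw [e, smul_smul, map_mul]
    have e1 : MulAut.conj g • K' = MulAut.conj (g * k * g⁻¹) • MulAut.conj g • K := by
      rw [smul_smul, ← map_mul, e0]; simp
    have e2 : D.conj (g * k) e0 d = D.conj (g * k * g⁻¹) e1 (D.conj g rfl d) := by
      rw [D.conj_conj _ _ (by rw [e0]; simp)]; congr 1; group
    rw [D.conj_conj e rfl e0, e2]
    refine mk_conj _ _ ?_ _ _
    rw [h, mem_conj]; simpa [mul_assoc] using hk)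

theorem freeConj_mk {g : G} {H H' K K' : Subgroup G} (h : H' = MulAut.conj g • H) (hK : K ≤ H)
    (hK' : K' ≤ H') (e : K' = MulAut.conj g • K) (d : D.obj K) :
    freeConj g h (gen hK d) = gen hK' (D.conj g e d) := by
  subst e
  exact lift_mk _ _ _ _

/-- The inclusion, sending `tr_K^H [d]` to `tr_K^{H'} [d]`. -/
def freeTr {H H' : Subgroup G} (h : H ≤ H') : D.FreeObj H →+ D.FreeObj H' :=
  lift (fun _ hK d => gen (hK.trans h) d)
    (fun _ _ hK hK' _ hk e d => mk_conj (hK.trans h) (hK'.trans h) (h hk) e d)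

@[simp] theorem freeTr_mk {H H' K : Subgroup G} (h : H ≤ H') (hK : K ≤ H) (d : D.obj K) :
    freeTr h (gen hK d) = gen (hK.trans h) d := lift_mk _ _ _ _

theorem mk_congr {H K K' : Subgroup G} (hK : K ≤ H) (hK' : K' ≤ H) (g g' : G) {L : Subgroup G}
    (e : K = MulAut.conj g • L) (e' : K' = MulAut.conj g' • L) (h : g = g') (d : D.obj L) :
    gen hK (D.conj g e d) = gen hK' (D.conj g' e' d) := by
  subst h; subst e; subst e'; rfl

theorem conj_eq_of_eq {g g' : G} {H H' : Subgroup G} (e : H' = MulAut.conj g • H)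
    (e' : H' = MulAut.conj g' • H) (h : g = g') (d : D.obj H) : D.conj g e d = D.conj g' e' d := by
  subst h; rfl

variable (D) in
/-- The Mackey functor freely generated by `D` under transfers: restrictions are given by the
double coset formula. -/
noncomputable def free : MackeyFunctor G where
  obj := D.FreeObj
  tr := freeTr
  res := freeRes
  conj g _ _ := freeConj g
  tr_self h := ext' (g := AddMonoidHom.id _) fun K hK d => by simp
  res_self {H} h := ext' (g := AddMonoidHom.id _) fun K hK d => by
    have hone : ∀ x ∈ H, term H d x = gen hK d := by
      intro x hx
      have : gen hK d = gen hK (D.conj 1 (by simp) (D.res le_rfl d)) := by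
        rw [D.conj_self K.one_mem, D.res_self]
      rw [this]
      refine mk_eq' (a := x) (k := 1) _ _ _ _ ?_ hx _ _ K.one_mem (by group) d
      rw [inf_eq_right]
      exact conj_mono hK (conj_eq_self hx) rfl
    rw [freeRes_mk, sumOver_single (f := term H d)]
    · exact hone 1 H.one_mem
    · intro x
      rw [dc_iff]
      constructor
      · rintro ⟨a, ha, b, hb, hab⟩
        rw [eq_mul_inv_of_mul_eq (eq_inv_mul_of_mul_eq ((mul_assoc _ _ _).symm.trans hab.symm))]
        exact H.mul_mem (H.mul_mem (H.inv_mem ha) H.one_mem) (H.inv_mem (hK hb))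
      · exact fun hx => ⟨x⁻¹, H.inv_mem hx, 1, K.one_mem, by group⟩
    · exact fun x hx => (hone x hx).trans (hone 1 H.one_mem).symm
  conj_self {H g} hg h := ext' (g := AddMonoidHom.id _) fun K hK d => by
    rw [freeConj_mk h hK (conj_mono hK h rfl) rfl]
    exact mk_conj _ _ hg _ _
  tr_tr h h' h'' := ext' (f := (freeTr h').comp (freeTr h)) fun K hK d => by simp
  res_res {J K H} h h' h'' := ext' (f := (freeRes h).comp (freeRes h')) fun L hL d => by
    rw [AddMonoidHom.comp_apply, freeRes_mk, freeRes_mk, map_sumOver,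
      sumOver_nested_left h h' hL (fun x _ a ha b hb => term_inv _ x a ha b hb)]
    refine sumOver_congr fun x hx => ?_
    rw [term, freeRes_mk]
    refine sumOver_congr fun y hy => ?_
    have e1 : K ⊓ MulAut.conj x • L = MulAut.conj x • (MulAut.conj x⁻¹ • K ⊓ L) := conj_inf K L x
    rw [term]
    have h2 : MulAut.conj y⁻¹ • J ⊓ (K ⊓ MulAut.conj x • L) =
        MulAut.conj x • (MulAut.conj x⁻¹ • (MulAut.conj y⁻¹ • J ⊓ (K ⊓ MulAut.conj x • L))) := by
      rw [smul_smul, ← map_mul]; simp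
    have h3 : MulAut.conj x⁻¹ • (MulAut.conj y⁻¹ • J ⊓ (K ⊓ MulAut.conj x • L)) ≤
        MulAut.conj x⁻¹ • K ⊓ L := by
      exact (Subgroup.pointwise_smul_le_pointwise_smul_iff (a := MulAut.conj x)).1
        (by rw [← h2, ← e1]; exact inf_le_right)
    rw [← D.conj_res h3 _ h2 e1, D.conj_conj _ _ (conj_mul h2 (conj_inf _ _ _)),
      D.res_res _ _ (h3.trans inf_le_right)]
    refine mk_eq' (a := 1) (k := 1) _ _ _ _ ?_ J.one_mem _ _ L.one_mem (by group) d
    rw [Subgroup.smul_inf, Subgroup.conj_smul_eq_self_of_mem hy, ← inf_assoc, inf_eq_left.2 h,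
      map_mul, mul_smul]
    simp
  conj_conj {g g' H H' H''} h h' h'' :=
    ext' (f := (freeConj g' h').comp (freeConj g h)) fun K hK d => by
      rw [AddMonoidHom.comp_apply, freeConj_mk h hK (conj_mono hK h rfl) rfl,
        freeConj_mk h' _ (conj_mono (conj_mono hK h rfl) h' rfl) rfl,
        freeConj_mk h'' hK (conj_mono hK h'' rfl) rfl, D.conj_conj _ _ (conj_mul rfl rfl)]
      exact mk_congr _ _ _ _ _ _ rfl d
  conj_tr {g H K H' K'} h h' hK hH :=
    ext' (f := (freeConj g hH).comp (freeTr h)) (g := (freeTr h').comp (freeConj g hK))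
      fun L hL d => by
      rw [AddMonoidHom.comp_apply, AddMonoidHom.comp_apply, freeTr_mk,
        freeConj_mk hH _ (conj_mono (hL.trans h) hH rfl) rfl,
        freeConj_mk hK hL (conj_mono hL hK rfl) rfl, freeTr_mk]
  conj_res {g H K H' K'} h h' hK hH :=
    ext' (f := (freeConj g hK).comp (freeRes h)) (g := (freeRes h').comp (freeConj g hH))
      fun L hL d => by
      rw [AddMonoidHom.comp_apply, AddMonoidHom.comp_apply,
        freeConj_mk hH hL (conj_mono hL hH rfl) rfl, freeRes_mk, freeRes_mk, map_sumOver,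
        sumOver_conj h hL g g hH hK (by simp) rfl
          (fun x _ a ha b hb => term_inv _ x a ha b hb)]
      refine sumOver_congr fun x hx => ?_
      rw [term, freeConj_mk hK _ (conj_mono inf_le_left hK rfl) rfl,
        D.conj_conj _ _ (conj_mul (conj_inf _ _ _) rfl)]
      symm
      refine mk_eq (a := 1) (k := 1) _ _ _ _ ?_ K'.one_mem _ _ _ L.one_mem (by group) d
      rw [Subgroup.smul_inf, hK, smul_smul, smul_smul, ← map_mul, ← map_mul]
      simp
  res_tr {J K H} hJ hK := by
    intro x
    have := ext' (f := (freeRes hJ).comp (freeTr hK)) (g := ∑ q : Reps (dc J K) H,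
      (freeTr (inf_le_left : J ⊓ MulAut.conj q.1.out • K ≤ J)).comp
        ((freeConj q.1.out (conj_inf J K _)).comp
          (freeRes (inf_le_right : MulAut.conj q.1.out⁻¹ • J ⊓ K ≤ K)))) ?_ x
    · rw [AddMonoidHom.comp_apply, AddMonoidHom.finsetSum_apply] at this
      exact this
    · intro L hL d
      rw [AddMonoidHom.comp_apply, AddMonoidHom.finsetSum_apply, freeTr_mk, freeRes_mk,
        sumOver_nested_right hJ hK hL (fun x _ a ha b hb => term_inv _ x a ha b hb)]
      refine Finset.sum_congr rfl fun q _ => ?_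
      generalize q.1.out = x
      rw [AddMonoidHom.comp_apply, AddMonoidHom.comp_apply, freeRes_mk, map_sumOver, map_sumOver]
      refine sumOver_congr fun y hy => ?_
      rw [term, term, freeConj_mk (conj_inf J K x) _ (conj_mono inf_le_left (conj_inf J K x) rfl) rfl,
        freeTr_mk, D.conj_conj _ _ (conj_mul (conj_inf _ _ _) rfl)]
      refine mk_eq' (a := 1) (k := 1) _ _ _ _ ?_ J.one_mem _ _ L.one_mem (by group) d
      have hL' : MulAut.conj y • L ≤ K := conj_mono hL (conj_eq_self hy) rfl
      rw [inf_assoc, inf_eq_right.2 hL', Subgroup.smul_inf, smul_smul, smul_smul, ← map_mul,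
        ← map_mul]
      simp

end ResSystem

end Mackey

/-! ### The box product -/

section Box

variable {G : Type u} [Group G] [Finite G]

namespace ResSystem

section

variable {D : ResSystem G} {P : MackeyFunctor G} (φ : ∀ K, D.obj K → P.obj K)

/-- The map sending `tr_K^H [d]` to `tr_K^H (φ d)`. -/
def freeHomApp (hconj : ∀ {g : G} {H H' : Subgroup G} (h : H' = MulAut.conj g • H) (d : D.obj H),
      φ H' (D.conj g h d) = P.conj g h (φ H d)) (H : Subgroup G) : D.FreeObj H →+ P.obj H :=
  lift (fun K hK d => P.tr hK (φ K d)) (by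
    intro K K' hK hK' h hh e d
    rw [hconj, ← P.conj_tr hK hK' e (conj_eq_self hh), P.conj_self hh])

theorem freeHomApp_gen (hconj) {K H : Subgroup G} (hK : K ≤ H) (d : D.obj K) :
    freeHomApp φ hconj H (gen hK d) = P.tr hK (φ K d) := lift_mk _ _ _ _

/-- A family of maps `D(K) → P(K)` that is compatible with restrictions and conjugations extends to
a morphism out of the Mackey functor generated by `D`. -/
noncomputable def freeHom (hres : ∀ {K H : Subgroup G} (h : K ≤ H) (d : D.obj H),
      φ K (D.res h d) = P.res h (φ H d))
    (hconj : ∀ {g : G} {H H' : Subgroup G} (h : H' = MulAut.conj g • H) (d : D.obj H),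
      φ H' (D.conj g h d) = P.conj g h (φ H d)) : D.free ⟶ P where
  app := freeHomApp φ hconj
  app_tr {K H} h := ext' (f := (freeHomApp φ hconj H).comp (freeTr h))
    (g := (P.tr h).comp (freeHomApp φ hconj K)) fun L hL d => by
      rw [AddMonoidHom.comp_apply, AddMonoidHom.comp_apply, freeTr_mk, freeHomApp_gen,
        freeHomApp_gen, P.tr_tr hL h (hL.trans h)]
  app_res {J H} h := ext' (f := (freeHomApp φ hconj J).comp (freeRes h))
    (g := (P.res h).comp (freeHomApp φ hconj H)) fun L hL d => by
      rw [AddMonoidHom.comp_apply, AddMonoidHom.comp_apply, freeRes_mk, freeHomApp_gen,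
        P.res_tr h hL, map_sumOver]
      refine sumOver_congr fun x hx => ?_
      rw [term, freeHomApp_gen, hconj, hres]
  app_conj {g H H'} h := ext' (f := (freeHomApp φ hconj H').comp (freeConj g h))
    (g := (P.conj g h).comp (freeHomApp φ hconj H)) fun L hL d => by
      rw [AddMonoidHom.comp_apply, AddMonoidHom.comp_apply,
        freeConj_mk h hL (conj_mono hL h rfl) rfl, freeHomApp_gen, freeHomApp_gen, hconj,
        P.conj_tr hL (conj_mono hL h rfl) rfl h]

theorem freeHom_gen (hres) (hconj) {K H : Subgroup G} (hK : K ≤ H) (d : D.obj K) :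
    MackeyFunctor.Hom.app (freeHom (P := P) φ hres hconj) H (gen hK d) = P.tr hK (φ K d) :=
  freeHomApp_gen _ hconj _ _

end

end ResSystem

namespace MackeyFunctor

open ResSystem

/-- The pairs `(m, n) ∈ M(K) × N(K)`. -/
def boxSystem (M N : MackeyFunctor G) : ResSystem G where
  obj K := M.obj K × N.obj K
  res h x := (M.res h x.1, N.res h x.2)
  conj g _ _ h x := (M.conj g h x.1, N.conj g h x.2)
  res_self h x := Prod.ext (M.res_self h _) (N.res_self h _)
  conj_self hg h x := Prod.ext (M.conj_self hg h _) (N.conj_self hg h _)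
  res_res h h' h'' x := Prod.ext (M.res_res h h' h'' _) (N.res_res h h' h'' _)
  conj_conj h h' h'' x := Prod.ext (M.conj_conj h h' h'' _) (N.conj_conj h h' h'' _)
  conj_res h h' hK hH x := Prod.ext (M.conj_res h h' hK hH _) (N.conj_res h h' hK hH _)


/-- The symbol `m ⊗ n` at `H`, with `m ∈ M(K)`, `n ∈ N(K)`, `K ≤ H`. -/
def sym {M N : MackeyFunctor G} {H K : Subgroup G} (hK : K ≤ H) (m : M.obj K) (n : N.obj K) :
    (boxSystem M N).FreeObj H := gen (D := boxSystem M N) hK (m, n)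

theorem freeTr_sym {M N : MackeyFunctor G} {H H' K : Subgroup G} (h : H ≤ H') (hK : K ≤ H)
    (m : M.obj K) (n : N.obj K) : freeTr h (sym hK m n) = sym (hK.trans h) m n :=
  freeTr_mk h hK (D := boxSystem M N) (m, n)

theorem freeConj_sym {M N : MackeyFunctor G} {g : G} {H H' K K' : Subgroup G}
    (h : H' = MulAut.conj g • H) (hK : K ≤ H) (hK' : K' ≤ H') (e : K' = MulAut.conj g • K)
    (m : M.obj K) (n : N.obj K) :
    freeConj g h (sym hK m n) = sym hK' (M.conj g e m) (N.conj g e n) :=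
  freeConj_mk (D := boxSystem M N) h hK hK' e (m, n)

theorem freeRes_sym {M N : MackeyFunctor G} {J H K : Subgroup G} (hJ : J ≤ H) (hK : K ≤ H)
    (m : M.obj K) (n : N.obj K) :
    freeRes hJ (sym hK m n) = sumOver (dc J K) H fun x =>
      sym (inf_le_left : J ⊓ MulAut.conj x • K ≤ J)
        (M.conj x (conj_inf J K x) (M.res inf_le_right m))
        (N.conj x (conj_inf J K x) (N.res inf_le_right n)) :=
  freeRes_mk (D := boxSystem M N) hJ hK (m, n)

theorem sym_conj {M N : MackeyFunctor G} {K K' H : Subgroup G} (hK : K ≤ H) (hK' : K' ≤ H) {h : G}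
    (hh : h ∈ H) (e : K' = MulAut.conj h • K) (m : M.obj K) (n : N.obj K) :
    sym hK' (M.conj h e m) (N.conj h e n) = sym hK m n :=
  mk_conj (D := boxSystem M N) hK hK' hh e (m, n)

/-- The defining relations of the box product at `H`, in addition to the conjugation relations:
bilinearity and Frobenius reciprocity. -/
inductive BoxRel (M N : MackeyFunctor G) (H : Subgroup G) : (boxSystem M N).FreeObj H → Prop
  | add_left {K : Subgroup G} (hK : K ≤ H) (m m' : M.obj K) (n : N.obj K) :
    BoxRel M N H (sym hK (m + m') n - (sym hK m n + sym hK m' n))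
  | add_right {K : Subgroup G} (hK : K ≤ H) (m : M.obj K) (n n' : N.obj K) :
    BoxRel M N H (sym hK m (n + n') - (sym hK m n + sym hK m n'))
  | tr_left {L K : Subgroup G} (hL : L ≤ K) (hK : K ≤ H) (m : M.obj L) (n : N.obj K) :
    BoxRel M N H (sym hK (M.tr hL m) n - sym (hL.trans hK) m (N.res hL n))
  | tr_right {L K : Subgroup G} (hL : L ≤ K) (hK : K ≤ H) (m : M.obj K) (n : N.obj L) :
    BoxRel M N H (sym hK m (N.tr hL n) - sym (hL.trans hK) (M.res hL m) n)

/-- The subgroup generated by the relations. -/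
def boxSub (M N : MackeyFunctor G) (H : Subgroup G) : AddSubgroup ((boxSystem M N).FreeObj H) :=
  AddSubgroup.closure {z | BoxRel M N H z}

theorem frobenius_res {M N : MackeyFunctor G} {J H K L : Subgroup G} (hJ : J ≤ H) (hK : K ≤ H)
    (hL : L ≤ K) {A : Type*} [AddCommGroup A] (β : ∀ T : Subgroup G, T ≤ J → M.obj T → N.obj T → A)
    (hadd : ∀ T hT m m' n, β T hT (m + m') n = β T hT m n + β T hT m' n)
    (htr : ∀ T T' hT (h : T' ≤ T) m n, β T hT (M.tr h m) n = β T' (h.trans hT) m (N.res h n))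
    (hconj : ∀ T T' hT hT' a (_ : a ∈ J) (e : T' = MulAut.conj a • T) m n,
      β T' hT' (M.conj a e m) (N.conj a e n) = β T hT m n)
    (m : M.obj L) (n : N.obj K) :
    (sumOver (dc J K) H fun x => β (J ⊓ MulAut.conj x • K) inf_le_left
      (M.conj x (conj_inf J K x) (M.res inf_le_right (M.tr hL m)))
      (N.conj x (conj_inf J K x) (N.res inf_le_right n))) =
    sumOver (dc J L) H fun x => β (J ⊓ MulAut.conj x • L) inf_le_left
      (M.conj x (conj_inf J L x) (M.res inf_le_right m))
      (N.conj x (conj_inf J L x) (N.res inf_le_right (N.res hL n))) := by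
  rw [sumOver_nested_right hJ hK hL]
  · refine sumOver_congr fun x hx => ?_
    let b : M.obj (J ⊓ MulAut.conj x • K) →+ A := AddMonoidHom.mk' (fun m' =>
      β (J ⊓ MulAut.conj x • K) inf_le_left m'
      (N.conj x (conj_inf J K x) (N.res inf_le_right n))) fun _ _ => hadd _ _ _ _ _
    change b _ = _
    rw [M.res_tr _ hL, map_sumOver, map_sumOver]
    refine sumOver_congr fun y hy => ?_
    have hyL : MulAut.conj y • L ≤ K := conj_mono hL (conj_eq_self hy) rfl
    have eT : J ⊓ MulAut.conj (x * y) • L =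
        MulAut.conj x • ((MulAut.conj x⁻¹ • J ⊓ K) ⊓ MulAut.conj y • L) := by
      rw [inf_assoc, inf_eq_right.2 hyL, Subgroup.smul_inf, smul_smul, smul_smul, ← map_mul,
        ← map_mul]
      simp
    rw [M.conj_tr inf_le_left (conj_mono inf_le_left (conj_inf J K x) eT) eT]
    change β _ _ _ _ = _
    rw [htr, ← N.conj_res inf_le_left _ eT, N.res_res _ _ (inf_le_left.trans inf_le_right),
      M.conj_conj _ _ (conj_mul (conj_inf _ _ _) eT),
      N.res_res _ _ (inf_le_right.trans hL)]
    have hs : ∀ (S S' : Subgroup G) (hS : S ≤ L) (hS' : S' ≤ L), S = S' →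
        ∀ e : J ⊓ MulAut.conj (x * y) • L = MulAut.conj (x * y) • S,
        ∀ e' : J ⊓ MulAut.conj (x * y) • L = MulAut.conj (x * y) • S',
        M.conj (x * y) e (M.res hS m) = M.conj (x * y) e' (M.res hS' m) := by
      rintro S S' hS hS' rfl e e'; rfl
    have e2 : (MulAut.conj x⁻¹ • J ⊓ K) ⊓ MulAut.conj y • L =
        MulAut.conj y • (MulAut.conj y⁻¹ • (MulAut.conj x⁻¹ • J ⊓ K) ⊓ L) := conj_inf _ _ _
    have e3 : MulAut.conj (x * y)⁻¹ • J ⊓ L = MulAut.conj y⁻¹ • (MulAut.conj x⁻¹ • J ⊓ K) ⊓ L := by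
      apply smul_left_cancel (MulAut.conj (x * y))
      rw [← conj_inf, eT, map_mul, mul_smul, ← conj_inf]
    congr 1
    · exact hs _ _ _ _ e3.symm _ _
    · have := N.conj_res (inf_le_right.trans hL) (inf_le_left.trans inf_le_right) e2
        (conj_eq_self hy) n
      rw [N.conj_self hy] at this
      rw [← this, N.conj_conj _ _ (conj_mul e2 eT)]
      have hs' : ∀ (S S' : Subgroup G) (hS : S ≤ K) (hS' : S' ≤ K), S = S' →
          ∀ e : J ⊓ MulAut.conj (x * y) • L = MulAut.conj (x * y) • S,
          ∀ e' : J ⊓ MulAut.conj (x * y) • L = MulAut.conj (x * y) • S',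
          N.conj (x * y) e (N.res hS n) = N.conj (x * y) e' (N.res hS' n) := by
        rintro S S' hS hS' rfl e e'; rfl
      exact hs' _ _ _ _ e3.symm _ _
  · intro x hx a ha b hb
    have eT : J ⊓ MulAut.conj (a * x * b) • L = MulAut.conj a • (J ⊓ MulAut.conj x • L) := by
      rw [map_mul, map_mul, mul_smul, mul_smul, Subgroup.smul_inf,
        Subgroup.conj_smul_eq_self_of_mem hb, Subgroup.conj_smul_eq_self_of_mem ha]
    have := ResSystem.conj_res_eq (D := boxSystem M N) (conj_inf J L x) (conj_inf J L (a * x * b))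
      eT inf_le_right inf_le_right hb rfl (m, N.res hL n)
    rw [show M.conj (a * x * b) (conj_inf J L _) (M.res inf_le_right m) = _ from
      congrArg Prod.fst this, show N.conj (a * x * b) (conj_inf J L _)
      (N.res inf_le_right (N.res hL n)) = _ from congrArg Prod.snd this]
    exact hconj _ _ _ _ _ ha _ _ _

section

variable (M N : MackeyFunctor G)

/-- The symbol `m ⊗ n` in the quotient. -/
def bq {H : Subgroup G} (K : Subgroup G) (hK : K ≤ H) (m : M.obj K) (n : N.obj K) :
    (boxSystem M N).FreeObj H ⧸ boxSub M N H :=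
  QuotientAddGroup.mk (sym hK m n)

variable {M N}

theorem bq_rel {H : Subgroup G} {x y : (boxSystem M N).FreeObj H} (h : BoxRel M N H (x - y)) :
    (QuotientAddGroup.mk x : (boxSystem M N).FreeObj H ⧸ boxSub M N H) = QuotientAddGroup.mk y :=
  sub_eq_zero.1 ((QuotientAddGroup.eq_zero_iff _).2 (AddSubgroup.subset_closure h))

theorem boxRel_tr {K H : Subgroup G} (h : K ≤ H) {x : (boxSystem M N).FreeObj K}
    (hx : BoxRel M N K x) : BoxRel M N H (freeTr h x) := by
  rcases hx with ⟨hK, m, m', n⟩ | ⟨hK, m, n, n'⟩ | ⟨hL, hK, m, n⟩ | ⟨hL, hK, m, n⟩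
  · rw [map_sub, map_add, freeTr_sym, freeTr_sym, freeTr_sym]; exact .add_left _ _ _ _
  · rw [map_sub, map_add, freeTr_sym, freeTr_sym, freeTr_sym]; exact .add_right _ _ _ _
  · rw [map_sub, freeTr_sym, freeTr_sym]; exact .tr_left _ _ _ _
  · rw [map_sub, freeTr_sym, freeTr_sym]; exact .tr_right _ _ _ _

theorem boxRel_conj {g : G} {H H' : Subgroup G} (h : H' = MulAut.conj g • H)
    {x : (boxSystem M N).FreeObj H} (hx : BoxRel M N H x) : BoxRel M N H' (freeConj g h x) := by
  rcases hx with ⟨hK, m, m', n⟩ | ⟨hK, m, n, n'⟩ | ⟨hL, hK, m, n⟩ | ⟨hL, hK, m, n⟩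
  · have := conj_mono hK h rfl
    rw [map_sub, map_add, freeConj_sym h hK this rfl, freeConj_sym h hK this rfl,
      freeConj_sym h hK this rfl, map_add]; exact .add_left _ _ _ _
  · have := conj_mono hK h rfl
    rw [map_sub, map_add, freeConj_sym h hK this rfl, freeConj_sym h hK this rfl,
      freeConj_sym h hK this rfl, map_add]; exact .add_right _ _ _ _
  · have := conj_mono hK h rfl
    have h2 := conj_mono hL rfl rfl (g := g)
    rw [map_sub, freeConj_sym h hK this rfl, freeConj_sym h (hL.trans hK) (h2.trans this) rfl,
      M.conj_tr hL h2 rfl rfl, N.conj_res hL h2 rfl rfl]; exact .tr_left _ _ _ _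
  · have := conj_mono hK h rfl
    have h2 := conj_mono hL rfl rfl (g := g)
    rw [map_sub, freeConj_sym h hK this rfl, freeConj_sym h (hL.trans hK) (h2.trans this) rfl,
      N.conj_tr hL h2 rfl rfl, M.conj_res hL h2 rfl rfl]; exact .tr_right _ _ _ _

theorem mk_freeRes_sym {J H K : Subgroup G} (hJ : J ≤ H) (hK : K ≤ H)
    (m : M.obj K) (n : N.obj K) :
    QuotientAddGroup.mk' (boxSub M N J) (freeRes hJ (sym hK m n)) = sumOver (dc J K) H fun x =>
      bq M N (J ⊓ MulAut.conj x • K) inf_le_left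
        (M.conj x (conj_inf J K x) (M.res inf_le_right m))
        (N.conj x (conj_inf J K x) (N.res inf_le_right n)) := by
  rw [freeRes_sym, map_sumOver]
  rfl

theorem boxRel_res {J H : Subgroup G} (h : J ≤ H)
    {x : (boxSystem M N).FreeObj H} (hx : BoxRel M N H x) : freeRes h x ∈ boxSub M N J := by
  refine (QuotientAddGroup.eq_zero_iff _).1 (?_ : QuotientAddGroup.mk' (boxSub M N J) _ = 0)
  have hconj : ∀ T T' (hT : T ≤ J) (hT' : T' ≤ J) a (_ : a ∈ J) (e : T' = MulAut.conj a • T)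
      (m : M.obj T) (n : N.obj T),
      bq M N T' hT' (M.conj a e m) (N.conj a e n) = bq M N T hT m n :=
    fun T T' hT hT' a ha e m n => congrArg QuotientAddGroup.mk (sym_conj hT hT' ha e m n)
  rcases hx with ⟨hK, m, m', n⟩ | ⟨hK, m, n, n'⟩ | ⟨hL, hK, m, n⟩ | ⟨hL, hK, m, n⟩
  · rw [map_sub, map_sub, sub_eq_zero, map_add, map_add, mk_freeRes_sym, mk_freeRes_sym,
      mk_freeRes_sym, ← sumOver_add]
    refine sumOver_congr fun x _ => ?_
    rw [map_add, map_add]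
    exact bq_rel (.add_left _ _ _ _)
  · rw [map_sub, map_sub, sub_eq_zero, map_add, map_add, mk_freeRes_sym, mk_freeRes_sym,
      mk_freeRes_sym, ← sumOver_add]
    refine sumOver_congr fun x _ => ?_
    rw [map_add, map_add]
    exact bq_rel (.add_right _ _ _ _)
  · rw [map_sub, map_sub, sub_eq_zero, mk_freeRes_sym, mk_freeRes_sym]
    exact frobenius_res h hK hL (bq M N) (fun _ _ _ _ _ => bq_rel (.add_left _ _ _ _))
      (fun _ _ _ _ _ _ => bq_rel (.tr_left _ _ _ _)) hconj m n
  · rw [map_sub, map_sub, sub_eq_zero, mk_freeRes_sym, mk_freeRes_sym]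
    exact frobenius_res h hK hL (fun T hT n m => bq M N T hT m n)
      (fun _ _ _ _ _ => bq_rel (.add_right _ _ _ _))
      (fun _ _ _ _ _ _ => bq_rel (.tr_right _ _ _ _))
      (fun T T' hT hT' a ha e m n => hconj T T' hT hT' a ha e n m) n m

theorem boxSub_stable : (boxSystem M N).free.IsStable (boxSub M N) where
  tr {K H} h x hx := by
    refine (AddSubgroup.closure_le (K := (boxSub M N H).comap (freeTr h))).2 ?_ hx
    exact fun z hz => AddSubgroup.subset_closure (boxRel_tr h hz)
  conj {g H H'} h x hx := by
    refine (AddSubgroup.closure_le (K := (boxSub M N H').comap (freeConj g h))).2 ?_ hx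
    exact fun z hz => AddSubgroup.subset_closure (boxRel_conj h hz)
  res {J H} h x hx := by
    refine (AddSubgroup.closure_le (K := (boxSub M N J).comap (freeRes h))).2 ?_ hx
    exact fun z hz => boxRel_res h hz

variable (M N) in
/-- The box product `M □ N`: its value at `H` is `⨁_{K ≤ H} M(K) ⊗ N(K)` modulo the relations
`tr m ⊗ n = m ⊗ res n`, `m ⊗ tr n = res m ⊗ n` and `c_h m ⊗ c_h n = m ⊗ n` for `h ∈ H`. -/
noncomputable def box : MackeyFunctor G := (boxSystem M N).free.quot boxSub_stable

/-- The class of `m ⊗ n`, with `m ∈ M(H)`, `n ∈ N(H)`, in `(M □ N)(H)`. -/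
def bx {H : Subgroup G} (m : M.obj H) (n : N.obj H) : (box M N).obj H := bq M N H le_rfl m n

theorem tr_bx {K H : Subgroup G} (h : K ≤ H) (m : M.obj K) (n : N.obj K) :
    (box M N).tr h (bx m n) = bq M N K h m n :=
  congrArg QuotientAddGroup.mk (freeTr_sym h le_rfl m n)

theorem bx_add_left {H : Subgroup G} (m m' : M.obj H) (n : N.obj H) :
    bx (m + m') n = bx m n + bx m' n := bq_rel (BoxRel.add_left _ _ _ _)

theorem bx_add_right {H : Subgroup G} (m : M.obj H) (n n' : N.obj H) :
    bx m (n + n') = bx m n + bx m n' := bq_rel (BoxRel.add_right _ _ _ _)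

theorem bx_tr_left {K H : Subgroup G} (h : K ≤ H) (m : M.obj K) (n : N.obj H) :
    bx (M.tr h m) n = (box M N).tr h (bx m (N.res h n)) :=
  (bq_rel (BoxRel.tr_left h le_rfl _ _)).trans (tr_bx _ _ _).symm

theorem bx_tr_right {K H : Subgroup G} (h : K ≤ H) (m : M.obj H) (n : N.obj K) :
    bx m (N.tr h n) = (box M N).tr h (bx (M.res h m) n) :=
  (bq_rel (BoxRel.tr_right h le_rfl _ _)).trans (tr_bx _ _ _).symm

theorem conj_bx {g : G} {H H' : Subgroup G} (h : H' = MulAut.conj g • H) (m : M.obj H)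
    (n : N.obj H) : (box M N).conj g h (bx m n) = bx (M.conj g h m) (N.conj g h n) :=
  congrArg QuotientAddGroup.mk (freeConj_sym h le_rfl le_rfl h m n)

theorem res_bx {K H : Subgroup G} (h : K ≤ H) (m : M.obj H)
    (n : N.obj H) : (box M N).res h (bx m n) = bx (M.res h m) (N.res h n) := by
  refine congrArg QuotientAddGroup.mk ((freeRes_mk (D := boxSystem M N) h le_rfl (m, n)).trans ?_)
  have hone : ∀ x ∈ H, term (D := boxSystem M N) K (m, n) x =
      gen (D := boxSystem M N) le_rfl (M.res h m, N.res h n) := by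
    intro x hx
    have e : K ⊓ MulAut.conj x • H = K := by
      rw [Subgroup.conj_smul_eq_self_of_mem hx, inf_eq_left.2 h]
    have h1 : (boxSystem M N).res h (m, n) = (boxSystem M N).conj 1 (by simp)
        ((boxSystem M N).res h (m, n)) := by
      rw [(boxSystem M N).conj_self K.one_mem]
    change _ = gen (D := boxSystem M N) le_rfl ((boxSystem M N).res h (m, n))
    rw [h1]
    refine mk_eq' (D := boxSystem M N) (a := 1) (k := x) _ _ _ _ ?_ K.one_mem _ _ hx (by group) _
    simpa using e
  rw [sumOver_single (f := term (D := boxSystem M N) K (m, n)), hone 1 H.one_mem]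
  · rfl
  · intro x
    rw [dc_iff]
    constructor
    · rintro ⟨a, ha, b, hb, hab⟩
      rw [eq_mul_inv_of_mul_eq (eq_inv_mul_of_mul_eq ((mul_assoc _ _ _).symm.trans hab.symm))]
      exact H.mul_mem (H.mul_mem (H.inv_mem (h ha)) H.one_mem) (H.inv_mem hb)
    · exact fun hx => ⟨1, K.one_mem, x⁻¹, H.inv_mem hx, by group⟩
  · exact fun x hx => (hone x hx).trans (hone 1 H.one_mem).symm

theorem box_induction {H : Subgroup G} {p : (box M N).obj H → Prop} (z : (box M N).obj H)
    (h : ∀ (K : Subgroup G) (hK : K ≤ H) m n, p ((box M N).tr hK (bx m n)))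
    (h0 : p 0) (hadd : ∀ x y, p x → p y → p (x + y)) (hneg : ∀ x, p x → p (-x)) : p z := by
  obtain ⟨z, rfl⟩ := QuotientAddGroup.mk_surjective z
  obtain ⟨z, rfl⟩ := QuotientAddGroup.mk_surjective z
  have hof : ∀ x, p (QuotientAddGroup.mk (QuotientAddGroup.mk (FreeAbelianGroup.of x))) := by
    rintro ⟨⟨K, hK⟩, m, n⟩
    have := h K hK m n
    rw [tr_bx] at this
    exact this
  induction z using FreeAbelianGroup.induction_on with
  | zero => exact h0
  | of x => exact hof x
  | neg x hx => exact hneg _ (hof x)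
  | add x y hx hy => exact hadd _ _ hx hy

theorem box_hom_ext {P : MackeyFunctor G} {f g : box M N ⟶ P}
    (h : ∀ (H : Subgroup G) (m : M.obj H) (n : N.obj H),
      Hom.app f H (bx m n) = Hom.app g H (bx m n)) : f = g := by
  refine hom_ext fun H z => ?_
  induction z using box_induction with
  | h K hK m n => rw [f.app_tr, g.app_tr, h]
  | h0 => simp
  | hadd x y hx hy => rw [map_add, map_add, hx, hy]
  | hneg x hx => rw [map_neg, map_neg, hx]

end

end MackeyFunctor

end Box

/-! ### The symmetric monoidal category of Mackey functors -/

section Monoidal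

variable {G : Type u} [Group G] [Finite G]

theorem sumOver_apply {s : Setoid G} {H : Subgroup G} {A B : Type*} [AddCommMonoid A]
    [AddCommMonoid B] (f : G → A →+ B) (a : A) :
    (sumOver s H f) a = sumOver s H fun x => f x a := AddMonoidHom.finsetSum_apply _ _ _

namespace ResSystem

theorem gen_induction {D : ResSystem G} {H : Subgroup G} {p : D.FreeObj H → Prop}
    (z : D.FreeObj H) (h : ∀ (K : Subgroup G) (hK : K ≤ H) d, p (gen hK d))
    (h0 : p 0) (hadd : ∀ x y, p x → p y → p (x + y)) (hneg : ∀ x, p x → p (-x)) : p z := by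
  obtain ⟨z, rfl⟩ := QuotientAddGroup.mk_surjective z
  have hof : ∀ x, p (QuotientAddGroup.mk (FreeAbelianGroup.of x)) := by
    rintro ⟨⟨K, hK⟩, d⟩
    exact h K hK d
  induction z using FreeAbelianGroup.induction_on with
  | zero => exact h0
  | of x => exact hof x
  | neg x hx => exact hneg _ (hof x)
  | add x y hx hy => exact hadd _ _ hx hy

theorem freeRes_gen_self {D : ResSystem G} {K H : Subgroup G} (h : K ≤ H) (d : D.obj H) :
    freeRes h (gen le_rfl d) = gen le_rfl (D.res h d) := by
  rw [freeRes_mk]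
  have hone : ∀ x ∈ H, term K d x = gen le_rfl (D.res h d) := by
    intro x hx
    have h1 : D.res h d = D.conj 1 (by simp) (D.res h d) := by
      rw [D.conj_self K.one_mem]
    rw [h1]
    refine mk_eq' (a := 1) (k := x) _ _ _ _ ?_ K.one_mem _ _ hx (by group) _
    rw [Subgroup.conj_smul_eq_self_of_mem hx, inf_eq_left.2 h]
    simp
  rw [sumOver_single (f := term K d), hone 1 H.one_mem]
  · intro x
    rw [dc_iff]
    constructor
    · rintro ⟨a, ha, b, hb, hab⟩
      rw [eq_mul_inv_of_mul_eq (eq_inv_mul_of_mul_eq ((mul_assoc _ _ _).symm.trans hab.symm))]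
      exact H.mul_mem (H.mul_mem (H.inv_mem (h ha)) H.one_mem) (H.inv_mem hb)
    · exact fun hx => ⟨1, K.one_mem, x⁻¹, H.inv_mem hx, by group⟩
  · exact fun x hx => (hone x hx).trans (hone 1 H.one_mem).symm

end ResSystem

namespace MackeyFunctor

open ResSystem

/-- A pairing `(M, N) → P` of Mackey functors. -/
structure Pairing (M N P : MackeyFunctor G) where
  app : ∀ H : Subgroup G, M.obj H →+ N.obj H →+ P.obj H
  res : ∀ {K H : Subgroup G} (h : K ≤ H) (m : M.obj H) (n : N.obj H),
    P.res h (app H m n) = app K (M.res h m) (N.res h n)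
  conj : ∀ {g : G} {H H' : Subgroup G} (h : H' = MulAut.conj g • H) (m : M.obj H) (n : N.obj H),
    P.conj g h (app H m n) = app H' (M.conj g h m) (N.conj g h n)
  tr_left : ∀ {K H : Subgroup G} (h : K ≤ H) (m : M.obj K) (n : N.obj H),
    app H (M.tr h m) n = P.tr h (app K m (N.res h n))
  tr_right : ∀ {K H : Subgroup G} (h : K ≤ H) (m : M.obj H) (n : N.obj K),
    app H m (N.tr h n) = P.tr h (app K (M.res h m) n)

/-- The bilinear map `(m, n) ↦ m ⊗ n`. -/
noncomputable def bxHom (M N : MackeyFunctor G) (H : Subgroup G) :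
    M.obj H →+ N.obj H →+ (box M N).obj H :=
  AddMonoidHom.mk' (fun m => AddMonoidHom.mk' (bx m) (bx_add_right m)) fun m m' =>
    AddMonoidHom.ext (bx_add_left m m')

@[simp] theorem bxHom_apply {M N : MackeyFunctor G} {H : Subgroup G} (m : M.obj H) (n : N.obj H) :
    bxHom M N H m n = bx m n := rfl

theorem boxSub_le {M N : MackeyFunctor G} {H : Subgroup G} {A : Type*} [AddCommGroup A]
    (f : (boxSystem M N).FreeObj H →+ A)
    (h1 : ∀ (K : Subgroup G) (hK : K ≤ H) (m m' : M.obj K) (n : N.obj K),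
      f (sym hK (m + m') n) = f (sym hK m n) + f (sym hK m' n))
    (h2 : ∀ (K : Subgroup G) (hK : K ≤ H) (m : M.obj K) (n n' : N.obj K),
      f (sym hK m (n + n')) = f (sym hK m n) + f (sym hK m n'))
    (h3 : ∀ (L K : Subgroup G) (hL : L ≤ K) (hK : K ≤ H) (m : M.obj L) (n : N.obj K),
      f (sym hK (M.tr hL m) n) = f (sym (hL.trans hK) m (N.res hL n)))
    (h4 : ∀ (L K : Subgroup G) (hL : L ≤ K) (hK : K ≤ H) (m : M.obj K) (n : N.obj L),
      f (sym hK m (N.tr hL n)) = f (sym (hL.trans hK) (M.res hL m) n)) :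
    ∀ x ∈ boxSub M N H, f x = 0 := by
  intro x hx
  refine (AddSubgroup.closure_le (K := AddMonoidHom.ker f)).2 ?_ hx
  rintro _ (⟨hK, m, m', n⟩ | ⟨hK, m, n, n'⟩ | ⟨hL, hK, m, n⟩ | ⟨hL, hK, m, n⟩) <;>
    rw [SetLike.mem_coe, AddMonoidHom.mem_ker, map_sub, sub_eq_zero]
  · rw [map_add, h1]
  · rw [map_add, h2]
  · exact h3 _ _ _ _ _ _
  · exact h4 _ _ _ _ _ _

namespace Pairing

variable {M N P : MackeyFunctor G}

theorem app_conj_tr (p : Pairing M N P) {g : G} {H H' : Subgroup G} (h : H' = MulAut.conj g • H)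
    (d : (boxSystem M N).obj H) :
    p.app H' ((boxSystem M N).conj g h d).1 ((boxSystem M N).conj g h d).2 =
      P.conj g h (p.app H d.1 d.2) := (p.conj h d.1 d.2).symm

/-- The map sending `tr (m ⊗ n)` to `tr (p(m, n))`. -/
noncomputable def symApp (p : Pairing M N P) (H : Subgroup G) :
    (boxSystem M N).FreeObj H →+ P.obj H :=
  freeHomApp (D := boxSystem M N) (fun K d => p.app K d.1 d.2) p.app_conj_tr H

theorem symApp_sym (p : Pairing M N P) {K H : Subgroup G} (hK : K ≤ H) (m : M.obj K)
    (n : N.obj K) : p.symApp H (sym hK m n) = P.tr hK (p.app K m n) :=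
  freeHomApp_gen (D := boxSystem M N) (fun K d => p.app K d.1 d.2) p.app_conj_tr hK (m, n)

theorem symApp_zero (p : Pairing M N P) (H : Subgroup G) (x) (hx : x ∈ boxSub M N H) :
    p.symApp H x = 0 := by
  refine boxSub_le (p.symApp H) ?_ ?_ ?_ ?_ x hx
  · intro K hK m m' n
    rw [symApp_sym, symApp_sym, symApp_sym, map_add, AddMonoidHom.add_apply, map_add]
  · intro K hK m n n'
    rw [symApp_sym, symApp_sym, symApp_sym, map_add, map_add]
  · intro L K hL hK m n
    rw [symApp_sym, symApp_sym, p.tr_left, P.tr_tr hL hK]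
  · intro L K hL hK m n
    rw [symApp_sym, symApp_sym, p.tr_right, P.tr_tr hL hK]

/-- The morphism out of the box product that is given by a pairing. -/
noncomputable def lift (p : Pairing M N P) : box M N ⟶ P :=
  quotLift boxSub_stable (freeHom (D := boxSystem M N) (fun K d => p.app K d.1 d.2)
    (fun h d => (p.res h d.1 d.2).symm) p.app_conj_tr) p.symApp_zero

theorem lift_bx (p : Pairing M N P) {H : Subgroup G} (m : M.obj H) (n : N.obj H) :
    Hom.app p.lift H (bx m n) = p.app H m n :=
  (show _ = p.symApp H (sym le_rfl m n) from rfl).trans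
    ((p.symApp_sym le_rfl m n).trans (P.tr_self _ _))

section OfFree

variable {D : ResSystem G} (φ : ∀ K, D.obj K → N.obj K →+ P.obj K)

/-- The bilinear maps of the pairing `ofFree`. -/
def ofFreeApp
    (hconj : ∀ {g : G} {H H' : Subgroup G} (h : H' = MulAut.conj g • H) (d : D.obj H) n,
      P.conj g h (φ H d n) = φ H' (D.conj g h d) (N.conj g h n)) (H : Subgroup G) :
    D.FreeObj H →+ N.obj H →+ P.obj H :=
  ResSystem.lift (fun K hK d => (P.tr hK).comp ((φ K d).comp (N.res hK))) (by
    intro K K' hK hK' h hh e d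
    ext n
    have h1 := N.conj_res hK hK' e (conj_eq_self hh) n
    rw [N.conj_self hh] at h1
    simp only [AddMonoidHom.comp_apply]
    rw [← h1, ← hconj, ← P.conj_tr hK hK' e (conj_eq_self hh), P.conj_self hh])

theorem ofFreeApp_gen (hconj) {K H : Subgroup G} (hK : K ≤ H) (d : D.obj K) (n : N.obj H) :
    ofFreeApp φ hconj H (gen hK d) n = P.tr hK (φ K d (N.res hK n)) :=
  DFunLike.congr_fun (ResSystem.lift_mk (D := D) _ _ hK d) n

theorem ofFree_aux
    (hconj : ∀ {g : G} {H H' : Subgroup G} (h : H' = MulAut.conj g • H) (d : D.obj H) n,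
      P.conj g h (φ H d n) = φ H' (D.conj g h d) (N.conj g h n))
    {H K L T T' S S' : Subgroup G} {x y : G} (hx : x ∈ H) (hy : y = x⁻¹)
    (hL : L ≤ H) (hK : K ≤ H)
    (hT : T ≤ L) (hT' : T' ≤ K) (hS : S ≤ L) (hS' : S' ≤ K) (eS : S = T) (eS' : S' = T')
    (e : T = MulAut.conj x • T') (e' : S' = MulAut.conj y • S) (d : D.obj L) (n : N.obj K) :
    P.tr (hT.trans hL) (φ T (D.res hT d) (N.conj x e (N.res hT' n))) =
      P.tr (hS'.trans hK) (φ S' (D.conj y e' (D.res hS d)) (N.res hS' n)) := by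
  subst eS eS' hy
  have : D.res hS d = D.conj x e (D.conj x⁻¹ e' (D.res hS d)) := by
    rw [D.conj_conj _ _ (by simp), conj_eq_of_eq _ (by simp) (mul_inv_cancel x),
      D.conj_self (one_mem _)]
  conv_lhs => rw [this]
  rw [← hconj, ← P.conj_tr (hS'.trans hK) _ e (conj_eq_self hx), P.conj_self hx]

theorem ofFreeApp_res
    (hres : ∀ {K H : Subgroup G} (h : K ≤ H) (d : D.obj H) n,
      P.res h (φ H d n) = φ K (D.res h d) (N.res h n))
    (hconj : ∀ {g : G} {H H' : Subgroup G} (h : H' = MulAut.conj g • H) (d : D.obj H) n,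
      P.conj g h (φ H d n) = φ H' (D.conj g h d) (N.conj g h n))
    {J H : Subgroup G} (h : J ≤ H) (m : D.FreeObj H) (n : N.obj H) :
    P.res h (ofFreeApp φ hconj H m n) = ofFreeApp φ hconj J (freeRes h m) (N.res h n) := by
  induction m using gen_induction with
  | h K hK d =>
    rw [ofFreeApp_gen, P.res_tr, freeRes_mk, map_sumOver, sumOver_apply]
    refine sumOver_congr fun x hx => ?_
    rw [term, ofFreeApp_gen, hres, hconj]
    congr 2
    have h1 := N.conj_res (inf_le_right.trans hK) (inf_le_left.trans h) (conj_inf J K x)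
      (conj_eq_self hx) n
    rw [N.conj_self hx] at h1
    rw [N.res_res _ _ (inf_le_right.trans hK), h1, N.res_res]
  | h0 => simp
  | hadd x y hx hy => simp only [map_add, AddMonoidHom.add_apply, hx, hy]
  | hneg x hx => simp only [map_neg, AddMonoidHom.neg_apply, hx]

theorem ofFreeApp_conj
    (hconj : ∀ {g : G} {H H' : Subgroup G} (h : H' = MulAut.conj g • H) (d : D.obj H) n,
      P.conj g h (φ H d n) = φ H' (D.conj g h d) (N.conj g h n))
    {g : G} {H H' : Subgroup G} (h : H' = MulAut.conj g • H) (m : D.FreeObj H) (n : N.obj H) :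
    P.conj g h (ofFreeApp φ hconj H m n) =
      ofFreeApp φ hconj H' (freeConj g h m) (N.conj g h n) := by
  induction m using gen_induction with
  | h K hK d =>
    rw [ofFreeApp_gen, freeConj_mk h hK (conj_mono hK h rfl) rfl, ofFreeApp_gen,
      P.conj_tr hK (conj_mono hK h rfl) rfl h, hconj, N.conj_res hK (conj_mono hK h rfl) rfl h]
  | h0 => simp
  | hadd x y hx hy => simp only [map_add, AddMonoidHom.add_apply, hx, hy]
  | hneg x hx => simp only [map_neg, AddMonoidHom.neg_apply, hx]

theorem ofFreeApp_tr_left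
    (hconj : ∀ {g : G} {H H' : Subgroup G} (h : H' = MulAut.conj g • H) (d : D.obj H) n,
      P.conj g h (φ H d n) = φ H' (D.conj g h d) (N.conj g h n))
    {K H : Subgroup G} (h : K ≤ H) (m : D.FreeObj K) (n : N.obj H) :
    ofFreeApp φ hconj H (freeTr h m) n = P.tr h (ofFreeApp φ hconj K m (N.res h n)) := by
  induction m using gen_induction with
  | h L hL d =>
    rw [freeTr_mk, ofFreeApp_gen, ofFreeApp_gen, P.tr_tr hL h (hL.trans h),
      N.res_res hL h (hL.trans h)]
  | h0 => simp
  | hadd x y hx hy => simp only [map_add, AddMonoidHom.add_apply, hx, hy]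
  | hneg x hx => simp only [map_neg, AddMonoidHom.neg_apply, hx]

theorem ofFreeApp_tr_right
    (hconj : ∀ {g : G} {H H' : Subgroup G} (h : H' = MulAut.conj g • H) (d : D.obj H) n,
      P.conj g h (φ H d n) = φ H' (D.conj g h d) (N.conj g h n))
    (htr : ∀ {K H : Subgroup G} (h : K ≤ H) (d : D.obj H) (n : N.obj K),
      φ H d (N.tr h n) = P.tr h (φ K (D.res h d) n))
    {K H : Subgroup G} (h : K ≤ H) (m : D.FreeObj H) (n : N.obj K) :
    ofFreeApp φ hconj H m (N.tr h n) = P.tr h (ofFreeApp φ hconj K (freeRes h m) n) := by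
  induction m using gen_induction with
  | h L hL d =>
    rw [ofFreeApp_gen, N.res_tr, map_sumOver, map_sumOver, freeRes_mk, map_sumOver,
      sumOver_apply, map_sumOver, sumOver_inv h hL]
    · refine sumOver_congr fun x hx => ?_
      rw [term, ofFreeApp_gen, P.tr_tr inf_le_left h (inf_le_left.trans h), htr,
        P.tr_tr inf_le_left hL (inf_le_left.trans hL)]
      exact ofFree_aux φ hconj hx rfl hL h inf_le_left inf_le_right inf_le_right inf_le_left
        (by rw [inv_inv, inf_comm]) (inf_comm _ _) (conj_inf L K x) (conj_inf K L x⁻¹) d n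
    · intro x hx a ha b hb
      rw [term_inv _ _ _ ha _ hb]
  | h0 => simp
  | hadd x y hx hy => simp only [map_add, AddMonoidHom.add_apply, hx, hy]
  | hneg x hx => simp only [map_neg, AddMonoidHom.neg_apply, hx]

/-- The pairing with a free Mackey functor as first variable. -/
noncomputable def ofFree
    (hres : ∀ {K H : Subgroup G} (h : K ≤ H) (d : D.obj H) n,
      P.res h (φ H d n) = φ K (D.res h d) (N.res h n))
    (hconj : ∀ {g : G} {H H' : Subgroup G} (h : H' = MulAut.conj g • H) (d : D.obj H) n,
      P.conj g h (φ H d n) = φ H' (D.conj g h d) (N.conj g h n))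
    (htr : ∀ {K H : Subgroup G} (h : K ≤ H) (d : D.obj H) (n : N.obj K),
      φ H d (N.tr h n) = P.tr h (φ K (D.res h d) n)) : Pairing D.free N P where
  app := ofFreeApp φ hconj
  res h m n := ofFreeApp_res φ hres hconj h m n
  conj h m n := ofFreeApp_conj φ hconj h m n
  tr_left h m n := ofFreeApp_tr_left φ hconj h m n
  tr_right h m n := ofFreeApp_tr_right φ hconj htr h m n

end OfFree

/-- The pairing with a quotient as first variable. -/
noncomputable def ofQuot (p : Pairing M N P) {S : ∀ H, AddSubgroup (M.obj H)} (hS : M.IsStable S)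
    (h : ∀ H, ∀ x ∈ S H, p.app H x = 0) : Pairing (M.quot hS) N P where
  app H := QuotientAddGroup.lift _ (p.app H) (h H)
  res h m n := by obtain ⟨m, rfl⟩ := M.quotMk_surj hS _ m; exact p.res h m n
  conj h m n := by obtain ⟨m, rfl⟩ := M.quotMk_surj hS _ m; exact p.conj h m n
  tr_left h m n := by obtain ⟨m, rfl⟩ := M.quotMk_surj hS _ m; exact p.tr_left h m n
  tr_right h m n := by obtain ⟨m, rfl⟩ := M.quotMk_surj hS _ m; exact p.tr_right h m n

end Pairing

/-- The functoriality of the box product. -/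
noncomputable def boxMap {M M' N N' : MackeyFunctor G} (f : M ⟶ M') (g : N ⟶ N') :
    box M N ⟶ box M' N' :=
  Pairing.lift
    { app := fun H => AddMonoidHom.mk' (fun m => AddMonoidHom.mk'
        (fun n => bx (Hom.app f H m) (Hom.app g H n))
        fun n n' => by rw [map_add, bx_add_right]) fun m m' =>
          AddMonoidHom.ext fun n => by
            simp only [AddMonoidHom.mk'_apply, AddMonoidHom.add_apply, map_add, bx_add_left]
      res := fun h m n => by
        simp only [AddMonoidHom.mk'_apply, res_bx, f.app_res, g.app_res]
      conj := fun h m n => by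
        simp only [AddMonoidHom.mk'_apply, conj_bx, f.app_conj, g.app_conj]
      tr_left := fun h m n => by
        simp only [AddMonoidHom.mk'_apply, bx_tr_left, f.app_tr, g.app_res]
      tr_right := fun h m n => by
        simp only [AddMonoidHom.mk'_apply, bx_tr_right, f.app_res, g.app_tr] }

@[simp] theorem boxMap_bx {M M' N N' : MackeyFunctor G} (f : M ⟶ M') (g : N ⟶ N')
    {H : Subgroup G} (m : M.obj H) (n : N.obj H) :
    Hom.app (boxMap f g) H (bx m n) = bx (Hom.app f H m) (Hom.app g H n) :=
  Pairing.lift_bx _ _ _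

/-- The symmetry of the box product. -/
noncomputable def boxSwap (M N : MackeyFunctor G) : box M N ⟶ box N M :=
  Pairing.lift
    { app := fun H => (bxHom N M H).flip
      res := fun h m n => res_bx h n m
      conj := fun h m n => conj_bx h n m
      tr_left := fun h m n => bx_tr_right h n m
      tr_right := fun h m n => bx_tr_left h n m }

@[simp] theorem boxSwap_bx {M N : MackeyFunctor G} {H : Subgroup G} (m : M.obj H) (n : N.obj H) :
    Hom.app (boxSwap M N) H (bx m n) = bx n m := Pairing.lift_bx _ _ _

/-- The system with one point everywhere. -/
def point (G : Type u) [Group G] : ResSystem G where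
  obj _ := PUnit
  res _ x := x
  conj _ _ _ _ x := x
  res_self _ _ := rfl
  conj_self _ _ _ := rfl
  res_res _ _ _ _ := rfl
  conj_conj _ _ _ _ := rfl
  conj_res _ _ _ _ _ := rfl

theorem boxSwap_boxSwap (M N : MackeyFunctor G) : boxSwap M N ≫ boxSwap N M = 𝟙 (box M N) :=
  box_hom_ext (by simp)

/-- The Burnside Mackey functor: `Ω(H)` is free abelian on the `H`-conjugacy classes of subgroups
`K ≤ H`, where `K` stands for the `H`-set `H/K`. -/
noncomputable def burnside (G : Type u) [Group G] [Finite G] : MackeyFunctor G := (point G).free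

/-- The class of `H/H` in `Ω(H)`. -/
def one (H : Subgroup G) : (burnside G).obj H := gen (D := point G) le_rfl ⟨⟩

theorem res_one {K H : Subgroup G} (h : K ≤ H) : (burnside G).res h (one H) = one K :=
  freeRes_gen_self (D := point G) h ⟨⟩

theorem conj_one {g : G} {H H' : Subgroup G} (h : H' = MulAut.conj g • H) :
    (burnside G).conj g h (one H) = one H' :=
  freeConj_mk (D := point G) h le_rfl le_rfl h ⟨⟩

theorem tr_one {K H : Subgroup G} (h : K ≤ H) :
    (burnside G).tr h (one K) = gen (D := point G) h ⟨⟩ :=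
  freeTr_mk (D := point G) h le_rfl ⟨⟩

theorem burnside_induction {H : Subgroup G} {p : (burnside G).obj H → Prop}
    (z : (burnside G).obj H) (h : ∀ (K : Subgroup G) (hK : K ≤ H), p ((burnside G).tr hK (one K)))
    (h0 : p 0) (hadd : ∀ x y, p x → p y → p (x + y)) (hneg : ∀ x, p x → p (-x)) : p z := by
  refine gen_induction (D := point G) z (fun K hK d => ?_) h0 hadd hneg
  have := h K hK
  rwa [tr_one] at this

/-- The action of the Burnside Mackey functor. -/
noncomputable def unitPairing (M : MackeyFunctor G) : Pairing (burnside G) M M :=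
  Pairing.ofFree (D := point G) (fun _ _ => AddMonoidHom.id _) (fun _ _ _ => rfl)
    (fun _ _ _ => rfl) (fun _ _ _ => rfl)

theorem unitPairing_one (M : MackeyFunctor G) {H : Subgroup G} (m : M.obj H) :
    (unitPairing M).app H (one H) m = m :=
  (Pairing.ofFreeApp_gen (D := point G) (fun _ _ => AddMonoidHom.id _) (fun _ _ _ => rfl)
    le_rfl ⟨⟩ m).trans ((M.tr_self _ _).trans (M.res_self _ _))

section Assoc

variable (M N P : MackeyFunctor G)

/-- The trilinear map `m, n, p ↦ m ⊗ (n ⊗ p)`. -/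
noncomputable def triple (K : Subgroup G) (d : (boxSystem M N).obj K) :
    P.obj K →+ (box M (box N P)).obj K :=
  (bxHom M (box N P) K d.1).comp (bxHom N P K d.2)

theorem triple_apply {K : Subgroup G} (d : (boxSystem M N).obj K) (p : P.obj K) :
    triple M N P K d p = bx d.1 (bx d.2 p) := rfl

theorem triple_res {K H : Subgroup G} (h : K ≤ H) (d : (boxSystem M N).obj H) (n : P.obj H) :
    (box M (box N P)).res h (triple M N P H d n) =
      triple M N P K ((boxSystem M N).res h d) (P.res h n) := by
  rw [triple_apply, triple_apply, res_bx, res_bx]; rfl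

theorem triple_conj {g : G} {H H' : Subgroup G} (h : H' = MulAut.conj g • H)
    (d : (boxSystem M N).obj H) (n : P.obj H) :
    (box M (box N P)).conj g h (triple M N P H d n) =
      triple M N P H' ((boxSystem M N).conj g h d) (P.conj g h n) := by
  rw [triple_apply, triple_apply, conj_bx, conj_bx]; rfl

theorem triple_tr {K H : Subgroup G} (h : K ≤ H) (d : (boxSystem M N).obj H) (n : P.obj K) :
    triple M N P H d (P.tr h n) =
      (box M (box N P)).tr h (triple M N P K ((boxSystem M N).res h d) n) := by
  rw [triple_apply, triple_apply, bx_tr_right, bx_tr_right]; rfl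

/-- The map sending `tr (m ⊗ n), p` to `tr (m ⊗ (n ⊗ res p))`. -/
noncomputable def tripleApp (H : Subgroup G) :
    (boxSystem M N).FreeObj H →+ P.obj H →+ (box M (box N P)).obj H :=
  Pairing.ofFreeApp (triple M N P) (triple_conj M N P) H

theorem tripleApp_sym {K H : Subgroup G} (hK : K ≤ H) (m : M.obj K) (n : N.obj K) (p : P.obj H) :
    tripleApp M N P H (sym hK m n) p = (box M (box N P)).tr hK (bx m (bx n (P.res hK p))) :=
  Pairing.ofFreeApp_gen (triple M N P) (triple_conj M N P) hK (m, n) p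

theorem tripleApp_zero (H : Subgroup G) (x) (hx : x ∈ boxSub M N H) : tripleApp M N P H x = 0 := by
  refine boxSub_le (tripleApp M N P H) ?_ ?_ ?_ ?_ x hx
  · intro K hK m m' n
    ext p
    rw [AddMonoidHom.add_apply, tripleApp_sym, tripleApp_sym, tripleApp_sym, bx_add_left, map_add]
  · intro K hK m m' n
    ext p
    rw [AddMonoidHom.add_apply, tripleApp_sym, tripleApp_sym, tripleApp_sym, bx_add_left,
      bx_add_right, map_add]
  · intro L K hL hK m n
    ext p
    rw [tripleApp_sym, tripleApp_sym, bx_tr_left, res_bx, P.res_res hL hK (hL.trans hK),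
      MackeyFunctor.tr_tr _ hL hK (hL.trans hK)]
  · intro L K hL hK m n
    ext p
    rw [tripleApp_sym, tripleApp_sym, bx_tr_left, bx_tr_right, P.res_res hL hK (hL.trans hK),
      MackeyFunctor.tr_tr _ hL hK (hL.trans hK)]

/-- The pairing inducing the associativity of the box product. -/
noncomputable def assocPairing : Pairing (box M N) P (box M (box N P)) :=
  Pairing.ofQuot (Pairing.ofFree (triple M N P) (triple_res M N P) (triple_conj M N P)
    (triple_tr M N P)) boxSub_stable (tripleApp_zero M N P)

variable {M N P} in
theorem assocPairing_bx {H : Subgroup G} (m : M.obj H) (n : N.obj H) (p : P.obj H) :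
    (assocPairing M N P).app H (bx m n) p = bx m (bx n p) := by
  refine (show _ = tripleApp M N P H (sym le_rfl m n) p from rfl).trans ?_
  rw [tripleApp_sym, MackeyFunctor.tr_self, P.res_self]

end Assoc

/-- The map `Ω □ M → M`. -/
noncomputable def unitL (M : MackeyFunctor G) : box (burnside G) M ⟶ M := (unitPairing M).lift

theorem unitL_bx {M : MackeyFunctor G} {H : Subgroup G} (m : M.obj H) :
    Hom.app (unitL M) H (bx (one H) m) = m :=
  (Pairing.lift_bx _ _ _).trans (unitPairing_one M m)

/-- The inverse of `unitL`. -/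
noncomputable def unitLInv (M : MackeyFunctor G) : M ⟶ box (burnside G) M where
  app H := bxHom _ _ H (one H)
  app_tr h x := by rw [bxHom_apply, bxHom_apply, bx_tr_right, res_one]
  app_res h x := by rw [bxHom_apply, bxHom_apply, res_bx, res_one]
  app_conj h x := by rw [bxHom_apply, bxHom_apply, conj_bx, conj_one]

theorem unitLInv_app {M : MackeyFunctor G} {H : Subgroup G} (m : M.obj H) :
    Hom.app (unitLInv M) H m = bx (one H) m := rfl

variable {M N P Q R : MackeyFunctor G}

theorem bx_zero_left {H : Subgroup G} (n : N.obj H) : bx (0 : M.obj H) n = 0 := by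
  rw [← bxHom_apply, map_zero]; rfl

theorem bx_neg_left {H : Subgroup G} (m : M.obj H) (n : N.obj H) : bx (-m) n = - bx m n := by
  rw [← bxHom_apply, map_neg]; rfl

theorem bx_zero_right {H : Subgroup G} (m : M.obj H) : bx m (0 : N.obj H) = 0 := by
  rw [← bxHom_apply, map_zero]

theorem bx_neg_right {H : Subgroup G} (m : M.obj H) (n : N.obj H) : bx m (-n) = - bx m n := by
  rw [← bxHom_apply, map_neg]; rfl

theorem box_hom_ext_unit {f g : box (burnside G) M ⟶ P}
    (h : ∀ (H : Subgroup G) (m : M.obj H),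
      Hom.app f H (bx (one H) m) = Hom.app g H (bx (one H) m)) : f = g := by
  refine box_hom_ext fun H z m => ?_
  induction z using burnside_induction with
  | h K hK => rw [bx_tr_left, f.app_tr, g.app_tr, h]
  | h0 => rw [bx_zero_left, map_zero, map_zero]
  | hadd x y hx hy => rw [bx_add_left, map_add, map_add, hx, hy]
  | hneg x hx => rw [bx_neg_left, map_neg, map_neg, hx]

theorem box_hom_ext₃ {f g : box (box M N) P ⟶ Q}
    (h : ∀ (H : Subgroup G) (m : M.obj H) (n : N.obj H) (p : P.obj H),
      Hom.app f H (bx (bx m n) p) = Hom.app g H (bx (bx m n) p)) : f = g := by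
  refine box_hom_ext fun H z p => ?_
  induction z using box_induction with
  | h K hK m n => rw [bx_tr_left, f.app_tr, g.app_tr, h]
  | h0 => rw [bx_zero_left, map_zero, map_zero]
  | hadd x y hx hy => rw [bx_add_left, map_add, map_add, hx, hy]
  | hneg x hx => rw [bx_neg_left, map_neg, map_neg, hx]

theorem box_hom_ext₃' {f g : box M (box N P) ⟶ Q}
    (h : ∀ (H : Subgroup G) (m : M.obj H) (n : N.obj H) (p : P.obj H),
      Hom.app f H (bx m (bx n p)) = Hom.app g H (bx m (bx n p))) : f = g := by
  refine box_hom_ext fun H m z => ?_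
  induction z using box_induction with
  | h K hK n p => rw [bx_tr_right, f.app_tr, g.app_tr, h]
  | h0 => rw [bx_zero_right, map_zero, map_zero]
  | hadd x y hx hy => rw [bx_add_right, map_add, map_add, hx, hy]
  | hneg x hx => rw [bx_neg_right, map_neg, map_neg, hx]

theorem box_hom_ext₄ {f g : box (box (box M N) P) Q ⟶ R}
    (h : ∀ (H : Subgroup G) (m : M.obj H) (n : N.obj H) (p : P.obj H) (q : Q.obj H),
      Hom.app f H (bx (bx (bx m n) p) q) = Hom.app g H (bx (bx (bx m n) p) q)) : f = g := by
  refine box_hom_ext₃ fun H z p q => ?_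
  induction z using box_induction with
  | h K hK m n => rw [bx_tr_left, bx_tr_left, f.app_tr, g.app_tr, h]
  | h0 => rw [bx_zero_left, bx_zero_left, map_zero, map_zero]
  | hadd x y hx hy => rw [bx_add_left, bx_add_left, map_add, map_add, hx, hy]
  | hneg x hx => rw [bx_neg_left, bx_neg_left, map_neg, map_neg, hx]

/-- The map `(m ⊗ n) ⊗ p ↦ m ⊗ (n ⊗ p)`. -/
noncomputable def boxAssoc (M N P : MackeyFunctor G) : box (box M N) P ⟶ box M (box N P) :=
  (assocPairing M N P).lift

@[simp] theorem boxAssoc_bx {H : Subgroup G} (m : M.obj H) (n : N.obj H) (p : P.obj H) :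
    Hom.app (boxAssoc M N P) H (bx (bx m n) p) = bx m (bx n p) :=
  (Pairing.lift_bx _ _ _).trans (assocPairing_bx m n p)

/-- The map `m ⊗ (n ⊗ p) ↦ (m ⊗ n) ⊗ p`. -/
noncomputable def boxAssocInv (M N P : MackeyFunctor G) : box M (box N P) ⟶ box (box M N) P :=
  boxSwap _ _ ≫ boxAssoc _ _ _ ≫ boxSwap _ _ ≫ boxAssoc _ _ _ ≫ boxSwap _ _

@[simp] theorem boxAssocInv_bx {H : Subgroup G} (m : M.obj H) (n : N.obj H) (p : P.obj H) :
    Hom.app (boxAssocInv M N P) H (bx m (bx n p)) = bx (bx m n) p := by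
  simp [boxAssocInv]

@[simp] theorem unitL_bx' {H : Subgroup G} (m : M.obj H) :
    Hom.app (boxSwap M (burnside G) ≫ unitL M) H (bx m (one H)) = m := by
  simp [unitL_bx]

/-- The map `M □ Ω → M`. -/
noncomputable def unitR (M : MackeyFunctor G) : box M (burnside G) ⟶ M :=
  boxSwap M (burnside G) ≫ unitL M

theorem unitR_bx {H : Subgroup G} (m : M.obj H) :
    Hom.app (unitR M) H (bx m (one H)) = m := by
  simp [unitR, unitL_bx]

noncomputable instance : MonoidalCategoryStruct (MackeyFunctor G) where
  tensorObj := box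
  whiskerLeft M _ _ f := boxMap (𝟙 M) f
  whiskerRight f N := boxMap f (𝟙 N)
  tensorHom := boxMap
  tensorUnit := burnside G
  associator M N P := ⟨boxAssoc M N P, boxAssocInv M N P,
    box_hom_ext₃ (by simp), box_hom_ext₃' (by simp)⟩
  leftUnitor M := ⟨unitL M, unitLInv M,
    box_hom_ext_unit (by simp [unitL_bx, unitLInv_app]),
    hom_ext (by simp [unitL_bx, unitLInv_app])⟩
  rightUnitor M := ⟨unitR M, unitLInv M ≫ boxSwap (burnside G) M,
    by
      have h : Function.Injective fun f : box M (burnside G) ⟶ box M (burnside G) =>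
          boxSwap (burnside G) M ≫ f := fun f g hfg => by
        refine box_hom_ext fun H m z => ?_
        have := congrArg (fun φ => Hom.app φ H (bx z m)) hfg
        simpa using this
      exact h (box_hom_ext_unit (by simp [unitR_bx, unitLInv_app])),
    hom_ext (by simp [unitR_bx, unitLInv_app])⟩

/-- The box product makes `Mack_G(Ab)` a monoidal category with unit the Burnside Mackey functor. -/
noncomputable instance : MonoidalCategory (MackeyFunctor G) :=
  MonoidalCategory.ofTensorHom
    (id_tensorHom_id := fun M N => box_hom_ext fun H m n => boxMap_bx _ _ m n)
    (id_tensorHom := fun _ _ _ _ => rfl)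
    (tensorHom_id := fun _ _ => rfl)
    (tensorHom_comp_tensorHom := fun f f' g g' => box_hom_ext fun H m n => by
      change Hom.app (boxMap f f' ≫ boxMap g g') H _ = Hom.app (boxMap (f ≫ g) (f' ≫ g')) H _
      simp)
    (associator_naturality := fun f g h => box_hom_ext₃ fun H m n p => by
      change Hom.app (boxMap (boxMap f g) h ≫ boxAssoc _ _ _) H _ =
        Hom.app (boxAssoc _ _ _ ≫ boxMap f (boxMap g h)) H _
      simp)
    (leftUnitor_naturality := fun {M N} f => box_hom_ext_unit fun H m => by
      change Hom.app (boxMap (𝟙 (burnside G)) f ≫ unitL N) H _ = Hom.app (unitL M ≫ f) H _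
      simp [unitL_bx])
    (rightUnitor_naturality := fun {M N} f => by
      change boxMap f (𝟙 (burnside G)) ≫ boxSwap _ _ ≫ unitL N = (boxSwap _ _ ≫ unitL M) ≫ f
      have e : boxSwap M (burnside G) ≫ boxMap (𝟙 (burnside G)) f =
        boxMap f (𝟙 (burnside G)) ≫ boxSwap _ _ := box_hom_ext (by simp)
      have e' : boxMap (𝟙 (burnside G)) f ≫ unitL N = unitL M ≫ f :=
        box_hom_ext_unit (by simp [unitL_bx])
      rw [Category.assoc, ← e', ← Category.assoc, ← e, Category.assoc])
    (pentagon := fun M N P Q => box_hom_ext₄ fun H m n p q => by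
      change Hom.app (boxMap (boxAssoc M N P) (𝟙 Q) ≫ boxAssoc M (box N P) Q ≫
        boxMap (𝟙 M) (boxAssoc N P Q)) H _ =
        Hom.app (boxAssoc (box M N) P Q ≫ boxAssoc M N (box P Q)) H _
      simp)
    (triangle := fun M N => by
      change boxAssoc M (burnside G) N ≫ boxMap (𝟙 M) (unitL N) = boxMap (unitR M) (𝟙 N)
      refine box_hom_ext₃ fun H m z n => ?_
      have h1 : ∀ (K : Subgroup G) (m : M.obj K) (n : N.obj K),
          Hom.app (boxAssoc M (burnside G) N ≫ boxMap (𝟙 M) (unitL N)) K (bx (bx m (one K)) n) =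
            Hom.app (boxMap (unitR M) (𝟙 N)) K (bx (bx m (one K)) n) := by
        intro K m n
        simp [unitL_bx, unitR_bx]
      generalize boxAssoc M (burnside G) N ≫ boxMap (𝟙 M) (unitL N) = f at h1 ⊢
      generalize boxMap (unitR M) (𝟙 N) = g at h1 ⊢
      induction z using burnside_induction with
      | h K hK => rw [bx_tr_right, bx_tr_left, f.app_tr, g.app_tr, h1]
      | h0 => rw [bx_zero_right, bx_zero_left, map_zero, map_zero]
      | hadd x y hx hy => rw [bx_add_right, bx_add_left, map_add, map_add, hx, hy]
      | hneg x hx => rw [bx_neg_right, bx_neg_left, map_neg, map_neg, hx])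

noncomputable instance : SymmetricCategory (MackeyFunctor G) where
  braiding M N := ⟨boxSwap M N, boxSwap N M, boxSwap_boxSwap M N, boxSwap_boxSwap N M⟩
  braiding_naturality_right M _ _ f := box_hom_ext fun H m n => by
    change Hom.app (boxMap (𝟙 M) f ≫ boxSwap _ _) H _ = Hom.app (boxSwap _ _ ≫ boxMap f (𝟙 M)) H _
    simp
  braiding_naturality_left f N := box_hom_ext fun H m n => by
    change Hom.app (boxMap f (𝟙 N) ≫ boxSwap _ _) H _ = Hom.app (boxSwap _ _ ≫ boxMap (𝟙 N) f) H _
    simp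
  hexagon_forward M N P := box_hom_ext₃ fun H m n p => by
    change Hom.app (boxAssoc M N P ≫ boxSwap M (box N P) ≫ boxAssoc N P M) H _ =
      Hom.app (boxMap (boxSwap M N) (𝟙 P) ≫ boxAssoc N M P ≫ boxMap (𝟙 N) (boxSwap M P)) H _
    simp
  hexagon_reverse M N P := box_hom_ext₃' fun H m n p => by
    change Hom.app (boxAssocInv M N P ≫ boxSwap (box M N) P ≫ boxAssocInv P M N) H _ =
      Hom.app (boxMap (𝟙 M) (boxSwap N P) ≫ boxAssocInv M P N ≫ boxMap (boxSwap M P) (𝟙 N)) H _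
    simp
  symmetry := boxSwap_boxSwap

end MackeyFunctor

end Monoidal

/-! ### The category of pairs of a commutative ring and a module -/

section ModCat

/-- An object `(R; M)` of `Mod`: a commutative ring `R` and an `R`-module `M`. -/
structure ModCat where
  R : Type u
  M : Type u
  [ring : CommRing R]
  [grp : AddCommGroup M]
  [mod : Module R M]

attribute [instance] ModCat.ring ModCat.grp ModCat.mod

namespace ModCat

/-- A morphism `(R; M) → (R'; M')`: a ring homomorphism `R → R'` and an additive map `M → M'` that
is linear over it. -/
@[ext]
structure Hom (X Y : ModCat.{u}) where
  ring : X.R →+* Y.R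
  map : X.M →+ Y.M
  map_smul : ∀ (r : X.R) (m : X.M), map (r • m) = ring r • map m

instance : Category ModCat.{u} where
  Hom := Hom
  id X := ⟨RingHom.id _, AddMonoidHom.id _, fun _ _ => rfl⟩
  comp f g := ⟨g.ring.comp f.ring, g.map.comp f.map, fun r m => by
    simp [f.map_smul, g.map_smul]⟩

@[simp] theorem id_ring (X : ModCat.{u}) (r : X.R) : Hom.ring (𝟙 X) r = r := rfl

@[simp] theorem id_map (X : ModCat.{u}) (m : X.M) : Hom.map (𝟙 X) m = m := rfl

@[simp] theorem comp_ring {X Y Z : ModCat.{u}} (f : X ⟶ Y) (g : Y ⟶ Z) (r : X.R) :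
    Hom.ring (f ≫ g) r = Hom.ring g (Hom.ring f r) := rfl

@[simp] theorem comp_map {X Y Z : ModCat.{u}} (f : X ⟶ Y) (g : Y ⟶ Z) (m : X.M) :
    Hom.map (f ≫ g) m = Hom.map g (Hom.map f m) := rfl

theorem hom_ext {X Y : ModCat.{u}} {f g : X ⟶ Y} (h : ∀ r, Hom.ring f r = Hom.ring g r)
    (h' : ∀ m, Hom.map f m = Hom.map g m) : f = g :=
  Hom.ext (RingHom.ext h) (AddMonoidHom.ext h')

section Tensor

variable {A B C D E : Type*} [AddCommGroup A] [AddCommGroup B] [AddCommGroup C] [AddCommGroup D]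
  [AddCommGroup E]

theorem tmul_ext {f g : A ⊗[ℤ] B →+ E} (h : ∀ a b, f (a ⊗ₜ b) = g (a ⊗ₜ b)) (x : A ⊗[ℤ] B) :
    f x = g x := by
  induction x using TensorProduct.induction_on with
  | zero => rw [map_zero, map_zero]
  | tmul a b => exact h a b
  | add x y hx hy => rw [map_add, map_add, hx, hy]

theorem tmul_ext₃ {f g : (A ⊗[ℤ] B) ⊗[ℤ] C →+ E}
    (h : ∀ a b c, f ((a ⊗ₜ b) ⊗ₜ c) = g ((a ⊗ₜ b) ⊗ₜ c)) (x : (A ⊗[ℤ] B) ⊗[ℤ] C) : f x = g x := by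
  refine tmul_ext (fun y c => ?_) x
  induction y using TensorProduct.induction_on with
  | zero => rw [TensorProduct.zero_tmul, map_zero, map_zero]
  | tmul a b => exact h a b c
  | add x y hx hy => rw [TensorProduct.add_tmul, map_add, map_add, hx, hy]

theorem tmul_ext₃' {f g : A ⊗[ℤ] (B ⊗[ℤ] C) →+ E}
    (h : ∀ a b c, f (a ⊗ₜ (b ⊗ₜ c)) = g (a ⊗ₜ (b ⊗ₜ c))) (x : A ⊗[ℤ] (B ⊗[ℤ] C)) : f x = g x := by
  refine tmul_ext (fun a y => ?_) x
  induction y using TensorProduct.induction_on with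
  | zero => rw [TensorProduct.tmul_zero, map_zero, map_zero]
  | tmul b c => exact h a b c
  | add x y hx hy => rw [TensorProduct.tmul_add, map_add, map_add, hx, hy]

theorem tmul_ext₄ {f g : ((A ⊗[ℤ] B) ⊗[ℤ] C) ⊗[ℤ] D →+ E}
    (h : ∀ a b c d, f (((a ⊗ₜ b) ⊗ₜ c) ⊗ₜ d) = g (((a ⊗ₜ b) ⊗ₜ c) ⊗ₜ d))
    (x : ((A ⊗[ℤ] B) ⊗[ℤ] C) ⊗[ℤ] D) : f x = g x := by
  refine tmul_ext₃ (fun y c d => ?_) x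
  induction y using TensorProduct.induction_on with
  | zero => rw [TensorProduct.zero_tmul, TensorProduct.zero_tmul, map_zero, map_zero]
  | tmul a b => exact h a b c d
  | add x y hx hy =>
    rw [TensorProduct.add_tmul, TensorProduct.add_tmul, map_add, map_add, hx, hy]

/-- The map `f ⊗ g`. -/
noncomputable def tmap (f : A →+ C) (g : B →+ D) : A ⊗[ℤ] B →+ C ⊗[ℤ] D :=
  (TensorProduct.map f.toIntLinearMap g.toIntLinearMap).toAddMonoidHom

@[simp] theorem tmap_tmul (f : A →+ C) (g : B →+ D) (a : A) (b : B) :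
    tmap f g (a ⊗ₜ b) = f a ⊗ₜ g b := rfl

end Tensor

/-- The action of `R ⊗ R'` on `M ⊗ M'`. -/
noncomputable def tensorAction (X Y : ModCat.{u}) :
    X.R ⊗[ℤ] Y.R →+* Module.End ℤ (X.M ⊗[ℤ] Y.M) :=
  ((Module.endTensorEndAlgHom (R := ℤ) (A := ℤ) (M := X.M) (N := Y.M)).comp
    (Algebra.TensorProduct.map (Module.toModuleEnd ℤ (S := X.R) X.M).toIntAlgHom
      (Module.toModuleEnd ℤ (S := Y.R) Y.M).toIntAlgHom)).toRingHom

/-- The tensor product `(R; M) ⊗ (R'; M') = (R ⊗ R'; M ⊗ M')` over the integers. -/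
noncomputable def tensor (X Y : ModCat.{u}) : ModCat.{u} where
  R := X.R ⊗[ℤ] Y.R
  M := X.M ⊗[ℤ] Y.M
  mod := Module.compHom _ (tensorAction X Y)

/-- The element `r ⊗ r'`. -/
def rt {X Y : ModCat.{u}} (r : X.R) (s : Y.R) : (tensor X Y).R := r ⊗ₜ[ℤ] s

/-- The element `m ⊗ m'`. -/
def mt {X Y : ModCat.{u}} (m : X.M) (n : Y.M) : (tensor X Y).M := m ⊗ₜ[ℤ] n

theorem rt_smul_mt {X Y : ModCat.{u}} (r : X.R) (s : Y.R) (m : X.M) (n : Y.M) :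
    (rt r s : (tensor X Y).R) • (mt m n : (tensor X Y).M) = mt (r • m) (s • n) := rfl

section Ext

variable {X Y Z W V : ModCat.{u}} {E : Type*} [AddCommGroup E]

theorem rt_ext {f g : (tensor X Y).R →+ E} (h : ∀ r s, f (rt r s) = g (rt r s))
    (x : (tensor X Y).R) : f x = g x := tmul_ext (f := f) (g := g) h x

theorem mt_ext {f g : (tensor X Y).M →+ E} (h : ∀ m n, f (mt m n) = g (mt m n))
    (x : (tensor X Y).M) : f x = g x := tmul_ext (f := f) (g := g) h x

/-- A morphism out of a tensor product. -/
def mkHom (α : (tensor X Y).R →+* V.R) (φ : (tensor X Y).M →+ V.M)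
    (h : ∀ r s m n, φ ((rt r s : (tensor X Y).R) •
      (mt m n : (tensor X Y).M)) = α (rt r s) • φ (mt m n)) :
    tensor X Y ⟶ V where
  ring := α
  map := φ
  map_smul r m := by
    have h1 : ∀ r s, φ ((rt r s : (tensor X Y).R) • m) = α (rt r s) • φ m :=
      fun r s => mt_ext
        (f := φ.comp (DistribSMul.toAddMonoidHom _ (rt r s : (tensor X Y).R)))
        (g := (DistribSMul.toAddMonoidHom _ (α (rt r s))).comp φ) (h r s) m
    exact rt_ext (f := φ.comp ((smulAddHom (tensor X Y).R (tensor X Y).M).flip m))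
      (g := ((smulAddHom V.R V.M).flip (φ m)).comp α.toAddMonoidHom) h1 r

theorem tensor_ext {f g : tensor X Y ⟶ V}
    (h : ∀ r s, Hom.ring f (rt r s) = Hom.ring g (rt r s))
    (h' : ∀ m n, Hom.map f (mt m n) = Hom.map g (mt m n)) : f = g :=
  hom_ext (rt_ext (f := (Hom.ring f).toAddMonoidHom) (g := (Hom.ring g).toAddMonoidHom) h)
    (mt_ext (f := Hom.map f) (g := Hom.map g) h')

theorem rt_ext₃ {f g : (tensor (tensor X Y) Z).R →+ E} (h : ∀ r s t, f (rt (rt r s) t) = g (rt (rt r s) t))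
    (x : (tensor (tensor X Y) Z).R) : f x = g x := tmul_ext₃ (f := f) (g := g) h x

theorem mt_ext₃ {f g : (tensor (tensor X Y) Z).M →+ E} (h : ∀ m n p, f (mt (mt m n) p) = g (mt (mt m n) p))
    (x : (tensor (tensor X Y) Z).M) : f x = g x := tmul_ext₃ (f := f) (g := g) h x

/-- A morphism out of a tensor product. -/
def mkHom₃ (α : (tensor (tensor X Y) Z).R →+* V.R) (φ : (tensor (tensor X Y) Z).M →+ V.M)
    (h : ∀ r s t m n p, φ ((rt (rt r s) t : (tensor (tensor X Y) Z).R) •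
      (mt (mt m n) p : (tensor (tensor X Y) Z).M)) = α (rt (rt r s) t) • φ (mt (mt m n) p)) :
    tensor (tensor X Y) Z ⟶ V where
  ring := α
  map := φ
  map_smul r m := by
    have h1 : ∀ r s t, φ ((rt (rt r s) t : (tensor (tensor X Y) Z).R) • m) = α (rt (rt r s) t) • φ m :=
      fun r s t => mt_ext₃
        (f := φ.comp (DistribSMul.toAddMonoidHom _ (rt (rt r s) t : (tensor (tensor X Y) Z).R)))
        (g := (DistribSMul.toAddMonoidHom _ (α (rt (rt r s) t))).comp φ) (h r s t) m
    exact rt_ext₃ (f := φ.comp ((smulAddHom (tensor (tensor X Y) Z).R (tensor (tensor X Y) Z).M).flip m))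
      (g := ((smulAddHom V.R V.M).flip (φ m)).comp α.toAddMonoidHom) h1 r

theorem tensor_ext₃ {f g : tensor (tensor X Y) Z ⟶ V}
    (h : ∀ r s t, Hom.ring f (rt (rt r s) t) = Hom.ring g (rt (rt r s) t))
    (h' : ∀ m n p, Hom.map f (mt (mt m n) p) = Hom.map g (mt (mt m n) p)) : f = g :=
  hom_ext (rt_ext₃ (f := (Hom.ring f).toAddMonoidHom) (g := (Hom.ring g).toAddMonoidHom) h)
    (mt_ext₃ (f := Hom.map f) (g := Hom.map g) h')

theorem rt_ext₃' {f g : (tensor X (tensor Y Z)).R →+ E} (h : ∀ r s t, f (rt r (rt s t)) = g (rt r (rt s t)))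
    (x : (tensor X (tensor Y Z)).R) : f x = g x := tmul_ext₃' (f := f) (g := g) h x

theorem mt_ext₃' {f g : (tensor X (tensor Y Z)).M →+ E} (h : ∀ m n p, f (mt m (mt n p)) = g (mt m (mt n p)))
    (x : (tensor X (tensor Y Z)).M) : f x = g x := tmul_ext₃' (f := f) (g := g) h x

/-- A morphism out of a tensor product. -/
def mkHom₃' (α : (tensor X (tensor Y Z)).R →+* V.R) (φ : (tensor X (tensor Y Z)).M →+ V.M)
    (h : ∀ r s t m n p, φ ((rt r (rt s t) : (tensor X (tensor Y Z)).R) •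
      (mt m (mt n p) : (tensor X (tensor Y Z)).M)) = α (rt r (rt s t)) • φ (mt m (mt n p))) :
    tensor X (tensor Y Z) ⟶ V where
  ring := α
  map := φ
  map_smul r m := by
    have h1 : ∀ r s t, φ ((rt r (rt s t) : (tensor X (tensor Y Z)).R) • m) = α (rt r (rt s t)) • φ m :=
      fun r s t => mt_ext₃'
        (f := φ.comp (DistribSMul.toAddMonoidHom _ (rt r (rt s t) : (tensor X (tensor Y Z)).R)))
        (g := (DistribSMul.toAddMonoidHom _ (α (rt r (rt s t)))).comp φ) (h r s t) m
    exact rt_ext₃' (f := φ.comp ((smulAddHom (tensor X (tensor Y Z)).R (tensor X (tensor Y Z)).M).flip m))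
      (g := ((smulAddHom V.R V.M).flip (φ m)).comp α.toAddMonoidHom) h1 r

theorem tensor_ext₃' {f g : tensor X (tensor Y Z) ⟶ V}
    (h : ∀ r s t, Hom.ring f (rt r (rt s t)) = Hom.ring g (rt r (rt s t)))
    (h' : ∀ m n p, Hom.map f (mt m (mt n p)) = Hom.map g (mt m (mt n p))) : f = g :=
  hom_ext (rt_ext₃' (f := (Hom.ring f).toAddMonoidHom) (g := (Hom.ring g).toAddMonoidHom) h)
    (mt_ext₃' (f := Hom.map f) (g := Hom.map g) h')

theorem tensor_ext₄ {f g : tensor (tensor (tensor X Y) Z) W ⟶ V}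
    (h : ∀ r s t u, Hom.ring f (rt (rt (rt r s) t) u) = Hom.ring g (rt (rt (rt r s) t) u))
    (h' : ∀ m n p q, Hom.map f (mt (mt (mt m n) p) q) = Hom.map g (mt (mt (mt m n) p) q)) :
    f = g :=
  hom_ext (tmul_ext₄ (f := (Hom.ring f).toAddMonoidHom) (g := (Hom.ring g).toAddMonoidHom) h)
    (tmul_ext₄ (f := Hom.map f) (g := Hom.map g) h')

end Ext

/-- The tensor product of morphisms. -/
noncomputable def tensorMap {X X' Y Y' : ModCat.{u}} (f : X ⟶ X') (g : Y ⟶ Y') :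
    tensor X Y ⟶ tensor X' Y' :=
  mkHom (Algebra.TensorProduct.map (Hom.ring f).toIntAlgHom (Hom.ring g).toIntAlgHom).toRingHom
    (tmap (Hom.map f) (Hom.map g)) fun r s m n => by
    change mt (Hom.map f (r • m)) (Hom.map g (s • n)) =
      (rt (Hom.ring f r) (Hom.ring g s) : (tensor X' Y').R) •
        (mt (Hom.map f m) (Hom.map g n) : (tensor X' Y').M)
    rw [f.map_smul, g.map_smul, rt_smul_mt]

@[simp] theorem tensorMap_ring {X X' Y Y' : ModCat.{u}} (f : X ⟶ X') (g : Y ⟶ Y') (r : X.R)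
    (s : Y.R) : Hom.ring (tensorMap f g) (rt r s) = rt (Hom.ring f r) (Hom.ring g s) := rfl

@[simp] theorem tensorMap_map {X X' Y Y' : ModCat.{u}} (f : X ⟶ X') (g : Y ⟶ Y') (m : X.M)
    (n : Y.M) : Hom.map (tensorMap f g) (mt m n) = mt (Hom.map f m) (Hom.map g n) := rfl

/-- The symmetry. -/
noncomputable def swap (X Y : ModCat.{u}) : tensor X Y ⟶ tensor Y X :=
  mkHom ((Algebra.TensorProduct.comm ℤ X.R Y.R).toRingEquiv.toRingHom)
    ((TensorProduct.comm ℤ X.M Y.M).toLinearMap.toAddMonoidHom)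
    fun _ _ _ _ => rfl

@[simp] theorem swap_ring {X Y : ModCat.{u}} (r : X.R) (s : Y.R) :
    Hom.ring (swap X Y) (rt r s) = rt s r := rfl

@[simp] theorem swap_map {X Y : ModCat.{u}} (m : X.M) (n : Y.M) :
    Hom.map (swap X Y) (mt m n) = mt n m := rfl

/-- The associativity. -/
noncomputable def assoc (X Y Z : ModCat.{u}) : tensor (tensor X Y) Z ⟶ tensor X (tensor Y Z) :=
  mkHom₃ ((Algebra.TensorProduct.assoc ℤ ℤ ℤ X.R Y.R Z.R).toRingEquiv.toRingHom)
    ((TensorProduct.assoc ℤ X.M Y.M Z.M).toLinearMap.toAddMonoidHom)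
    fun _ _ _ _ _ _ => rfl

@[simp] theorem assoc_ring {X Y Z : ModCat.{u}} (r : X.R) (s : Y.R) (t : Z.R) :
    Hom.ring (assoc X Y Z) (rt (rt r s) t) = rt r (rt s t) := rfl

@[simp] theorem assoc_map {X Y Z : ModCat.{u}} (m : X.M) (n : Y.M) (p : Z.M) :
    Hom.map (assoc X Y Z) (mt (mt m n) p) = mt m (mt n p) := rfl

/-- The inverse of the associativity. -/
noncomputable def assocInv (X Y Z : ModCat.{u}) :
    tensor X (tensor Y Z) ⟶ tensor (tensor X Y) Z :=
  mkHom₃' ((Algebra.TensorProduct.assoc ℤ ℤ ℤ X.R Y.R Z.R).symm.toRingEquiv.toRingHom)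
    ((TensorProduct.assoc ℤ X.M Y.M Z.M).symm.toLinearMap.toAddMonoidHom)
    fun _ _ _ _ _ _ => rfl

@[simp] theorem assocInv_ring {X Y Z : ModCat.{u}} (r : X.R) (s : Y.R) (t : Z.R) :
    Hom.ring (assocInv X Y Z) (rt r (rt s t)) = rt (rt r s) t := rfl

@[simp] theorem assocInv_map {X Y Z : ModCat.{u}} (m : X.M) (n : Y.M) (p : Z.M) :
    Hom.map (assocInv X Y Z) (mt m (mt n p)) = mt (mt m n) p := rfl

/-- The object `(ℤ; A)` for an abelian group `A`. -/
def zmod (A : Type u) [AddCommGroup A] : ModCat.{u} where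
  R := ULift.{u} ℤ
  M := A

/-- The object `(R; R)`. -/
def self (R : Type u) [CommRing R] : ModCat.{u} where
  R := R
  M := R

/-- The object `(ℤ; ℤ)`. -/
def unit : ModCat.{u} := zmod (ULift.{u} ℤ)

/-- The element `1` of the module `ℤ`. -/
def u1 : (unit.{u}).M := ULift.up 1

/-- The unit isomorphism, `(k ⊗ r, l ⊗ m) ↦ (k r, l m)`. -/
noncomputable def unitL (X : ModCat.{u}) : tensor unit X ⟶ X :=
  mkHom (Algebra.TensorProduct.lift
      (((Int.castRingHom X.R).comp ULift.ringEquiv.toRingHom).toIntAlgHom :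
        (unit.{u}).R →ₐ[ℤ] X.R) (AlgHom.id ℤ X.R) (fun _ _ => Commute.all _ _)).toRingHom
    (TensorProduct.lift (((LinearMap.lsmul ℤ X.M).restrictScalars ℤ).comp
      ((AddEquiv.ulift (α := ℤ)).toAddMonoidHom.toIntLinearMap :
        (unit.{u}).M →ₗ[ℤ] ℤ))).toAddMonoidHom
    fun k r l m => by
      obtain ⟨k⟩ := k
      obtain ⟨l⟩ := l
      change (k * l : ℤ) • (r • m) = ((k : X.R) * r) • (l • m)
      rw [mul_smul, mul_smul, Int.cast_smul_eq_zsmul, smul_comm r l]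

theorem unitL_ring {X : ModCat.{u}} (r : X.R) : Hom.ring (unitL X) (rt 1 r) = r :=
  (show _ = ((1 : ℤ) : X.R) * r from rfl).trans (by simp)

theorem unitL_map {X : ModCat.{u}} (m : X.M) : Hom.map (unitL X) (mt u1 m) = m :=
  (show _ = (1 : ℤ) • m from rfl).trans (by simp)

theorem rt_unit {X : ModCat.{u}} (k : (unit.{u}).R) (r : X.R) :
    (rt k r : (tensor unit X).R) = rt 1 ((ULift.down (α := ℤ) k) • r) := by
  have : k = (ULift.down (α := ℤ) k) • (1 : (unit.{u}).R) := by
    refine ULift.ext _ _ ?_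
    change ULift.down (α := ℤ) k = ULift.down (α := ℤ) ((ULift.down (α := ℤ) k) • (1 : ULift.{u} ℤ))
    simp
  conv_lhs => rw [this]
  exact TensorProduct.smul_tmul _ _ _

theorem mt_unit {X : ModCat.{u}} (k : (unit.{u}).M) (m : X.M) :
    (mt k m : (tensor unit X).M) = mt u1 ((ULift.down (α := ℤ) k) • m) := by
  have : k = (ULift.down (α := ℤ) k) • u1 := by
    refine ULift.ext _ _ ?_
    change ULift.down (α := ℤ) k = ULift.down (α := ℤ) ((ULift.down (α := ℤ) k) • (1 : ULift.{u} ℤ))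
    simp
  conv_lhs => rw [this]
  exact TensorProduct.smul_tmul _ _ _

theorem tensor_ext_unit {X Y : ModCat.{u}} {f g : tensor unit X ⟶ Y}
    (h : ∀ r, Hom.ring f (rt 1 r) = Hom.ring g (rt 1 r))
    (h' : ∀ m, Hom.map f (mt u1 m) = Hom.map g (mt u1 m)) : f = g :=
  tensor_ext (fun k r => by rw [rt_unit, h]) (fun k m => by rw [mt_unit, h'])

/-- The inverse of the unit isomorphism. -/
noncomputable def unitLInv (X : ModCat.{u}) : X ⟶ tensor unit X where
  ring := (Algebra.TensorProduct.includeRight (R := ℤ) (A := (unit.{u}).R) (B := X.R)).toRingHom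
  map := (TensorProduct.mk ℤ (unit.{u}).M X.M u1).toAddMonoidHom
  map_smul r m := by
    change (mt u1 (r • m) : (tensor unit X).M) =
      (rt 1 r : (tensor unit X).R) • (mt u1 m : (tensor unit X).M)
    rw [rt_smul_mt, one_smul]

@[simp] theorem unitLInv_ring {X : ModCat.{u}} (r : X.R) : Hom.ring (unitLInv X) r = rt 1 r := rfl

@[simp] theorem unitLInv_map {X : ModCat.{u}} (m : X.M) :
    Hom.map (unitLInv X) m = mt u1 m := rfl

theorem swap_swap (X Y : ModCat.{u}) : swap X Y ≫ swap Y X = 𝟙 (tensor X Y) :=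
  tensor_ext (by simp) (by simp)

theorem unitL_inv (X : ModCat.{u}) : unitL X ≫ unitLInv X = 𝟙 (tensor unit X) :=
  tensor_ext_unit (by simp [unitL_ring]) (by simp [unitL_map])

theorem unitLInv_unitL (X : ModCat.{u}) : unitLInv X ≫ unitL X = 𝟙 X :=
  hom_ext (by simp [unitL_ring]) (by simp [unitL_map])

noncomputable instance : MonoidalCategoryStruct ModCat.{u} where
  tensorObj := tensor
  whiskerLeft M _ _ f := tensorMap (𝟙 M) f
  whiskerRight f N := tensorMap f (𝟙 N)
  tensorHom := tensorMap
  tensorUnit := unit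
  associator X Y Z := ⟨assoc X Y Z, assocInv X Y Z,
    tensor_ext₃ (by simp) (by simp), tensor_ext₃' (by simp) (by simp)⟩
  leftUnitor X := ⟨unitL X, unitLInv X, unitL_inv X, unitLInv_unitL X⟩
  rightUnitor X := ⟨swap X unit ≫ unitL X, unitLInv X ≫ swap unit X,
    by rw [Category.assoc, ← Category.assoc (unitL X), unitL_inv, Category.id_comp, swap_swap],
    by rw [Category.assoc, ← Category.assoc (swap _ _), swap_swap, Category.id_comp,
      unitLInv_unitL]⟩

/-- The monoidal category `Mod`, with unit `(ℤ; ℤ)`. -/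
noncomputable instance : MonoidalCategory ModCat.{u} :=
  MonoidalCategory.ofTensorHom
    (id_tensorHom_id := fun M N => tensor_ext (fun _ _ => rfl) (fun _ _ => rfl))
    (id_tensorHom := fun _ _ _ _ => rfl)
    (tensorHom_id := fun _ _ => rfl)
    (tensorHom_comp_tensorHom := fun f f' g g' => tensor_ext (fun _ _ => rfl) (fun _ _ => rfl))
    (associator_naturality := fun f g h => tensor_ext₃ (fun _ _ _ => rfl) (fun _ _ _ => rfl))
    (leftUnitor_naturality := fun {X Y} f => by
      change tensorMap (𝟙 unit) f ≫ unitL Y = unitL X ≫ f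
      exact tensor_ext_unit (by simp [unitL_ring]) (by simp [unitL_map]))
    (rightUnitor_naturality := fun {X Y} f => by
      change tensorMap f (𝟙 unit) ≫ swap _ _ ≫ unitL Y = (swap _ _ ≫ unitL X) ≫ f
      have e : tensorMap f (𝟙 unit) ≫ swap _ _ = swap X unit ≫ tensorMap (𝟙 unit) f :=
        tensor_ext (fun _ _ => rfl) (fun _ _ => rfl)
      have e' : tensorMap (𝟙 unit) f ≫ unitL Y = unitL X ≫ f :=
        tensor_ext_unit (by simp [unitL_ring]) (by simp [unitL_map])
      rw [Category.assoc, ← e', ← Category.assoc, e, Category.assoc])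
    (pentagon := fun X Y Z W => tensor_ext₄ (fun _ _ _ _ => rfl) (fun _ _ _ _ => rfl))
    (triangle := fun X Y => by
      change assoc X unit Y ≫ tensorMap (𝟙 X) (unitL Y) =
        tensorMap (swap X unit ≫ unitL X) (𝟙 Y)
      refine tensor_ext₃ (fun r k s => ?_) (fun m k n => ?_)
      · change r ⊗ₜ[ℤ] (((ULift.down (α := ℤ) k : ℤ) : Y.R) * s) =
          (((ULift.down (α := ℤ) k : ℤ) : X.R) * r) ⊗ₜ[ℤ] s
        rw [← zsmul_eq_mul, ← zsmul_eq_mul]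
        exact (TensorProduct.smul_tmul _ r s).symm
      · exact (TensorProduct.smul_tmul (ULift.down (α := ℤ) k) m n).symm)

noncomputable instance : SymmetricCategory ModCat.{u} where
  braiding X Y := ⟨swap X Y, swap Y X, swap_swap X Y, swap_swap Y X⟩
  braiding_naturality_right _ _ _ _ := tensor_ext (fun _ _ => rfl) (fun _ _ => rfl)
  braiding_naturality_left _ _ := tensor_ext (fun _ _ => rfl) (fun _ _ => rfl)
  hexagon_forward _ _ _ := tensor_ext₃ (fun _ _ _ => rfl) (fun _ _ _ => rfl)
  hexagon_reverse _ _ _ := tensor_ext₃' (fun _ _ _ => rfl) (fun _ _ _ => rfl)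
  symmetry := swap_swap

end ModCat

end ModCat

/-! ### Tensor powers -/

section TensorPowers

section Block

variable {R M : Type*} [CommRing R] [AddCommGroup M] [Module R M] [Module Rᵐᵒᵖ M]
  [IsCentralScalar R M] {A B C : Type*} [Fintype A] [Fintype B] [DecidableEq C]

/-- The multilinear map `⨂_A M × ⋯ × ⨂_A M → ⨂_C M` with one factor for each element of `B`, that
regroups tensors along a bijection `e : C ≃ A × B` (see `blockMul_tprod`, which characterises it).
It is built by multiplication in the algebra `⨂_C (R ⊕ M)`, where `R ⊕ M` is the square-zero
extension. -/
noncomputable def blockMul (e : C ≃ A × B) :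
    MultilinearMap R (fun _ : B => ⨂[R] _ : A, M) (⨂[R] _ : C, M) :=
  (PiTensorProduct.map fun _ : C => TrivSqZeroExt.sndHom R M).compMultilinearMap
    ((MultilinearMap.mkPiAlgebra R B (⨂[R] _ : C, TrivSqZeroExt R M)).compLinearMap fun b =>
      PiTensorProduct.lift
        ((MultilinearMap.mkPiAlgebra R A (⨂[R] _ : C, TrivSqZeroExt R M)).compLinearMap fun a =>
          (PiTensorProduct.singleAlgHom (R := R) (A := fun _ : C => TrivSqZeroExt R M)
            (e.symm (a, b))).toLinearMap ∘ₗ TrivSqZeroExt.inrHom R M))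

theorem blockMul_tprod (e : C ≃ A × B) (f : B → A → M) :
    blockMul e (fun b => PiTensorProduct.tprod R (f b)) =
      PiTensorProduct.tprod R fun c => f (e c).2 (e c).1 := by
  have key : (∏ b : B, ∏ a : A, PiTensorProduct.tprod R (Pi.mulSingle (e.symm (a, b))
      (TrivSqZeroExt.inr (R := R) (f b a)) : C → TrivSqZeroExt R M)) =
      PiTensorProduct.tprod R fun c => TrivSqZeroExt.inr (f (e c).2 (e c).1) := by
    simp_rw [← PiTensorProduct.tprod_prod]
    congr 1
    ext1 c
    rw [Finset.prod_apply, Finset.prod_eq_single (e c).2, Finset.prod_apply,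
      Finset.prod_eq_single (e c).1]
    · simp
    · intro a _ ha
      refine Pi.mulSingle_eq_of_ne (fun h => ha ?_) _
      rw [h]; simp
    · simp
    · intro b _ hb
      rw [Finset.prod_apply]
      refine Finset.prod_eq_one fun a _ => Pi.mulSingle_eq_of_ne (fun h => hb ?_) _
      rw [h]; simp
    · simp
  have := congrArg (PiTensorProduct.map fun _ : C => TrivSqZeroExt.sndHom R M) key
  rw [PiTensorProduct.map_tprod] at this
  refine Eq.trans ?_ this
  simp only [blockMul, LinearMap.compMultilinearMap_apply, MultilinearMap.compLinearMap_apply,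
    MultilinearMap.mkPiAlgebra_apply, PiTensorProduct.lift.tprod]
  rfl

end Block

namespace ModCat

/-- The right action, needed for the square-zero extension. -/
instance (X : ModCat.{u}) : Module X.Rᵐᵒᵖ X.M :=
  Module.compHom X.M ((RingHom.id X.R).fromOpposite fun _ _ => Commute.all _ _)

instance (X : ModCat.{u}) : IsCentralScalar X.R X.M := ⟨fun _ _ => rfl⟩

/-- The tensor power `M^{⊗_R ι}`. -/
abbrev TP (X : ModCat.{u}) (ι : Type u) : Type u := ⨂[X.R] _ : ι, X.M

/-- A pure tensor. -/
abbrev pure (X : ModCat.{u}) {ι : Type u} (m : ι → X.M) : X.TP ι := PiTensorProduct.tprod X.R m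

section

variable {X Y Z : ModCat.{u}} {ι κ A B C : Type u}

theorem pure_update_add [DecidableEq ι] (m : ι → X.M) (i : ι) (x y : X.M) :
    X.pure (Function.update m i (x + y)) =
      X.pure (Function.update m i x) + X.pure (Function.update m i y) :=
  MultilinearMap.map_update_add _ _ _ _ _

theorem pure_update_smul [DecidableEq ι] (m : ι → X.M) (i : ι) (r : X.R) (x : X.M) :
    X.pure (Function.update m i (r • x)) = r • X.pure (Function.update m i x) :=
  MultilinearMap.map_update_smul _ _ _ _ _

theorem span_pure [Nonempty ι] : Submodule.span ℤ (Set.range (X.pure (ι := ι))) = ⊤ := by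
  classical
  rw [eq_top_iff]
  intro x _
  induction x using PiTensorProduct.induction_on with
  | smul_tprod r f =>
    obtain ⟨i⟩ := ‹Nonempty ι›
    refine Submodule.subset_span ⟨Function.update f i (r • f i), ?_⟩
    rw [pure_update_smul, Function.update_eq_self]
  | add x y hx hy => exact Submodule.add_mem _ (hx trivial) (hy trivial)

theorem TP_ext [Nonempty ι] {E : Type*} [AddCommGroup E] {f g : X.TP ι →+ E}
    (h : ∀ m, f (X.pure m) = g (X.pure m)) (x : X.TP ι) : f x = g x := by
  have : f.toIntLinearMap = g.toIntLinearMap := by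
    refine LinearMap.ext_on_range span_pure h
  exact LinearMap.congr_fun this x

theorem TP_multi_ext [Nonempty A] [Finite B] {E : Type*} [AddCommGroup E]
    {f g : MultilinearMap ℤ (fun _ : B => X.TP A) E}
    (h : ∀ m : B → A → X.M, f (fun b => X.pure (m b)) = g (fun b => X.pure (m b))) : f = g :=
  MultilinearMap.ext_of_span_eq_top (g := fun _ : B => X.pure (ι := A)) (fun _ => span_pure) h

/-- The map `f^{⊗ ι}` induced by a morphism. -/
noncomputable def tpMap (f : X ⟶ Y) (ι : Type u) : X.TP ι →+ Y.TP ι :=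
  letI : Module X.R (Y.TP ι) := Module.compHom _ (Hom.ring f)
  (PiTensorProduct.lift
    { toFun := fun m => Y.pure fun i => Hom.map f (m i)
      map_update_add' := fun m i x y => by
        have h : ∀ z, (fun j => Hom.map f (Function.update m i z j)) =
            Function.update (fun j => Hom.map f (m j)) i (Hom.map f z) := fun z =>
          funext fun j => Function.apply_update (fun _ => Hom.map f) m i z j
        rw [h, h, h, map_add, pure_update_add]
      map_update_smul' := fun m i r x => by
        have h : ∀ z, (fun j => Hom.map f (Function.update m i z j)) =
            Function.update (fun j => Hom.map f (m j)) i (Hom.map f z) := fun z =>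
          funext fun j => Function.apply_update (fun _ => Hom.map f) m i z j
        rw [h, h, f.map_smul, pure_update_smul]
        rfl } : X.TP ι →ₗ[X.R] Y.TP ι).toAddMonoidHom

@[simp] theorem tpMap_pure (f : X ⟶ Y) (m : ι → X.M) :
    tpMap f ι (X.pure m) = Y.pure fun i => Hom.map f (m i) := by
  letI : Module X.R (Y.TP ι) := Module.compHom _ (Hom.ring f)
  exact PiTensorProduct.lift.tprod m

/-- Reindexing tensors along a bijection. -/
noncomputable def tpIdx (X : ModCat.{u}) (γ : ι ≃ κ) : X.TP ι →+ X.TP κ :=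
  (PiTensorProduct.reindex X.R (fun _ => X.M) γ).toLinearMap.toAddMonoidHom

@[simp] theorem tpIdx_pure (γ : ι ≃ κ) (m : ι → X.M) :
    X.tpIdx γ (X.pure m) = X.pure fun i => m (γ.symm i) :=
  PiTensorProduct.reindex_tprod γ m

theorem tpIdx_refl (x : X.TP ι) : X.tpIdx (Equiv.refl ι) x = x :=
  LinearEquiv.congr_fun (PiTensorProduct.reindex_refl (R := X.R) (s := fun _ : ι => X.M)) x

theorem tpIdx_tpIdx {μ : Type u} (γ : ι ≃ κ) (δ : κ ≃ μ) (x : X.TP ι) :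
    X.tpIdx δ (X.tpIdx γ x) = X.tpIdx (γ.trans δ) x :=
  PiTensorProduct.reindex_reindex γ δ x

theorem tpMap_id [Nonempty ι] (x : X.TP ι) : tpMap (𝟙 X) ι x = x :=
  TP_ext (g := AddMonoidHom.id _) (fun m => by simp) x

theorem tpMap_comp [Nonempty ι] (f : X ⟶ Y) (g : Y ⟶ Z) (x : X.TP ι) :
    tpMap (f ≫ g) ι x = tpMap g ι (tpMap f ι x) :=
  TP_ext (g := (tpMap g ι).comp (tpMap f ι)) (fun m => by simp) x

theorem tpMap_tpIdx [Nonempty ι] (f : X ⟶ Y) (γ : ι ≃ κ) (x : X.TP ι) :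
    tpMap f κ (X.tpIdx γ x) = Y.tpIdx γ (tpMap f ι x) :=
  TP_ext (f := (tpMap f κ).comp (X.tpIdx γ)) (g := (Y.tpIdx γ).comp (tpMap f ι))
    (fun m => by simp) x

/-- The ring homomorphism `r ↦ r ⊗ 1`. -/
noncomputable def inl (X Y : ModCat.{u}) : X.R →+* (tensor X Y).R :=
  (Algebra.TensorProduct.includeLeft (R := ℤ) (S := ℤ) (A := X.R) (B := Y.R)).toRingHom

/-- The ring homomorphism `r ↦ 1 ⊗ r`. -/
noncomputable def inr (X Y : ModCat.{u}) : Y.R →+* (tensor X Y).R :=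
  (Algebra.TensorProduct.includeRight (R := ℤ) (A := X.R) (B := Y.R)).toRingHom

theorem inl_smul (r : X.R) (m : X.M) (n : Y.M) :
    (mt (r • m) n : (tensor X Y).M) = inl X Y r • (mt m n : (tensor X Y).M) :=
  ((rt_smul_mt r 1 m n).trans (by rw [one_smul])).symm

theorem inr_smul (r : Y.R) (m : X.M) (n : Y.M) :
    (mt m (r • n) : (tensor X Y).M) = inr X Y r • (mt m n : (tensor X Y).M) :=
  ((rt_smul_mt 1 r m n).trans (by rw [one_smul])).symm

theorem mt_add_left (m m' : X.M) (n : Y.M) :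
    (mt (m + m') n : (tensor X Y).M) = mt m n + mt m' n := TensorProduct.add_tmul _ _ _

theorem mt_add_right (m : X.M) (n n' : Y.M) :
    (mt m (n + n') : (tensor X Y).M) = mt m n + mt m n' := TensorProduct.tmul_add _ _ _

/-- The shuffle map with one argument a pure tensor. -/
noncomputable def shufflePure (X : ModCat.{u}) (n : ι → Y.M) : X.TP ι →+ (tensor X Y).TP ι :=
  letI : Module X.R ((tensor X Y).TP ι) := Module.compHom _ (inl X Y)
  (PiTensorProduct.lift
    { toFun := fun m => (tensor X Y).pure fun i => mt (m i) (n i)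
      map_update_add' := fun m i x y => by
        have h : ∀ z, (fun j => (mt (Function.update m i z j) (n j) : (tensor X Y).M)) =
            Function.update (fun j => mt (m j) (n j)) i (mt z (n i)) := fun z =>
          funext fun j => Function.apply_update (fun j a => (mt a (n j) : (tensor X Y).M)) m i z j
        rw [h, h, h, mt_add_left, pure_update_add]
      map_update_smul' := fun m i r x => by
        have h : ∀ z, (fun j => (mt (Function.update m i z j) (n j) : (tensor X Y).M)) =
            Function.update (fun j => mt (m j) (n j)) i (mt z (n i)) := fun z =>
          funext fun j => Function.apply_update (fun j a => (mt a (n j) : (tensor X Y).M)) m i z j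
        rw [h, h, inl_smul, pure_update_smul]
        rfl } : X.TP ι →ₗ[X.R] (tensor X Y).TP ι).toAddMonoidHom

theorem shufflePure_pure (m : ι → X.M) (n : ι → Y.M) :
    shufflePure X n (X.pure m) = (tensor X Y).pure fun i => mt (m i) (n i) := by
  letI : Module X.R ((tensor X Y).TP ι) := Module.compHom _ (inl X Y)
  exact PiTensorProduct.lift.tprod m

/-- The shuffle map with its arguments in the opposite order. -/
noncomputable def shuffleFlip (X Y : ModCat.{u}) (ι : Type u) [Nonempty ι] :
    Y.TP ι →+ X.TP ι →+ (tensor X Y).TP ι :=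
  letI : Module Y.R ((tensor X Y).TP ι) := Module.compHom _ (inr X Y)
  (PiTensorProduct.lift
    { toFun := fun n => shufflePure X n
      map_update_add' := fun n i x y => AddMonoidHom.ext <| TP_ext fun m => by
        have h : ∀ z, (fun j => (mt (m j) (Function.update n i z j) : (tensor X Y).M)) =
            Function.update (fun j => mt (m j) (n j)) i (mt (m i) z) := fun z =>
          funext fun j => Function.apply_update (fun j a => (mt (m j) a : (tensor X Y).M)) n i z j
        rw [AddMonoidHom.add_apply, shufflePure_pure, shufflePure_pure, shufflePure_pure, h, h, h,
          mt_add_right, pure_update_add]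
      map_update_smul' := fun n i r x => AddMonoidHom.ext <| TP_ext fun m => by
        have h : ∀ z, (fun j => (mt (m j) (Function.update n i z j) : (tensor X Y).M)) =
            Function.update (fun j => mt (m j) (n j)) i (mt (m i) z) := fun z =>
          funext fun j => Function.apply_update (fun j a => (mt (m j) a : (tensor X Y).M)) n i z j
        change _ = inr X Y r • shufflePure X (Function.update n i x) (X.pure m)
        rw [shufflePure_pure, shufflePure_pure, h, h, inr_smul, pure_update_smul] } :
    Y.TP ι →ₗ[Y.R] X.TP ι →+ (tensor X Y).TP ι).toAddMonoidHom

/-- The shuffle map `s : M^{⊗ ι} × M'^{⊗ ι} → (M ⊗ M')^{⊗ ι}`, as a biadditive map; see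
`shuffle_pure`. -/
noncomputable def shuffle (X Y : ModCat.{u}) (ι : Type u) [Nonempty ι] :
    X.TP ι →+ Y.TP ι →+ (tensor X Y).TP ι := (shuffleFlip X Y ι).flip

theorem shuffleFlip_pure [Nonempty ι] (m : ι → X.M) (n : ι → Y.M) :
    shuffleFlip X Y ι (Y.pure n) (X.pure m) = (tensor X Y).pure fun i => mt (m i) (n i) := by
  refine Eq.trans ?_ (shufflePure_pure m n)
  letI : Module Y.R ((tensor X Y).TP ι) := Module.compHom _ (inr X Y)
  exact DFunLike.congr_fun (PiTensorProduct.lift.tprod n) (X.pure m)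

theorem shuffle_pure [Nonempty ι] (m : ι → X.M) (n : ι → Y.M) :
    shuffle X Y ι (X.pure m) (Y.pure n) = (tensor X Y).pure fun i => mt (m i) (n i) :=
  shuffleFlip_pure m n

section Pow

variable [Finite A] [Finite B]

/-- The multilinear map `(x_b)_b ↦ ⨂_b x_b` in `M^{⊗ C}`, for a bijection `C ≃ A × B`. -/
noncomputable def block (X : ModCat.{u}) (e : C ≃ A × B) :
    MultilinearMap ℤ (fun _ : B => X.TP A) (X.TP C) :=
  letI := Fintype.ofFinite A
  letI := Fintype.ofFinite B
  letI := Classical.decEq C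
  (blockMul e).restrictScalars ℤ

theorem block_pure (e : C ≃ A × B) (f : B → A → X.M) :
    X.block e (fun b => X.pure (f b)) = X.pure fun c => f (e c).2 (e c).1 := by
  letI := Fintype.ofFinite A
  letI := Fintype.ofFinite B
  letI := Classical.decEq C
  exact blockMul_tprod e f

/-- The power `x^{⊗ B}` of `x ∈ M^{⊗ A}`, as an element of `M^{⊗ C}` via a bijection
`C ≃ A × B`. -/
noncomputable def pow (e : C ≃ A × B) (x : X.TP A) : X.TP C := X.block e fun _ => x

theorem tpMap_pow [Nonempty A] (f : X ⟶ Y) (e : C ≃ A × B) (x : X.TP A) :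
    tpMap f C (pow e x) = pow e (tpMap f A x) := by
  have := TP_multi_ext (X := X) (f := (tpMap f C).toIntLinearMap.compMultilinearMap (X.block e))
    (g := (Y.block e).compLinearMap fun _ => (tpMap f A).toIntLinearMap) (fun m => by
      simp [block_pure])
  exact DFunLike.congr_fun this fun _ => x

theorem tpIdx_pow {A' B' C' : Type u} [Finite A'] [Finite B'] [Nonempty A] (e : C ≃ A × B)
    (e' : C' ≃ A' × B') (γ : C ≃ C') (α : A ≃ A') (h : ∀ c, (e' (γ c)).1 = α (e c).1)
    (h' : ∀ c c', (e' (γ c)).2 = (e' (γ c')).2 ↔ (e c).2 = (e c').2) (x : X.TP A) :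
    X.tpIdx γ (pow e x) = pow e' (X.tpIdx α x) := by
  obtain ⟨a⟩ := ‹Nonempty A›
  have hβ : ∀ c, (e' (γ (e.symm (a, (e c).2)))).2 = (e' (γ c)).2 := fun c =>
    (h' _ _).2 (by simp)
  have inj : Function.Injective fun b => (e' (γ (e.symm (a, b)))).2 := fun b b' hb => by
    simpa using (h' _ _).1 hb
  have surj : Function.Surjective fun b => (e' (γ (e.symm (a, b)))).2 := fun b' =>
    ⟨(e (γ.symm (e'.symm (α a, b')))).2, by
      have := hβ (γ.symm (e'.symm (α a, b')))
      simpa using this⟩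
  let β : B ≃ B' := Equiv.ofBijective _ ⟨inj, surj⟩
  have hβ' : ∀ c, β (e c).2 = (e' (γ c)).2 := hβ
  have := TP_multi_ext (X := X)
    (f := (X.tpIdx γ).toIntLinearMap.compMultilinearMap (X.block e))
    (g := ((X.block e').compLinearMap fun _ => (X.tpIdx α).toIntLinearMap).domDomCongr β.symm)
    (fun m => by
      simp only [LinearMap.compMultilinearMap_apply, AddMonoidHom.coe_toIntLinearMap, block_pure,
        tpIdx_pure, MultilinearMap.domDomCongr_apply, MultilinearMap.compLinearMap_apply]
      congr 1
      ext c'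
      obtain ⟨c, rfl⟩ := γ.surjective c'
      rw [h, ← hβ']
      simp)
  exact DFunLike.congr_fun this fun _ => x

theorem pow_pow {D B₁ B₂ : Type u} [Finite B₁] [Finite B₂] [Finite C] [Nonempty A]
    (e₁ : C ≃ A × B₁) (e₂ : D ≃ C × B₂) (e : D ≃ A × B) (h : ∀ d, (e d).1 = (e₁ (e₂ d).1).1)
    (h' : ∀ d d', (e d).2 = (e d').2 ↔
      (e₁ (e₂ d).1).2 = (e₁ (e₂ d').1).2 ∧ (e₂ d).2 = (e₂ d').2) (x : X.TP A) :
    pow e₂ (pow e₁ x) = pow e x := by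
  have := tpIdx_pow (X := X) (e₂.trans ((e₁.prodCongr (Equiv.refl _)).trans
    (Equiv.prodAssoc _ _ _))) e (Equiv.refl _) (Equiv.refl _) (by simpa using h)
    (fun d d' => by simpa [Prod.ext_iff] using h' d d') x
  rw [tpIdx_refl, tpIdx_refl] at this
  rw [← this]
  have key := TP_multi_ext (X := X)
    (f := (X.block e₂).compMultilinearMap fun _ : B₂ => X.block e₁)
    (g := (X.block (e₂.trans ((e₁.prodCongr (Equiv.refl _)).trans
      (Equiv.prodAssoc _ _ _)))).domDomCongr ((Equiv.prodComm _ _).trans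
        (Equiv.sigmaEquivProd B₂ B₁).symm))
    (fun m => by
      rw [MultilinearMap.compMultilinearMap_apply, MultilinearMap.domDomCongr_apply]
      have h1 : ∀ b₂ : B₂, X.block e₁ (fun b₁ : B₁ => X.pure (m ⟨b₂, b₁⟩)) =
        X.pure fun c => m ⟨b₂, (e₁ c).2⟩ (e₁ c).1 := fun b₂ =>
          block_pure e₁ fun b₁ => m ⟨b₂, b₁⟩
      change X.block e₂ (fun b₂ => X.block e₁ (fun b₁ : B₁ => X.pure (m ⟨b₂, b₁⟩))) = _
      rw [funext h1, block_pure, block_pure]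
      rfl)
  exact DFunLike.congr_fun key fun _ => x

end Pow

end

end ModCat

end TensorPowers

/-! ### Ghost components -/

section Ghost

variable {G : Type u} [Group G] [Finite G]

/-- The bijection `G/U → G/xUx⁻¹`, `aU ↦ ax⁻¹(xUx⁻¹)`. -/
def cosetConj (x : G) {U U' : Subgroup G} (e : U' = MulAut.conj x • U) : G ⧸ U ≃ G ⧸ U' where
  toFun := Quotient.map' (fun a => a * x⁻¹) fun a b h => by
    rw [QuotientGroup.leftRel_apply] at h ⊢
    rw [e, mem_conj]
    simpa [mul_assoc] using h
  invFun := Quotient.map' (fun a => a * x) fun a b h => by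
    rw [QuotientGroup.leftRel_apply] at h ⊢
    rw [e, mem_conj] at h
    simpa [mul_assoc] using h
  left_inv := by
    rintro ⟨a⟩
    exact congrArg (QuotientGroup.mk (s := U)) (inv_mul_cancel_right a x)
  right_inv := by
    rintro ⟨a⟩
    exact congrArg (QuotientGroup.mk (s := U')) (mul_inv_cancel_right a x)

@[simp] theorem cosetConj_mk (x : G) {U U' : Subgroup G} (e : U' = MulAut.conj x • U) (a : G) :
    cosetConj x e (a : G ⧸ U) = ((a * x⁻¹ : G) : G ⧸ U') := rfl

theorem cosetConj_self {x : G} {U : Subgroup G} (e : U = MulAut.conj x • U) (hx : x ∈ U) :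
    cosetConj x e = Equiv.refl _ := by
  ext c
  obtain ⟨a, rfl⟩ := QuotientGroup.mk_surjective c
  rw [cosetConj_mk, Equiv.refl_apply, QuotientGroup.eq]
  simpa using hx

theorem cosetConj_trans {x y : G} {U U' U'' : Subgroup G} (e : U' = MulAut.conj x • U)
    (e' : U'' = MulAut.conj y • U') (e'' : U'' = MulAut.conj (y * x) • U) :
    (cosetConj x e).trans (cosetConj y e') = cosetConj (y * x) e'' := by
  ext c
  obtain ⟨a, rfl⟩ := QuotientGroup.mk_surjective c
  rw [Equiv.trans_apply, cosetConj_mk, cosetConj_mk, cosetConj_mk, mul_inv_rev, mul_assoc]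

/-- Families `(a_U)_U` with `a_U ∈ M^{⊗ G/U}` for all subgroups `U` of `G`. -/
def Fam (G : Type u) [Group G] (X : ModCat.{u}) : Type u := ∀ U : Subgroup G, X.TP (G ⧸ U)

instance (X : ModCat.{u}) : AddCommGroup (Fam G X) :=
  inferInstanceAs (AddCommGroup (∀ U : Subgroup G, X.TP (G ⧸ U)))

namespace Fam

variable {X Y : ModCat.{u}}

@[simp] theorem add_apply (a b : Fam G X) (U : Subgroup G) : (a + b) U = a U + b U := rfl

@[simp] theorem zero_apply (U : Subgroup G) : (0 : Fam G X) U = 0 := rfl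

theorem conj_conj_inv (x : G) (U : Subgroup G) : U = MulAut.conj x • (MulAut.conj x⁻¹ • U) := by
  rw [smul_smul, ← map_mul]; simp

/-- The action of `G`, given by `(x • a)_{xUx⁻¹} = x · a_U`, where
`x · (-) : M^{⊗ G/U} → M^{⊗ G/xUx⁻¹}` is induced by `cosetConj x`. -/
noncomputable instance : SMul G (Fam G X) :=
  ⟨fun x a U => X.tpIdx (cosetConj x (conj_conj_inv x U)) (a (MulAut.conj x⁻¹ • U))⟩

theorem smul_apply (x : G) (a : Fam G X) {U U' : Subgroup G} (e : U' = MulAut.conj x • U) :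
    (x • a) U' = X.tpIdx (cosetConj x e) (a U) := by
  have : ∀ (V : Subgroup G) (hV : V = U) (e' : U' = MulAut.conj x • V),
      X.tpIdx (cosetConj x e') (a V) = X.tpIdx (cosetConj x e) (a U) := by
    rintro V rfl e'; rfl
  refine this _ ?_ (conj_conj_inv x U')
  rw [e, smul_smul, ← map_mul]; simp

noncomputable instance : DistribMulAction G (Fam G X) where
  one_smul a := by
    funext U
    rw [smul_apply 1 a (U := U) (by simp), cosetConj_self _ (one_mem _), ModCat.tpIdx_refl]
  mul_smul x y a := by
    funext U
    have e1 := conj_conj_inv x U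
    have e2 := conj_conj_inv y (MulAut.conj x⁻¹ • U)
    rw [smul_apply x _ e1, smul_apply y _ e2, smul_apply (x * y) a (conj_mul e2 e1),
      ModCat.tpIdx_tpIdx, cosetConj_trans e2 e1 (conj_mul e2 e1)]
  smul_zero x := funext fun U => map_zero (X.tpIdx (cosetConj x (conj_conj_inv x U)))
  smul_add x a b := funext fun U => map_add (X.tpIdx (cosetConj x (conj_conj_inv x U))) _ _

open Classical in
/-- Restricting a family to the subgroups of `K`, and extending by zero. -/
noncomputable def cut (K : Subgroup G) : Fam G X →+ Fam G X where
  toFun a U := if U ≤ K then a U else 0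
  map_zero' := funext fun _ => ite_self _
  map_add' a b := funext fun U => by
    change (if U ≤ K then a U + b U else 0) = (if U ≤ K then a U else 0) + if U ≤ K then b U else 0
    split_ifs
    · rfl
    · rw [add_zero]

theorem cut_apply_of_le {K U : Subgroup G} (h : U ≤ K) (a : Fam G X) : cut K a U = a U :=
  if_pos h

theorem cut_apply_of_not_le {K U : Subgroup G} (h : ¬ U ≤ K) (a : Fam G X) : cut K a U = 0 :=
  if_neg h

theorem cut_cut (J K : Subgroup G) (a : Fam G X) : cut J (cut K a) = cut (J ⊓ K) a := by
  funext U
  by_cases h : U ≤ J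
  · rw [cut_apply_of_le h]
    by_cases h' : U ≤ K
    · rw [cut_apply_of_le h', cut_apply_of_le (le_inf h h')]
    · rw [cut_apply_of_not_le h', cut_apply_of_not_le fun h'' => h' (h''.trans inf_le_right)]
  · rw [cut_apply_of_not_le h, cut_apply_of_not_le fun h'' => h (h''.trans inf_le_left)]

theorem smul_cut (x : G) (K : Subgroup G) (a : Fam G X) :
    x • cut K a = cut (MulAut.conj x • K) (x • a) := by
  funext U
  have e := conj_conj_inv x U
  by_cases h : MulAut.conj x⁻¹ • U ≤ K
  · have h' : U ≤ MulAut.conj x • K := conj_mono h rfl e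
    rw [smul_apply x _ e, cut_apply_of_le h, cut_apply_of_le h', smul_apply x _ e]
  · have h' : ¬ U ≤ MulAut.conj x • K := fun h' => h <| by
      rw [e] at h'
      exact Subgroup.pointwise_smul_le_pointwise_smul_iff.1 h'
    rw [smul_apply x _ e, cut_apply_of_not_le h, cut_apply_of_not_le h', map_zero]

theorem cut_comm (J K : Subgroup G) (a : Fam G X) : cut J (cut K a) = cut K (cut J a) := by
  rw [cut_cut, cut_cut, inf_comm]

/-- The map induced by a morphism of coefficients. -/
noncomputable def map (f : X ⟶ Y) : Fam G X →+ Fam G Y where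
  toFun a U := ModCat.tpMap f _ (a U)
  map_zero' := funext fun _ => map_zero _
  map_add' _ _ := funext fun _ => map_add _ _ _

theorem map_apply (f : X ⟶ Y) (a : Fam G X) (U : Subgroup G) :
    map f a U = ModCat.tpMap f _ (a U) := rfl

theorem map_cut (f : X ⟶ Y) (K : Subgroup G) (a : Fam G X) : map f (cut K a) = cut K (map f a) := by
  funext U
  by_cases h : U ≤ K
  · rw [map_apply, cut_apply_of_le h, cut_apply_of_le h, map_apply]
  · rw [map_apply, cut_apply_of_not_le h, cut_apply_of_not_le h, map_zero]

theorem map_smul (f : X ⟶ Y) (x : G) (a : Fam G X) : map f (x • a) = x • map f a := by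
  funext U
  have e := conj_conj_inv x U
  rw [map_apply, smul_apply x _ e, smul_apply x _ e, ModCat.tpMap_tpIdx, map_apply]

end Fam

open Fam

/-- The ghost group `(∏_{U ≤ H} M^{⊗ G/U})^H` at `H`, as a group of families extended by zero. -/
noncomputable def ghostSub (X : ModCat.{u}) (H : Subgroup G) : AddSubgroup (Fam G X) where
  carrier := {a | cut H a = a ∧ ∀ h ∈ H, h • a = a}
  zero_mem' := ⟨map_zero _, fun _ _ => smul_zero _⟩
  add_mem' ha hb := ⟨by rw [map_add, ha.1, hb.1], fun h hh => by rw [smul_add, ha.2 h hh, hb.2 h hh]⟩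
  neg_mem' ha := ⟨by rw [map_neg, ha.1], fun h hh => by rw [smul_neg, ha.2 h hh]⟩

section Finite

variable {X Y : ModCat.{u}}

theorem smul_sumOver (x : G) {s : Setoid G} {H : Subgroup G} (f : G → Fam G X) :
    x • sumOver s H f = sumOver s H fun y => x • f y :=
  map_sumOver (DistribSMul.toAddMonoidHom (Fam G X) x) f

theorem ghost_mul_right {K : Subgroup G} {a : Fam G X} (ha : a ∈ ghostSub X K) (x b : G)
    (hb : b ∈ K) : (x * b) • a = x • a := by rw [mul_smul, ha.2 b hb]

theorem ghost_cut_mem {K H : Subgroup G} (h : K ≤ H) {a : Fam G X} (ha : a ∈ ghostSub X H) :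
    cut K a ∈ ghostSub X K :=
  ⟨by rw [cut_cut, inf_idem], fun k hk => by
    rw [smul_cut, ha.2 k (h hk), Subgroup.conj_smul_eq_self_of_mem hk]⟩

theorem ghost_smul_mem {g : G} {H H' : Subgroup G} (h : H' = MulAut.conj g • H) {a : Fam G X}
    (ha : a ∈ ghostSub X H) : g • a ∈ ghostSub X H' :=
  ⟨by conv_rhs => rw [← ha.1, smul_cut, ← h], fun k hk => by
    rw [h, mem_conj] at hk
    have := ha.2 _ hk
    calc k • g • a = g • (g⁻¹ * k * g) • a := by rw [smul_smul, smul_smul]; congr 1; group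
      _ = g • a := by rw [this]⟩

/-- The transfer on ghost components, `V_K^H(a) = ∑_{xK ∈ H/K} x • a`. (Its component at `U` only
has contributions from the cosets `xK` with `x⁻¹Ux ≤ K`, that is, those fixed by `U`.) -/
noncomputable def ghostTr (K H : Subgroup G) (a : Fam G X) : Fam G X :=
  sumOver (lc K) H fun x => x • a

theorem ghostTr_add (K H : Subgroup G) (a b : Fam G X) :
    ghostTr K H (a + b) = ghostTr K H a + ghostTr K H b := by
  rw [ghostTr, ghostTr, ghostTr, ← sumOver_add]
  simp only [smul_add]

theorem ghost_inv {K : Subgroup G} {a : Fam G X} (ha : a ∈ ghostSub X K) {H : Subgroup G} :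
    ∀ x ∈ H, ∀ c ∈ (⊥ : Subgroup G), ∀ b ∈ K, (c * x * b) • a = x • a := by
  intro x _ c hc b hb
  rw [Subgroup.mem_bot.1 hc, one_mul, ghost_mul_right ha _ _ hb]

theorem ghostTr_mem {K H : Subgroup G} (h : K ≤ H) {a : Fam G X} (ha : a ∈ ghostSub X K) :
    ghostTr K H a ∈ ghostSub X H := by
  constructor
  · rw [ghostTr, map_sumOver]
    refine sumOver_congr fun x hx => ?_
    have h' : MulAut.conj x • K ≤ H := conj_mono h (conj_eq_self hx) rfl
    conv_lhs => rw [← ha.1, smul_cut, cut_cut, inf_eq_right.2 h', ← smul_cut, ha.1]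
  · intro k hk
    rw [ghostTr, smul_sumOver, lc_eq]
    have := sumOver_conj (H := H) (J := ⊥) (J' := ⊥) (K := K) (K' := K) bot_le h k⁻¹ 1
      (conj_eq_self (H.inv_mem hk)) (by simp) (by simpa using hk) (by simp)
      (f := fun x => k • x • a) (fun x hx c hc b hb => by rw [ghost_inv ha x hx c hc b hb])
    rw [this]
    refine sumOver_congr fun x _ => ?_
    rw [smul_smul]
    congr 1
    group

/-- The Mackey functor `gh` of ghost components. -/
noncomputable def ghost (G : Type u) [Group G] [Finite G] (X : ModCat.{u}) : MackeyFunctor G where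
  obj H := ghostSub X H
  tr {K H} h := AddMonoidHom.mk' (fun a => ⟨ghostTr K H a.1, ghostTr_mem h a.2⟩)
    fun a b => Subtype.ext (ghostTr_add K H a.1 b.1)
  res {K H} h := AddMonoidHom.mk' (fun a => ⟨cut K a.1, ghost_cut_mem h a.2⟩)
    fun a b => Subtype.ext (map_add (cut K) a.1 b.1)
  conj g _ _ h := AddMonoidHom.mk' (fun a => ⟨g • a.1, ghost_smul_mem h a.2⟩)
    fun a b => Subtype.ext (smul_add g a.1 b.1)
  tr_self {H} h a := Subtype.ext <| by
    change ghostTr H H a.1 = a.1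
    rw [ghostTr, sumOver_single, one_smul]
    · intro x
      rw [QuotientGroup.leftRel_apply, mul_one, inv_mem_iff]
    · intro x hx
      rw [a.2.2 x hx, one_smul]
  res_self h a := Subtype.ext a.2.1
  conj_self hg h a := Subtype.ext (a.2.2 _ hg)
  tr_tr {J K H} h h' h'' a := Subtype.ext <| by
    change ghostTr K H (ghostTr J K a.1) = ghostTr J H a.1
    conv_rhs => rw [ghostTr, lc_eq, sumOver_nested_right bot_le h' h (ghost_inv a.2)]
    rw [ghostTr, lc_eq K]
    refine sumOver_congr fun x hx => ?_
    have : MulAut.conj x⁻¹ • (⊥ : Subgroup G) ⊓ K = ⊥ := by simp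
    rw [this, ghostTr, smul_sumOver, lc_eq]
    simp only [mul_smul]
  res_res {J K H} h h' h'' a := Subtype.ext <| by
    change cut J (cut K a.1) = cut J a.1
    rw [cut_cut, inf_eq_left.2 h]
  conj_conj h h' h'' a := Subtype.ext (mul_smul _ _ _).symm
  conj_tr {g H K H' K'} h h' hK hH a := Subtype.ext <| by
    change g • ghostTr K H a.1 = ghostTr K' H' (g • a.1)
    rw [ghostTr, ghostTr, smul_sumOver, lc_eq K, lc_eq K', sumOver_conj (H := H) (J := ⊥) bot_le h
      g g hH (by simp) (by simp) hK (ghost_inv (ghost_smul_mem hK a.2))]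
    refine sumOver_congr fun x hx => ?_
    rw [smul_smul, smul_smul]
    congr 1
    group
  conj_res {g H K H' K'} h h' hK hH a := Subtype.ext <| by
    change g • cut K a.1 = cut K' (g • a.1)
    rw [smul_cut, hK]
  res_tr {J K H} hJ hK a := Subtype.ext <| by
    refine Eq.trans ?_ (coe_sumOver (ghostSub X J) _).symm
    change cut J (ghostTr K H a.1) = sumOver (dc J K) H fun x =>
      ghostTr (J ⊓ MulAut.conj x • K) J (x • cut (MulAut.conj x⁻¹ • J ⊓ K) a.1)
    rw [ghostTr, map_sumOver, lc_eq, sumOver_nested_left (I := ⊥) bot_le hJ hK]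
    · refine sumOver_congr fun x hx => ?_
      rw [ghostTr, lc_eq]
      refine sumOver_congr fun y hy => ?_
      rw [smul_cut, ← conj_inf, smul_cut, Subgroup.smul_inf, Subgroup.conj_smul_eq_self_of_mem hy,
        ← cut_cut, ← smul_cut y, ← smul_cut x, a.2.1, mul_smul]
    · intro x hx c hc b hb
      rw [ghost_inv a.2 x hx c hc b hb]

theorem map_mem_ghost (f : X ⟶ Y) {H : Subgroup G} {a : Fam G X} (ha : a ∈ ghostSub X H) :
    Fam.map f a ∈ ghostSub Y H :=
  ⟨by rw [← map_cut, ha.1], fun h hh => by rw [← Fam.map_smul, ha.2 h hh]⟩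

theorem map_ghostTr (f : X ⟶ Y) (K H : Subgroup G) (a : Fam G X) :
    Fam.map f (ghostTr K H a) = ghostTr K H (Fam.map f a) := by
  rw [ghostTr, ghostTr, map_sumOver]
  exact sumOver_congr fun x _ => Fam.map_smul f x a

/-- Functoriality of the ghost components. -/
noncomputable def ghostMap (f : X ⟶ Y) : ghost G X ⟶ ghost G Y where
  app H := AddMonoidHom.mk' (fun a => ⟨Fam.map f a.1, map_mem_ghost f a.2⟩)
    fun a b => Subtype.ext (map_add (Fam.map f) a.1 b.1)
  app_tr h a := Subtype.ext (map_ghostTr f _ _ a.1)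
  app_res h a := Subtype.ext (map_cut f _ a.1)
  app_conj h a := Subtype.ext (Fam.map_smul f _ a.1)

end Finite

end Ghost

/-! ### Norms and Witt vectors -/

section Witt

open Fam

variable {G : Type u} [Group G] [Finite G]

section Norm

variable {X Y : ModCat.{u}}

open Classical in
/-- For `m ∈ M^{⊗ G/V}`, the family with component `f_{G/V}(m^{⊗ V/U})` at `U ≤ V` and zero
elsewhere. Here `f_{G/V} : M^{⊗ G/V × V/U} ≅ M^{⊗ G/U}` is induced by the bijection
`(c, vU) ↦ σ(c) v U`, for a choice `σ` of representatives of the cosets in `G/V`. -/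
noncomputable def normFam (V : Subgroup G) (σ : G ⧸ V → G)
    (hσ : Function.RightInverse σ QuotientGroup.mk) (m : X.TP (G ⧸ V)) : Fam G X :=
  fun U => if h : U ≤ V then ModCat.pow (Subgroup.quotientEquivProdOfLE' h σ hσ) m else 0

theorem normFam_of_le {V U : Subgroup G} {σ : G ⧸ V → G}
    {hσ : Function.RightInverse σ QuotientGroup.mk} {m : X.TP (G ⧸ V)} (h : U ≤ V) :
    normFam V σ hσ m U = ModCat.pow (Subgroup.quotientEquivProdOfLE' h σ hσ) m := dif_pos h

theorem normFam_of_not_le {V U : Subgroup G} {σ : G ⧸ V → G}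
    {hσ : Function.RightInverse σ QuotientGroup.mk} {m : X.TP (G ⧸ V)} (h : ¬ U ≤ V) :
    normFam V σ hσ m U = 0 := dif_neg h

theorem prod_fst {V U : Subgroup G} (h : U ≤ V) {σ : G ⧸ V → G}
    {hσ : Function.RightInverse σ QuotientGroup.mk} (a : G) :
    (Subgroup.quotientEquivProdOfLE' h σ hσ (a : G ⧸ U)).1 = (a : G ⧸ V) := rfl

theorem prod_snd_eq {V U : Subgroup G} (h : U ≤ V) {σ : G ⧸ V → G}
    {hσ : Function.RightInverse σ QuotientGroup.mk} (a b : G) :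
    (Subgroup.quotientEquivProdOfLE' h σ hσ (a : G ⧸ U)).2 =
      (Subgroup.quotientEquivProdOfLE' h σ hσ (b : G ⧸ U)).2 ↔
    ((σ (a : G ⧸ V))⁻¹ * a)⁻¹ * ((σ (b : G ⧸ V))⁻¹ * b) ∈ U := by
  refine Quotient.eq''.trans ?_
  rw [QuotientGroup.leftRel_apply]
  rfl

theorem smul_normFam {x w : G} {V V' : Subgroup G} (e : V' = MulAut.conj x • V) {σ : G ⧸ V → G}
    {hσ : Function.RightInverse σ QuotientGroup.mk} {σ' : G ⧸ V' → G}
    {hσ' : Function.RightInverse σ' QuotientGroup.mk}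
    (hw : ∀ c, σ' (cosetConj x e c) = σ c * w) (m : X.TP (G ⧸ V)) :
    x • normFam V σ hσ m = normFam V' σ' hσ' (X.tpIdx (cosetConj x e) m) := by
  funext U'
  have e' := conj_conj_inv x U'
  generalize MulAut.conj x⁻¹ • U' = U at e'
  rw [smul_apply x _ e']
  by_cases h : U ≤ V
  · have h' : U' ≤ V' := conj_mono h e e'
    rw [normFam_of_le h, normFam_of_le h']
    refine ModCat.tpIdx_pow _ _ _ _ ?_ ?_ m
    · intro c
      obtain ⟨a, rfl⟩ := QuotientGroup.mk_surjective c
      rfl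
    · intro c d
      obtain ⟨a, rfl⟩ := QuotientGroup.mk_surjective c
      obtain ⟨b, rfl⟩ := QuotientGroup.mk_surjective d
      rw [cosetConj_mk, cosetConj_mk, prod_snd_eq, prod_snd_eq, ← cosetConj_mk x e,
        ← cosetConj_mk x e, hw, hw, e', mem_conj]
      simp only [mul_inv_rev, inv_inv, mul_assoc, mul_inv_cancel_left, inv_mul_cancel_left,
        inv_mul_cancel, mul_one]
  · have h' : ¬ U' ≤ V' := fun h' => h <| by
      rw [e, e'] at h'
      exact Subgroup.pointwise_smul_le_pointwise_smul_iff.1 h'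
    rw [normFam_of_not_le h, normFam_of_not_le h', map_zero]

/-- The choice of representatives for `G/U` induced by one for `G/V` and one for `V/U`. -/
noncomputable def refineRep {U V : Subgroup G} (h : U ≤ V) (σ : G ⧸ V → G)
    (hσ : Function.RightInverse σ QuotientGroup.mk) (c : G ⧸ U) : G :=
  σ (Subgroup.quotientEquivProdOfLE' h σ hσ c).1 *
    ((Subgroup.quotientEquivProdOfLE' h σ hσ c).2.out : V)

theorem refineRep_spec {U V : Subgroup G} (h : U ≤ V) (σ : G ⧸ V → G)
    (hσ : Function.RightInverse σ QuotientGroup.mk) :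
    Function.RightInverse (refineRep h σ hσ) (QuotientGroup.mk (s := U)) := by
  intro c
  have : QuotientGroup.mk (s := U) (refineRep h σ hσ c) = (Subgroup.quotientEquivProdOfLE' h σ hσ).symm
      ((Subgroup.quotientEquivProdOfLE' h σ hσ c).1,
        QuotientGroup.mk (Subgroup.quotientEquivProdOfLE' h σ hσ c).2.out) := rfl
  rw [this, QuotientGroup.out_eq', Prod.mk.eta, Equiv.symm_apply_apply]

theorem cut_normFam {U V : Subgroup G} (h : U ≤ V) {σ : G ⧸ V → G}
    {hσ : Function.RightInverse σ QuotientGroup.mk} (m : X.TP (G ⧸ V)) :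
    cut U (normFam V σ hσ m) = normFam U (refineRep h σ hσ) (refineRep_spec h σ hσ)
      (ModCat.pow (Subgroup.quotientEquivProdOfLE' h σ hσ) m) := by
  funext W
  by_cases hW : W ≤ U
  · rw [cut_apply_of_le hW, normFam_of_le (hW.trans h), normFam_of_le hW]
    refine (ModCat.pow_pow _ _ _ ?_ ?_ m).symm
    · intro d
      obtain ⟨a, rfl⟩ := QuotientGroup.mk_surjective d
      rfl
    · intro d d'
      obtain ⟨a, rfl⟩ := QuotientGroup.mk_surjective d
      obtain ⟨b, rfl⟩ := QuotientGroup.mk_surjective d'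
      rw [prod_fst, prod_fst, prod_snd_eq, prod_snd_eq, prod_snd_eq]
      have key (hab : (Subgroup.quotientEquivProdOfLE' h σ hσ (a : G ⧸ U)).2 =
          (Subgroup.quotientEquivProdOfLE' h σ hσ (b : G ⧸ U)).2) :
          ((refineRep h σ hσ (a : G ⧸ U))⁻¹ * a)⁻¹ * ((refineRep h σ hσ (b : G ⧸ U))⁻¹ * b) =
            ((σ (a : G ⧸ V))⁻¹ * a)⁻¹ * ((σ (b : G ⧸ V))⁻¹ * b) := by
        rw [refineRep, refineRep, prod_fst, prod_fst, hab]
        group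
      constructor
      · intro hab
        have := (prod_snd_eq h (hσ := hσ) a b).2 (hW hab)
        exact ⟨hW hab, by rwa [key this]⟩
      · rintro ⟨h1, h2⟩
        rwa [key ((prod_snd_eq h (hσ := hσ) a b).2 h1)] at h2
  · rw [cut_apply_of_not_le hW, normFam_of_not_le hW]

theorem map_normFam (f : X ⟶ Y) {V : Subgroup G} {σ : G ⧸ V → G}
    {hσ : Function.RightInverse σ QuotientGroup.mk} (m : X.TP (G ⧸ V)) :
    Fam.map f (normFam V σ hσ m) = normFam V σ hσ (ModCat.tpMap f _ m) := by
  funext U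
  by_cases h : U ≤ V
  · rw [map_apply, normFam_of_le h, normFam_of_le h, ModCat.tpMap_pow]
  · rw [map_apply, normFam_of_not_le h, normFam_of_not_le h, map_zero]

theorem normFam_mem (V : Subgroup G) (σ : G ⧸ V → G)
    (hσ : Function.RightInverse σ QuotientGroup.mk) (m : X.TP (G ⧸ V)) :
    normFam V σ hσ m ∈ ghostSub X V := by
  constructor
  · funext U
    by_cases h : U ≤ V
    · rw [cut_apply_of_le h]
    · rw [cut_apply_of_not_le h, normFam_of_not_le h]
  · intro v hv
    have e := conj_eq_self hv
    rw [smul_normFam (w := 1) e (hσ' := hσ) (fun c => by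
      rw [cosetConj_self e hv, Equiv.refl_apply, mul_one]), cosetConj_self e hv, ModCat.tpIdx_refl]

/-- The family `normFam` as an element of the ghost group at `V`. -/
noncomputable def normElt (V : Subgroup G) (σ : G ⧸ V → G)
    (hσ : Function.RightInverse σ QuotientGroup.mk) (m : X.TP (G ⧸ V)) : (ghost G X).obj V :=
  ⟨normFam V σ hσ m, normFam_mem V σ hσ m⟩

variable (X) in
/-- The subgroup of the ghost group at `H` generated by the elements `V_V^H (f_{G/V}(m^{⊗ V/U}))_U`,
for all `V ≤ H`, all `m ∈ M^{⊗ G/V}` and all choices of coset representatives. The ghost map of an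
element `(n_V)_V` is by definition the sum of such elements over conjugacy class representatives `V`
of subgroups of `H`, so this is the subgroup generated by the images of the ghost maps for all the
possible choices; for free coefficients it is the image of the ghost map for any fixed choice. -/
noncomputable def wittSub (H : Subgroup G) : AddSubgroup ((ghost G X).obj H) :=
  AddSubgroup.closure {a | ∃ (V : Subgroup G) (h : V ≤ H) (σ : G ⧸ V → G)
    (hσ : Function.RightInverse σ QuotientGroup.mk) (m : X.TP (G ⧸ V)),
    a = (ghost G X).tr h (normElt V σ hσ m)}

theorem tr_norm_mem {V H : Subgroup G} (h : V ≤ H) (σ : G ⧸ V → G)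
    (hσ : Function.RightInverse σ QuotientGroup.mk) (m : X.TP (G ⧸ V)) :
    (ghost G X).tr h (normElt V σ hσ m) ∈ wittSub X H :=
  AddSubgroup.subset_closure ⟨V, h, σ, hσ, m, rfl⟩

theorem conj_normElt {g : G} {V V' : Subgroup G} (e : V' = MulAut.conj g • V) (σ : G ⧸ V → G)
    (hσ : Function.RightInverse σ QuotientGroup.mk) (m : X.TP (G ⧸ V)) :
    ∃ (σ' : G ⧸ V' → G) (hσ' : Function.RightInverse σ' QuotientGroup.mk) (m' : X.TP (G ⧸ V')),
      (ghost G X).conj g e (normElt V σ hσ m) = normElt V' σ' hσ' m' := by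
  refine ⟨fun c => σ ((cosetConj g e).symm c) * g⁻¹, fun c => ?_, X.tpIdx (cosetConj g e) m,
    Subtype.ext (smul_normFam (w := g⁻¹) e (fun c => ?_) m)⟩
  · rw [← cosetConj_mk g e, hσ, Equiv.apply_symm_apply]
  · rw [Equiv.symm_apply_apply]

theorem wittSub_stable (X : ModCat.{u}) : (ghost G X).IsStable (wittSub X) where
  tr {K H} h x hx := by
    change x ∈ (wittSub X H).comap ((ghost G X).tr h)
    refine (AddSubgroup.closure_le _).2 ?_ hx
    rintro _ ⟨V, hV, σ, hσ, m, rfl⟩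
    rw [SetLike.mem_coe, AddSubgroup.mem_comap, (ghost G X).tr_tr hV h (hV.trans h)]
    exact tr_norm_mem _ _ _ _
  res {K H} h x hx := by
    change x ∈ (wittSub X K).comap ((ghost G X).res h)
    refine (AddSubgroup.closure_le _).2 ?_ hx
    rintro _ ⟨V, hV, σ, hσ, m, rfl⟩
    rw [SetLike.mem_coe, AddSubgroup.mem_comap, (ghost G X).res_tr]
    refine sumOver_mem _ fun g _ => ?_
    have : (ghost G X).res (inf_le_right : MulAut.conj g⁻¹ • K ⊓ V ≤ V) (normElt V σ hσ m) =
        normElt _ _ (refineRep_spec inf_le_right σ hσ)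
          (ModCat.pow (Subgroup.quotientEquivProdOfLE' inf_le_right σ hσ) m) :=
      Subtype.ext (cut_normFam _ m)
    rw [this]
    obtain ⟨σ', hσ', m', e⟩ := conj_normElt (conj_inf K V g) _
      (refineRep_spec (inf_le_right : MulAut.conj g⁻¹ • K ⊓ V ≤ V) σ hσ)
      (ModCat.pow (Subgroup.quotientEquivProdOfLE' inf_le_right σ hσ) m)
    rw [e]
    exact tr_norm_mem _ _ _ _
  conj {g H H'} h x hx := by
    change x ∈ (wittSub X H').comap ((ghost G X).conj g h)
    refine (AddSubgroup.closure_le _).2 ?_ hx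
    rintro _ ⟨V, hV, σ, hσ, m, rfl⟩
    have hV' : MulAut.conj g • V ≤ H' := conj_mono hV h rfl
    rw [SetLike.mem_coe, AddSubgroup.mem_comap, (ghost G X).conj_tr hV hV' rfl h]
    obtain ⟨σ', hσ', m', e⟩ := conj_normElt (g := g) rfl σ hσ m
    rw [e]
    exact tr_norm_mem _ _ _ _

theorem ghostMap_mem (f : X ⟶ Y) (H : Subgroup G) {x : (ghost G X).obj H} (hx : x ∈ wittSub X H) :
    MackeyFunctor.Hom.app (ghostMap f) H x ∈ wittSub Y H := by
  change x ∈ (wittSub Y H).comap (MackeyFunctor.Hom.app (ghostMap f) H)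
  refine (AddSubgroup.closure_le _).2 ?_ hx
  rintro _ ⟨V, hV, σ, hσ, m, rfl⟩
  rw [SetLike.mem_coe, AddSubgroup.mem_comap, MackeyFunctor.Hom.app_tr]
  have : MackeyFunctor.Hom.app (ghostMap f) V (normElt V σ hσ m) =
      normElt V σ hσ (ModCat.tpMap f _ m) := Subtype.ext (map_normFam f m)
  rw [this]
  exact tr_norm_mem _ _ _ _

end Norm

open MackeyFunctor

/-- The Mackey functor `H ↦ im(w) ⊆ gh_H`; see `wittSub`. It is used on free coefficients. -/
noncomputable def ghostImage (G : Type u) [Group G] [Finite G] (X : ModCat.{u}) :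
    MackeyFunctor G := (ghost G X).sub (wittSub_stable X)

/-- Functoriality of `ghostImage`. -/
noncomputable def ghostImageMap {X Y : ModCat.{u}} (f : X ⟶ Y) :
    ghostImage G X ⟶ ghostImage G Y where
  app H := ((Hom.app (ghostMap f) H).comp (wittSub X H).subtype).codRestrict (wittSub Y H)
    fun x => ghostMap_mem f H x.2
  app_tr h x := Subtype.ext (Hom.app_tr (ghostMap f) h x.1)
  app_res h x := Subtype.ext (Hom.app_res (ghostMap f) h x.1)
  app_conj h x := Subtype.ext (Hom.app_conj (ghostMap f) h x.1)

/-- The inclusion `im(w) ⊆ gh`. -/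
noncomputable def ghostIncl (X : ModCat.{u}) : ghostImage G X ⟶ ghost G X where
  app H := (wittSub X H).subtype
  app_tr _ _ := rfl
  app_res _ _ := rfl
  app_conj _ _ := rfl

theorem famMap_id {X : ModCat.{u}} (a : Fam G X) : Fam.map (𝟙 X) a = a :=
  funext fun _ => ModCat.tpMap_id _

theorem famMap_comp {X Y Z : ModCat.{u}} (f : X ⟶ Y) (g : Y ⟶ Z) (a : Fam G X) :
    Fam.map (f ≫ g) a = Fam.map g (Fam.map f a) := funext fun _ => ModCat.tpMap_comp _ _ _

theorem ghostMap_comp {X Y Z : ModCat.{u}} (f : X ⟶ Y) (g : Y ⟶ Z) :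
    ghostMap (G := G) (f ≫ g) = ghostMap f ≫ ghostMap g :=
  MackeyFunctor.hom_ext fun _ a => Subtype.ext (famMap_comp f g a.1)

theorem ghostImageMap_id (X : ModCat.{u}) : ghostImageMap (G := G) (𝟙 X) = 𝟙 _ :=
  MackeyFunctor.hom_ext fun _ a => Subtype.ext (Subtype.ext (famMap_id a.1.1))

theorem ghostImageMap_comp {X Y Z : ModCat.{u}} (f : X ⟶ Y) (g : Y ⟶ Z) :
    ghostImageMap (G := G) (f ≫ g) = ghostImageMap f ≫ ghostImageMap g :=
  MackeyFunctor.hom_ext fun _ a => Subtype.ext (Subtype.ext (famMap_comp f g a.1.1))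

theorem ghostImageMap_incl {X Y : ModCat.{u}} (f : X ⟶ Y) :
    ghostImageMap (G := G) f ≫ ghostIncl Y = ghostIncl X ≫ ghostMap f :=
  MackeyFunctor.hom_ext fun _ _ => rfl

namespace MackeyFunctor

variable {M N P Q : MackeyFunctor G}

/-- The image of the difference of two morphisms. -/
def diffRange (f g : M ⟶ N) (H : Subgroup G) : AddSubgroup (N.obj H) :=
  (Hom.app f H - Hom.app g H).range

theorem diffRange_stable (f g : M ⟶ N) : N.IsStable (diffRange f g) where
  tr h := by
    rintro _ ⟨x, rfl⟩
    exact ⟨M.tr h x, by rw [AddMonoidHom.sub_apply, AddMonoidHom.sub_apply, map_sub,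
      Hom.app_tr, Hom.app_tr]⟩
  res h := by
    rintro _ ⟨x, rfl⟩
    exact ⟨M.res h x, by rw [AddMonoidHom.sub_apply, AddMonoidHom.sub_apply, map_sub,
      Hom.app_res, Hom.app_res]⟩
  conj {g' H H'} h := by
    rintro _ ⟨x, rfl⟩
    exact ⟨M.conj g' h x, by rw [AddMonoidHom.sub_apply, AddMonoidHom.sub_apply, map_sub,
      Hom.app_conj, Hom.app_conj]⟩

/-- The coequaliser of two morphisms of Mackey functors (computed levelwise). -/
def coeq (f g : M ⟶ N) : MackeyFunctor G := N.quot (diffRange_stable f g)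

/-- The projection to the coequaliser. -/
def coeqMk (f g : M ⟶ N) : N ⟶ coeq f g := N.quotMk (diffRange_stable f g)

/-- The universal property of the coequaliser. -/
def coeqLift (f g : M ⟶ N) (k : N ⟶ P) (hk : f ≫ k = g ≫ k) : coeq f g ⟶ P :=
  quotLift (diffRange_stable f g) k <| by
    rintro H _ ⟨x, rfl⟩
    rw [AddMonoidHom.sub_apply, map_sub, sub_eq_zero]
    exact DFunLike.congr_fun (congrArg (fun t : M ⟶ P => Hom.app t H) hk) x

theorem coeqMk_lift (f g : M ⟶ N) (k : N ⟶ P) (hk : f ≫ k = g ≫ k) :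
    coeqMk f g ≫ coeqLift f g k hk = k := rfl

theorem coeq_condition (f g : M ⟶ N) : f ≫ coeqMk f g = g ≫ coeqMk f g :=
  hom_ext fun H x => (QuotientAddGroup.eq_iff_sub_mem).2 ⟨x, rfl⟩

theorem coeq_ext {f g : M ⟶ N} {k l : coeq f g ⟶ P} (h : coeqMk f g ≫ k = coeqMk f g ≫ l) :
    k = l :=
  hom_ext fun H x => by
    obtain ⟨x, rfl⟩ := N.quotMk_surj (diffRange_stable f g) H x
    exact DFunLike.congr_fun (congrArg (fun t : N ⟶ P => Hom.app t H) h) x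

end MackeyFunctor

namespace ModCat

variable {A B A' B' : Type u} {X Y : ModCat.{u}}

/-- The free object `(ℤ[A]; ℤ[A](B))` on a pair of sets. -/
noncomputable def free (A B : Type u) : ModCat.{u} where
  R := MvPolynomial A ℤ
  M := B →₀ MvPolynomial A ℤ

/-- The free generators in the ring. -/
noncomputable def genR (B : Type u) (a : A) : (free A B).R :=
  (MvPolynomial.X a : MvPolynomial A ℤ)

/-- The free generators in the module. -/
noncomputable def genM (A : Type u) (b : B) : (free A B).M :=
  (Finsupp.single b 1 : B →₀ MvPolynomial A ℤ)

/-- The additive map on `ℤ[A](B)` determined by maps on the generators. -/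
noncomputable def freeLiftAdd (X : ModCat.{u}) (φ : A → X.R) (ψ : B → X.M) :
    (B →₀ MvPolynomial A ℤ) →+ X.M :=
  Finsupp.liftAddHom fun b => ((smulAddHom X.R X.M).flip (ψ b)).comp
    (MvPolynomial.eval₂Hom (Int.castRingHom X.R) φ).toAddMonoidHom

theorem freeLiftAdd_single (φ : A → X.R) (ψ : B → X.M) (b : B) (p : MvPolynomial A ℤ) :
    freeLiftAdd X φ ψ (Finsupp.single b p) =
      MvPolynomial.eval₂Hom (Int.castRingHom X.R) φ p • ψ b :=
  Finsupp.liftAddHom_apply_single _ _ _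

theorem freeLiftAdd_smul (φ : A → X.R) (ψ : B → X.M) (r : MvPolynomial A ℤ)
    (m : B →₀ MvPolynomial A ℤ) : freeLiftAdd X φ ψ (r • m) =
      MvPolynomial.eval₂Hom (Int.castRingHom X.R) φ r • freeLiftAdd X φ ψ m := by
  induction m using Finsupp.induction_linear with
  | zero => rw [smul_zero, map_zero, smul_zero]
  | add f g hf hg => rw [smul_add, map_add, map_add, hf, hg, smul_add]
  | single b p =>
    rw [Finsupp.smul_single, freeLiftAdd_single, freeLiftAdd_single, smul_eq_mul, map_mul, mul_smul]

/-- The morphism out of a free object determined by maps on the generators. -/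
noncomputable def freeLift (X : ModCat.{u}) (φ : A → X.R) (ψ : B → X.M) : free A B ⟶ X where
  ring := MvPolynomial.eval₂Hom (Int.castRingHom X.R) φ
  map := freeLiftAdd X φ ψ
  map_smul := freeLiftAdd_smul φ ψ

theorem freeLift_genR (φ : A → X.R) (ψ : B → X.M) (a : A) :
    Hom.ring (freeLift X φ ψ) (genR B a) = φ a :=
  MvPolynomial.eval₂Hom_X' _ _ _

theorem freeLift_genM (φ : A → X.R) (ψ : B → X.M) (b : B) :
    Hom.map (freeLift X φ ψ) (genM A b) = ψ b :=
  (freeLiftAdd_single φ ψ b 1).trans (by rw [map_one, one_smul])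

theorem free_hom_ext {f g : free A B ⟶ X}
    (h : ∀ a, Hom.ring f (genR B a) = Hom.ring g (genR B a))
    (h' : ∀ b, Hom.map f (genM A b) = Hom.map g (genM A b)) : f = g := by
  have hr : Hom.ring f = Hom.ring g :=
    MvPolynomial.ringHom_ext' (f := Hom.ring f) (g := Hom.ring g) (RingHom.ext_int _ _) h
  refine hom_ext (fun r => DFunLike.congr_fun hr r) ?_
  intro (m : B →₀ MvPolynomial A ℤ)
  induction m using Finsupp.induction_linear with
  | zero => exact (map_zero (Hom.map f)).trans (map_zero (Hom.map g)).symm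
  | add m n hm hn =>
    exact (map_add (Hom.map f) m n).trans ((congrArg₂ (· + ·) hm hn).trans
      (map_add (Hom.map g) m n).symm)
  | single b p =>
    have e : (Finsupp.single b p : B →₀ MvPolynomial A ℤ) = p • Finsupp.single b 1 := by
      rw [Finsupp.smul_single, smul_eq_mul, mul_one]
    rw [e]
    refine (f.map_smul p _).trans (Eq.trans ?_ (g.map_smul p _).symm)
    exact congrArg₂ (· • ·) (DFunLike.congr_fun hr p) (h' b)

/-- The comonad `FU` of the free-forgetful adjunction between pairs of sets and `Mod`, on
objects. -/
noncomputable abbrev fu (X : ModCat.{u}) : ModCat.{u} := free X.R X.M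

/-- The comonad `FU` on morphisms. -/
noncomputable def fuMap (f : X ⟶ Y) : fu X ⟶ fu Y :=
  freeLift (fu Y) (fun r => genR Y.M (Hom.ring f r)) fun m => genM Y.R (Hom.map f m)

/-- The counit `FU(R; M) → (R; M)`. -/
noncomputable def counit (X : ModCat.{u}) : fu X ⟶ X := freeLift X id id

theorem fuMap_id (X : ModCat.{u}) : fuMap (𝟙 X) = 𝟙 (fu X) :=
  free_hom_ext (fun _ => freeLift_genR _ _ _) fun _ => freeLift_genM _ _ _

theorem fuMap_comp {Z : ModCat.{u}} (f : X ⟶ Y) (g : Y ⟶ Z) :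
    fuMap (f ≫ g) = fuMap f ≫ fuMap g :=
  free_hom_ext
    (fun r => by
      rw [comp_ring, fuMap, fuMap, fuMap, freeLift_genR, freeLift_genR, freeLift_genR, comp_ring])
    fun m => by
      rw [comp_map, fuMap, fuMap, fuMap, freeLift_genM, freeLift_genM, freeLift_genM, comp_map]

theorem fuMap_counit (f : X ⟶ Y) : fuMap f ≫ counit Y = counit X ≫ f :=
  free_hom_ext
    (fun r => by
      rw [comp_ring, comp_ring, fuMap, counit, counit, freeLift_genR, freeLift_genR,
        freeLift_genR, id, id])
    fun m => by
      rw [comp_map, comp_map, fuMap, counit, counit, freeLift_genM, freeLift_genM,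
        freeLift_genM, id, id]

end ModCat

/-- The Mackey functor `H ↦ W_{H ≤ G}(R; M)` of untruncated Witt vectors, as the coequaliser of
`im(w)` applied to the canonical free resolution `FUFU(R; M) ⇉ FU(R; M) → (R; M)`. -/
noncomputable def wittObj (G : Type u) [Group G] [Finite G] (X : ModCat.{u}) : MackeyFunctor G :=
  coeq (ghostImageMap (G := G) (ModCat.fuMap (ModCat.counit X)))
    (ghostImageMap (ModCat.counit (ModCat.fu X)))

theorem witt_condition {X Y : ModCat.{u}} (f : X ⟶ Y) :
    ghostImageMap (G := G) (ModCat.fuMap (ModCat.counit X)) ≫ ghostImageMap (ModCat.fuMap f) ≫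
      coeqMk (ghostImageMap (ModCat.fuMap (ModCat.counit Y)))
        (ghostImageMap (ModCat.counit (ModCat.fu Y))) =
    ghostImageMap (ModCat.counit (ModCat.fu X)) ≫ ghostImageMap (ModCat.fuMap f) ≫
      coeqMk (ghostImageMap (ModCat.fuMap (ModCat.counit Y)))
        (ghostImageMap (ModCat.counit (ModCat.fu Y))) := by
  rw [← Category.assoc, ← Category.assoc, ← ghostImageMap_comp, ← ghostImageMap_comp,
    ← ModCat.fuMap_counit (ModCat.fuMap f), ← ModCat.fuMap_comp, ← ModCat.fuMap_counit f,
    ModCat.fuMap_comp, ghostImageMap_comp, ghostImageMap_comp, Category.assoc, Category.assoc,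
    coeq_condition]

/-- Functoriality of the Witt vectors in the coefficients. -/
noncomputable def wittMap {X Y : ModCat.{u}} (f : X ⟶ Y) : wittObj G X ⟶ wittObj G Y :=
  coeqLift _ _ (ghostImageMap (ModCat.fuMap f) ≫ coeqMk _ _) (witt_condition f)

/-- The functor `W_G : Mod ⥤ Mack_G(Ab)` of untruncated Witt vectors with coefficients. -/
noncomputable def wittMackey (G : Type u) [Group G] [Finite G] :
    ModCat.{u} ⥤ MackeyFunctor G where
  obj := wittObj G
  map f := wittMap f
  map_id X := coeq_ext <| by
    change ghostImageMap (ModCat.fuMap (𝟙 X)) ≫ coeqMk _ _ = coeqMk _ _ ≫ 𝟙 _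
    rw [ModCat.fuMap_id, ghostImageMap_id, Category.id_comp, Category.comp_id]
  map_comp f g := coeq_ext <| by
    change ghostImageMap (ModCat.fuMap (f ≫ g)) ≫ coeqMk _ _ =
      ghostImageMap (ModCat.fuMap f) ≫ ghostImageMap (ModCat.fuMap g) ≫ coeqMk _ _
    rw [ModCat.fuMap_comp, ghostImageMap_comp, Category.assoc]

/-- The (additive) ghost map `w : W_{H ≤ G}(R; M) → gh_{H ≤ G}(R; M)`, as a morphism of Mackey
functors. -/
noncomputable def wittGhost (X : ModCat.{u}) : (wittMackey G).obj X ⟶ ghost G X :=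
  coeqLift _ _ (ghostIncl (ModCat.fu X) ≫ ghostMap (ModCat.counit X)) <| by
    rw [← Category.assoc, ← Category.assoc, ghostImageMap_incl, ghostImageMap_incl,
      Category.assoc, Category.assoc, ← ghostMap_comp, ← ghostMap_comp, ModCat.fuMap_counit]

theorem wittMap_ghost {X Y : ModCat.{u}} (f : X ⟶ Y) :
    (wittMackey G).map f ≫ wittGhost Y = wittGhost X ≫ ghostMap f :=
  coeq_ext <| by
    change ghostImageMap (ModCat.fuMap f) ≫ ghostIncl (ModCat.fu Y) ≫ ghostMap (ModCat.counit Y) =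
      ghostIncl (ModCat.fu X) ≫ ghostMap (ModCat.counit X) ≫ ghostMap f
    rw [← Category.assoc, ghostImageMap_incl, Category.assoc, ← ghostMap_comp, ← ghostMap_comp,
      ModCat.fuMap_counit]

end Witt

/-! ### Modules over commutative monoids and relative tensor products -/

section RelTensor

universe v w

variable {C : Type w} [Category.{v} C] [MonoidalCategory C]

section

variable {D : Type*} [Category* D] [MonoidalCategory D]

/-- The image of a module under a lax monoidal functor, as a module over the image of the
monoid. -/
abbrev modObjObj (F : C ⥤ D) [F.LaxMonoidal] (A M : C) [MonObj A] [ModObj A M] :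
    letI : MonObj (F.obj A) := F.monObjObj (X := A)
    ModObj (F.obj A) (F.obj M) :=
  letI : MonObj (F.obj A) := F.monObjObj (X := A)
  { smul := Functor.LaxMonoidal.μ F A M ≫ F.map (ModObj.smul (M := A) (X := M))
    one_smul := by
      change (Functor.LaxMonoidal.ε F ≫ F.map MonObj.one) ▷ F.obj M ≫
        Functor.LaxMonoidal.μ F A M ≫ F.map (ModObj.smul (M := A) (X := M)) = (λ_ (F.obj M)).hom
      rw [MonoidalCategory.comp_whiskerRight, Category.assoc,
        Functor.LaxMonoidal.μ_natural_left_assoc, ← F.map_comp,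
        Functor.LaxMonoidal.left_unitality]
      congr 3
      exact ModObj.one_smul (M := A) M
    mul_smul := by
      change (Functor.LaxMonoidal.μ F A A ≫ F.map MonObj.mul) ▷ F.obj M ≫
        Functor.LaxMonoidal.μ F A M ≫ F.map (ModObj.smul (M := A) (X := M)) =
        (α_ (F.obj A) (F.obj A) (F.obj M)).hom ≫
          F.obj A ◁ (Functor.LaxMonoidal.μ F A M ≫ F.map (ModObj.smul (M := A) (X := M))) ≫
          Functor.LaxMonoidal.μ F A M ≫ F.map (ModObj.smul (M := A) (X := M))
      have h : MonObj.mul ▷ M ≫ ModObj.smul (M := A) (X := M) =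
          (α_ A A M).hom ≫ A ◁ ModObj.smul (M := A) (X := M) ≫ ModObj.smul (M := A) (X := M) :=
        ModObj.mul_smul (M := A) M
      rw [MonoidalCategory.comp_whiskerRight, Category.assoc,
        Functor.LaxMonoidal.μ_natural_left_assoc, ← F.map_comp, h, F.map_comp, F.map_comp,
        Functor.LaxMonoidal.associativity_assoc, MonoidalCategory.whiskerLeft_comp, Category.assoc,
        Functor.LaxMonoidal.μ_natural_right_assoc] }

end

variable [BraidedCategory C]

/-- The right action on a left module over a commutative monoid. -/
def rightAct (A M : C) [MonObj A] [ModObj A M] : M ⊗ A ⟶ M :=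
  (β_ M A).hom ≫ ModObj.smul (M := A) (X := M)

/-- The map `π : M ⊗ N ⟶ P` exhibits `P` as the relative tensor product `M ⊗_A N`, for modules `M`
and `N` over a commutative monoid `A`: it is a coequaliser of the maps `M ⊗ A ⊗ N ⇉ M ⊗ N` given by
the actions on `M` and on `N`. -/
def IsRelTensor (A : C) {M N P : C} [MonObj A] [IsCommMonObj A] [ModObj A M] [ModObj A N]
    (π : M ⊗ N ⟶ P) : Prop :=
  ∃ h : rightAct A M ▷ N ≫ π = ((α_ M A N).hom ≫ M ◁ ModObj.smul (M := A) (X := N)) ≫ π,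
    Nonempty (Limits.IsColimit (Limits.Cofork.ofπ π h))

end RelTensor

namespace ModCat

section Pair

variable {X Y Z : ModCat.{u}}

/-- The morphism out of a tensor product given by ring homomorphisms and a biadditive map. -/
noncomputable def pairHom (i : X.R →+* Z.R) (j : Y.R →+* Z.R) (b : X.M →+ Y.M →+ Z.M)
    (h : ∀ r s m n, b (r • m) (s • n) = (i r * j s) • b m n) : tensor X Y ⟶ Z :=
  mkHom (Algebra.TensorProduct.lift i.toIntAlgHom j.toIntAlgHom
      (fun _ _ => Commute.all _ _)).toRingHom
    (TensorProduct.liftAddHom b fun k m n => by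
      rw [map_zsmul, map_zsmul, AddMonoidHom.zsmul_apply])
    fun r s m n => h r s m n

theorem pairHom_ring (i : X.R →+* Z.R) (j : Y.R →+* Z.R) (b : X.M →+ Y.M →+ Z.M)
    (h : ∀ r s m n, b (r • m) (s • n) = (i r * j s) • b m n) (r : X.R) (s : Y.R) :
    Hom.ring (pairHom i j b h) (rt r s) = i r * j s := rfl

theorem pairHom_map (i : X.R →+* Z.R) (j : Y.R →+* Z.R) (b : X.M →+ Y.M →+ Z.M)
    (h : ∀ r s m n, b (r • m) (s • n) = (i r * j s) • b m n) (m : X.M) (n : Y.M) :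
    Hom.map (pairHom i j b h) (mt m n) = b m n := rfl

end Pair

/-- The ring homomorphism `ℤ → R`. -/
def intHom (R : Type u) [CommRing R] : ULift.{u} ℤ →+* R :=
  (Int.castRingHom R).comp ULift.ringEquiv.toRingHom

variable (R : Type u) [CommRing R] (M : Type u) [AddCommGroup M] [Module R M]

/-- The object `(R; M)`. -/
abbrev of : ModCat.{u} := ⟨R, M⟩

/-- The action `(ℤ; R) ⊗ (ℤ; M) → (ℤ; M)`, `(k ⊗ l, r ⊗ m) ↦ (k l, r m)`. -/
noncomputable def actZ : zmod R ⊗ zmod M ⟶ zmod M :=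
  pairHom (X := zmod R) (Y := zmod M) (Z := zmod M) (RingHom.id (ULift.{u} ℤ))
    (RingHom.id (ULift.{u} ℤ)) (smulAddHom R M) fun (k l : ULift.{u} ℤ) (r : R) (m : M) =>
      show (k.down • r) • (l.down • m) = (k.down * l.down) • (r • m) by
        rw [mul_smul, smul_assoc, smul_comm r l.down]

/-- The action `(ℤ; R) ⊗ (R; R) → (R; R)`, `(k ⊗ s, r ⊗ m) ↦ (k s, r m)`. -/
noncomputable def actR : zmod R ⊗ self R ⟶ self R :=
  pairHom (X := zmod R) (Y := self R) (Z := self R) (intHom R) (RingHom.id R) (smulAddHom R R)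
    fun (k : ULift.{u} ℤ) (s r m : R) =>
      show (k.down • r) * (s * m) = ((k.down : R) * s) * (r * m) by
        rw [zsmul_eq_mul]; ring

/-- The map `(R; R) ⊗ (ℤ; M) → (R; M)`, `(s ⊗ k, r ⊗ m) ↦ (k s, r m)`. -/
noncomputable def actPi : self R ⊗ zmod M ⟶ of R M :=
  pairHom (X := self R) (Y := zmod M) (Z := of R M) (RingHom.id R) (intHom R) (smulAddHom R M)
    fun (s : R) (k : ULift.{u} ℤ) (r : R) (m : M) =>
      show (s * r) • (k.down • m) = (s * (k.down : R)) • (r • m) by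
        rw [mul_smul, mul_smul, smul_comm r k.down, Int.cast_smul_eq_zsmul]

/-- The unit `(ℤ; ℤ) → (ℤ; R)`. -/
def oneZ : 𝟙_ ModCat.{u} ⟶ zmod R where
  ring := RingHom.id (ULift.{u} ℤ)
  map := (intHom R).toAddMonoidHom
  map_smul k l := show ((k.down * l.down : ℤ) : R) = k.down • (l.down : R) by
    rw [zsmul_eq_mul, Int.cast_mul]

/-- The monoid `(ℤ; R)` in `Mod`. -/
noncomputable instance : MonObj (zmod R) where
  one := oneZ R
  mul := actZ R R
  one_mul := tensor_ext
    (fun (k l : ULift.{u} ℤ) => show k * l = ((k.down : ℤ) : ULift.{u} ℤ) * l from rfl)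
    (fun (k : ULift.{u} ℤ) (m : R) => show (k.down : R) * m = k.down • m from (zsmul_eq_mul _ _).symm)
  mul_one := tensor_ext
    (fun (k l : ULift.{u} ℤ) => show k * l = ((l.down : ℤ) : ULift.{u} ℤ) * k from
      mul_comm (G := ULift.{u} ℤ) k l)
    (fun (m : R) (k : ULift.{u} ℤ) => show m * (k.down : R) = k.down • m by rw [zsmul_eq_mul, mul_comm])
  mul_assoc := tensor_ext₃ (fun k l m => mul_assoc (G := ULift.{u} ℤ) k l m)
    (fun k l m => mul_assoc (G := R) k l m)

instance : IsCommMonObj (zmod R) where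
  mul_comm := tensor_ext (fun k l => mul_comm (G := ULift.{u} ℤ) l k)
    (fun k l => mul_comm (G := R) l k)

/-- The `(ℤ; R)`-module `(ℤ; M)`. -/
noncomputable instance modZ : ModObj (zmod R) (zmod M) where
  smul := actZ R M
  one_smul := tensor_ext
    (fun (k l : ULift.{u} ℤ) => show k * l = ((k.down : ℤ) : ULift.{u} ℤ) * l from rfl)
    (fun (k : ULift.{u} ℤ) (m : M) => show (k.down : R) • m = k.down • m from Int.cast_smul_eq_zsmul _ _ _)
  mul_smul := tensor_ext₃ (fun k l m => mul_assoc (G := ULift.{u} ℤ) k l m)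
    (fun (k l : R) (m : M) => mul_smul (α := R) k l m)

/-- The `(ℤ; R)`-module `(R; R)`. -/
noncomputable instance modR : ModObj (zmod R) (self R) where
  smul := actR R
  one_smul := tensor_ext
    (fun (k : ULift.{u} ℤ) (r : R) => show ((k.down : ℤ) : R) * r = ((k.down : ℤ) : R) * r from rfl)
    (fun (k : ULift.{u} ℤ) (m : R) => show (k.down : R) * m = k.down • m from (zsmul_eq_mul _ _).symm)
  mul_smul := tensor_ext₃
    (fun (k l : ULift.{u} ℤ) (r : R) => show ((k.down * l.down : ℤ) : R) * r = (k.down : R) * ((l.down : R) * r) by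
      rw [Int.cast_mul, mul_assoc])
    (fun k l m => mul_assoc (G := R) k l m)

end ModCat

end WittMackey

open WittMackey

/-!
The argument is a calculation with generators. For an invariant function `f : G/K → M`, the norm of
the pure tensor `⨂_{c ∈ G/K} f(c)` has the ghost component `⨂_{c ∈ G/U} f(cK)` at every `U ≤ K`
(`normFam_pure`). So norms of pure tensors do not depend on coset representatives, they are
compatible with restriction, conjugation and maps of coefficients, and the shuffle map multiplies
them pointwise. The norm of a sum of pure tensors is a sum of transfers of norms of pure tensors
(`normElt_sum`), and signs can be removed by expanding the norm of `m - m = 0`. Hence the image of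
the ghost map is generated under transfers by the norms of those pure tensors whose entries lie in
any given set of additive generators of `M` (`generates_pureIm`). The same follows for `W(R; M)`,
where a norm only depends on `f : G/K → M` (`wittMk_pureIm`). By Frobenius reciprocity, products of
norms generate box products (`Generates.box`). All identities between morphisms are checked on such
generators. This applies to the coherence of the external product `μ`, which descends from the
shuffle map on ghost components, and of `ε`, which sends `1` to the norm of `1`.

That `μ` is invertible is first shown for free coefficients and for the images of the ghost maps in
place of the Witt vectors. Surjectivity is clear on generators. For injectivity, choose the monomial
multiples of the module generators as additive generators of a free module. The pairs of norms of
tensors of such monomials, in the two factors, form a system of sets with restrictions and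
conjugations, and the free Mackey functor on this system maps onto the box product. An element of a
free Mackey functor is zero if its restriction to each `U` is zero modulo proper transfers
(`ResSystem.eq_zero_of_mark`). The component at `U` of a ghost vector over `U` kills proper
transfers, and on the generators at `U` it takes distinct tensors of monomials as values, which are
linearly independent. So the composite from the free Mackey functor to the ghost components of the
tensor product is injective (`injective_to_ghost`, `imagePairing_injective`), and with it the
external product. The same argument, for the one-point system, shows that `ε` is injective.

General coefficients follow by descent: for a surjection `Z → X`, a morphism out of the image of the
ghost map for `Z` induces one out of `W(X)` if its values on norms only depend on the images of the
entries in `X` (`exists_descent`). Entries with the same image have to be related. If `X` is the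
quotient of `Z` by a reflexive pair, then any two such elements are the images of a single one
(`exists_of_reflexive`), which may be chosen simultaneously for all entries of an invariant
function. The reflexive pair `FUFU(X) ⊗ FUFU(Y) ⇉ FU(X) ⊗ FU(Y)` yields the retraction of `μ`
(`exists_wittMu_retraction`). In the same way, `W` preserves the coequaliser of the reflexive pair
`(R; R) ⊗ (ℤ; R) ⊗ (ℤ; M) ⇉ (R; R) ⊗ (ℤ; M)`, which is `(R; M)` (`exists_wittMackey_desc`), and as
`W` is strong monoidal, this is the statement on relative box products (`isRelTensor_map`).
-/

namespace WittMackey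

open Fam

/-! ### Norms of pure tensors -/

/-- The functions on `G` that are invariant under right translation by `K`, that is, the functions
on `G/K`. Restriction along `K ≤ H` does not change the underlying function on `G`. -/
def invSystem (G : Type u) [Group G] [Finite G] (S : Type u) : ResSystem G where
  obj K := {f : G → S // ∀ g, ∀ k ∈ K, f (g * k) = f g}
  res h f := ⟨f.1, fun g k hk => f.2 g k (h hk)⟩
  conj x H H' e f := ⟨fun g => f.1 (g * x), fun g k hk => by
    rw [e, mem_conj] at hk
    change f.1 (g * k * x) = f.1 (g * x)
    rw [← f.2 (g * x) _ hk]
    group⟩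
  res_self _ _ := rfl
  conj_self hg _ f := Subtype.ext (funext fun a => f.2 a _ hg)
  res_res _ _ _ _ := rfl
  conj_conj _ _ _ f := Subtype.ext (funext fun a => by simp only [mul_assoc])
  conj_res _ _ _ _ _ := rfl

variable {G : Type u} [Group G] [Finite G] {S T : Type u} {X Y : ModCat.{u}}

/-- The invariant functions `f : G/K → S`. -/
abbrev Inv (K : Subgroup G) (S : Type u) : Type u := (invSystem G S).obj K

/-- Composing an invariant function with a map of the values. -/
def Inv.map (φ : S → T) {K : Subgroup G} (f : Inv K S) : Inv K T :=
  ⟨fun g => φ (f.1 g), fun g k hk => congrArg φ (f.2 g k hk)⟩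

theorem Inv.out_eq {K U : Subgroup G} (f : Inv K S) (h : U ≤ K) (g : G) :
    f.1 ((g : G ⧸ U).out) = f.1 g := by
  have : g⁻¹ * (g : G ⧸ U).out ∈ U := QuotientGroup.eq.1 (QuotientGroup.out_eq' _).symm
  rw [← f.2 g _ (h this), mul_inv_cancel_left]

/-- A function on cosets as an invariant function on the group. -/
def Inv.ofCoset {K : Subgroup G} (m : G ⧸ K → S) : Inv K S :=
  ⟨fun g => m g, fun g k hk => congrArg m (by
    rw [QuotientGroup.eq]
    simpa using hk)⟩

open Classical in
/-- The family with component `⨂_{c ∈ G/U} f(c)` at `U ≤ K`. -/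
noncomputable def pureFam {K : Subgroup G} (f : Inv K X.M) : Fam G X := fun U =>
  if U ≤ K then X.pure (fun c : G ⧸ U => f.1 c.out) else 0

theorem pureFam_of_le {K U : Subgroup G} (f : Inv K X.M) (h : U ≤ K) :
    pureFam f U = X.pure (fun c : G ⧸ U => f.1 c.out) := if_pos h

theorem pureFam_of_not_le {K U : Subgroup G} (f : Inv K X.M) (h : ¬ U ≤ K) :
    pureFam f U = 0 := if_neg h

/-- Norms of pure tensors do not depend on the choice of coset representatives. -/
theorem normFam_pure {K : Subgroup G} (f : Inv K X.M) (σ : G ⧸ K → G)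
    (hσ : Function.RightInverse σ QuotientGroup.mk) :
    normFam K σ hσ (X.pure fun c => f.1 c.out) = pureFam f := by
  funext U
  by_cases h : U ≤ K
  · rw [normFam_of_le h, pureFam_of_le f h, ModCat.pow, ModCat.block_pure]
    congr 1
    ext c
    obtain ⟨a, rfl⟩ := QuotientGroup.mk_surjective c
    rw [prod_fst, f.out_eq le_rfl, f.out_eq h]
  · rw [normFam_of_not_le h, pureFam_of_not_le f h]

theorem pure_ofCoset {K : Subgroup G} (m : G ⧸ K → X.M) :
    (X.pure fun c => (Inv.ofCoset m).1 c.out) = X.pure m := by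
  congr 1
  ext c
  exact congrArg m (QuotientGroup.out_eq' c)

theorem pureFam_mem {K : Subgroup G} (f : Inv K X.M) : pureFam f ∈ ghostSub X K := by
  rw [← normFam_pure f Quotient.out Quotient.out_eq']
  exact normFam_mem _ _ _ _

theorem cut_pureFam {J K : Subgroup G} (h : J ≤ K) (f : Inv K X.M) :
    cut J (pureFam f) = pureFam ((invSystem G X.M).res h f) := by
  funext U
  by_cases hU : U ≤ J
  · rw [cut_apply_of_le hU, pureFam_of_le _ hU, pureFam_of_le _ (hU.trans h)]
    rfl
  · rw [cut_apply_of_not_le hU, pureFam_of_not_le _ hU]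

theorem smul_pureFam {x : G} {K K' : Subgroup G} (e : K' = MulAut.conj x • K) (f : Inv K X.M) :
    x • pureFam f = pureFam ((invSystem G X.M).conj x e f) := by
  funext U'
  have e' := conj_conj_inv x U'
  generalize MulAut.conj x⁻¹ • U' = U at e'
  rw [smul_apply x _ e']
  by_cases h : U ≤ K
  · have h' : U' ≤ K' := conj_mono h e e'
    rw [pureFam_of_le f h, pureFam_of_le _ h', ModCat.tpIdx_pure]
    congr 1
    ext c
    obtain ⟨c, rfl⟩ := (cosetConj x e').surjective c
    obtain ⟨a, rfl⟩ := QuotientGroup.mk_surjective c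
    rw [Equiv.symm_apply_apply, f.out_eq h, cosetConj_mk, Inv.out_eq _ h']
    change _ = f.1 (a * x⁻¹ * x)
    rw [inv_mul_cancel_right]
  · have h' : ¬ U' ≤ K' := fun h' => h <| by
      rw [e, e'] at h'
      exact Subgroup.pointwise_smul_le_pointwise_smul_iff.1 h'
    rw [pureFam_of_not_le _ h, pureFam_of_not_le _ h', map_zero]

theorem map_pureFam (φ : X ⟶ Y) {K : Subgroup G} (f : Inv K X.M) :
    Fam.map φ (pureFam f) = pureFam (f.map (ModCat.Hom.map φ)) := by
  funext U
  by_cases h : U ≤ K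
  · rw [map_apply, pureFam_of_le _ h, pureFam_of_le _ h, ModCat.tpMap_pure]
    rfl
  · rw [map_apply, pureFam_of_not_le _ h, pureFam_of_not_le _ h, map_zero]

/-- The norm of a pure tensor as an element of the ghost group. -/
noncomputable def pureGh {K : Subgroup G} (f : Inv K X.M) : (ghost G X).obj K :=
  ⟨pureFam f, pureFam_mem f⟩

theorem normElt_pure {K : Subgroup G} (f : Inv K X.M) (σ : G ⧸ K → G)
    (hσ : Function.RightInverse σ QuotientGroup.mk) :
    normElt K σ hσ (X.pure fun c => f.1 c.out) = pureGh f :=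
  Subtype.ext (normFam_pure f σ hσ)

theorem pureGh_mem {K : Subgroup G} (f : Inv K X.M) : pureGh f ∈ wittSub X K := by
  rw [← normElt_pure f Quotient.out Quotient.out_eq', ← (ghost G X).tr_self le_rfl (normElt _ _ _ _)]
  exact tr_norm_mem _ _ _ _

/-- The norm of a pure tensor as an element of the image of the ghost map. -/
noncomputable def pureIm {K : Subgroup G} (f : Inv K X.M) : (ghostImage G X).obj K :=
  ⟨pureGh f, pureGh_mem f⟩

theorem res_pureIm {J K : Subgroup G} (h : J ≤ K) (f : Inv K X.M) :
    (ghostImage G X).res h (pureIm f) = pureIm ((invSystem G X.M).res h f) :=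
  Subtype.ext (Subtype.ext (cut_pureFam h f))

theorem conj_pureIm {x : G} {K K' : Subgroup G} (e : K' = MulAut.conj x • K) (f : Inv K X.M) :
    (ghostImage G X).conj x e (pureIm f) = pureIm ((invSystem G X.M).conj x e f) :=
  Subtype.ext (Subtype.ext (smul_pureFam e f))

theorem ghostImageMap_pureIm (φ : X ⟶ Y) {K : Subgroup G} (f : Inv K X.M) :
    MackeyFunctor.Hom.app (ghostImageMap φ) K (pureIm f) = pureIm (f.map (ModCat.Hom.map φ)) :=
  Subtype.ext (Subtype.ext (map_pureFam φ f))

/-! ### The norm of a sum -/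

section NormSum

variable {V : Subgroup G} {I : Type} (s : I → Inv V X.M) (σ : G ⧸ V → G)
  (hσ : Function.RightInverse σ QuotientGroup.mk)

/-- For `g ∈ G`, the element `v ∈ V` with `g v = σ(gV)`. -/
def repDiff (g : G) : V := ⟨g⁻¹ * σ g, QuotientGroup.eq.1 (hσ g).symm⟩

theorem repDiff_mul (g : G) (v : V) : repDiff σ hσ (g * v) = v⁻¹ * repDiff σ hσ g := by
  refine Subtype.ext ?_
  have : ((g * v : G) : G ⧸ V) = g := QuotientGroup.mk_mul_of_mem g v.2
  change (g * v)⁻¹ * σ ((g * v : G) : G ⧸ V) = (v : G)⁻¹ * (g⁻¹ * σ (g : G ⧸ V))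
  rw [this, mul_inv_rev, mul_assoc]

/-- Functions `V → I`, with `V` acting by translations. They index the summands of the norm of a
sum indexed by `I`. -/
def Choice {G : Type u} [Group G] (V : Subgroup G) (I : Type) : Type u := V → I

instance (V : Subgroup G) (I : Type) : MulAction V (Choice V I) := arrowAction

theorem choice_smul_apply (v : V) (φ : Choice V I) (w : V) : (v • φ) w = φ (v⁻¹ * w) := rfl

/-- The function `V → I` induced by a function on cosets; the inverse makes the stabiliser act
by right multiplication on the argument. -/
def Choice.ofCoset {U : Subgroup G} (ψ : V ⧸ U.subgroupOf V → I) : Choice V I :=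
  fun w => ψ (w⁻¹ : V)

/-- The stabiliser of a function `V → I`, as a subgroup of `G`. -/
def choiceStab (φ : Choice V I) : Subgroup G := (MulAction.stabilizer V φ).map V.subtype

theorem choiceStab_le (φ : Choice V I) : choiceStab φ ≤ V := by
  rintro _ ⟨v, -, rfl⟩
  exact v.2

theorem mem_choiceStab {φ : Choice V I} (v : V) : (v : G) ∈ choiceStab φ ↔ v • φ = φ := by
  constructor
  · rintro ⟨w, hw, e⟩
    rw [← show w = v from Subtype.ext e]
    exact hw
  · exact fun h => ⟨v, h, rfl⟩

/-- The function that takes its values from the summands that are chosen by `φ`: its value at `g` is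
that of `s i` for `i = φ(v)`, where `v ∈ V` is determined by `g v = σ(gV)`. -/
def choiceFun (φ : Choice V I) (g : G) : X.M := (s (φ (repDiff σ hσ g))).1 g

theorem choiceFun_mul (φ : Choice V I) (g : G) (v : V) :
    choiceFun s σ hσ φ (g * v) = choiceFun s σ hσ (v • φ) g := by
  rw [choiceFun, repDiff_mul, (s _).2 g v v.2]
  rfl

/-- The function `choiceFun`, as an invariant function under the stabiliser. -/
def choiceInv (φ : Choice V I) : Inv (choiceStab φ) X.M :=
  ⟨choiceFun s σ hσ φ, by
    intro g k hk
    have h := choiceFun_mul s σ hσ φ g ⟨k, choiceStab_le φ hk⟩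
    rwa [(mem_choiceStab ⟨k, choiceStab_le φ hk⟩).1 hk] at h⟩

theorem choiceStab_smul (v : V) (φ : Choice V I) :
    choiceStab (v • φ) = MulAut.conj (v : G) • choiceStab φ := by
  ext g
  rw [mem_conj]
  have key : ∀ w : V, (w : G) ∈ choiceStab (v • φ) ↔
      ((v⁻¹ * w * v : V) : G) ∈ choiceStab φ := fun w => by
    rw [mem_choiceStab, mem_choiceStab, mul_smul, mul_smul, inv_smul_eq_iff]
  constructor
  · intro h
    exact (key ⟨g, choiceStab_le _ h⟩).1 h
  · intro h
    have hg : g ∈ V := by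
      have := V.mul_mem (V.mul_mem v.2 (choiceStab_le _ h)) (V.inv_mem v.2)
      have e : (v : G) * ((v : G)⁻¹ * g * v) * (v : G)⁻¹ = g := by group
      rwa [e] at this
    exact (key ⟨g, hg⟩).2 h

theorem smul_choice (v : V) (φ : Choice V I) :
    (v : G) • pureFam (choiceInv s σ hσ φ) = pureFam (choiceInv s σ hσ (v • φ)) := by
  rw [smul_pureFam (choiceStab_smul v φ)]
  congr 1
  exact Subtype.ext (funext fun g => choiceFun_mul s σ hσ φ g v)

noncomputable instance [Finite I] : Fintype (Choice V I) :=
  @Fintype.ofFinite _ (inferInstanceAs (Finite (V → I)))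

noncomputable instance [Finite I] : Fintype (MulAction.orbitRel.Quotient V (Choice V I)) :=
  @Fintype.ofFinite _ (inferInstanceAs (Finite (Quotient _)))

/-- Expanding the norm of a sum of pure tensors. By multilinearity, the component at `U ≤ V` is the
sum over all functions `V/U → I`; these are the functions `V → I` whose stabiliser contains `U`. -/
theorem normFam_sum [Fintype I] :
    normFam V σ hσ (∑ i, X.pure fun c => (s i).1 c.out) =
      ∑ φ : Choice V I, pureFam (choiceInv s σ hσ φ) := by
  classical
  funext U
  have hsum : (∑ φ : Choice V I, pureFam (choiceInv s σ hσ φ)) U =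
      ∑ φ : Choice V I, pureFam (choiceInv s σ hσ φ) U := Finset.sum_apply _ _ _
  rw [hsum]
  by_cases h : U ≤ V
  · rw [normFam_of_le h, ModCat.pow]
    let _ : Fintype (V ⧸ U.subgroupOf V) := Fintype.ofFinite _
    rw [MultilinearMap.map_sum]
    refine Fintype.sum_of_injective
      (Choice.ofCoset (U := U) (V := V) (I := I)) ?_ _ _ ?_ ?_
    · intro ψ ψ' e
      ext c
      obtain ⟨w, rfl⟩ := QuotientGroup.mk_surjective c
      have := congrFun e w⁻¹
      simpa [Choice.ofCoset] using this
    · intro φ hφ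
      refine pureFam_of_not_le _ fun hU => hφ ?_
      refine ⟨fun c => φ c.out⁻¹, ?_⟩
      funext w
      have h1 : (((w⁻¹ : V) : V ⧸ U.subgroupOf V).out)⁻¹ * w⁻¹ ∈ U.subgroupOf V :=
        QuotientGroup.eq.1 (QuotientGroup.out_eq' _)
      have h2 := (mem_choiceStab (φ := φ) _).1 (hU (Subgroup.mem_subgroupOf.1 h1))
      change φ (((w⁻¹ : V) : V ⧸ U.subgroupOf V).out)⁻¹ = φ w
      conv_lhs => rw [← h2, choice_smul_apply]
      congr 1
      group
    · intro ψ
      have hU : U ≤ choiceStab (Choice.ofCoset ψ) := by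
        intro u hu
        refine (mem_choiceStab ⟨u, h hu⟩).2 ?_
        funext w
        rw [choice_smul_apply]
        refine congrArg ψ ?_
        rw [QuotientGroup.eq, Subgroup.mem_subgroupOf]
        simpa using hu
      rw [pureFam_of_le _ hU, ModCat.block_pure]
      congr 1
      ext c
      obtain ⟨a, rfl⟩ := QuotientGroup.mk_surjective c
      rw [prod_fst, (s _).out_eq le_rfl, Inv.out_eq _ hU]
      change _ = (s (ψ ((repDiff σ hσ a)⁻¹ : V))).1 a
      refine congrArg (fun w => (s (ψ w)).1 a) ?_
      refine congrArg QuotientGroup.mk (Subtype.ext ?_)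
      change (σ (a : G ⧸ V))⁻¹ * a = (a⁻¹ * σ (a : G ⧸ V))⁻¹
      rw [mul_inv_rev, inv_inv]
  · rw [normFam_of_not_le h]
    exact (Finset.sum_eq_zero fun φ _ =>
      pureFam_of_not_le _ fun hU => h (hU.trans (choiceStab_le φ))).symm

/-- A sum over all functions `V → I` is a sum of transfers, indexed by the orbits. -/
theorem sum_choice [Finite I] :
    ∑ φ : Choice V I, pureFam (choiceInv s σ hσ φ) =
      ∑ q : MulAction.orbitRel.Quotient V (Choice V I),
        ghostTr (choiceStab q.out) V (pureFam (choiceInv s σ hσ q.out)) := by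
  classical
  rw [← Finset.sum_fiberwise Finset.univ
    (fun φ => (Quotient.mk'' φ : MulAction.orbitRel.Quotient V (Choice V I)))]
  refine Finset.sum_congr rfl fun q _ => ?_
  have hq : ∀ i : {φ : Choice V I // (Quotient.mk'' φ : MulAction.orbitRel.Quotient V _) = q},
      ∃ v : V, v • q.out = i.1 := fun i => by
    have : MulAction.orbitRel V (Choice V I) i.1 q.out :=
      Quotient.exact (i.2.trans (Quotient.out_eq' q).symm)
    exact this
  choose r hr using hq
  rw [ghostTr, sumOver_eq (fun i => (r i : G)) (fun i => (r i).2)]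
  · rw [← Finset.sum_subtype (s := Finset.univ.filter fun φ : Choice V I =>
      (Quotient.mk'' φ : MulAction.orbitRel.Quotient V _) = q)
      (f := fun φ => pureFam (choiceInv s σ hσ φ)) (p := fun φ : Choice V I =>
      (Quotient.mk'' φ : MulAction.orbitRel.Quotient V _) = q) (by simp) |>.symm]
    refine Finset.sum_congr rfl fun i _ => ?_
    rw [smul_choice, hr]
  · intro x hx
    refine ⟨⟨(⟨x, hx⟩ : V) • q.out, ?_⟩, ?_⟩
    · rw [← Quotient.out_eq' q]
      exact Quotient.sound (s := MulAction.orbitRel V (Choice V I))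
        ⟨⟨x, hx⟩, by rw [Quotient.out_eq' q]⟩
    · rw [QuotientGroup.leftRel_apply]
      generalize hi : (⟨_, _⟩ : {φ : Choice V I // _}) = i
      have := hr i
      rw [← hi] at this
      refine (mem_choiceStab (φ := q.out) (⟨x, hx⟩⁻¹ * r i)).2 ?_
      rw [← hi, mul_smul, this, inv_smul_smul]
  · intro i j hij
    rw [QuotientGroup.leftRel_apply] at hij
    have := (mem_choiceStab (φ := q.out) ((r i)⁻¹ * r j)).1 hij
    rw [mul_smul, inv_smul_eq_iff, hr, hr] at this
    exact Subtype.ext this.symm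
  · intro x y hxy hx
    rw [QuotientGroup.leftRel_apply] at hxy
    have := V.mul_mem hx (choiceStab_le _ hxy)
    rwa [mul_inv_cancel_left] at this
  · intro x hx y hy hxy
    rw [QuotientGroup.leftRel_apply] at hxy
    rw [← ghost_mul_right (pureFam_mem (choiceInv s σ hσ q.out)) x _ hxy, mul_inv_cancel_left]

theorem ghost_coe_sum {H : Subgroup G} {J : Type*} [Fintype J] (f : J → (ghost G X).obj H) :
    (∑ j, f j).1 = ∑ j, (f j).1 := map_sum (ghostSub X H).subtype f _

/-- The norm of a sum of pure tensors is a sum of transfers of norms of pure tensors. -/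
theorem normElt_sum [Fintype I] :
    normElt V σ hσ (∑ i, X.pure fun c => (s i).1 c.out) =
      ∑ q : MulAction.orbitRel.Quotient V (Choice V I),
        (ghost G X).tr (choiceStab_le q.out) (pureGh (choiceInv s σ hσ q.out)) := by
  refine Subtype.ext ((normFam_sum s σ hσ).trans ((sum_choice s σ hσ).trans ?_))
  rw [ghost_coe_sum]
  rfl

end NormSum

end WittMackey

namespace WittMackey

open Fam

variable {G : Type u} [Group G] [Finite G] {X Y : ModCat.{u}}

/-! ### Generators of the image of the ghost map -/

section Generation

variable {ι : Type u} [Finite ι] [Nonempty ι] {S : Set X.M}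

/-- If `S` generates `M` as an abelian group, then tensors of elements of `S` generate the tensor
powers. -/
theorem closure_pure (hS : AddSubgroup.closure S = ⊤) :
    AddSubgroup.closure (Set.range fun s : ι → S => X.pure fun i => (s i : X.M)) = ⊤ := by
  set Λ := AddSubgroup.closure (Set.range fun s : ι → S => X.pure fun i => (s i : X.M)) with hΛ
  have hS' : Submodule.span ℤ (Set.range ((↑) : S → X.M)) = ⊤ := by
    rw [Subtype.range_coe]
    refine Submodule.toAddSubgroup_injective ?_
    rw [Submodule.span_int_eq_addSubgroupClosure, hS]
    rfl
  let F₀ : MultilinearMap ℤ (fun _ : ι => X.M) (X.TP ι) :=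
    { toFun := X.pure
      map_update_add' := fun m i x y => by convert ModCat.pure_update_add (X := X) m i x y
      map_update_smul' := fun m i k x => by
        have h := ModCat.pure_update_smul (X := X) m i (k : X.R) x
        rw [Int.cast_smul_eq_zsmul, Int.cast_smul_eq_zsmul] at h
        convert h }
  let F : MultilinearMap ℤ (fun _ : ι => X.M) (X.TP ι ⧸ Λ) :=
    (QuotientAddGroup.mk' Λ).toIntLinearMap.compMultilinearMap F₀
  have hF : F = 0 := MultilinearMap.ext_of_span_eq_top (g := fun _ : ι => ((↑) : S → X.M))
    (fun _ => hS') fun s => (QuotientAddGroup.eq_zero_iff _).2 (AddSubgroup.subset_closure ⟨s, rfl⟩)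
  have h0 : ∀ x : X.TP ι, QuotientAddGroup.mk' Λ x = 0 :=
    ModCat.TP_ext (g := 0) fun m => DFunLike.congr_fun hF m
  exact eq_top_iff.2 fun x _ => (QuotientAddGroup.eq_zero_iff x).1 (h0 x)

/-- Every tensor is a finite sum of pure tensors of elements of `±S`. -/
theorem exists_sum_pure (hS : AddSubgroup.closure S = ⊤) (x : X.TP ι) :
    ∃ (I : Type) (_ : Fintype I) (s : I → ι → X.M), (∀ i c, s i c ∈ S ∨ -s i c ∈ S) ∧
      x = ∑ i, X.pure (s i) := by
  classical
  have hx : x ∈ AddSubgroup.closure (Set.range fun s : ι → S => X.pure fun i => (s i : X.M)) := by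
    rw [closure_pure hS]
    trivial
  induction hx using AddSubgroup.closure_induction with
  | mem x hx =>
    obtain ⟨s, rfl⟩ := hx
    exact ⟨Unit, inferInstance, fun _ i => s i, fun _ c => .inl (s c).2, by simp⟩
  | zero => exact ⟨Empty, inferInstance, fun i => i.elim, fun i => i.elim, by simp⟩
  | add x y _ _ hx hy =>
    obtain ⟨I, _, s, hs, rfl⟩ := hx
    obtain ⟨J, _, t, ht, rfl⟩ := hy
    exact ⟨I ⊕ J, inferInstance, Sum.elim s t, fun i => by cases i <;> simp [hs, ht], by simp⟩
  | neg x _ hx =>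
    obtain ⟨I, _, s, hs, rfl⟩ := hx
    obtain ⟨c⟩ := ‹Nonempty ι›
    refine ⟨I, inferInstance, fun i => Function.update (s i) c (-s i c), fun i d => ?_, ?_⟩
    · by_cases h : d = c
      · subst h
        simpa using (hs i d).symm
      · simpa [Function.update_of_ne h] using hs i d
    · rw [← Finset.sum_neg_distrib]
      refine Finset.sum_congr rfl fun i _ => ?_
      change _ = X.pure (Function.update (s i) c (-s i c))
      rw [← neg_one_smul X.R (s i c), ModCat.pure_update_smul, Function.update_eq_self,
        neg_one_smul]

/-- A pure tensor of elements of `±S` is plus or minus a pure tensor of elements of `S`. -/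
theorem pure_sign (m : ι → X.M) (h : ∀ c, m c ∈ S ∨ -m c ∈ S) :
    ∃ s : ι → X.M, (∀ c, s c ∈ S) ∧ (X.pure m = X.pure s ∨ X.pure m = -X.pure s) := by
  classical
  let _ := Fintype.ofFinite ι
  have h' : ∀ c, ∃ (e : ℤˣ) (s : X.M), s ∈ S ∧ m c = ((e : ℤ) : X.R) • s := fun c => by
    rcases h c with h | h
    · exact ⟨1, _, h, by simp⟩
    · exact ⟨-1, _, h, by simp⟩
  choose e s hs hm using h'
  refine ⟨s, hs, ?_⟩
  rw [funext hm]
  have := MultilinearMap.map_smul_univ (PiTensorProduct.tprod X.R)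
    (fun c => ((e c : ℤ) : X.R)) s
  have hprod : ∏ c, (((e c : ℤ)) : X.R) = (((∏ c, e c : ℤˣ) : ℤ) : X.R) := by push_cast; rfl
  rw [hprod] at this
  rcases Int.units_eq_one_or (∏ c, e c) with h1 | h1
  · left
    refine this.trans ?_
    rw [h1]
    simp
  · right
    refine this.trans ?_
    rw [h1]
    simp

end Generation

theorem normFam_zero (V : Subgroup G) (σ : G ⧸ V → G)
    (hσ : Function.RightInverse σ QuotientGroup.mk) : normFam V σ hσ (0 : X.TP (G ⧸ V)) = 0 := by
  funext U
  by_cases h : U ≤ V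
  · rw [normFam_of_le h, ModCat.pow]
    exact MultilinearMap.map_coord_zero _ (QuotientGroup.mk (1 : V)) rfl
  · rw [normFam_of_not_le h]
    rfl

variable {S : Set X.M}

/-- The transfers of the norms of pure tensors of elements of `±S` lie in the group generated by
those of pure tensors of elements of `S`. A norm of a pure tensor with sign `-1` is expressed by
transfers from smaller subgroups, by expanding the norm of `s + (-s) = 0`. -/
theorem tr_pureGh_sign {H : Subgroup G} (Γ : AddSubgroup ((ghost G X).obj H))
    (hΓ : ∀ (K : Subgroup G) (hK : K ≤ H) (f : Inv K X.M), (∀ g, f.1 g ∈ S) →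
      (ghost G X).tr hK (pureGh f) ∈ Γ)
    (K : Subgroup G) (hK : K ≤ H) (f : Inv K X.M) (hf : ∀ g, f.1 g ∈ S ∨ -f.1 g ∈ S) :
    (ghost G X).tr hK (pureGh f) ∈ Γ := by
  classical
  induction hn : Nat.card K using Nat.strong_induction_on generalizing K with
  | _ n ih =>
  obtain ⟨s, hs, hsign⟩ := pure_sign (S := S) (fun c : G ⧸ K => f.1 c.out) fun c => hf _
  have hσ : Function.RightInverse (Quotient.out : G ⧸ K → G) QuotientGroup.mk :=
    QuotientGroup.out_eq'
  rw [← pure_ofCoset s] at hsign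
  rcases hsign with h | h
  · rw [← normElt_pure f _ hσ, h, normElt_pure]
    exact hΓ K hK _ fun g => hs _
  · let t : Bool → Inv K X.M := fun b => cond b (Inv.ofCoset s) f
    have ht : ∀ b g, (t b).1 g ∈ S ∨ -(t b).1 g ∈ S := by
      rintro (_ | _) g
      · exact hf g
      · exact .inl (hs _)
    have hsum : ∑ b, X.pure (fun c : G ⧸ K => (t b).1 c.out) = 0 := by
      rw [Fintype.sum_bool]
      refine (congrArg (X.pure (fun c : G ⧸ K => (t true).1 c.out) + ·) h).trans ?_
      exact add_neg_cancel _
    have key := normElt_sum t Quotient.out hσ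
    -- the norm of zero vanishes, so the summands of the expansion add up to zero
    rw [hsum] at key
    have hz : normElt K Quotient.out hσ (0 : X.TP (G ⧸ K)) = 0 :=
      Subtype.ext (normFam_zero K _ hσ)
    rw [hz] at key
    replace key := congrArg ((ghost G X).tr hK) key
    rw [map_zero, map_sum] at key
    -- the summand for the constant function `false` is the transfer of the norm of `f`
    let q₀ : MulAction.orbitRel.Quotient K (Choice K Bool) :=
      Quotient.mk'' (fun _ => false : Choice K Bool)
    have hconst : ∀ φ : Choice K Bool, choiceStab φ = K → ∃ b, φ = fun _ => b := by
      intro φ hφ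
      refine ⟨φ 1, funext fun w => ?_⟩
      have hw : ((w⁻¹ : K) : G) ∈ choiceStab φ := hφ.symm ▸ (w⁻¹).2
      have := congrFun ((mem_choiceStab _).1 hw) 1
      rw [choice_smul_apply, inv_inv, mul_one] at this
      exact this
    have heq : ∀ (φ : Choice K Bool) (b : Bool), (φ = fun _ => b) →
        (ghost G X).tr hK ((ghost G X).tr (choiceStab_le φ)
          (pureGh (choiceInv t Quotient.out hσ φ))) = (ghost G X).tr hK (pureGh (t b)) := by
      intro φ b hφ
      have hst : choiceStab φ = K := le_antisymm (choiceStab_le φ) fun w hw =>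
        (mem_choiceStab ⟨w, hw⟩).2 (by rw [hφ]; rfl)
      have hfun : (choiceInv t Quotient.out hσ φ).1 = (t b).1 := funext fun g => by
        change (t (φ _)).1 g = _
        rw [hφ]
      have : ∀ (J : Subgroup G) (hJ : J ≤ K) (f' : Inv J X.M), J = K → f'.1 = (t b).1 →
          (ghost G X).tr hK ((ghost G X).tr hJ (pureGh f')) =
            (ghost G X).tr hK (pureGh (t b)) := by
        rintro J hJ f' rfl h'
        rw [(ghost G X).tr_self, Subtype.ext h']
      exact this _ _ _ hst hfun
    have hq₀ : q₀.out = (fun _ => false : Choice K Bool) := by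
      obtain ⟨v, hv⟩ : MulAction.orbitRel K (Choice K Bool) q₀.out (fun _ => false) :=
        Quotient.exact (Quotient.out_eq' q₀)
      exact hv.symm
    rw [← Finset.add_sum_erase _ _ (Finset.mem_univ q₀), heq _ false hq₀] at key
    change (ghost G X).tr hK (pureGh (t false)) ∈ Γ
    rw [eq_neg_of_add_eq_zero_left key.symm]
    refine Γ.neg_mem (Γ.sum_mem fun q hq => ?_)
    by_cases hst : choiceStab q.out = K
    · obtain ⟨b, hb⟩ := hconst _ hst
      cases b with
      | false =>
        refine absurd ?_ (Finset.ne_of_mem_erase hq)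
        rw [← Quotient.out_eq' q, hb]
      | true =>
        rw [heq _ true hb]
        exact hΓ K hK _ fun g => hs _
    · -- the remaining summands are transferred from proper subgroups of `K`
      rw [(ghost G X).tr_tr _ hK ((choiceStab_le _).trans hK)]
      refine ih (Nat.card (choiceStab q.out)) ?_ _ _ _ (fun g => ht _ _) rfl
      rw [← hn]
      refine lt_of_le_of_ne (Subgroup.card_le_of_le (choiceStab_le _)) fun hc => hst ?_
      exact Subgroup.eq_of_le_of_card_ge (choiceStab_le _) hc.ge

/-- If `S` generates `M` as an abelian group, then the image of the ghost map is generated by the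
transfers of the norms of the pure tensors of elements of `S`. -/
theorem wittSub_le (hS : AddSubgroup.closure S = ⊤) {H : Subgroup G}
    (Γ : AddSubgroup ((ghost G X).obj H))
    (hΓ : ∀ (K : Subgroup G) (hK : K ≤ H) (f : Inv K X.M), (∀ g, f.1 g ∈ S) →
      (ghost G X).tr hK (pureGh f) ∈ Γ) : wittSub X H ≤ Γ := by
  refine (AddSubgroup.closure_le _).2 ?_
  rintro _ ⟨V, hV, σ, hσ, m, rfl⟩
  obtain ⟨I, _, s, hs, rfl⟩ := exists_sum_pure hS m
  have : ∑ i, X.pure (s i) = ∑ i, X.pure fun c => (Inv.ofCoset (s i)).1 c.out :=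
    Finset.sum_congr rfl fun i _ => (pure_ofCoset (s i)).symm
  rw [this, normElt_sum (fun i => Inv.ofCoset (s i)), SetLike.mem_coe, map_sum]
  refine Γ.sum_mem fun q _ => ?_
  rw [(ghost G X).tr_tr _ hV ((choiceStab_le _).trans hV)]
  exact tr_pureGh_sign Γ hΓ _ _ _ fun g => hs _ _

/-- A family of elements of a Mackey functor generates it if their transfers generate all the
groups. -/
def Generates {M : MackeyFunctor G} {D : Subgroup G → Type u} (φ : ∀ K, D K → M.obj K) : Prop :=
  ∀ H : Subgroup G, AddSubgroup.closure {z | ∃ (K : Subgroup G) (hK : K ≤ H) (d : D K),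
    z = M.tr hK (φ K d)} = ⊤

theorem Generates.induction {M : MackeyFunctor G} {D : Subgroup G → Type u}
    {φ : ∀ K, D K → M.obj K} (h : Generates φ) {H : Subgroup G} {p : M.obj H → Prop}
    (hp : ∀ (K : Subgroup G) (hK : K ≤ H) (d : D K), p (M.tr hK (φ K d)))
    (h0 : p 0) (hadd : ∀ x y, p x → p y → p (x + y)) (hneg : ∀ x, p x → p (-x)) (z : M.obj H) :
    p z := by
  have hz : z ∈ AddSubgroup.closure {z | ∃ (K : Subgroup G) (hK : K ≤ H) (d : D K),
      z = M.tr hK (φ K d)} := by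
    rw [h H]
    trivial
  induction hz using AddSubgroup.closure_induction with
  | mem x hx =>
    obtain ⟨K, hK, d, rfl⟩ := hx
    exact hp K hK d
  | zero => exact h0
  | add x y _ _ hx hy => exact hadd x y hx hy
  | neg x _ hx => exact hneg x hx

theorem Generates.mem {M : MackeyFunctor G} {D : Subgroup G → Type u}
    {φ : ∀ K, D K → M.obj K} (h : Generates φ) {H : Subgroup G} (Γ : AddSubgroup (M.obj H))
    (hp : ∀ (K : Subgroup G) (hK : K ≤ H) (d : D K), M.tr hK (φ K d) ∈ Γ) (z : M.obj H) :
    z ∈ Γ :=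
  h.induction hp Γ.zero_mem (fun _ _ => Γ.add_mem) (fun _ => Γ.neg_mem) z

theorem Generates.hom_ext {M P : MackeyFunctor G} {D : Subgroup G → Type u}
    {φ : ∀ K, D K → M.obj K} (h : Generates φ) {f g : M ⟶ P}
    (hfg : ∀ K d, MackeyFunctor.Hom.app f K (φ K d) = MackeyFunctor.Hom.app g K (φ K d)) :
    f = g :=
  MackeyFunctor.hom_ext fun H z => h.induction
    (p := fun z => MackeyFunctor.Hom.app f H z = MackeyFunctor.Hom.app g H z)
    (fun K hK d => by rw [f.app_tr, g.app_tr, hfg]) (by simp)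
    (fun x y hx hy => by rw [map_add, map_add, hx, hy]) (fun x hx => by rw [map_neg, map_neg, hx]) z

/-- Generators are carried to generators by a surjective morphism. -/
theorem Generates.of_surj {M N : MackeyFunctor G} {D D' : Subgroup G → Type u}
    {φ : ∀ K, D K → M.obj K} {ψ : ∀ K, D' K → N.obj K} (h : Generates φ) (f : M ⟶ N)
    (hf : ∀ H, Function.Surjective (MackeyFunctor.Hom.app f H))
    (hφ : ∀ K d, ∃ d', MackeyFunctor.Hom.app f K (φ K d) = ψ K d') : Generates ψ := by
  intro H
  refine eq_top_iff.2 fun z _ => ?_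
  obtain ⟨z, rfl⟩ := hf H z
  refine h.mem ((AddSubgroup.closure {z | ∃ (K : Subgroup G) (hK : K ≤ H) (d : D' K),
    z = N.tr hK (ψ K d)}).comap (MackeyFunctor.Hom.app f H)) (fun K hK d => ?_) z
  rw [AddSubgroup.mem_comap, f.app_tr]
  obtain ⟨d', hd'⟩ := hφ K d
  exact AddSubgroup.subset_closure ⟨K, hK, d', by rw [hd']⟩

/-- A morphism of Mackey functors that hits generators is surjective. -/
theorem Generates.surjective {M N : MackeyFunctor G} {D : Subgroup G → Type u}
    {ψ : ∀ K, D K → N.obj K} (h : Generates ψ) (f : M ⟶ N)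
    (hf : ∀ K d, ∃ z, MackeyFunctor.Hom.app f K z = ψ K d) (H : Subgroup G) :
    Function.Surjective (MackeyFunctor.Hom.app f H) := fun z =>
  h.mem (MackeyFunctor.Hom.app f H).range (fun K hK d => by
    obtain ⟨z, hz⟩ := hf K d
    exact ⟨M.tr hK z, by rw [f.app_tr, hz]⟩) z

/-- A subset `S` that generates the module gives generators of the image of the ghost map. -/
theorem generates_pureIm (hS : AddSubgroup.closure S = ⊤) :
    Generates (M := ghostImage G X) (D := fun K => {f : Inv K X.M // ∀ g, f.1 g ∈ S})
      fun _ f => pureIm f.1 := by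
  intro H
  refine eq_top_iff.2 fun z _ => ?_
  set Λ := AddSubgroup.closure {z : (ghostImage G X).obj H | ∃ (K : Subgroup G) (hK : K ≤ H)
    (d : {f : Inv K X.M // ∀ g, f.1 g ∈ S}), z = (ghostImage G X).tr hK (pureIm d.1)}
  have := wittSub_le hS (Λ.map (wittSub X H).subtype) (fun K hK f hf =>
    ⟨(ghostImage G X).tr hK (pureIm f), AddSubgroup.subset_closure ⟨K, hK, ⟨f, hf⟩, rfl⟩, rfl⟩) z.2
  obtain ⟨z', hz', e⟩ := this
  rwa [← Subtype.ext e]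

end WittMackey

namespace WittMackey

open Fam MackeyFunctor

variable {G : Type u} [Group G] [Finite G]

/-! ### Generators of Witt vectors -/

section WittGenerators

variable {X Y Z : ModCat.{u}} {P : MackeyFunctor G}

/-- The projection from the image of the ghost map for `FU(R; M)` to the Witt vectors. -/
noncomputable def wittMk (X : ModCat.{u}) : ghostImage G (ModCat.fu X) ⟶ (wittMackey G).obj X :=
  coeqMk _ _

theorem wittMk_surj (X : ModCat.{u}) (H : Subgroup G) :
    Function.Surjective (Hom.app (wittMk X) H) := quotMk_surj _ _ H

/-- The norm of the pure tensor `⨂_{c ∈ G/K} f(c)` in the Witt vectors. -/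
noncomputable def wittNorm {K : Subgroup G} (f : Inv K X.M) : ((wittMackey G).obj X).obj K :=
  Hom.app (wittMk X) K (pureIm (f.map (ModCat.genM X.R)))

/-- In the Witt vectors, the norm of a pure tensor with entries in the free module `FU(R; M)` only
depends on the images of the entries in `M`: this is what the relations coming from `FUFU(R; M)`
say on norms. -/
theorem wittMk_pureIm {K : Subgroup G} (a : Inv K (ModCat.fu X).M) :
    Hom.app (wittMk X) K (pureIm a) = wittNorm (a.map (ModCat.Hom.map (ModCat.counit X))) := by
  have h := congrArg (fun t => Hom.app t K (pureIm (a.map (ModCat.genM (ModCat.fu X).R))))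
    (coeq_condition (ghostImageMap (G := G) (ModCat.fuMap (ModCat.counit X)))
      (ghostImageMap (ModCat.counit (ModCat.fu X))))
  simp only [comp_app, ghostImageMap_pureIm] at h
  have e1 : (a.map (ModCat.genM (ModCat.fu X).R)).map
      (ModCat.Hom.map (ModCat.counit (ModCat.fu X))) = a :=
    Subtype.ext (funext fun g => ModCat.freeLift_genM _ _ _)
  have e2 : (a.map (ModCat.genM (ModCat.fu X).R)).map
      (ModCat.Hom.map (ModCat.fuMap (ModCat.counit X))) =
        (a.map (ModCat.Hom.map (ModCat.counit X))).map (ModCat.genM X.R) :=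
    Subtype.ext (funext fun g => ModCat.freeLift_genM _ _ _)
  rw [e1, e2] at h
  exact h.symm

theorem generates_pureIm_all (X : ModCat.{u}) :
    Generates (M := ghostImage G X) (D := fun K => Inv K X.M) fun _ f => pureIm f :=
  (generates_pureIm (S := Set.univ) AddSubgroup.closure_univ).of_surj (𝟙 _)
    (fun _ => Function.surjective_id) fun _ d => ⟨d.1, rfl⟩

theorem generates_wittNorm (X : ModCat.{u}) :
    Generates (M := (wittMackey G).obj X) (D := fun K => Inv K X.M) fun _ f => wittNorm f :=
  (generates_pureIm_all (ModCat.fu X)).of_surj (wittMk X) (wittMk_surj X)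
    fun _ d => ⟨_, wittMk_pureIm d⟩

theorem res_wittNorm {J K : Subgroup G} (h : J ≤ K) (f : Inv K X.M) :
    ((wittMackey G).obj X).res h (wittNorm f) = wittNorm ((invSystem G X.M).res h f) := by
  rw [wittNorm, ← Hom.app_res, res_pureIm]
  rfl

theorem conj_wittNorm {x : G} {K K' : Subgroup G} (e : K' = MulAut.conj x • K) (f : Inv K X.M) :
    ((wittMackey G).obj X).conj x e (wittNorm f) = wittNorm ((invSystem G X.M).conj x e f) := by
  rw [wittNorm, ← Hom.app_conj, conj_pureIm]
  rfl

theorem map_wittNorm (φ : X ⟶ Y) {K : Subgroup G} (f : Inv K X.M) :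
    Hom.app ((wittMackey G).map φ) K (wittNorm f) = wittNorm (f.map (ModCat.Hom.map φ)) := by
  change Hom.app (wittMk Y) K (Hom.app (ghostImageMap (ModCat.fuMap φ)) K _) = _
  rw [ghostImageMap_pureIm]
  have e : (f.map (ModCat.genM X.R)).map (ModCat.Hom.map (ModCat.fuMap φ)) =
      (f.map (ModCat.Hom.map φ)).map (ModCat.genM Y.R) :=
    Subtype.ext (funext fun g => ModCat.freeLift_genM _ _ _)
  rw [e]
  rfl

theorem wittGhost_wittNorm {K : Subgroup G} (f : Inv K X.M) :
    Hom.app (wittGhost X) K (wittNorm f) = pureGh f := by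
  refine Subtype.ext ((map_pureFam (ModCat.counit X) (f.map (ModCat.genM X.R))).trans ?_)
  congr 1
  exact Subtype.ext (funext fun g => ModCat.freeLift_genM _ _ _)

/-- Let `Z → X` be surjective. A morphism out of the image of the ghost map for `Z` whose values on
norms of pure tensors only depend on the images of the entries in `X` induces a morphism out of the
Witt vectors of `X`. -/
theorem exists_descent (π : Z ⟶ X) (hR : Function.Surjective (ModCat.Hom.ring π))
    (hM : Function.Surjective (ModCat.Hom.map π)) (k : ghostImage G Z ⟶ P)
    (hk : ∀ (K : Subgroup G) (z z' : Inv K Z.M), z.map (ModCat.Hom.map π) =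
      z'.map (ModCat.Hom.map π) → Hom.app k K (pureIm z) = Hom.app k K (pureIm z')) :
    ∃ k' : (wittMackey G).obj X ⟶ P, ∀ (K : Subgroup G) (z : Inv K Z.M),
      Hom.app k' K (wittNorm (z.map (ModCat.Hom.map π))) = Hom.app k K (pureIm z) := by
  -- a lift of the counit along `π`, which exists since `FU(X)` is free
  let t : ModCat.fu X ⟶ Z := ModCat.freeLift Z (Function.surjInv hR) (Function.surjInv hM)
  have ht : t ≫ π = ModCat.counit X := ModCat.free_hom_ext
    (fun r => by
      rw [ModCat.comp_ring, ModCat.freeLift_genR, ModCat.counit, ModCat.freeLift_genR]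
      exact Function.surjInv_eq hR r)
    fun m => by
      rw [ModCat.comp_map, ModCat.freeLift_genM, ModCat.counit, ModCat.freeLift_genM]
      exact Function.surjInv_eq hM m
  refine ⟨coeqLift _ _ (ghostImageMap t ≫ k) ?_, ?_⟩
  · refine (generates_pureIm_all _).hom_ext fun K a => ?_
    simp only [comp_app, ghostImageMap_pureIm]
    refine hk K _ _ (Subtype.ext (funext fun g => ?_))
    change ModCat.Hom.map (ModCat.fuMap (ModCat.counit X) ≫ t ≫ π) _ =
      ModCat.Hom.map (ModCat.counit (ModCat.fu X) ≫ t ≫ π) _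
    rw [ht, ModCat.fuMap_counit]
  · intro K z
    change Hom.app k K (Hom.app (ghostImageMap t) K (pureIm _)) = _
    rw [ghostImageMap_pureIm]
    refine hk K _ _ (Subtype.ext (funext fun g => ?_))
    change ModCat.Hom.map (t ≫ π) (ModCat.genM X.R _) = _
    rw [ht, ModCat.counit, ModCat.freeLift_genM]
    rfl

end WittGenerators

/-! ### Generators of box products -/

section BoxGenerators

variable {M N P Q : MackeyFunctor G} {D D' : Subgroup G → Type u}
  {φ : ∀ K, D K → M.obj K} {ψ : ∀ K, D' K → N.obj K}

/-- Products of generators generate the box product, if one of the two families of generators is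
closed under restriction: by Frobenius reciprocity, `x · tr(y) = tr(res(x) · y)`. -/
theorem Generates.box (hφ : Generates φ) (hψ : Generates ψ)
    (hres : ∀ {K H : Subgroup G} (h : K ≤ H) (d : D H), ∃ d', M.res h (φ H d) = φ K d') :
    Generates (M := MackeyFunctor.box M N) (D := fun K => D K × D' K)
      fun K d => bx (φ K d.1) (ψ K d.2) := by
  intro H
  refine eq_top_iff.2 fun z _ => ?_
  set Λ := fun H : Subgroup G => AddSubgroup.closure {z : (MackeyFunctor.box M N).obj H |
    ∃ (K : Subgroup G) (hK : K ≤ H) (d : D K × D' K),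
      z = (MackeyFunctor.box M N).tr hK (bx (φ K d.1) (ψ K d.2))} with hΛ
  have htr : ∀ {K H : Subgroup G} (h : K ≤ H) (z), z ∈ Λ K →
      (MackeyFunctor.box M N).tr h z ∈ Λ H := by
    intro K H h z hz
    refine (AddSubgroup.closure_le (K := (Λ H).comap ((MackeyFunctor.box M N).tr h))).2 ?_ hz
    rintro _ ⟨L, hL, d, rfl⟩
    rw [SetLike.mem_coe, AddSubgroup.mem_comap, MackeyFunctor.tr_tr _ hL h (hL.trans h)]
    exact AddSubgroup.subset_closure ⟨L, hL.trans h, d, rfl⟩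
  have h1 : ∀ (K : Subgroup G) (d : D K) (n : N.obj K), bx (φ K d) n ∈ Λ K := by
    intro K d n
    refine hψ.mem ((Λ K).comap (bxHom M N K (φ K d))) (fun L hL d' => ?_) n
    rw [AddSubgroup.mem_comap, bxHom_apply, bx_tr_right]
    obtain ⟨d'', hd''⟩ := hres hL d
    rw [hd'']
    exact AddSubgroup.subset_closure ⟨L, hL, (d'', d'), rfl⟩
  have h2 : ∀ (K : Subgroup G) (m : M.obj K) (n : N.obj K), bx m n ∈ Λ K := by
    intro K m n
    refine hφ.mem ((Λ K).comap ((bxHom M N K).flip n)) (fun L hL d => ?_) m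
    rw [AddSubgroup.mem_comap, AddMonoidHom.flip_apply, bxHom_apply, bx_tr_left]
    exact htr hL _ (h1 L d _)
  exact box_induction z (fun K hK m n => htr hK _ (h2 K m n)) (Λ H).zero_mem
    (fun _ _ => (Λ H).add_mem) fun _ => (Λ H).neg_mem

theorem generates_one : Generates (M := burnside G) (D := fun _ => PUnit) fun K _ => one K := by
  intro H
  refine eq_top_iff.2 fun z _ => ?_
  exact burnside_induction z (fun K hK => AddSubgroup.subset_closure ⟨K, hK, ⟨⟩, rfl⟩)
    (zero_mem _) (fun _ _ => add_mem) fun _ => neg_mem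

/-- Exchanging the arguments of a pairing. -/
def _root_.WittMackey.MackeyFunctor.Pairing.flip (p : Pairing M N P) : Pairing N M P where
  app H := (p.app H).flip
  res h m n := p.res h n m
  conj h m n := p.conj h n m
  tr_left h m n := p.tr_right h n m
  tr_right h m n := p.tr_left h n m

/-- Composing a pairing with a morphism. -/
def _root_.WittMackey.MackeyFunctor.Pairing.post (p : Pairing M N P) (f : P ⟶ Q) :
    Pairing M N Q where
  app H := (AddMonoidHom.compHom (Hom.app f H)).comp (p.app H)
  res h m n := (f.app_res h _).symm.trans (congrArg _ (p.res h m n))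
  conj h m n := (f.app_conj h _).symm.trans (congrArg _ (p.conj h m n))
  tr_left h m n := (congrArg _ (p.tr_left h m n)).trans (f.app_tr h _)
  tr_right h m n := (congrArg _ (p.tr_right h m n)).trans (f.app_tr h _)

end BoxGenerators

/-! ### The external product on ghost components -/

section Shuffle

variable {X Y : ModCat.{u}}

/-- The pointwise tensor product of invariant functions. -/
def Inv.tmul {K : Subgroup G} (f : Inv K X.M) (g : Inv K Y.M) :
    Inv K (ModCat.tensor X Y).M :=
  ⟨fun x => ModCat.mt (f.1 x) (g.1 x), fun x k hk =>
    congrArg₂ ModCat.mt (f.2 x k hk) (g.2 x k hk)⟩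

theorem shuffle_ext {ι : Type u} [Nonempty ι] {E : Type*} [AddCommGroup E]
    {f g : X.TP ι →+ Y.TP ι →+ E} (h : ∀ m n, f (X.pure m) (Y.pure n) = g (X.pure m) (Y.pure n)) :
    f = g :=
  AddMonoidHom.ext <| ModCat.TP_ext fun m => AddMonoidHom.ext <| ModCat.TP_ext fun n => h m n

theorem tpIdx_shuffle {ι κ : Type u} [Nonempty ι] [Nonempty κ] (γ : ι ≃ κ) (x : X.TP ι)
    (y : Y.TP ι) : (ModCat.tensor X Y).tpIdx γ (ModCat.shuffle X Y ι x y) =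
      ModCat.shuffle X Y κ (X.tpIdx γ x) (Y.tpIdx γ y) := by
  let f : X.TP ι →+ Y.TP ι →+ (ModCat.tensor X Y).TP κ :=
    (AddMonoidHom.compHom ((ModCat.tensor X Y).tpIdx γ)).comp (ModCat.shuffle X Y ι)
  let g : X.TP ι →+ Y.TP ι →+ (ModCat.tensor X Y).TP κ :=
    (AddMonoidHom.compHom.flip (Y.tpIdx γ)).comp ((ModCat.shuffle X Y κ).comp (X.tpIdx γ))
  have : f = g := shuffle_ext fun m n => by
    change (ModCat.tensor X Y).tpIdx γ (ModCat.shuffle X Y ι (X.pure m) (Y.pure n)) =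
      ModCat.shuffle X Y κ (X.tpIdx γ (X.pure m)) (Y.tpIdx γ (Y.pure n))
    rw [ModCat.shuffle_pure, ModCat.tpIdx_pure, ModCat.tpIdx_pure, ModCat.tpIdx_pure,
      ModCat.shuffle_pure]
  exact DFunLike.congr_fun (DFunLike.congr_fun this x) y

/-- The shuffle map on families. -/
noncomputable def famShuffle (X Y : ModCat.{u}) :
    Fam G X →+ Fam G Y →+ Fam G (ModCat.tensor X Y) :=
  AddMonoidHom.mk' (fun a => AddMonoidHom.mk'
    (fun b U => ModCat.shuffle X Y (G ⧸ U) (a U) (b U)) fun b b' => funext fun U =>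
      map_add (ModCat.shuffle X Y (G ⧸ U) (a U)) (b U) (b' U)) fun a a' => AddMonoidHom.ext
    fun b => funext fun U =>
      DFunLike.congr_fun (map_add (ModCat.shuffle X Y (G ⧸ U)) (a U) (a' U)) (b U)

theorem famShuffle_apply (a : Fam G X) (b : Fam G Y) (U : Subgroup G) :
    famShuffle X Y a b U = ModCat.shuffle X Y (G ⧸ U) (a U) (b U) := rfl

theorem cut_famShuffle (K : Subgroup G) (a : Fam G X) (b : Fam G Y) :
    cut K (famShuffle X Y a b) = famShuffle X Y (cut K a) b := by
  funext U
  by_cases h : U ≤ K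
  · rw [cut_apply_of_le h, famShuffle_apply, famShuffle_apply, cut_apply_of_le h]
  · rw [cut_apply_of_not_le h, famShuffle_apply, cut_apply_of_not_le h, map_zero,
      AddMonoidHom.zero_apply]

theorem cut_famShuffle' (K : Subgroup G) (a : Fam G X) (b : Fam G Y) :
    cut K (famShuffle X Y a b) = famShuffle X Y a (cut K b) := by
  funext U
  by_cases h : U ≤ K
  · rw [cut_apply_of_le h, famShuffle_apply, famShuffle_apply, cut_apply_of_le h]
  · rw [cut_apply_of_not_le h, famShuffle_apply, cut_apply_of_not_le h, map_zero]

theorem cut_famShuffle_both (K : Subgroup G) (a : Fam G X) (b : Fam G Y) :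
    cut K (famShuffle X Y a b) = famShuffle X Y (cut K a) (cut K b) := by
  rw [← cut_famShuffle, ← cut_famShuffle', cut_cut, inf_idem]

theorem smul_famShuffle (x : G) (a : Fam G X) (b : Fam G Y) :
    x • famShuffle X Y a b = famShuffle X Y (x • a) (x • b) := by
  funext U
  have e := conj_conj_inv x U
  rw [smul_apply x _ e, famShuffle_apply, famShuffle_apply, smul_apply x _ e, smul_apply x _ e,
    tpIdx_shuffle]

theorem famShuffle_mem {H : Subgroup G} {a : Fam G X} {b : Fam G Y} (ha : a ∈ ghostSub X H)
    (hb : b ∈ ghostSub Y H) : famShuffle X Y a b ∈ ghostSub (ModCat.tensor X Y) H :=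
  ⟨by rw [cut_famShuffle, ha.1], fun h hh => by rw [smul_famShuffle, ha.2 h hh, hb.2 h hh]⟩

theorem famShuffle_pureFam {K : Subgroup G} (f : Inv K X.M) (g : Inv K Y.M) :
    famShuffle X Y (pureFam f) (pureFam g) = pureFam (f.tmul g) := by
  funext U
  rw [famShuffle_apply]
  by_cases h : U ≤ K
  · rw [pureFam_of_le _ h, pureFam_of_le _ h, pureFam_of_le _ h, ModCat.shuffle_pure]
    rfl
  · rw [pureFam_of_not_le f h, pureFam_of_not_le g h, pureFam_of_not_le _ h, map_zero]

theorem famShuffle_tr_left {K H : Subgroup G} {a : Fam G X} {b : Fam G Y}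
    (ha : a ∈ ghostSub X K) (hb : b ∈ ghostSub Y H) :
    famShuffle X Y (ghostTr K H a) b = ghostTr K H (famShuffle X Y a (cut K b)) := by
  rw [← cut_famShuffle', cut_famShuffle, ha.1]
  refine (DFunLike.congr_fun (map_sumOver (famShuffle X Y) _) b).trans ?_
  refine (map_sumOver (AddMonoidHom.eval b) _).trans (sumOver_congr fun x hx => ?_)
  rw [smul_famShuffle, hb.2 x hx]
  rfl

theorem famShuffle_tr_right {K H : Subgroup G} {a : Fam G X} {b : Fam G Y}
    (ha : a ∈ ghostSub X H) (hb : b ∈ ghostSub Y K) :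
    famShuffle X Y a (ghostTr K H b) = ghostTr K H (famShuffle X Y (cut K a) b) := by
  rw [← cut_famShuffle, cut_famShuffle', hb.1]
  refine (map_sumOver (famShuffle X Y a) _).trans (sumOver_congr fun x hx => ?_)
  rw [smul_famShuffle, ha.2 x hx]

/-- The external product of ghost components. -/
noncomputable def ghostPairing (X Y : ModCat.{u}) :
    Pairing (ghost G X) (ghost G Y) (ghost G (ModCat.tensor X Y)) where
  app _ := AddMonoidHom.mk' (fun a => AddMonoidHom.mk'
    (fun b => ⟨famShuffle X Y a.1 b.1, famShuffle_mem a.2 b.2⟩) fun b b' => Subtype.ext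
      (map_add (famShuffle X Y a.1) b.1 b'.1)) fun a a' => AddMonoidHom.ext fun b => Subtype.ext <|
      DFunLike.congr_fun (map_add (famShuffle X Y) a.1 a'.1) b.1
  res _ m n := Subtype.ext (cut_famShuffle_both _ m.1 n.1)
  conj _ m n := Subtype.ext (smul_famShuffle _ m.1 n.1)
  tr_left _ m n := Subtype.ext (famShuffle_tr_left m.2 n.2)
  tr_right _ m n := Subtype.ext (famShuffle_tr_right m.2 n.2)

theorem ghostPairing_pureGh {K : Subgroup G} (f : Inv K X.M) (g : Inv K Y.M) :
    (ghostPairing X Y).app K (pureGh f) (pureGh g) = pureGh (f.tmul g) :=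
  Subtype.ext (famShuffle_pureFam f g)

theorem ghostPairing_mem {H : Subgroup G} (a : (ghostImage G X).obj H)
    (b : (ghostImage G Y).obj H) :
    (ghostPairing X Y).app H a.1 b.1 ∈ wittSub (ModCat.tensor X Y) H := by
  have h1 : ∀ (K : Subgroup G) (f : Inv K X.M) (b : (ghostImage G Y).obj K),
      (ghostPairing X Y).app K (pureGh f) b.1 ∈ wittSub (ModCat.tensor X Y) K := by
    intro K f b
    refine (generates_pureIm_all Y).mem ((wittSub (ModCat.tensor X Y) K).comap
      (((ghostPairing X Y).app K (pureGh f)).comp (wittSub Y K).subtype)) (fun L hL g => ?_) b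
    refine AddSubgroup.mem_comap.2 ?_
    change (ghostPairing X Y).app K (pureGh f) ((ghost G Y).tr hL (pureGh g)) ∈ _
    rw [(ghostPairing X Y).tr_right]
    refine (wittSub_stable _).tr hL _ ?_
    have : (ghost G X).res hL (pureGh f) = pureGh ((invSystem G X.M).res hL f) :=
      Subtype.ext (cut_pureFam hL f)
    rw [this, ghostPairing_pureGh]
    exact pureGh_mem _
  refine (generates_pureIm_all X).mem ((wittSub (ModCat.tensor X Y) H).comap
    (((ghostPairing X Y).app H).flip b.1 |>.comp (wittSub X H).subtype)) (fun L hL g => ?_) a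
  refine AddSubgroup.mem_comap.2 ?_
  change (ghostPairing X Y).app H ((ghost G X).tr hL (pureGh g)) b.1 ∈ _
  rw [(ghostPairing X Y).tr_left]
  exact (wittSub_stable _).tr hL _ (h1 L g ((ghostImage G Y).res hL b))

/-- The external product on the images of the ghost maps. -/
noncomputable def imagePairing (X Y : ModCat.{u}) :
    Pairing (ghostImage G X) (ghostImage G Y) (ghostImage G (ModCat.tensor X Y)) where
  app H := AddMonoidHom.mk' (fun a => AddMonoidHom.mk'
    (fun b => ⟨(ghostPairing X Y).app H a.1 b.1, ghostPairing_mem a b⟩) fun b b' => Subtype.ext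
      (map_add ((ghostPairing X Y).app H a.1) b.1 b'.1)) fun a a' => AddMonoidHom.ext fun b =>
      Subtype.ext <| DFunLike.congr_fun (map_add ((ghostPairing X Y).app H) a.1 a'.1) b.1
  res h m n := Subtype.ext ((ghostPairing X Y).res h m.1 n.1)
  conj h m n := Subtype.ext ((ghostPairing X Y).conj h m.1 n.1)
  tr_left h m n := Subtype.ext ((ghostPairing X Y).tr_left h m.1 n.1)
  tr_right h m n := Subtype.ext ((ghostPairing X Y).tr_right h m.1 n.1)

theorem imagePairing_pureIm {K : Subgroup G} (f : Inv K X.M) (g : Inv K Y.M) :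
    (imagePairing X Y).app K (pureIm f) (pureIm g) = pureIm (f.tmul g) :=
  Subtype.ext (ghostPairing_pureGh f g)

end Shuffle

end WittMackey

namespace WittMackey

open Fam MackeyFunctor

variable {G : Type u} [Group G] [Finite G]

/-! ### Tensor products of free objects -/

namespace ModCat

variable {A A' B B' : Type u} {Z : ModCat.{u}}

/-- The biadditive map on `ℤ[A](B) × ℤ[A'](B')` determined by a function on `B × B'`. It is the map
that is determined, in the first variable, by additive maps in the second variable. -/
noncomputable def freePairAdd (φ : A → Z.R) (φ' : A' → Z.R) (ψ : B × B' → Z.M) :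
    (free A B).M →+ (free A' B').M →+ Z.M :=
  freeLiftAdd ⟨Z.R, (free A' B').M →+ Z.M⟩ φ fun b => freeLiftAdd Z φ' fun b' => ψ (b, b')

theorem freePairAdd_single (φ : A → Z.R) (φ' : A' → Z.R) (ψ : B × B' → Z.M) (b : B)
    (p : MvPolynomial A ℤ) (n : (free A' B').M) :
    freePairAdd φ φ' ψ (Finsupp.single b p : B →₀ MvPolynomial A ℤ) n =
      MvPolynomial.eval₂Hom (Int.castRingHom Z.R) φ p •
        freeLiftAdd Z φ' (fun b' => ψ (b, b')) n :=
  DFunLike.congr_fun (freeLiftAdd_single (X := ⟨Z.R, (free A' B').M →+ Z.M⟩) _ _ _ _) n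

theorem freePairAdd_smul (φ : A → Z.R) (φ' : A' → Z.R) (ψ : B × B' → Z.M)
    (r : (free A B).R) (s : (free A' B').R) (m : (free A B).M) (n : (free A' B').M) :
    freePairAdd φ φ' ψ (r • m) (s • n) =
      (MvPolynomial.eval₂Hom (Int.castRingHom Z.R) φ r *
        MvPolynomial.eval₂Hom (Int.castRingHom Z.R) φ' s) • freePairAdd φ φ' ψ m n := by
  have h1 := DFunLike.congr_fun (freeLiftAdd_smul (X := ⟨Z.R, (free A' B').M →+ Z.M⟩) φ
    (fun b => freeLiftAdd Z φ' fun b' => ψ (b, b')) r m) (s • n)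
  refine h1.trans ?_
  rw [mul_smul]
  refine congrArg (fun z : Z.M => MvPolynomial.eval₂Hom (Int.castRingHom Z.R) φ r • z) ?_
  change freePairAdd φ φ' ψ m (s • n) = _
  clear h1
  revert m
  intro (m : B →₀ MvPolynomial A ℤ)
  induction m using Finsupp.induction_linear with
  | zero =>
    refine (DFunLike.congr_fun (map_zero (freePairAdd φ φ' ψ)) _).trans ?_
    refine Eq.trans ?_ (congrArg _ (DFunLike.congr_fun (map_zero (freePairAdd φ φ' ψ)) n).symm)
    exact (smul_zero _).symm
  | add m m' hm hm' =>
    refine (DFunLike.congr_fun (map_add (freePairAdd φ φ' ψ) m m') _).trans ?_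
    refine Eq.trans ?_ (congrArg _ (DFunLike.congr_fun (map_add (freePairAdd φ φ' ψ) m m') n).symm)
    exact (congrArg₂ (· + ·) hm hm').trans (smul_add _ _ _).symm
  | single b p =>
    rw [freePairAdd_single, freePairAdd_single, smul_comm]
    exact congrArg _ (freeLiftAdd_smul φ' _ s n)

/-- The morphism out of the tensor product of two free objects that is determined by the images of
the generators. -/
noncomputable def freePair (φ : A → Z.R) (φ' : A' → Z.R) (ψ : B × B' → Z.M) :
    tensor (free A B) (free A' B') ⟶ Z :=
  pairHom (X := free A B) (Y := free A' B') (MvPolynomial.eval₂Hom (Int.castRingHom Z.R) φ)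
    (MvPolynomial.eval₂Hom (Int.castRingHom Z.R) φ') (freePairAdd φ φ' ψ)
    (freePairAdd_smul φ φ' ψ)

theorem freePair_genR_left (φ : A → Z.R) (φ' : A' → Z.R) (ψ : B × B' → Z.M) (a : A) :
    Hom.ring (freePair φ φ' ψ) (rt (genR B a) 1) = φ a := by
  change MvPolynomial.eval₂Hom (Int.castRingHom Z.R) φ (MvPolynomial.X a) *
    MvPolynomial.eval₂Hom (Int.castRingHom Z.R) φ' 1 = φ a
  rw [map_one, mul_one, MvPolynomial.eval₂Hom_X']

theorem freePair_genR_right (φ : A → Z.R) (φ' : A' → Z.R) (ψ : B × B' → Z.M) (a : A') :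
    Hom.ring (freePair φ φ' ψ) (rt 1 (genR B' a)) = φ' a := by
  change MvPolynomial.eval₂Hom (Int.castRingHom Z.R) φ 1 *
    MvPolynomial.eval₂Hom (Int.castRingHom Z.R) φ' (MvPolynomial.X a) = φ' a
  rw [map_one, one_mul, MvPolynomial.eval₂Hom_X']

theorem freePair_genM (φ : A → Z.R) (φ' : A' → Z.R) (ψ : B × B' → Z.M) (b : B) (b' : B') :
    Hom.map (freePair φ φ' ψ) (mt (genM A b) (genM A' b')) = ψ (b, b') := by
  refine (freePairAdd_single φ φ' ψ b 1 _).trans ?_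
  rw [map_one, one_smul]
  exact freeLift_genM φ' _ b'

theorem free_induction {p : (free A B).M → Prop} (h0 : p 0) (hadd : ∀ m n, p m → p n → p (m + n))
    (h : ∀ (r : (free A B).R) b, p (r • genM A b)) (m : (free A B).M) : p m := by
  revert m
  intro (m : B →₀ MvPolynomial A ℤ)
  induction m using Finsupp.induction_linear with
  | zero => exact h0
  | add m n hm hn => exact hadd m n hm hn
  | single b r =>
    have e : (Finsupp.single b r : B →₀ MvPolynomial A ℤ) = r • Finsupp.single b 1 := by
      rw [Finsupp.smul_single, smul_eq_mul, mul_one]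
    rw [e]
    exact h r b

theorem rt_eq {X Y : ModCat.{u}} (r : X.R) (s : Y.R) :
    (rt r s : (tensor X Y).R) = rt r 1 * rt 1 s := by
  refine Eq.trans ?_ (Algebra.TensorProduct.tmul_mul_tmul r 1 1 s).symm
  rw [mul_one, one_mul]
  rfl

theorem tensor_free_hom_ext {f g : tensor (free A B) (free A' B') ⟶ Z}
    (h : ∀ a, Hom.ring f (rt (genR B a) 1) = Hom.ring g (rt (genR B a) 1))
    (h' : ∀ a, Hom.ring f (rt 1 (genR B' a)) = Hom.ring g (rt 1 (genR B' a)))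
    (hM : ∀ b b', Hom.map f (mt (genM A b) (genM A' b')) =
      Hom.map g (mt (genM A b) (genM A' b'))) : f = g := by
  have h1 : (Hom.ring f).comp (inl (free A B) (free A' B')) =
      (Hom.ring g).comp (inl (free A B) (free A' B')) :=
    MvPolynomial.ringHom_ext' (RingHom.ext_int _ _) h
  have h2 : (Hom.ring f).comp (inr (free A B) (free A' B')) =
      (Hom.ring g).comp (inr (free A B) (free A' B')) :=
    MvPolynomial.ringHom_ext' (RingHom.ext_int _ _) h'
  have hR : ∀ (r : (free A B).R) (s : (free A' B').R),
      Hom.ring f (rt r s) = Hom.ring g (rt r s) := fun r s => by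
    rw [rt_eq, map_mul, map_mul]
    exact congrArg₂ (· * ·) (DFunLike.congr_fun h1 r) (DFunLike.congr_fun h2 s)
  refine tensor_ext hR fun m n => ?_
  induction m using free_induction with
  | h0 =>
    have : (mt 0 n : (tensor (free A B) (free A' B')).M) = 0 := TensorProduct.zero_tmul _ _
    rw [this, map_zero, map_zero]
  | hadd m m' hm hm' => rw [mt_add_left, map_add, map_add, hm, hm']
  | h r b =>
    induction n using free_induction with
    | h0 =>
      have : (mt (r • genM A b) 0 : (tensor (free A B) (free A' B')).M) = 0 :=
        TensorProduct.tmul_zero _ _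
      rw [this, map_zero, map_zero]
    | hadd m m' hm hm' => rw [mt_add_right, map_add, map_add, hm, hm']
    | h s b' =>
      rw [← rt_smul_mt]
      refine (f.map_smul _ _).trans (Eq.trans ?_ (g.map_smul _ _).symm)
      exact congrArg₂ (· • ·) (hR r s) (hM b b')

/-- The counits of two objects factor through the counit of the tensor product. -/
noncomputable def fuTensor (X Y : ModCat.{u}) : tensor (fu X) (fu Y) ⟶ fu (tensor X Y) :=
  freePair (fun r => genR _ (rt r 1)) (fun s => genR _ (rt 1 s)) fun p => genM _ (mt p.1 p.2)

theorem fuTensor_counit (X Y : ModCat.{u}) :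
    fuTensor X Y ≫ counit (tensor X Y) = tensorMap (counit X) (counit Y) := by
  refine tensor_free_hom_ext (fun r => ?_) (fun s => ?_) fun m n => ?_
  · rw [comp_ring, fuTensor, freePair_genR_left, tensorMap_ring, map_one]
    refine (freeLift_genR _ _ _).trans ?_
    exact congrArg (fun r' => rt r' (1 : Y.R)) (freeLift_genR (X := X) id id r).symm
  · rw [comp_ring, fuTensor, freePair_genR_right, tensorMap_ring, map_one]
    refine (freeLift_genR _ _ _).trans ?_
    exact congrArg (fun r' => rt (1 : X.R) r') (freeLift_genR (X := Y) id id s).symm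
  · rw [comp_map, fuTensor, freePair_genM, tensorMap_map]
    refine (freeLift_genM _ _ _).trans ?_
    exact congrArg₂ mt (freeLift_genM (X := X) id id m).symm (freeLift_genM (X := Y) id id n).symm

end ModCat

/-! ### The external product of Witt vectors -/

section WittProduct

variable {X Y Z : ModCat.{u}} {M N P Q : MackeyFunctor G}

/-- A pairing that coequalises two morphisms in the first variable. -/
noncomputable def _root_.WittMackey.MackeyFunctor.Pairing.coeqLeft (p : Pairing N Q P)
    (f g : M ⟶ N) (h : boxMap f (𝟙 Q) ≫ p.lift = boxMap g (𝟙 Q) ≫ p.lift) :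
    Pairing (coeq f g) Q P :=
  p.ofQuot (diffRange_stable f g) fun H => by
    rintro _ ⟨z, rfl⟩
    refine AddMonoidHom.ext fun n => ?_
    have := congrArg (fun t => Hom.app t H (bx z n)) h
    simp only [comp_app, boxMap_bx, Pairing.lift_bx, id_app] at this
    change p.app H (Hom.app f H z - Hom.app g H z) n = 0
    rw [map_sub, AddMonoidHom.sub_apply, this, sub_self]

theorem generates_box_pureIm (X Y : ModCat.{u}) :
    Generates (M := MackeyFunctor.box (ghostImage G X) (ghostImage G Y))
      (D := fun K => Inv K X.M × Inv K Y.M) fun _ d => bx (pureIm d.1) (pureIm d.2) :=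
  (generates_pureIm_all X).box (generates_pureIm_all Y) fun h d => ⟨_, res_pureIm h d⟩

/-- The external product of elements of the images of the ghost maps, with values in the Witt
vectors. -/
noncomputable def prePairing (X Y : ModCat.{u}) :
    Pairing (ghostImage G (ModCat.fu X)) (ghostImage G (ModCat.fu Y))
      ((wittMackey G).obj (ModCat.tensor X Y)) :=
  (imagePairing _ _).post (ghostImageMap (ModCat.fuTensor X Y) ≫ wittMk _)

theorem prePairing_pureIm {K : Subgroup G} (f : Inv K (ModCat.fu X).M)
    (g : Inv K (ModCat.fu Y).M) : (prePairing X Y).app K (pureIm f) (pureIm g) =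
      wittNorm ((f.map (ModCat.Hom.map (ModCat.counit X))).tmul
        (g.map (ModCat.Hom.map (ModCat.counit Y)))) := by
  change Hom.app (wittMk _) K (Hom.app (ghostImageMap (ModCat.fuTensor X Y)) K
    ((imagePairing _ _).app K (pureIm f) (pureIm g))) = _
  rw [imagePairing_pureIm, ghostImageMap_pureIm, wittMk_pureIm]
  congr 1
  refine Subtype.ext (funext fun x => ?_)
  exact congrArg (fun t => ModCat.Hom.map t (ModCat.mt (f.1 x) (g.1 x)))
    (ModCat.fuTensor_counit X Y)

/-- The two maps from `FUFU(R; M)` to `FU(R; M)` become equal in `(R; M)`. -/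
theorem map_counit_counit {K : Subgroup G} (f : Inv K (ModCat.fu (ModCat.fu X)).M) :
    (f.map (ModCat.Hom.map (ModCat.fuMap (ModCat.counit X)))).map
      (ModCat.Hom.map (ModCat.counit X)) =
    (f.map (ModCat.Hom.map (ModCat.counit (ModCat.fu X)))).map
      (ModCat.Hom.map (ModCat.counit X)) :=
  Subtype.ext (funext fun x => congrArg (fun t => ModCat.Hom.map t (f.1 x))
    (ModCat.fuMap_counit (ModCat.counit X)))

/-- The external product, with the first variable in the Witt vectors and the second one in the
image of the ghost map. -/
noncomputable def halfPairing (X Y : ModCat.{u}) :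
    Pairing ((wittMackey G).obj X) (ghostImage G (ModCat.fu Y))
      ((wittMackey G).obj (ModCat.tensor X Y)) :=
  Pairing.coeqLeft (prePairing X Y) _ _ <| (generates_box_pureIm _ _).hom_ext fun K d => by
    simp only [comp_app, boxMap_bx, ghostImageMap_pureIm, id_app, Pairing.lift_bx,
      prePairing_pureIm, map_counit_counit]

theorem halfPairing_pureIm {K : Subgroup G} (f : Inv K X.M) (g : Inv K (ModCat.fu Y).M) :
    (halfPairing X Y).app K (wittNorm f) (pureIm g) =
      wittNorm (f.tmul (g.map (ModCat.Hom.map (ModCat.counit Y)))) := by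
  refine (prePairing_pureIm _ _).trans ?_
  congr 1
  exact Subtype.ext (funext fun x => congrArg (fun m => ModCat.mt m _) (ModCat.freeLift_genM _ _ _))

theorem halfPairing_condition (X Y : ModCat.{u}) :
    boxMap (ghostImageMap (ModCat.fuMap (ModCat.counit Y))) (𝟙 _) ≫
      (halfPairing (G := G) X Y).flip.lift =
    boxMap (ghostImageMap (ModCat.counit (ModCat.fu Y))) (𝟙 _) ≫ (halfPairing X Y).flip.lift :=
  ((generates_pureIm_all (ModCat.fu (ModCat.fu Y))).box (generates_wittNorm X)
    fun h d => ⟨_, res_pureIm h d⟩).hom_ext fun K d => by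
    simp only [comp_app, boxMap_bx, ghostImageMap_pureIm, id_app, Pairing.lift_bx]
    refine (halfPairing_pureIm _ _).trans (Eq.trans ?_ (halfPairing_pureIm _ _).symm)
    rw [map_counit_counit]

/-- The external product of Witt vectors. -/
noncomputable def wittPairing (X Y : ModCat.{u}) :
    Pairing ((wittMackey G).obj X) ((wittMackey G).obj Y)
      ((wittMackey G).obj (ModCat.tensor X Y)) :=
  ((halfPairing X Y).flip.coeqLeft _ _ (halfPairing_condition X Y)).flip

theorem wittPairing_wittNorm {K : Subgroup G} (f : Inv K X.M) (g : Inv K Y.M) :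
    (wittPairing X Y).app K (wittNorm f) (wittNorm g) = wittNorm (f.tmul g) := by
  refine (halfPairing_pureIm _ _).trans ?_
  congr 1
  exact Subtype.ext (funext fun x => congrArg (ModCat.mt _) (ModCat.freeLift_genM _ _ _))

/-- The external product of Witt vectors, as a morphism out of the box product. -/
noncomputable def wittMu (X Y : ModCat.{u}) :
    MackeyFunctor.box ((wittMackey G).obj X) ((wittMackey G).obj Y) ⟶
      (wittMackey G).obj (ModCat.tensor X Y) := (wittPairing X Y).lift

theorem wittMu_wittNorm {K : Subgroup G} (f : Inv K X.M) (g : Inv K Y.M) :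
    Hom.app (wittMu X Y) K (bx (wittNorm f) (wittNorm g)) = wittNorm (f.tmul g) := by
  rw [wittMu, Pairing.lift_bx, wittPairing_wittNorm]

theorem generates_box_wittNorm (X Y : ModCat.{u}) :
    Generates (M := MackeyFunctor.box ((wittMackey G).obj X) ((wittMackey G).obj Y))
      (D := fun K => Inv K X.M × Inv K Y.M) fun _ d => bx (wittNorm d.1) (wittNorm d.2) :=
  (generates_wittNorm X).box (generates_wittNorm Y) fun h d => ⟨_, res_wittNorm h d⟩

/-- On ghost components, the external product is the shuffle map. -/
theorem wittMu_ghost : wittMu X Y ≫ wittGhost (G := G) (ModCat.tensor X Y) =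
    boxMap (wittGhost X) (wittGhost Y) ≫ (ghostPairing X Y).lift :=
  (generates_box_wittNorm X Y).hom_ext fun K d => by
    simp only [comp_app, boxMap_bx, wittMu_wittNorm, wittGhost_wittNorm, Pairing.lift_bx,
      ghostPairing_pureGh]

/-- The constant function with value `1`. -/
def Inv.u1 (K : Subgroup G) : Inv K ModCat.unit.{u}.M := ⟨fun _ => ModCat.u1, fun _ _ _ => rfl⟩

theorem res_wittNorm_u1 {J K : Subgroup G} (h : J ≤ K) :
    wittNorm (Inv.u1 J) = ((wittMackey G).obj ModCat.unit).res h (wittNorm (Inv.u1 K)) :=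
  (res_wittNorm h (Inv.u1 K)).symm

theorem conj_wittNorm_u1 {x : G} {K K' : Subgroup G} (e : K' = MulAut.conj x • K) :
    wittNorm (Inv.u1 K') = ((wittMackey G).obj ModCat.unit).conj x e (wittNorm (Inv.u1 K)) :=
  (conj_wittNorm e (Inv.u1 K)).symm

/-- The map from the Burnside Mackey functor that sends `1` to the norm of `1`. -/
noncomputable def wittEps (G : Type u) [Group G] [Finite G] :
    burnside G ⟶ (wittMackey G).obj ModCat.unit :=
  ResSystem.freeHom (D := point G) (P := (wittMackey G).obj ModCat.unit)
    (fun K _ => wittNorm (Inv.u1 K))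
    (fun h _ => res_wittNorm_u1 h) fun h _ => conj_wittNorm_u1 h

theorem wittEps_one (K : Subgroup G) :
    Hom.app (wittEps G) K (one K) = wittNorm (Inv.u1 K) :=
  (ResSystem.freeHom_gen (D := point G) (P := (wittMackey G).obj ModCat.unit)
    (fun K _ => wittNorm (Inv.u1 K))
    (fun h _ => res_wittNorm_u1 h) (fun h _ => conj_wittNorm_u1 h)
    le_rfl ⟨⟩).trans (MackeyFunctor.tr_self _ _ _)

/-- The lax monoidal structure on the Witt vectors given by the external product. -/
noncomputable abbrev wittLaxMonoidal (G : Type u) [Group G] [Finite G] :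
    (wittMackey.{u} G).LaxMonoidal where
  ε := wittEps G
  μ := wittMu
  μ_natural_left {X Y} φ X' := (generates_box_wittNorm X X').hom_ext fun K d => by
    change Hom.app (boxMap ((wittMackey G).map φ) (𝟙 ((wittMackey G).obj X')) ≫ wittMu Y X') K _ =
      Hom.app (wittMu X X' ≫ (wittMackey G).map (ModCat.tensorMap φ (𝟙 X'))) K _
    simp only [comp_app, boxMap_bx, map_wittNorm, id_app, wittMu_wittNorm]
    rfl
  μ_natural_right {X Y} X' φ := (generates_box_wittNorm X' X).hom_ext fun K d => by
    change Hom.app (boxMap (𝟙 ((wittMackey G).obj X')) ((wittMackey G).map φ) ≫ wittMu X' Y) K _ =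
      Hom.app (wittMu X' X ≫ (wittMackey G).map (ModCat.tensorMap (𝟙 X') φ)) K _
    simp only [comp_app, boxMap_bx, map_wittNorm, id_app, wittMu_wittNorm]
    rfl
  associativity X Y Z := ((generates_box_wittNorm X Y).box (generates_wittNorm Z) fun h d =>
      ⟨(_, _), (res_bx _ _ _).trans
        (congrArg₂ bx (res_wittNorm h d.1) (res_wittNorm h d.2))⟩).hom_ext fun K d => by
    change Hom.app (boxMap (wittMu X Y) (𝟙 ((wittMackey G).obj Z)) ≫ wittMu (ModCat.tensor X Y) Z ≫
        (wittMackey G).map (ModCat.assoc X Y Z)) K _ =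
      Hom.app (boxAssoc _ _ _ ≫ boxMap (𝟙 ((wittMackey G).obj X)) (wittMu Y Z) ≫
        wittMu X (ModCat.tensor Y Z)) K _
    simp only [comp_app, boxMap_bx, map_wittNorm, id_app, wittMu_wittNorm, boxAssoc_bx]
    rfl
  left_unitality X := (generates_one.box (generates_wittNorm X) fun h d =>
      ⟨⟨⟩, res_one h⟩).hom_ext fun K d => by
    change Hom.app (MackeyFunctor.unitL ((wittMackey G).obj X)) K _ =
      Hom.app (boxMap (wittEps G) (𝟙 ((wittMackey G).obj X)) ≫ wittMu ModCat.unit X ≫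
        (wittMackey G).map (ModCat.unitL X)) K _
    simp only [comp_app, boxMap_bx, map_wittNorm, id_app, wittMu_wittNorm, unitL_bx, wittEps_one]
    congr 1
    exact Subtype.ext (funext fun x => (ModCat.unitL_map _).symm)
  right_unitality X := ((generates_wittNorm X).box generates_one fun h d =>
      ⟨_, res_wittNorm h d⟩).hom_ext fun K d => by
    change Hom.app (MackeyFunctor.unitR ((wittMackey G).obj X)) K _ =
      Hom.app (boxMap (𝟙 ((wittMackey G).obj X)) (wittEps G) ≫ wittMu X ModCat.unit ≫
        (wittMackey G).map (ModCat.swap X ModCat.unit ≫ ModCat.unitL X)) K _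
    simp only [comp_app, boxMap_bx, map_wittNorm, id_app, wittMu_wittNorm, unitR_bx, wittEps_one]
    congr 1
    exact Subtype.ext (funext fun x => (ModCat.unitL_map _).symm)

theorem wittMu_braided (X Y : ModCat.{u}) :
    wittMu (G := G) X Y ≫ (wittMackey G).map (ModCat.swap X Y) = boxSwap _ _ ≫ wittMu Y X :=
  (generates_box_wittNorm X Y).hom_ext fun K d => by
    simp only [comp_app, boxSwap_bx, map_wittNorm, wittMu_wittNorm]
    rfl

end WittProduct

end WittMackey

namespace WittMackey

open Fam MackeyFunctor

variable {G : Type u} [Group G] [Finite G]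

/-! ### Detecting elements of free Mackey functors -/

namespace ResSystem

variable {D : ResSystem G}

open Classical in
/-- The quotient of the value at `U` of a free Mackey functor by the proper transfers. The quotient is
the free abelian group on the generators at `U`. -/
noncomputable def topPart (U : Subgroup G) : D.FreeObj U →+ FreeAbelianGroup (D.obj U) :=
  lift (fun K _ d => if h : U ≤ K then FreeAbelianGroup.of (D.res h d) else 0) (by
    intro K K' hK hK' x hx e d
    by_cases h : U ≤ K
    · have h' : U ≤ K' := conj_mono h e (conj_eq_self hx)
      rw [dif_pos h, dif_pos h', ← D.conj_res h h' (conj_eq_self hx) e, D.conj_self hx]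
    · have h' : ¬ U ≤ K' := fun h' => h <| by
        rw [e, conj_eq_self hx] at h'
        exact Subgroup.pointwise_smul_le_pointwise_smul_iff.1 h'
      rw [dif_neg h, dif_neg h'])

open Classical in
theorem topPart_gen {K U : Subgroup G} (hK : K ≤ U) (d : D.obj K) : topPart U (gen hK d) =
    if h : U ≤ K then FreeAbelianGroup.of (D.res h d) else 0 := lift_mk _ _ _ _

open Classical in
theorem topPart_term {K U : Subgroup G} (d : D.obj K) (x : G) : topPart U (term U d x) =
    if h : U ≤ MulAut.conj x • K then FreeAbelianGroup.of (D.res h (D.conj x rfl d)) else 0 := by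
  rw [term, topPart_gen]
  by_cases h : U ≤ MulAut.conj x • K
  · rw [dif_pos h, dif_pos (le_inf le_rfl h), D.conj_res _ inf_le_right _ rfl,
      D.res_res _ _ h]
  · rw [dif_neg h, dif_neg fun h' => h (h'.trans inf_le_right)]

/-- The restriction to `U`, modulo proper transfers. -/
noncomputable def mark {U H : Subgroup G} (h : U ≤ H) :
    D.FreeObj H →+ FreeAbelianGroup (D.obj U) := (topPart U).comp (freeRes h)

theorem mark_gen {K U H : Subgroup G} (h : U ≤ H) (hK : K ≤ H) (d : D.obj K) :
    mark h (gen hK d) = sumOver (dc U K) H fun x => topPart U (term U d x) := by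
  rw [mark, AddMonoidHom.comp_apply, freeRes_mk, map_sumOver]

theorem card_conj (x : G) (K : Subgroup G) :
    Nat.card (MulAut.conj x • K : Subgroup G) = Nat.card K :=
  (Nat.card_congr (Subgroup.equivSMul (MulAut.conj x) K).toEquiv).symm

/-- Only cosets fixed by `U` contribute to the sum, so that double cosets may be replaced by left
cosets. -/
theorem sumOver_fixed {H U K : Subgroup G} (hU : U ≤ H) (hK : K ≤ H) {A : Type*} [AddCommMonoid A]
    (a : A) [∀ x : G, Decidable (U ≤ MulAut.conj x • K)] :
    (sumOver (dc U K) H fun x => if U ≤ MulAut.conj x • K then a else 0) =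
      sumOver (lc K) H fun x => if U ≤ MulAut.conj x • K then a else 0 := by
  have key : ∀ y ∈ U, ∀ x : G, ∀ b ∈ K, (U ≤ MulAut.conj (y * x * b) • K ↔
      U ≤ MulAut.conj x • K) := by
    intro y hy x b hb
    rw [map_mul, map_mul, mul_smul, mul_smul, Subgroup.conj_smul_eq_self_of_mem hb]
    conv_lhs => rw [conj_eq_self hy]
    rw [Subgroup.pointwise_smul_le_pointwise_smul_iff]
  rw [lc_eq, sumOver_nested_left (I := ⊥) bot_le hU hK]
  · refine sumOver_congr fun x hx => ?_
    have hU' : ∀ y ∈ U, (if U ≤ MulAut.conj (y * x) • K then a else 0) =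
        if U ≤ MulAut.conj x • K then a else 0 := fun y hy => if_congr (by
      have := key y hy x 1 K.one_mem
      rwa [mul_one] at this) rfl rfl
    by_cases h : U ≤ MulAut.conj x • K
    · rw [sumOver_single (f := fun y => if U ≤ MulAut.conj (y * x) • K then a else 0), one_mul]
      · intro y
        rw [dc_iff, inf_eq_left.2 h]
        constructor
        · rintro ⟨c, hc, b, hb, e⟩
          rw [Subgroup.mem_bot.1 hc, one_mul] at e
          rw [eq_mul_inv_of_mul_eq e.symm, one_mul]
          exact U.inv_mem hb
        · exact fun hy => ⟨1, Subgroup.one_mem _, y⁻¹, U.inv_mem hy, by group⟩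
      · intro y hy
        rw [hU' y hy, hU' 1 U.one_mem]
    · rw [if_neg h, sumOver_congr fun y hy => (hU' y hy).trans (if_neg h)]
      exact Finset.sum_const_zero.symm
  · intro x _ c hc b hb
    rw [Subgroup.mem_bot.1 hc]
    exact if_congr (key 1 U.one_mem x b hb) rfl rfl

theorem sumOver_const {H K : Subgroup G} (hK : K ≤ H) {A : Type*} [AddCommMonoid A] (a : A) :
    (sumOver (lc K) H fun _ => a) = K.relIndex H • a := by
  let _ : Fintype (H ⧸ K.subgroupOf H) := Fintype.ofFinite _
  rw [sumOver_eq (fun i : H ⧸ K.subgroupOf H => (i.out : G)) (fun i => i.out.2),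
    Finset.sum_const, Finset.card_univ, ← Nat.card_eq_fintype_card]
  · rfl
  · intro x hx
    refine ⟨QuotientGroup.mk ⟨x, hx⟩, ?_⟩
    rw [QuotientGroup.leftRel_apply]
    have := QuotientGroup.out_eq' (QuotientGroup.mk (s := K.subgroupOf H) (⟨x, hx⟩ : H))
    exact Subgroup.mem_subgroupOf.1 (QuotientGroup.eq.1 this.symm)
  · intro i j h
    rw [QuotientGroup.leftRel_apply] at h
    rw [← QuotientGroup.out_eq' i, ← QuotientGroup.out_eq' j]
    exact QuotientGroup.eq.2 h
  · intro x y h hx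
    rw [QuotientGroup.leftRel_apply] at h
    simpa using H.mul_mem hx (hK h)
  · exact fun _ _ _ _ _ => rfl

/-- The values of a free Mackey functor are torsion free: the value at `H` is free abelian on the
`H`-conjugacy classes of pairs of a subgroup `K ≤ H` and a generator at `K`. -/
theorem freeObj_torsionFree {H : Subgroup G} {n : ℕ} (hn : n ≠ 0) {z : D.FreeObj H}
    (hz : n • z = 0) : z = 0 := by
  let r : D.Gen H → D.Gen H → Prop := fun p q => ∃ (h : G) (_ : h ∈ H)
    (e : q.1.1 = MulAut.conj h • p.1.1), q.2 = D.conj h e p.2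
  let f : D.FreeObj H →+ FreeAbelianGroup (Quot r) :=
    lift (fun K hK d => FreeAbelianGroup.of (Quot.mk r ⟨⟨K, hK⟩, d⟩))
      fun K K' hK hK' h hh e d => congrArg _ (Quot.sound ⟨h, hh, e, rfl⟩).symm
  let g : FreeAbelianGroup (Quot r) →+ D.FreeObj H :=
    FreeAbelianGroup.lift (Quot.lift (fun p : D.Gen H => gen p.1.2 p.2) (by
      rintro ⟨⟨K, hK⟩, d⟩ ⟨⟨K', hK'⟩, d'⟩ ⟨h, hh, e, hd⟩
      change gen hK d = gen hK' d'
      rw [← mk_conj hK hK' hh e d]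
      exact congrArg (gen hK') hd.symm))
  have hgf : ∀ x, g (f x) = x := ext' (f := g.comp f) (g := AddMonoidHom.id _) fun K hK d => by
    simp [f, g]
  have hf : n • (FreeAbelianGroup.equivFinsupp _ (f z)) = 0 := by
    rw [← map_nsmul, ← map_nsmul, hz, map_zero, map_zero]
  have h0 : FreeAbelianGroup.equivFinsupp _ (f z) = 0 := by
    ext q
    have := DFunLike.congr_fun hf q
    simpa [hn] using this
  rw [← hgf z, (AddEquiv.map_eq_zero_iff _).1 h0, map_zero]

/-- An element all of whose marks vanish is zero. The marks at subgroups of order `k` vanish on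
transfers from smaller subgroups, and recover the `|H|/k`-th multiple of a combination of transfers
from subgroups of order `k`. So one may argue by induction on the order of the subgroups that
occur. -/
theorem eq_zero_of_mark {H : Subgroup G} (z : D.FreeObj H)
    (hz : ∀ (U : Subgroup G) (h : U ≤ H), mark h z = 0) : z = 0 := by
  classical
  let F : ℕ → AddSubgroup (D.FreeObj H) := fun k => AddSubgroup.closure
    {w | ∃ (K : Subgroup G) (hK : K ≤ H) (d : D.obj K), Nat.card K < k ∧ w = gen hK d}
  have hF : ∀ k, ∀ z ∈ F k, (∀ (U : Subgroup G) (h : U ≤ H), mark h z = 0) → z = 0 := by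
    intro k
    induction k with
    | zero =>
      intro z hz _
      refine (AddSubgroup.closure_le ⊥).2 ?_ hz
      rintro _ ⟨K, hK, d, h, rfl⟩
      exact absurd h (Nat.not_lt_zero _)
    | succ k ih =>
      intro z hz hm
      let I := {U : Subgroup G // U ≤ H ∧ Nat.card U = k}
      let _ : Fintype I := Fintype.ofFinite I
      -- transferring the marks at the subgroups of order `k` back to `H`
      let T : D.FreeObj H →+ D.FreeObj H := ∑ U : I,
        (FreeAbelianGroup.lift fun d => gen U.2.1 d).comp (mark U.2.1)
      have hT : ∀ w, T w = ∑ U : I,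
          FreeAbelianGroup.lift (fun d => gen U.2.1 d) (mark U.2.1 w) := fun w => by
        simp only [T, AddMonoidHom.finsetSum_apply, AddMonoidHom.comp_apply]
      have hTgen : ∀ {K : Subgroup G} (hK : K ≤ H) (d : D.obj K), Nat.card K ≤ k →
          T (gen hK d) = sumOver (lc K) H fun x => ∑ U : I,
            if U.1 ≤ MulAut.conj x • K then gen hK d else 0 := by
        intro K hK d hk
        have : ∀ x ∈ H, ∀ U : I, FreeAbelianGroup.lift (fun d => gen U.2.1 d)
            (topPart U.1 (term U.1 d x)) = if U.1 ≤ MulAut.conj x • K then gen hK d else 0 := by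
          intro x hx U
          rw [topPart_term]
          by_cases h : U.1 ≤ MulAut.conj x • K
          · rw [dif_pos h, if_pos h, FreeAbelianGroup.lift_apply_of]
            obtain ⟨U, hU, hUk⟩ := U
            obtain rfl : U = MulAut.conj x • K := by
              refine Subgroup.eq_of_le_of_card_ge h ?_
              rw [hUk]
              exact (card_conj _ _).trans_le hk
            rw [D.res_self, mk_conj hK _ hx]
          · rw [dif_neg h, if_neg h, map_zero]
        rw [hT]
        simp only [mark_gen, map_sumOver]
        rw [Finset.sum_congr rfl fun U _ => sumOver_congr fun x hx => this x hx U,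
          Finset.sum_congr rfl fun U _ => sumOver_fixed U.2.1 hK _]
        exact Finset.sum_comm
      have hlow : ∀ {K : Subgroup G} (hK : K ≤ H) (d : D.obj K), Nat.card K < k →
          T (gen hK d) = 0 := by
        intro K hK d hk
        rw [hTgen hK d hk.le]
        refine Finset.sum_eq_zero fun q _ => Finset.sum_eq_zero fun U _ => if_neg fun h => ?_
        have := Subgroup.card_le_of_le h
        rw [U.2.2] at this
        exact (this.trans_eq (card_conj _ _)).not_gt hk
      have htop : ∀ {K : Subgroup G} (hK : K ≤ H) (d : D.obj K), Nat.card K = k →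
          T (gen hK d) = (Nat.card H / k) • gen hK d := by
        intro K hK d hk
        have hidx : Nat.card H / k = K.relIndex H := by
          have := Subgroup.relIndex_mul_relIndex ⊥ K H bot_le hK
          rw [Subgroup.relIndex_bot_left, Subgroup.relIndex_bot_left] at this
          rw [← hk, ← this, Nat.mul_div_cancel_left _ Nat.card_pos]
        rw [hTgen hK d hk.le, hidx, ← sumOver_const hK]
        refine sumOver_congr fun x hx => ?_
        have hx' : MulAut.conj x • K ≤ H := conj_mono hK (conj_eq_self hx) rfl
        rw [Finset.sum_eq_single ⟨MulAut.conj x • K, hx', (card_conj _ _).trans hk⟩]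
        · exact if_pos le_rfl
        · intro U _ hU
          refine if_neg fun h => hU (Subtype.ext ?_)
          refine Subgroup.eq_of_le_of_card_ge h ?_
          rw [U.2.2]
          exact ((card_conj _ _).trans hk).le
        · exact fun h => absurd (Finset.mem_univ _) h
      have hmem : ∀ w ∈ F (k + 1), (Nat.card H / k) • w - T w ∈ F k := by
        intro w hw
        refine (AddSubgroup.closure_le ((F k).comap
          ((nsmulAddMonoidHom (Nat.card H / k)) - T))).2 ?_ hw
        rintro _ ⟨K, hK, d, h, rfl⟩
        change (Nat.card H / k) • gen hK d - T (gen hK d) ∈ F k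
        rcases (Nat.lt_succ_iff.1 h).lt_or_eq with h | h
        · rw [hlow hK d h, sub_zero]
          exact (F k).nsmul_mem (AddSubgroup.subset_closure ⟨K, hK, d, h, rfl⟩) _
        · rw [htop hK d h, sub_self]
          exact (F k).zero_mem
      have hTz : T z = 0 := by
        rw [hT]
        exact Finset.sum_eq_zero fun U _ => by rw [hm, map_zero]
      have h1 := hmem z hz
      rw [hTz, sub_zero] at h1
      have h2 := ih _ h1 fun U h => by rw [map_nsmul, hm, smul_zero]
      by_cases hex : ∃ K ≤ H, Nat.card K = k
      · obtain ⟨K, hK, rfl⟩ := hex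
        refine freeObj_torsionFree ?_ h2
        exact (Nat.div_pos (Subgroup.card_le_of_le hK) Nat.card_pos).ne'
      · refine ih z ((AddSubgroup.closure_mono ?_ : F (k + 1) ≤ F k) hz) hm
        rintro _ ⟨K, hK, d, h, rfl⟩
        exact ⟨K, hK, d, (Nat.lt_succ_iff.1 h).lt_of_ne fun h' => hex ⟨K, hK, h'⟩, rfl⟩
  refine hF (Nat.card H + 1) z ?_ hz
  clear hz
  induction z using gen_induction with
  | h K hK d =>
    exact AddSubgroup.subset_closure ⟨K, hK, d, Nat.lt_succ_iff.2 (Subgroup.card_le_of_le hK), rfl⟩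
  | h0 => exact zero_mem _
  | hadd x y hx hy => exact add_mem hx hy
  | hneg x hx => exact neg_mem hx

end ResSystem

end WittMackey

namespace WittMackey

open Fam MackeyFunctor

variable {G : Type u} [Group G] [Finite G]

/-! ### Morphisms from free Mackey functors to ghost components -/

section Detect

/-- A family with a dual family of functionals is linearly independent over the integers. -/
theorem freeAbelian_lift_injective {I M : Type*} [AddCommGroup M] (v : I → M) (l : I → M →+ ℤ)
    (h1 : ∀ i, l i (v i) = 1) (h0 : ∀ i j, j ≠ i → l i (v j) = 0) :
    Function.Injective (FreeAbelianGroup.lift v) := by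
  classical
  have key : ∀ i, (l i).comp (FreeAbelianGroup.lift v) = FreeAbelianGroup.coeff i := fun i => by
    refine FreeAbelianGroup.lift_ext _ _ fun j => ?_
    rw [AddMonoidHom.comp_apply, FreeAbelianGroup.lift_apply_of, FreeAbelianGroup.coeff,
      AddMonoidHom.comp_apply, FreeAbelianGroup.toFinsupp_of]
    by_cases h : j = i
    · subst h
      simp [h1]
    · simp [h0 i j h, h]
  refine (injective_iff_map_eq_zero _).2 fun x hx => ?_
  refine (AddEquiv.map_eq_zero_iff (FreeAbelianGroup.equivFinsupp I)).1 (Finsupp.ext fun i => ?_)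
  have := DFunLike.congr_fun (key i) x
  rw [AddMonoidHom.comp_apply, hx, map_zero] at this
  exact this.symm

variable {D : ResSystem G} {X : ModCat.{u}}

/-- A morphism from a free Mackey functor to ghost components is injective, if for every `U`
the components at `U` of the generators at `U` are linearly independent: the component at `U` kills
proper transfers, so that it is determined by the mark at `U`. -/
theorem injective_to_ghost (Φ : D.free ⟶ ghost G X)
    (θ : ∀ U : Subgroup G, D.obj U → X.TP (G ⧸ U))
    (hΦ : ∀ (U : Subgroup G) (d : D.obj U),
      (Hom.app Φ U (ResSystem.gen le_rfl d)).1 U = θ U d)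
    (hθ : ∀ U, Function.Injective (FreeAbelianGroup.lift (θ U))) (H : Subgroup G) :
    Function.Injective (Hom.app Φ H) := by
  have h1 : ∀ (U : Subgroup G) (w : D.FreeObj U),
      (Hom.app Φ U w).1 U = FreeAbelianGroup.lift (θ U) (ResSystem.topPart U w) := by
    intro U
    let ev : Fam G X →+ X.TP (G ⧸ U) := Pi.evalAddMonoidHom (fun U => X.TP (G ⧸ U)) U
    refine ResSystem.ext' (f := (ev.comp (ghostSub X U).subtype).comp (Hom.app Φ U))
      (g := (FreeAbelianGroup.lift (θ U)).comp (ResSystem.topPart U)) fun K hK d => ?_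
    have e : Hom.app Φ U (ResSystem.gen hK d) =
        (ghost G X).tr hK (Hom.app Φ K (ResSystem.gen le_rfl d)) :=
      (congrArg (Hom.app Φ U) (ResSystem.freeTr_mk hK le_rfl d).symm).trans (Φ.app_tr hK _)
    change (Hom.app Φ U (ResSystem.gen hK d)).1 U = FreeAbelianGroup.lift (θ U) _
    rw [ResSystem.topPart_gen]
    by_cases h : U ≤ K
    · obtain rfl := le_antisymm h hK
      rw [dif_pos h, FreeAbelianGroup.lift_apply_of, D.res_self, hΦ]
    · rw [dif_neg h, map_zero, e]
      change ev (ghostTr K U _) = 0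
      rw [ghostTr, map_sumOver]
      refine Finset.sum_eq_zero fun q _ => ?_
      change (q.1.out • (Hom.app Φ K (ResSystem.gen le_rfl d)).1) U = 0
      rw [← (Hom.app Φ K (ResSystem.gen le_rfl d)).2.1, smul_cut]
      refine cut_apply_of_not_le (fun h' => h ?_) _
      refine (Subgroup.pointwise_smul_le_pointwise_smul_iff (a := MulAut.conj q.1.out)).1 ?_
      rwa [← conj_eq_self q.2]
  refine (injective_iff_map_eq_zero _).2 fun z hz => ResSystem.eq_zero_of_mark z fun U h => ?_
  refine (injective_iff_map_eq_zero _).1 (hθ U) _ ?_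
  have h2 : Hom.app Φ U (ResSystem.freeRes h z) = 0 := by
    refine (Φ.app_res h z).trans ?_
    rw [hz, map_zero]
  refine (h1 U _).symm.trans ?_
  rw [h2]
  rfl

end Detect

/-! ### Monomial generators for free coefficients -/

namespace ModCat

variable {A A' B B' : Type u}

/-- The multiple of a generator of the free module by a monomial. These elements form a basis of the
free module as an abelian group. -/
noncomputable def mono (α : A →₀ ℕ) (b : B) : (free A B).M :=
  (Finsupp.single b (MvPolynomial.monomial α 1) : B →₀ MvPolynomial A ℤ)

/-- The set of monomial multiples of the generators. -/
def monos (A B : Type u) : Set (free A B).M := {m | ∃ α b, m = mono α b}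

theorem closure_monos (A B : Type u) : AddSubgroup.closure (monos A B) = ⊤ := by
  refine eq_top_iff.2 ?_
  intro (m : B →₀ MvPolynomial A ℤ) _
  induction m using Finsupp.induction_linear with
  | zero => exact zero_mem _
  | add m n hm hn => exact add_mem (hm trivial) (hn trivial)
  | single b p =>
    induction p using MvPolynomial.induction_on' with
    | monomial α k =>
      have : (Finsupp.single b (MvPolynomial.monomial α k) : B →₀ MvPolynomial A ℤ) =
          k • Finsupp.single b (MvPolynomial.monomial α 1) := by
        rw [Finsupp.smul_single, MvPolynomial.smul_monomial, smul_eq_mul, mul_one]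
      rw [this]
      have hm : mono α b ∈ AddSubgroup.closure (monos A B) :=
        AddSubgroup.subset_closure ⟨α, b, rfl⟩
      exact AddSubgroup.zsmul_mem _ hm k
    | add p q hp hq =>
      rw [Finsupp.single_add]
      exact add_mem (hp trivial) (hq trivial)

/-- The functional on tensor powers of a free module that extracts the coefficient of the monomial
with exponent `β` in the coordinate of the basis tensor `⨂_c b(c)`. -/
noncomputable def coeffTP {ι : Type u} [Fintype ι] (b : ι → B) (β : A →₀ ℕ) :
    (free A B).TP ι →+ ℤ :=
  AddMonoidHom.comp (MvPolynomial.coeffAddMonoidHom β)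
    (PiTensorProduct.lift (R := MvPolynomial A ℤ) (s := fun _ : ι => B →₀ MvPolynomial A ℤ)
      ((MultilinearMap.mkPiAlgebra (MvPolynomial A ℤ) ι (MvPolynomial A ℤ)).compLinearMap
        fun c => Finsupp.lapply (b c))).toAddMonoidHom

open Classical in
theorem coeffTP_pure {ι : Type u} [Fintype ι] (b : ι → B) (β : A →₀ ℕ) (α : ι → A →₀ ℕ)
    (b' : ι → B) : coeffTP b β ((free A B).pure fun c => mono (α c) (b' c)) =
      if b' = b ∧ ∑ c, α c = β then 1 else 0 := by
  have h1 : coeffTP b β ((free A B).pure fun c => mono (α c) (b' c)) = MvPolynomial.coeff β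
      (∏ c, (Finsupp.single (b' c) (MvPolynomial.monomial (α c) 1) : B →₀ MvPolynomial A ℤ)
        (b c)) := by
    refine congrArg (MvPolynomial.coeff β) ?_
    refine (PiTensorProduct.lift.tprod (R := MvPolynomial A ℤ)
      (s := fun _ : ι => B →₀ MvPolynomial A ℤ) _).trans ?_
    exact MultilinearMap.mkPiAlgebra_apply (R := MvPolynomial A ℤ) (A := MvPolynomial A ℤ) _
  rw [h1]
  by_cases h : b' = b
  · subst h
    have : ∏ c, (Finsupp.single (b' c) (MvPolynomial.monomial (α c) 1) :
        B →₀ MvPolynomial A ℤ) (b' c) = MvPolynomial.monomial (∑ c, α c) 1 := by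
      rw [MvPolynomial.monomial_sum_one]
      exact Finset.prod_congr rfl fun c _ => Finsupp.single_eq_same
    rw [this, MvPolynomial.coeff_monomial]
    simp
  · obtain ⟨c, hc⟩ := Function.ne_iff.1 h
    have hz : (Finsupp.single (b' c) (MvPolynomial.monomial (α c) 1) :
        B →₀ MvPolynomial A ℤ) (b c) = 0 := Finsupp.single_eq_of_ne hc.symm
    rw [Finset.prod_eq_zero (Finset.mem_univ c) hz, if_neg fun h' => h h'.1,
      MvPolynomial.coeff_zero]

/-- Pure tensors of monomials only depend on the product of the monomials. -/
theorem pure_mono {ι : Type u} [Fintype ι] (b : ι → B) {α α' : ι → A →₀ ℕ}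
    (h : ∑ c, α c = ∑ c, α' c) : ((free A B).pure fun c => mono (α c) (b c)) =
      (free A B).pure fun c => mono (α' c) (b c) := by
  have key : ∀ α : ι → A →₀ ℕ, ((free A B).pure fun c => mono (α c) (b c)) =
      (MvPolynomial.monomial (∑ c, α c) 1 : MvPolynomial A ℤ) •
        (PiTensorProduct.tprod (MvPolynomial A ℤ) (s := fun _ : ι => B →₀ MvPolynomial A ℤ)
          fun c => Finsupp.single (b c) 1) := fun α => by
    rw [MvPolynomial.monomial_sum_one, ← MultilinearMap.map_smul_univ]
    refine congrArg (PiTensorProduct.tprod (MvPolynomial A ℤ)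
      (s := fun _ : ι => B →₀ MvPolynomial A ℤ)) (funext fun c => ?_)
    rw [Finsupp.smul_single, smul_eq_mul, mul_one]
    rfl
  rw [key, key, h]

/-- The tensor product of two free objects maps to a free object. -/
noncomputable def freeTensor (A A' B B' : Type u) :
    tensor (free A B) (free A' B') ⟶ free (A ⊕ A') (B × B') :=
  freePair (fun a => genR _ (.inl a)) (fun a => genR _ (.inr a)) fun p => genM _ p

/-- Products of monomials in disjoint sets of variables are monomials. -/
theorem freeTensor_mono (α : A →₀ ℕ) (b : B) (α' : A' →₀ ℕ) (b' : B') :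
    Hom.map (freeTensor A A' B B') (mt (mono α b) (mono α' b')) =
      mono (α.mapDomain .inl + α'.mapDomain .inr) (b, b') := by
  refine (freePairAdd_single _ _ _ b _ _).trans ?_
  refine (congrArg _ (freeLiftAdd_single _ _ b' _)).trans ?_
  have h : ∀ {C : Type u} (f : C → A ⊕ A') (γ : C →₀ ℕ),
      MvPolynomial.eval₂Hom (Int.castRingHom (MvPolynomial (A ⊕ A') ℤ))
        (fun c => MvPolynomial.X (f c)) (MvPolynomial.monomial γ 1) =
      MvPolynomial.monomial (γ.mapDomain f) 1 := fun f γ => by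
    rw [← MvPolynomial.rename_monomial]
    refine DFunLike.congr_fun (f := MvPolynomial.eval₂Hom _ _)
      (g := (MvPolynomial.rename f).toRingHom) ?_ _
    exact MvPolynomial.ringHom_ext' (RingHom.ext_int _ _) fun c => by simp
  change MvPolynomial.eval₂Hom (Int.castRingHom (MvPolynomial (A ⊕ A') ℤ))
        (fun c => MvPolynomial.X (.inl c)) (MvPolynomial.monomial α 1) •
      MvPolynomial.eval₂Hom (Int.castRingHom (MvPolynomial (A ⊕ A') ℤ))
        (fun c => MvPolynomial.X (.inr c)) (MvPolynomial.monomial α' 1) •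
      (Finsupp.single (b, b') 1 : (B × B') →₀ MvPolynomial (A ⊕ A') ℤ) = Finsupp.single (b, b') _
  rw [h, h, smul_smul, MvPolynomial.monomial_mul, Finsupp.smul_single, smul_eq_mul, mul_one,
    mul_one]

end ModCat

end WittMackey

namespace WittMackey

open Fam MackeyFunctor

variable {G : Type u} [Group G] [Finite G]

/-! ### The external product for free coefficients -/

section FreeProduct

variable {X Y : ModCat.{u}} {M N : MackeyFunctor G}

theorem isIso_of_bijective (f : M ⟶ N) (h : ∀ H, Function.Bijective (Hom.app f H)) :
    IsIso f := by
  let e := fun H => AddEquiv.ofBijective (Hom.app f H) (h H)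
  have he : ∀ H x, Hom.app f H ((e H).symm x) = x := fun H x => (e H).apply_symm_apply x
  let g : N ⟶ M :=
    { app := fun H => (e H).symm.toAddMonoidHom
      app_tr := fun {K H} hK x => (h H).1 <| by
        change Hom.app f H ((e H).symm _) = Hom.app f H (M.tr hK ((e K).symm x))
        rw [f.app_tr, he, he]
      app_res := fun {K H} hK x => (h K).1 <| by
        change Hom.app f K ((e K).symm _) = Hom.app f K (M.res hK ((e H).symm x))
        rw [f.app_res, he, he]
      app_conj := fun {x H H'} hx z => (h H').1 <| by
        change Hom.app f H' ((e H').symm _) = Hom.app f H' (M.conj x hx ((e H).symm z))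
        rw [f.app_conj, he, he] }
  exact ⟨g, hom_ext fun H x => (e H).symm_apply_apply x, hom_ext fun H x => he H x⟩

/-- The norm of a pure tensor is determined by the pure tensor. -/
theorem pureIm_eq {K : Subgroup G} {f g : Inv K X.M} (h : (X.pure fun c : G ⧸ K => f.1 c.out) =
    X.pure fun c : G ⧸ K => g.1 c.out) : pureIm f = pureIm g :=
  Subtype.ext <| by
    change pureGh f = pureGh g
    rw [← normElt_pure f _ Quotient.out_eq', h, normElt_pure]

theorem closure_mt (X Y : ModCat.{u}) : AddSubgroup.closure
    {z : (ModCat.tensor X Y).M | ∃ m n, z = ModCat.mt m n} = ⊤ := by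
  set S := {z : (ModCat.tensor X Y).M | ∃ m n, z = ModCat.mt m n}
  have hS : ∀ m n, ModCat.mt m n ∈ AddSubgroup.closure S := fun m n =>
    AddSubgroup.subset_closure ⟨m, n, rfl⟩
  refine eq_top_iff.2 fun z _ => (QuotientAddGroup.eq_zero_iff z).1 ?_
  exact ModCat.mt_ext (f := QuotientAddGroup.mk' (AddSubgroup.closure S)) (g := 0)
    (fun m n => (QuotientAddGroup.eq_zero_iff _).2 (hS m n)) z

/-- An invariant function whose values are elementary tensors is a tensor product of invariant
functions. -/
theorem Inv.exists_tmul {K : Subgroup G} (f : Inv K (ModCat.tensor X Y).M)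
    (h : ∀ g, ∃ m n, f.1 g = ModCat.mt m n) :
    ∃ (a : Inv K X.M) (b : Inv K Y.M), f = a.tmul b := by
  have h' : ∀ z : Set.range f.1, ∃ (m : X.M) (n : Y.M), z.1 = ModCat.mt m n := by
    rintro ⟨_, g, rfl⟩
    exact h g
  -- the decomposition is chosen for each value of `f`, which makes the choices invariant
  choose m n hmn using h'
  have hr : ∀ g, ∀ k ∈ K, (⟨f.1 (g * k), _, rfl⟩ : Set.range f.1) = ⟨f.1 g, _, rfl⟩ :=
    fun g k hk => Subtype.ext (f.2 g k hk)
  exact ⟨⟨fun g => m ⟨f.1 g, g, rfl⟩, fun g k hk => congrArg m (hr g k hk)⟩,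
    ⟨fun g => n ⟨f.1 g, g, rfl⟩, fun g k hk => congrArg n (hr g k hk)⟩,
    Subtype.ext (funext fun g => hmn ⟨f.1 g, g, rfl⟩)⟩

/-- The tensor products of invariant functions generate the image of the ghost map of a tensor
product. -/
theorem generates_pureIm_tmul (X Y : ModCat.{u}) :
    Generates (M := ghostImage G (ModCat.tensor X Y))
      (D := fun K => Inv K X.M × Inv K Y.M) fun _ d => pureIm (d.1.tmul d.2) :=
  (generates_pureIm (closure_mt X Y)).of_surj (𝟙 _) (fun _ => Function.surjective_id) fun K d => by
    obtain ⟨a, b, h⟩ := d.1.exists_tmul d.2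
    exact ⟨(a, b), congrArg pureIm h⟩

theorem imagePairing_surjective (X Y : ModCat.{u}) (H : Subgroup G) :
    Function.Surjective (Hom.app (imagePairing X Y).lift H) :=
  (generates_pureIm_tmul X Y).surjective _ (fun K d => ⟨bx (pureIm d.1) (pureIm d.2), by
    rw [Pairing.lift_bx, imagePairing_pureIm]⟩) H

/-- The norms of pure tensors with entries in `S`, as elements of the image of the ghost map, so that
pure tensors with the same norm are identified. -/
abbrev PureNorm (S : Set X.M) (K : Subgroup G) : Type u :=
  {t : (ghostImage G X).obj K // ∃ f : Inv K X.M, (∀ g, f.1 g ∈ S) ∧ t = pureIm f}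

/-- The system of the pairs of norms of pure tensors with entries in `S` and `S'`. -/
noncomputable def pureNormSystem (S : Set X.M) (S' : Set Y.M) : ResSystem G where
  obj K := PureNorm S K × PureNorm S' K
  res h d := (⟨(ghostImage G X).res h d.1.1, by
      obtain ⟨f, hf, e⟩ := d.1.2
      exact ⟨_, fun g => hf g, by rw [e, res_pureIm]⟩⟩,
    ⟨(ghostImage G Y).res h d.2.1, by
      obtain ⟨f, hf, e⟩ := d.2.2
      exact ⟨_, fun g => hf g, by rw [e, res_pureIm]⟩⟩)
  conj x _ _ h d := (⟨(ghostImage G X).conj x h d.1.1, by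
      obtain ⟨f, hf, e⟩ := d.1.2
      exact ⟨_, fun g => hf _, by rw [e, conj_pureIm]⟩⟩,
    ⟨(ghostImage G Y).conj x h d.2.1, by
      obtain ⟨f, hf, e⟩ := d.2.2
      exact ⟨_, fun g => hf _, by rw [e, conj_pureIm]⟩⟩)
  res_self h d := Prod.ext (Subtype.ext ((ghostImage G X).res_self h _))
    (Subtype.ext ((ghostImage G Y).res_self h _))
  conj_self hg h d := Prod.ext (Subtype.ext ((ghostImage G X).conj_self hg h _))
    (Subtype.ext ((ghostImage G Y).conj_self hg h _))
  res_res h h' h'' d := Prod.ext (Subtype.ext ((ghostImage G X).res_res h h' h'' _))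
    (Subtype.ext ((ghostImage G Y).res_res h h' h'' _))
  conj_conj h h' h'' d := Prod.ext (Subtype.ext ((ghostImage G X).conj_conj h h' h'' _))
    (Subtype.ext ((ghostImage G Y).conj_conj h h' h'' _))
  conj_res h h' hK hH d := Prod.ext (Subtype.ext ((ghostImage G X).conj_res h h' hK hH _))
    (Subtype.ext ((ghostImage G Y).conj_res h h' hK hH _))

/-- The map from the free Mackey functor on pairs of norms to the box product. -/
noncomputable def pureNormMap (S : Set X.M) (S' : Set Y.M) :
    (pureNormSystem (G := G) S S').free ⟶
      MackeyFunctor.box (ghostImage G X) (ghostImage G Y) :=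
  ResSystem.freeHom (fun _ d => bx d.1.1 d.2.1) (fun h d => (res_bx h d.1.1 d.2.1).symm)
    fun h d => (conj_bx h d.1.1 d.2.1).symm

theorem pureNormMap_gen (S : Set X.M) (S' : Set Y.M) {K : Subgroup G}
    (d : (pureNormSystem S S').obj K) :
    Hom.app (pureNormMap S S') K (ResSystem.gen le_rfl d) = bx d.1.1 d.2.1 :=
  (ResSystem.freeHom_gen _ _ _ _ _).trans (MackeyFunctor.tr_self _ _ _)

theorem pureNormMap_surjective {S : Set X.M} {S' : Set Y.M}
    (hS : AddSubgroup.closure S = ⊤) (hS' : AddSubgroup.closure S' = ⊤) (H : Subgroup G) :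
    Function.Surjective (Hom.app (pureNormMap S S') H) :=
  ((generates_pureIm hS).box (generates_pureIm hS') fun h d =>
    ⟨⟨_, fun g => d.2 g⟩, res_pureIm h d.1⟩).surjective _ (fun _ d =>
      ⟨ResSystem.gen le_rfl (⟨_, d.1.1, d.1.2, rfl⟩, ⟨_, d.2.1, d.2.2, rfl⟩),
        pureNormMap_gen _ _ _⟩) H

/-- The norm of a tensor of monomials is described by a family of exponents and a family of
generators. -/
theorem pureNorm_data {A B : Type u} {U : Subgroup G}
    (t : PureNorm (ModCat.monos A B) U) :
    ∃ (f : Inv U (ModCat.free A B).M) (α : G ⧸ U → A →₀ ℕ) (b : G ⧸ U → B),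
      t.1 = pureIm f ∧ ∀ c : G ⧸ U, f.1 c.out = ModCat.mono (α c) (b c) := by
  obtain ⟨_, f, hf, rfl⟩ := t
  have hf' := fun c : G ⧸ U => hf c.out
  choose α b h using hf'
  exact ⟨f, α, b, rfl, h⟩

theorem mapDomain_add_inj {A A' : Type*} {α β : A →₀ ℕ} {α' β' : A' →₀ ℕ}
    (h : α.mapDomain (Sum.inl : A → A ⊕ A') + α'.mapDomain Sum.inr =
      β.mapDomain (Sum.inl : A → A ⊕ A') + β'.mapDomain Sum.inr) : α = β ∧ α' = β' := by
  constructor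
  · ext a
    have := DFunLike.congr_fun h (Sum.inl a)
    rwa [Finsupp.add_apply, Finsupp.add_apply, Finsupp.mapDomain_apply Sum.inl_injective,
      Finsupp.mapDomain_apply Sum.inl_injective, Finsupp.mapDomain_of_notMem_range _ _ (by simp),
      Finsupp.mapDomain_of_notMem_range _ _ (by simp), add_zero, add_zero] at this
  · ext a
    have := DFunLike.congr_fun h (Sum.inr a)
    rwa [Finsupp.add_apply, Finsupp.add_apply, Finsupp.mapDomain_apply Sum.inr_injective,
      Finsupp.mapDomain_apply Sum.inr_injective, Finsupp.mapDomain_of_notMem_range _ _ (by simp),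
      Finsupp.mapDomain_of_notMem_range _ _ (by simp), zero_add, zero_add] at this

/-- For free coefficients, the external product of ghost components is injective on the box product
of the images of the ghost maps: all pairs of norms of tensors of monomials have linearly
independent external products. -/
theorem imagePairing_injective (A A' B B' : Type u) (H : Subgroup G) : Function.Injective
    (Hom.app (imagePairing (ModCat.free A B) (ModCat.free A' B')).lift H) := by
  classical
  let Ψ := pureNormMap (G := G) (ModCat.monos A B) (ModCat.monos A' B')
  let Φ : (pureNormSystem (ModCat.monos A B) (ModCat.monos A' B')).free ⟶ ghost G _ :=
    Ψ ≫ (imagePairing (ModCat.free A B) (ModCat.free A' B')).lift ≫ ghostIncl _ ≫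
      ghostMap (ModCat.freeTensor A A' B B')
  have hΦ : ∀ K, Function.Injective (Hom.app Φ K) := by
    refine injective_to_ghost Φ (fun U d => (Hom.app Φ U (ResSystem.gen le_rfl d)).1 U)
      (fun _ _ => rfl) fun U => ?_
    let _ : Fintype (G ⧸ U) := Fintype.ofFinite _
    choose f α b hf hm using pureNorm_data (G := G) (A := A) (B := B) (U := U)
    choose f' α' b' hf' hm' using pureNorm_data (G := G) (A := A') (B := B') (U := U)
    have hval : ∀ d : PureNorm (ModCat.monos A B) U × PureNorm (ModCat.monos A' B') U,
        (Hom.app Φ U (ResSystem.gen (D := pureNormSystem _ _) le_rfl d)).1 U =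
        (ModCat.free (A ⊕ A') (B × B')).pure fun c => ModCat.mono
          ((α d.1 c).mapDomain .inl + (α' d.2 c).mapDomain .inr) (b d.1 c, b' d.2 c) := by
      intro d
      have : Hom.app Φ U (ResSystem.gen (D := pureNormSystem _ _) le_rfl d) =
          pureGh (((f d.1).tmul (f' d.2)).map (ModCat.Hom.map (ModCat.freeTensor A A' B B'))) := by
        have h1 : Hom.app (imagePairing _ _).lift U
            (Hom.app Ψ U (ResSystem.gen (D := pureNormSystem _ _) le_rfl d)) =
            pureIm ((f d.1).tmul (f' d.2)) := by
          refine (congrArg _ (pureNormMap_gen _ _ d)).trans ?_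
          refine (Pairing.lift_bx _ _ _).trans ?_
          rw [hf, hf', imagePairing_pureIm]
        refine (congrArg (Hom.app (ghostIncl _ ≫ ghostMap (ModCat.freeTensor A A' B B')) U)
          h1).trans ?_
        exact Subtype.ext (map_pureFam _ _)
      rw [this]
      refine (pureFam_of_le _ le_rfl).trans (congrArg _ (funext fun c => ?_))
      change ModCat.Hom.map (ModCat.freeTensor A A' B B')
        (ModCat.mt ((f d.1).1 c.out) ((f' d.2).1 c.out)) = _
      rw [hm, hm', ModCat.freeTensor_mono]
    refine freeAbelian_lift_injective (I := PureNorm (ModCat.monos A B) U ×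
      PureNorm (ModCat.monos A' B') U) _ (fun d => ModCat.coeffTP (fun c => (b d.1 c, b' d.2 c))
      (∑ c, ((α d.1 c).mapDomain .inl + (α' d.2 c).mapDomain .inr))) (fun d => ?_) fun d e hed => ?_
    · exact (congrArg _ (hval d)).trans ((ModCat.coeffTP_pure _ _ _ _).trans (if_pos ⟨rfl, rfl⟩))
    · refine (congrArg _ (hval e)).trans ((ModCat.coeffTP_pure _ _ _ _).trans (if_neg ?_))
      -- the variables of the two factors are disjoint, so the product of all the monomials
      -- determines the product of the monomials of each factor, hence the two norms
      rintro ⟨h1, h2⟩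
      rw [Finset.sum_add_distrib, Finset.sum_add_distrib, ← Finsupp.mapDomain_finsetSum,
        ← Finsupp.mapDomain_finsetSum, ← Finsupp.mapDomain_finsetSum,
        ← Finsupp.mapDomain_finsetSum] at h2
      obtain ⟨h3, h4⟩ := mapDomain_add_inj h2
      refine hed (Prod.ext (Subtype.ext ?_) (Subtype.ext ?_))
      · rw [hf, hf]
        refine pureIm_eq ?_
        simp only [hm]
        rw [ModCat.pure_mono _ h3, show b e.1 = b d.1 from
          funext fun c => congrArg Prod.fst (congrFun h1 c)]
      · rw [hf', hf']
        refine pureIm_eq ?_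
        simp only [hm']
        rw [ModCat.pure_mono _ h4, show b' e.2 = b' d.2 from
          funext fun c => congrArg Prod.snd (congrFun h1 c)]
  intro x y hxy
  obtain ⟨x, rfl⟩ := pureNormMap_surjective (ModCat.closure_monos A B)
    (ModCat.closure_monos A' B') H x
  obtain ⟨y, rfl⟩ := pureNormMap_surjective (ModCat.closure_monos A B)
    (ModCat.closure_monos A' B') H y
  refine congrArg _ (hΦ H ?_)
  exact congrArg (fun z => Hom.app (ghostIncl _ ≫ ghostMap (ModCat.freeTensor A A' B B')) H z) hxy

theorem imagePairing_isIso (A A' B B' : Type u) :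
    IsIso (imagePairing (G := G) (ModCat.free A B) (ModCat.free A' B')).lift :=
  isIso_of_bijective _ fun H =>
    ⟨imagePairing_injective A A' B B' H, imagePairing_surjective _ _ H⟩

end FreeProduct

end WittMackey

namespace WittMackey

open Fam MackeyFunctor

variable {G : Type u} [Group G] [Finite G]

/-! ### The structure maps are isomorphisms -/

section Strong

variable {X Y : ModCat.{u}}

/-- Two elements with the same image in the quotient by a reflexive pair are related by a single
element, because the relation of a reflexive pair of homomorphisms is an equivalence relation. -/
theorem exists_of_reflexive {A₁ A₀ A : Type*} [AddCommGroup A₁] [AddCommGroup A₀] [AddCommGroup A]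
    (d₀ d₁ : A₁ →+ A₀) (s : A₀ → A₁) (h₀ : ∀ x, d₀ (s x) = x) (h₁ : ∀ x, d₁ (s x) = x)
    (π : A₀ →+ A) (hπ : ∀ x, π x = 0 → ∃ q, x = d₀ q - d₁ q) {x y : A₀} (h : π x = π y) :
    ∃ q, d₀ q = x ∧ d₁ q = y := by
  obtain ⟨q, hq⟩ := hπ (x - y) (by rw [map_sub, h, sub_self])
  refine ⟨q + s (x - d₀ q), ?_, ?_⟩
  · rw [map_add, h₀, add_sub_cancel]
  · rw [map_add, h₁, show x - d₀ q = y - d₁ q by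
      rw [← sub_eq_zero, sub_sub_sub_comm, hq, sub_self], add_sub_cancel]

/-- Related invariant functions are the images of a single invariant function: choosing preimages as
functions of the pairs of values makes them invariant. -/
theorem Inv.exists_of_reflexive {K : Subgroup G} {S T : Type u} (d₀ d₁ : S → T)
    (z z' : Inv K T) (h : ∀ g, ∃ q, d₀ q = z.1 g ∧ d₁ q = z'.1 g) :
    ∃ q : Inv K S, q.map d₀ = z ∧ q.map d₁ = z' := by
  have h' : ∀ p : Set.range fun g => (z.1 g, z'.1 g), ∃ q, d₀ q = p.1.1 ∧ d₁ q = p.1.2 := by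
    rintro ⟨_, g, rfl⟩
    exact h g
  choose q hq using h'
  refine ⟨⟨fun g => q ⟨_, g, rfl⟩, fun g k hk => congrArg q (Subtype.ext
    (Prod.ext (z.2 g k hk) (z'.2 g k hk)))⟩, ?_, ?_⟩
  · exact Subtype.ext (funext fun g => (hq ⟨_, g, rfl⟩).1)
  · exact Subtype.ext (funext fun g => (hq ⟨_, g, rfl⟩).2)

theorem Inv.exists_map_eq {K : Subgroup G} {S T : Type u} {φ : S → T}
    (hφ : Function.Surjective φ) (f : Inv K T) : ∃ z : Inv K S, z.map φ = f :=
  ⟨f.map (Function.surjInv hφ), Subtype.ext (funext fun g => Function.surjInv_eq hφ (f.1 g))⟩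

namespace ModCat

theorem counit_ring_surjective (X : ModCat.{u}) : Function.Surjective (Hom.ring (counit X)) :=
  fun r => ⟨genR X.M r, freeLift_genR _ _ _⟩

theorem counit_map_surjective (X : ModCat.{u}) : Function.Surjective (Hom.map (counit X)) :=
  fun m => ⟨genM X.R m, freeLift_genM _ _ _⟩

theorem counit_genM (m : X.M) : Hom.map (counit X) (genM X.R m) = m := freeLift_genM _ _ _

theorem fuMap_genM (f : X ⟶ Y) (m : X.M) :
    Hom.map (fuMap f) (genM X.R m) = genM Y.R (Hom.map f m) := freeLift_genM _ _ _

/-- The comultiplication of the comonad `FU`. -/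
noncomputable def fuDiag (X : ModCat.{u}) : fu X ⟶ fu (fu X) :=
  freeLift _ (fun r => genR _ (genR _ r)) fun m => genM _ (genM _ m)

theorem fuDiag_fuMap (X : ModCat.{u}) : fuDiag X ≫ fuMap (counit X) = 𝟙 (fu X) :=
  free_hom_ext
    (fun r => by
      rw [comp_ring, fuDiag, freeLift_genR, fuMap, freeLift_genR, counit, freeLift_genR]; rfl)
    fun m => by
      rw [comp_map, fuDiag, freeLift_genM, fuMap, freeLift_genM, counit, freeLift_genM]; rfl

theorem fuDiag_counit (X : ModCat.{u}) : fuDiag X ≫ counit (fu X) = 𝟙 (fu X) :=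
  free_hom_ext
    (fun r => by
      rw [comp_ring, fuDiag, freeLift_genR, counit, freeLift_genR]; rfl)
    fun m => by
      rw [comp_map, fuDiag, freeLift_genM, counit, freeLift_genM]; rfl

/-- The two maps `FUFU(X) ⊗ FUFU(Y) → FU(X) ⊗ FU(Y)` form a reflexive pair with quotient
`X ⊗ Y`. -/
theorem exists_tensor_counit (X Y : ModCat.{u}) (x y : (tensor (fu X) (fu Y)).M)
    (h : Hom.map (tensorMap (counit X) (counit Y)) x =
      Hom.map (tensorMap (counit X) (counit Y)) y) :
    ∃ q : (tensor (fu (fu X)) (fu (fu Y))).M,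
      Hom.map (tensorMap (fuMap (counit X)) (fuMap (counit Y))) q = x ∧
      Hom.map (tensorMap (counit (fu X)) (counit (fu Y))) q = y := by
  set d₀ := Hom.map (tensorMap (fuMap (counit X)) (fuMap (counit Y)))
  set d₁ := Hom.map (tensorMap (counit (fu X)) (counit (fu Y)))
  refine exists_of_reflexive d₀ d₁ (Hom.map (tensorMap (fuDiag X) (fuDiag Y)))
    (mt_ext (f := d₀.comp (Hom.map (tensorMap (fuDiag X) (fuDiag Y)))) (g := AddMonoidHom.id _)
      fun m n => ?_)
    (mt_ext (f := d₁.comp (Hom.map (tensorMap (fuDiag X) (fuDiag Y)))) (g := AddMonoidHom.id _)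
      fun m n => ?_) (Hom.map (tensorMap (counit X) (counit Y))) (fun p hp => ?_) h
  · exact congrArg₂ mt (congrArg (fun t => Hom.map t m) (fuDiag_fuMap X))
      (congrArg (fun t => Hom.map t n) (fuDiag_fuMap Y))
  · exact congrArg₂ mt (congrArg (fun t => Hom.map t m) (fuDiag_counit X))
      (congrArg (fun t => Hom.map t n) (fuDiag_counit Y))
  · -- `m ⊗ n ↦ [m] ⊗ [n]` is biadditive modulo the relations and inverts the projection
    let Q := (tensor (fu X) (fu Y)).M ⧸ (d₀ - d₁).range
    let mk : (tensor (fu X) (fu Y)).M →+ Q := QuotientAddGroup.mk' _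
    have key : ∀ (a : (fu X).M) (b : (fu Y).M),
        mk (mt (genM X.R (Hom.map (counit X) a)) (genM Y.R (Hom.map (counit Y) b))) =
          mk (mt a b) := by
      intro a b
      rw [← sub_eq_zero, ← map_sub]
      refine (QuotientAddGroup.eq_zero_iff _).2 ⟨mt (genM _ a) (genM _ b), ?_⟩
      exact congrArg₂ (· - ·) (congrArg₂ mt (fuMap_genM _ a) (fuMap_genM _ b))
        (congrArg₂ mt (counit_genM a) (counit_genM b))
    let σ : X.M →+ Y.M →+ Q := AddMonoidHom.mk' (fun m => AddMonoidHom.mk'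
      (fun n => mk (mt (genM X.R m) (genM Y.R n))) fun n n' => by
        have := key (genM X.R m) (genM Y.R n + genM Y.R n')
        rw [map_add, counit_genM, counit_genM, counit_genM, mt_add_right, map_add] at this
        exact this) fun m m' => AddMonoidHom.ext fun n => by
        have := key (genM X.R m + genM X.R m') (genM Y.R n)
        rw [map_add, counit_genM, counit_genM, counit_genM, mt_add_left, map_add] at this
        exact this
    let τ : (tensor X Y).M →+ Q := TensorProduct.liftAddHom σ fun k m n => by
      rw [map_zsmul, map_zsmul, AddMonoidHom.zsmul_apply]
    have hτ : ∀ z, τ (Hom.map (tensorMap (counit X) (counit Y)) z) = mk z :=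
      mt_ext (f := τ.comp (Hom.map (tensorMap (counit X) (counit Y)))) (g := mk) key
    have := hτ p
    rw [hp, map_zero] at this
    obtain ⟨q, hq⟩ := (QuotientAddGroup.eq_zero_iff p).1 this.symm
    exact ⟨q, hq.symm⟩

theorem tensorMap_ring_surjective {X' Y' : ModCat.{u}} (f : X ⟶ X') (g : Y ⟶ Y')
    (hf : Function.Surjective (Hom.ring f)) (hg : Function.Surjective (Hom.ring g)) :
    Function.Surjective (Hom.ring (tensorMap f g)) :=
  TensorProduct.map_surjective (g := (Hom.ring f).toIntAlgHom.toLinearMap)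
    (g' := (Hom.ring g).toIntAlgHom.toLinearMap) hf hg

theorem tensorMap_map_surjective {X' Y' : ModCat.{u}} (f : X ⟶ X') (g : Y ⟶ Y')
    (hf : Function.Surjective (Hom.map f)) (hg : Function.Surjective (Hom.map g)) :
    Function.Surjective (Hom.map (tensorMap f g)) :=
  TensorProduct.map_surjective (g := (Hom.map f).toIntLinearMap)
    (g' := (Hom.map g).toIntLinearMap) hf hg

end ModCat

/-- The norms of the tensor products of invariant functions generate the Witt vectors of a tensor
product. -/
theorem generates_wittNorm_tmul (X Y : ModCat.{u}) :
    Generates (M := (wittMackey G).obj (ModCat.tensor X Y))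
      (D := fun K => Inv K X.M × Inv K Y.M) fun _ d => wittNorm (d.1.tmul d.2) := by
  let k := ghostImageMap (G := G) (ModCat.fuTensor X Y) ≫ wittMk (ModCat.tensor X Y)
  have hk : ∀ (K : Subgroup G) (z : Inv K (ModCat.tensor (ModCat.fu X) (ModCat.fu Y)).M),
      Hom.app k K (pureIm z) = wittNorm (z.map (ModCat.Hom.map
        (ModCat.tensorMap (ModCat.counit X) (ModCat.counit Y)))) := by
    intro K z
    change Hom.app (wittMk _) K (Hom.app (ghostImageMap (ModCat.fuTensor X Y)) K (pureIm z)) = _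
    rw [ghostImageMap_pureIm, wittMk_pureIm, ← ModCat.fuTensor_counit]
    rfl
  refine (generates_pureIm_tmul (ModCat.fu X) (ModCat.fu Y)).of_surj k
    ((generates_wittNorm _).surjective k fun K f => ?_) fun K d =>
      ⟨(d.1.map (ModCat.Hom.map (ModCat.counit X)), d.2.map (ModCat.Hom.map (ModCat.counit Y))),
        hk K _⟩
  obtain ⟨z, rfl⟩ := f.exists_map_eq (ModCat.tensorMap_map_surjective (ModCat.counit X)
    (ModCat.counit Y) (ModCat.counit_map_surjective X) (ModCat.counit_map_surjective Y))
  exact ⟨pureIm z, hk K z⟩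

theorem wittMu_surjective (X Y : ModCat.{u}) (H : Subgroup G) :
    Function.Surjective (Hom.app (wittMu X Y) H) :=
  (generates_wittNorm_tmul X Y).surjective _
    (fun _ d => ⟨bx (wittNorm d.1) (wittNorm d.2), wittMu_wittNorm _ _⟩) H

/-- The external product of Witt vectors has a retraction. It is constructed by descent from
`FU(X) ⊗ FU(Y)`, where the external product is invertible on the images of the ghost maps. -/
theorem exists_wittMu_retraction (X Y : ModCat.{u}) :
    ∃ k : (wittMackey G).obj (ModCat.tensor X Y) ⟶
      MackeyFunctor.box ((wittMackey G).obj X) ((wittMackey G).obj Y),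
      wittMu X Y ≫ k = 𝟙 _ := by
  let m := (imagePairing (G := G) (ModCat.fu X) (ModCat.fu Y)).lift
  have : IsIso m := imagePairing_isIso _ _ _ _
  let k := inv m ≫ boxMap (wittMk X) (wittMk Y)
  have hk : ∀ (K : Subgroup G) (a : Inv K (ModCat.fu X).M) (b : Inv K (ModCat.fu Y).M),
      Hom.app k K (pureIm (a.tmul b)) = bx (wittNorm (a.map (ModCat.Hom.map (ModCat.counit X))))
        (wittNorm (b.map (ModCat.Hom.map (ModCat.counit Y)))) := by
    intro K a b
    have h : Hom.app (m ≫ k) K (bx (pureIm a) (pureIm b)) = Hom.app k K (pureIm (a.tmul b)) := by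
      rw [comp_app]
      refine congrArg (Hom.app k K) ?_
      exact (Pairing.lift_bx _ _ _).trans (imagePairing_pureIm a b)
    rw [← h, IsIso.hom_inv_id_assoc, boxMap_bx, wittMk_pureIm, wittMk_pureIm]
  have hd : ghostImageMap (ModCat.tensorMap (ModCat.fuMap (ModCat.counit X))
        (ModCat.fuMap (ModCat.counit Y))) ≫ k =
      ghostImageMap (ModCat.tensorMap (ModCat.counit (ModCat.fu X))
        (ModCat.counit (ModCat.fu Y))) ≫ k :=
    (generates_pureIm_tmul _ _).hom_ext fun K d => by
      simp only [comp_app, ghostImageMap_pureIm]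
      refine (hk K (d.1.map (ModCat.Hom.map (ModCat.fuMap (ModCat.counit X))))
        (d.2.map (ModCat.Hom.map (ModCat.fuMap (ModCat.counit Y))))).trans (Eq.trans ?_
        (hk K (d.1.map (ModCat.Hom.map (ModCat.counit (ModCat.fu X))))
        (d.2.map (ModCat.Hom.map (ModCat.counit (ModCat.fu Y))))).symm)
      rw [map_counit_counit, map_counit_counit]
  obtain ⟨k', hk'⟩ := exists_descent (ModCat.tensorMap (ModCat.counit X) (ModCat.counit Y))
    (ModCat.tensorMap_ring_surjective _ _ (ModCat.counit_ring_surjective X)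
      (ModCat.counit_ring_surjective Y))
    (ModCat.tensorMap_map_surjective _ _ (ModCat.counit_map_surjective X)
      (ModCat.counit_map_surjective Y)) k fun K z z' h => by
      obtain ⟨q, rfl, rfl⟩ := Inv.exists_of_reflexive _ _ z z' fun g =>
        ModCat.exists_tensor_counit X Y _ _ (congrFun (congrArg Subtype.val h) g)
      have := congrArg (fun t => Hom.app t K (pureIm q)) hd
      simpa only [comp_app, ghostImageMap_pureIm] using this
  refine ⟨k', (generates_box_wittNorm X Y).hom_ext fun K d => ?_⟩
  obtain ⟨a, ha⟩ := d.1.exists_map_eq (ModCat.counit_map_surjective X)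
  obtain ⟨b, hb⟩ := d.2.exists_map_eq (ModCat.counit_map_surjective Y)
  rw [comp_app, wittMu_wittNorm, id_app, ← ha, ← hb]
  exact (hk' K (a.tmul b)).trans (hk K a b)

theorem wittMu_isIso (X Y : ModCat.{u}) : IsIso (wittMu (G := G) X Y) := by
  obtain ⟨k, hk⟩ := exists_wittMu_retraction (G := G) X Y
  refine isIso_of_bijective _ fun H => ⟨fun x y h => ?_, wittMu_surjective X Y H⟩
  have h' : ∀ z, Hom.app k H (Hom.app (wittMu X Y) H z) = z := fun z =>
    congrArg (fun t => Hom.app t H z) hk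
  rw [← h' x, ← h' y, h]

/-- A section of the counit at `(ℤ; ℤ)`. -/
noncomputable def unitSection : ModCat.unit.{u} ⟶ ModCat.fu ModCat.unit where
  ring := (Int.castRingHom (ModCat.fu ModCat.unit).R).comp ULift.ringEquiv.toRingHom
  map := (zmultiplesHom (ModCat.fu ModCat.unit).M (ModCat.genM _ ModCat.u1)).comp
    (AddEquiv.ulift (α := ℤ)).toAddMonoidHom
  map_smul k l := by
    obtain ⟨k⟩ := k
    obtain ⟨l⟩ := l
    change (k * l : ℤ) • ModCat.genM _ ModCat.u1 =
      (k : (ModCat.fu ModCat.unit).R) • (l • ModCat.genM _ ModCat.u1)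
    rw [mul_smul, Int.cast_smul_eq_zsmul]

theorem unitSection_u1 : ModCat.Hom.map unitSection ModCat.u1.{u} = ModCat.genM _ ModCat.u1 :=
  one_zsmul _

theorem closure_u1 : AddSubgroup.closure {ModCat.u1.{u}} = ⊤ := by
  refine eq_top_iff.2 fun k _ => ?_
  refine AddSubgroup.mem_closure_singleton.2 ⟨ULift.down (α := ℤ) k, ULift.ext _ _ ?_⟩
  change ULift.down (α := ℤ) ((ULift.down (α := ℤ) k) • (1 : ULift.{u} ℤ)) = ULift.down (α := ℤ) k
  simp

theorem unitSection_counit (k : ModCat.unit.{u}.M) :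
    ModCat.Hom.map (ModCat.counit ModCat.unit) (ModCat.Hom.map unitSection k) = k := by
  have hk : k ∈ AddSubgroup.closure {ModCat.u1.{u}} := by
    rw [closure_u1]
    trivial
  obtain ⟨n, rfl⟩ := AddSubgroup.mem_closure_singleton.1 hk
  rw [map_zsmul, map_zsmul, unitSection_u1, ModCat.counit_genM]

/-- The Witt vectors of `(ℤ; ℤ)` are a quotient of the image of the ghost map for `(ℤ; ℤ)` itself, as
the counit has a section. So they are generated by the norms of `1`. -/
theorem wittEps_surjective (H : Subgroup G) : Function.Surjective (Hom.app (wittEps G) H) := by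
  let k := ghostImageMap (G := G) unitSection ≫ wittMk ModCat.unit
  have hk : ∀ (K : Subgroup G) (f : Inv K ModCat.unit.M), Hom.app k K (pureIm f) = wittNorm f := by
    intro K f
    rw [comp_app, ghostImageMap_pureIm, wittMk_pureIm]
    congr 1
    exact Subtype.ext (funext fun g => unitSection_counit _)
  have hgen : Generates (M := (wittMackey G).obj ModCat.unit) (D := fun _ => PUnit)
      fun K _ => wittNorm (Inv.u1 K) :=
    (generates_pureIm closure_u1).of_surj k ((generates_wittNorm _).surjective k fun K f =>
      ⟨pureIm f, hk K f⟩) fun K d => ⟨⟨⟩, (hk K d.1).trans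
        (congrArg wittNorm (Subtype.ext (funext fun g => d.2 g)))⟩
  exact hgen.surjective _ (fun K _ => ⟨one K, wittEps_one K⟩) H

/-- The ghost components of the norms of `1`, pushed to the free object `FU(ℤ; ℤ)`, are tensor powers
of a basis element, hence linearly independent. -/
theorem wittEps_injective (H : Subgroup G) : Function.Injective (Hom.app (wittEps G) H) := by
  classical
  let Φ : (point G).free ⟶ ghost G (ModCat.fu ModCat.unit) :=
    wittEps G ≫ wittGhost _ ≫ ghostMap unitSection
  have hΦ : ∀ K, Function.Injective (Hom.app Φ K) := by
    refine injective_to_ghost Φ (fun U d => (Hom.app Φ U (ResSystem.gen le_rfl d)).1 U)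
      (fun _ _ => rfl) fun U => ?_
    let _ : Fintype (G ⧸ U) := Fintype.ofFinite _
    have hval : (Hom.app Φ U (one U)).1 U = (ModCat.fu ModCat.unit).pure
        fun _ : G ⧸ U => ModCat.mono 0 ModCat.u1 := by
      have : Hom.app Φ U (one U) = pureGh ((Inv.u1 U).map (ModCat.Hom.map unitSection)) := by
        have h1 := congrArg (Hom.app (wittGhost _ ≫ ghostMap unitSection) U) (wittEps_one U)
        refine h1.trans ?_
        rw [comp_app, wittGhost_wittNorm]
        exact Subtype.ext (map_pureFam _ _)
      rw [this]
      refine (pureFam_of_le _ le_rfl).trans (congrArg _ (funext fun c => ?_))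
      exact unitSection_u1
    refine freeAbelian_lift_injective (I := PUnit) _
      (fun _ => ModCat.coeffTP (fun _ => ModCat.u1) 0) (fun _ => ?_) fun _ _ h => (h rfl).elim
    exact (congrArg _ hval).trans ((ModCat.coeffTP_pure _ _ (fun _ => 0) _).trans
      (if_pos ⟨rfl, Finset.sum_const_zero⟩))
  exact fun x y h => hΦ H (congrArg (Hom.app (wittGhost _ ≫ ghostMap unitSection) H) h)

theorem wittEps_isIso : IsIso (wittEps G) :=
  isIso_of_bijective _ fun H => ⟨wittEps_injective H, wittEps_surjective H⟩

end Strong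

end WittMackey

namespace WittMackey

open Fam MackeyFunctor

variable {G : Type u} [Group G] [Finite G]

/-! ### Relative tensor products -/

section Strong

universe v w v' w'

variable {C : Type w} [Category.{v} C] [MonoidalCategory C] [BraidedCategory C]
  {D : Type w'} [Category.{v'} D] [MonoidalCategory D] [BraidedCategory D]

open Functor.LaxMonoidal in
/-- If a strong monoidal functor `F` preserves the coequaliser `M ⊗ A ⊗ N ⇉ M ⊗ N → P`, then `F(P)` is
the relative tensor product of `F(M)` and `F(N)`: the structure maps of `F` identify the image of
`M ⊗ A ⊗ N ⇉ M ⊗ N` with `F(M) ⊗ F(A) ⊗ F(N) ⇉ F(M) ⊗ F(N)`. -/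
theorem isRelTensor_map (F : C ⥤ D) [F.Braided] (A M N : C) {P : C} [MonObj A]
    [ModObj A M] [ModObj A N] (π : M ⊗ N ⟶ P)
    (hπ : rightAct A M ▷ N ≫ π = ((α_ M A N).hom ≫ M ◁ ModObj.smul (M := A) (X := N)) ≫ π)
    (hF : ∀ {Q : D} (k : F.obj (M ⊗ N) ⟶ Q), F.map (rightAct A M ▷ N) ≫ k =
      F.map ((α_ M A N).hom ≫ M ◁ ModObj.smul (M := A) (X := N)) ≫ k →
      ∃ k', F.map π ≫ k' = k) [Epi (F.map π)] :
    letI : MonObj (F.obj A) := F.monObjObj A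
    letI : ModObj (F.obj A) (F.obj M) := modObjObj F A M
    letI : ModObj (F.obj A) (F.obj N) := modObjObj F A N
    ∀ _ : IsCommMonObj (F.obj A), IsRelTensor (F.obj A) (μ F M N ≫ F.map π) := by
  let : MonObj (F.obj A) := F.monObjObj A
  let : ModObj (F.obj A) (F.obj M) := modObjObj F A M
  let : ModObj (F.obj A) (F.obj N) := modObjObj F A N
  intro _
  have e₀ : rightAct (F.obj A) (F.obj M) ▷ F.obj N ≫ μ F M N =
      (μ F M A ▷ F.obj N ≫ μ F (M ⊗ A) N) ≫ F.map (rightAct A M ▷ N) := by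
    have h : rightAct (F.obj A) (F.obj M) = μ F M A ≫ F.map (rightAct A M) := by
      change (β_ (F.obj M) (F.obj A)).hom ≫ μ F A M ≫ F.map (ModObj.smul (M := A) (X := M)) = _
      rw [rightAct, F.map_comp, Functor.LaxBraided.braided_assoc]
    rw [h, MonoidalCategory.comp_whiskerRight, Category.assoc, Category.assoc, μ_natural_left]
  have e₁ : ((α_ (F.obj M) (F.obj A) (F.obj N)).hom ≫
        F.obj M ◁ ModObj.smul (M := F.obj A) (X := F.obj N)) ≫ μ F M N =
      (μ F M A ▷ F.obj N ≫ μ F (M ⊗ A) N) ≫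
        F.map ((α_ M A N).hom ≫ M ◁ ModObj.smul (M := A) (X := N)) := by
    change ((α_ (F.obj M) (F.obj A) (F.obj N)).hom ≫
      F.obj M ◁ (μ F A N ≫ F.map (ModObj.smul (M := A) (X := N)))) ≫ μ F M N = _
    rw [MonoidalCategory.whiskerLeft_comp, F.map_comp]
    simp only [Category.assoc]
    rw [μ_natural_right, associativity_assoc]
  have hk : ∀ s : Limits.Cofork (rightAct (F.obj A) (F.obj M) ▷ F.obj N)
      ((α_ (F.obj M) (F.obj A) (F.obj N)).hom ≫
        F.obj M ◁ ModObj.smul (M := F.obj A) (X := F.obj N)),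
      F.map (rightAct A M ▷ N) ≫ inv (μ F M N) ≫ s.π =
        F.map ((α_ M A N).hom ≫ M ◁ ModObj.smul (M := A) (X := N)) ≫ inv (μ F M N) ≫ s.π := by
    intro s
    rw [← cancel_epi (μ F M A ▷ F.obj N ≫ μ F (M ⊗ A) N), ← Category.assoc _ (F.map _),
      ← Category.assoc _ (F.map _), ← e₀, ← e₁, Category.assoc _ (μ F M N),
      Category.assoc _ (μ F M N), IsIso.hom_inv_id_assoc]
    exact s.condition
  refine ⟨?_, ⟨Limits.Cofork.IsColimit.mk _ (fun s => (hF _ (hk s)).choose) (fun s => ?_)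
    fun s m hm => ?_⟩⟩
  · rw [← Category.assoc, e₀, ← Category.assoc, e₁, Category.assoc _ (F.map _),
      Category.assoc _ (F.map _), ← F.map_comp, ← F.map_comp, hπ]
  · change (μ F M N ≫ F.map π) ≫ _ = _
    rw [Category.assoc, (hF _ (hk s)).choose_spec, IsIso.hom_inv_id_assoc]
  · rw [← cancel_epi (F.map π), (hF _ (hk s)).choose_spec, ← cancel_epi (μ F M N),
      IsIso.hom_inv_id_assoc, ← Category.assoc]
    exact hm

end Strong

section Relative

namespace ModCat

variable (R : Type u) [CommRing R] (M : Type u) [AddCommGroup M] [Module R M]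

theorem actPi_condition : rightAct (zmod R) (self R) ▷ zmod M ≫ actPi R M =
    ((α_ (self R) (zmod R) (zmod M)).hom ≫
      self R ◁ ModObj.smul (M := zmod R) (X := zmod M)) ≫ actPi R M :=
  tensor_ext₃
    (fun (r : R) (k l : ULift.{u} ℤ) =>
      show (((k.down : ℤ) : R) * r) * ((l.down : ℤ) : R) = r * ((k.down * l.down : ℤ) : R) by
        rw [Int.cast_mul]; ring)
    (fun (r s : R) (m : M) => show (s * r) • m = r • (s • m) by rw [mul_comm, mul_smul])

theorem actPi_ring_surjective : Function.Surjective (Hom.ring (actPi R M)) := fun (r : R) =>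
  ⟨rt (X := self R) (Y := zmod M) r (1 : ULift.{u} ℤ),
    show r * (((1 : ULift.{u} ℤ).down : ℤ) : R) = r by simp⟩

theorem actPi_map_surjective : Function.Surjective (Hom.map (actPi R M)) := fun (m : M) =>
  ⟨mt (X := self R) (Y := zmod M) (1 : R) m, one_smul R m⟩

/-- Two elements of `R ⊗_ℤ M` with the same image in `M` are the images of a single element under
the two maps `R ⊗ R ⊗ M ⇉ R ⊗ M`. -/
theorem exists_actPi (x y : (self R ⊗ zmod M).M)
    (h : Hom.map (actPi R M) x = Hom.map (actPi R M) y) :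
    ∃ q, Hom.map (rightAct (zmod R) (self R) ▷ zmod M) q = x ∧
      Hom.map ((α_ (self R) (zmod R) (zmod M)).hom ≫
        self R ◁ ModObj.smul (M := zmod R) (X := zmod M)) q = y := by
  let t : R → R → M → ((self R ⊗ zmod R) ⊗ zmod M).M := fun r s m =>
    mt (X := tensor (self R) (zmod R)) (Y := zmod M) (mt (X := self R) (Y := zmod R) r s) m
  set d₀ := Hom.map (rightAct (zmod R) (self R) ▷ zmod M)
  set d₁ := Hom.map ((α_ (self R) (zmod R) (zmod M)).hom ≫
    self R ◁ ModObj.smul (M := zmod R) (X := zmod M))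
  have t₀ : ∀ r s m, d₀ (t r s m) = mt (X := self R) (Y := zmod M) (s * r : R) m :=
    fun _ _ _ => rfl
  have t₁ : ∀ r s m, d₁ (t r s m) = mt (X := self R) (Y := zmod M) r (s • m : M) :=
    fun _ _ _ => rfl
  -- the degeneracy `r ⊗ m ↦ r ⊗ 1 ⊗ m`
  let σ : (self R ⊗ zmod M).M →+ ((self R ⊗ zmod R) ⊗ zmod M).M :=
    Hom.map (tensorMap (unitLInv (self R) ≫ tensorMap (oneZ R) (𝟙 (self R)) ≫
      swap (zmod R) (self R)) (𝟙 (zmod M)))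
  have hσ : ∀ r m, σ (mt (X := self R) (Y := zmod M) r m) = t r 1 m := fun r m =>
    show t r ((1 : ℤ) : R) m = t r 1 m by rw [Int.cast_one]
  refine exists_of_reflexive d₀ d₁ σ
    (mt_ext (X := self R) (Y := zmod M) (f := d₀.comp σ) (g := AddMonoidHom.id _)
      fun (r : R) (m : M) => ?_)
    (mt_ext (X := self R) (Y := zmod M) (f := d₁.comp σ) (g := AddMonoidHom.id _)
      fun (r : R) (m : M) => ?_)
    (Hom.map (actPi R M)) (fun p hp => ?_) h
  · change d₀ (σ (mt (X := self R) (Y := zmod M) r m)) = _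
    exact (congrArg d₀ (hσ r m)).trans ((t₀ r 1 m).trans
      (congrArg (fun r : R => mt (X := self R) (Y := zmod M) r m) (one_mul r)))
  · change d₁ (σ (mt (X := self R) (Y := zmod M) r m)) = _
    exact (congrArg d₁ (hσ r m)).trans ((t₁ r 1 m).trans
      (congrArg (fun m : M => mt (X := self R) (Y := zmod M) r m) (one_smul R m)))
  · -- modulo the relations, `r ⊗ m` is `1 ⊗ r m`
    let ι : M →+ (self R ⊗ zmod M).M := AddMonoidHom.mk'
      (fun m => mt (X := self R) (Y := zmod M) (1 : R) m) fun m n => mt_add_right _ _ _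
    have key : ∀ z, QuotientAddGroup.mk' (d₀ - d₁).range z =
        QuotientAddGroup.mk' (d₀ - d₁).range (ι (Hom.map (actPi R M) z)) :=
      mt_ext (X := self R) (Y := zmod M) (f := QuotientAddGroup.mk' (d₀ - d₁).range)
        (g := ((QuotientAddGroup.mk' (d₀ - d₁).range).comp ι).comp (Hom.map (actPi R M)))
        fun (r : R) (m : M) => by
          rw [← sub_eq_zero]
          refine (map_sub _ _ _).symm.trans ((QuotientAddGroup.eq_zero_iff _).2 ⟨t 1 r m, ?_⟩)
          exact congrArg₂ (· - ·) ((t₀ 1 r m).trans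
            (congrArg (fun r : R => mt (X := self R) (Y := zmod M) r m) (mul_one r))) (t₁ 1 r m)
    have := key p
    rw [hp, map_zero, map_zero] at this
    obtain ⟨q, hq⟩ := (QuotientAddGroup.eq_zero_iff p).1 this
    exact ⟨q, hq.symm⟩

end ModCat

/-- Witt vectors send surjections to epimorphisms. -/
theorem wittMackey_map_epi {X Y : ModCat.{u}} (φ : X ⟶ Y)
    (hφ : Function.Surjective (ModCat.Hom.map φ)) : Epi ((wittMackey G).map φ) :=
  ⟨fun f g h => (generates_wittNorm Y).hom_ext fun K d => by
    obtain ⟨z, rfl⟩ := d.exists_map_eq hφ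
    simpa only [comp_app, map_wittNorm] using congrArg (fun t => Hom.app t K (wittNorm z)) h⟩

/-- Witt vectors preserve coequalisers of pairs `d₀, d₁` for which any two elements of the module
with the same image in the quotient are the images of a single element. -/
theorem exists_wittMackey_desc {X Y Z : ModCat.{u}} (d₀ d₁ : X ⟶ Y) (π : Y ⟶ Z)
    (hR : Function.Surjective (ModCat.Hom.ring π)) (hM : Function.Surjective (ModCat.Hom.map π))
    (hπ : ∀ x y, ModCat.Hom.map π x = ModCat.Hom.map π y →
      ∃ q, ModCat.Hom.map d₀ q = x ∧ ModCat.Hom.map d₁ q = y)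
    {Q : MackeyFunctor G} (k : (wittMackey G).obj Y ⟶ Q)
    (hk : (wittMackey G).map d₀ ≫ k = (wittMackey G).map d₁ ≫ k) :
    ∃ k', (wittMackey G).map π ≫ k' = k := by
  obtain ⟨k', hk'⟩ := exists_descent (ModCat.counit Y ≫ π)
    (hR.comp (ModCat.counit_ring_surjective Y)) (hM.comp (ModCat.counit_map_surjective Y))
    (wittMk Y ≫ k) fun K z z' h => by
      obtain ⟨q, h₀, h₁⟩ := Inv.exists_of_reflexive _ _ (z.map (ModCat.Hom.map (ModCat.counit Y)))
        (z'.map (ModCat.Hom.map (ModCat.counit Y))) fun g =>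
          hπ _ _ (congrFun (congrArg Subtype.val h) g)
      have := congrArg (fun t => Hom.app t K (wittNorm q)) hk
      simpa only [comp_app, map_wittNorm, wittMk_pureIm, h₀, h₁] using this
  refine ⟨k', (generates_wittNorm Y).hom_ext fun K d => ?_⟩
  obtain ⟨z, rfl⟩ := d.exists_map_eq (ModCat.counit_map_surjective Y)
  rw [comp_app, map_wittNorm]
  refine (hk' K z).trans ?_
  rw [comp_app, wittMk_pureIm]

/-- The strong symmetric monoidal structure on the Witt vectors. -/
noncomputable abbrev wittBraided (G : Type u) [Group G] [Finite G] :
    (wittMackey.{u} G).Braided where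
  toMonoidal :=
    letI : (wittMackey G).LaxMonoidal := wittLaxMonoidal G
    have : IsIso (Functor.LaxMonoidal.ε (wittMackey G)) := wittEps_isIso
    have : ∀ X Y, IsIso (Functor.LaxMonoidal.μ (wittMackey G) X Y) := wittMu_isIso
    Functor.Monoidal.ofLaxMonoidal (wittMackey G)
  braided X Y := wittMu_braided X Y

end Relative

end WittMackey

theorem mainTheorem6 (G : Type u) [Group G] [Finite G] :
    ∃ _ : (wittMackey G).Braided,
      -- the structure map `μ` is induced by the external product: on ghost components it is the
      -- shuffle map
      (∀ (X Y : ModCat.{u}) (H : Subgroup G) (a : ((wittMackey G).obj X).obj H)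
        (b : ((wittMackey G).obj Y).obj H) (U : Subgroup G), U ≤ H →
        (MackeyFunctor.Hom.app (wittGhost (X ⊗ Y)) H
          (MackeyFunctor.Hom.app (Functor.LaxMonoidal.μ (wittMackey G) X Y) H
            (MackeyFunctor.bx a b))).1 U =
          ModCat.shuffle X Y (G ⧸ U)
            ((MackeyFunctor.Hom.app (wittGhost X) H a).1 U)
            ((MackeyFunctor.Hom.app (wittGhost Y) H b).1 U)) ∧
      -- the structure map `ε` sends `1 = [H/H]` in the Burnside group at `H` to an element whose
      -- ghost components are all `1`
      (∀ H U : Subgroup G, U ≤ H →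
        (MackeyFunctor.Hom.app (wittGhost (𝟙_ ModCat.{u})) H
          (MackeyFunctor.Hom.app (Functor.LaxMonoidal.ε (wittMackey G)) H
            (MackeyFunctor.one H))).1 U =
          ModCat.pure ModCat.unit fun _ => ModCat.u1) ∧
      -- `W(ℤ; R)` is a commutative Green functor, and `W(R; M)` is the relative box product of its
      -- modules `W(R; R)` and `W(ℤ; M)`
      ∀ (R : Type u) [CommRing R] (M : Type u) [AddCommGroup M] [Module R M],
        letI : MonObj ((wittMackey G).obj (ModCat.zmod R)) :=
          (wittMackey G).monObjObj (ModCat.zmod R)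
        letI : ModObj ((wittMackey G).obj (ModCat.zmod R)) ((wittMackey G).obj (ModCat.self R)) :=
          modObjObj (wittMackey G) (ModCat.zmod R) (ModCat.self R)
        letI : ModObj ((wittMackey G).obj (ModCat.zmod R)) ((wittMackey G).obj (ModCat.zmod M)) :=
          modObjObj (wittMackey G) (ModCat.zmod R) (ModCat.zmod M)
        ∃ _ : IsCommMonObj ((wittMackey G).obj (ModCat.zmod R)),
          IsRelTensor ((wittMackey G).obj (ModCat.zmod R))
            (Functor.LaxMonoidal.μ (wittMackey G) (ModCat.self R) (ModCat.zmod M) ≫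
              (wittMackey G).map (ModCat.actPi R M)) := by
  refine ⟨wittBraided G, fun X Y H a b U _ => ?_, fun H U hU => ?_, fun R _ M _ _ => ?_⟩
  · have h := congrArg (fun t => MackeyFunctor.Hom.app t H (MackeyFunctor.bx a b))
      (wittMu_ghost (G := G) (X := X) (Y := Y))
    simp only [MackeyFunctor.comp_app, MackeyFunctor.boxMap_bx,
      MackeyFunctor.Pairing.lift_bx] at h
    exact congrFun (congrArg Subtype.val h) U
  · have h := congrArg (MackeyFunctor.Hom.app (wittGhost (G := G) ModCat.unit) H) (wittEps_one H)
    rw [wittGhost_wittNorm] at h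
    exact (congrFun (congrArg Subtype.val h) U).trans (pureFam_of_le _ hU)
  · let _ := wittBraided G
    have : Epi ((wittMackey G).map (ModCat.actPi R M)) :=
      wittMackey_map_epi _ (ModCat.actPi_map_surjective R M)
    exact ⟨Functor.isCommMonObj_obj, isRelTensor_map (wittMackey G) (ModCat.zmod R)
      (ModCat.self R) (ModCat.zmod M) (ModCat.actPi R M) (ModCat.actPi_condition R M)
      (fun k hk => exists_wittMackey_desc _ _ _ (ModCat.actPi_ring_surjective R M)
        (ModCat.actPi_map_surjective R M) (ModCat.exists_actPi R M) k hk) _⟩
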